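/- Let $d\ge 1$, $0<\alpha<\min(2,d)$, and let $\Omega\subset\mathbb R^d$ be open with $0\in\Omega$. Put $$\mathcal A(d,\alpha)=\frac{\alpha\,\Gamma(\frac{d+\alpha}{2})}{2^{1-\alpha}\pi^{d/2}\Gamma(1-\frac{\alpha}{2})},\qquad c^*=\frac{2^\alpha\,\Gamma(\frac{d+\alpha}{4})^2}{\Gamma(\frac{d-\alpha}{4})^2},$$ $$\mathcal E[f]=\frac{\mathcal A(d,\alpha)}{2}\int_{\mathbb R^d}\int_{\mathbb R^d}\frac{(f(x)-f(y))^2}{|x-y|^{d+\alpha}}\,dx\,dy,\qquad W^{\alpha/2,2}(\mathbb R^d)=\{f\in L^2(\mathbb R^d,dx):\mathcal E[f]<\infty\}.$$ Let $W_0^{\alpha/2,2}(\Omega)$ be the space of all $f\in W^{\alpha/2,2}(\mathbb R^d)$ that have a quasi-continuous version vanishing quasi-everywhere on $\mathbb R^d\setminus\Omega$; here quasi-continuity and "quasi-everywhere" refer to the capacity $\mathrm{Cap}(A)=\inf\{\mathcal E[f]+\|f\|_{L^2}^2\}$, the infimum being over $f\in W^{\alpha/2,2}(\mathbb R^d)$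 with $f\ge 1$ a.e. on an open neighbourhood of $A$. Functions on $\Omega$ are extended by zero to $\mathbb R^d$. For $0<c\le c^*$ let $\mathcal E_\Omega^{V_c}$ be the quadratic form in $L^2(\Omega,dx)$ with domain $W_0^{\alpha/2,2}(\Omega)$ and $$\mathcal E_\Omega^{V_c}[f]=\mathcal E[f]-\int_\Omega f^2(x)\,\frac{c}{|x|^\alpha}\,dx$$ (for $c=c^*$ this form is also written $\dot{\mathcal E}_\Omega^{V_{c^*}}$). Let $w_c(x)=|x|^{-\beta}$, where $\beta=\beta(c)\in(0,\frac{d-\alpha}{2}]$ is the exponent for which $w=w_c$ solves $(-\Delta)^{\alpha/2}w-c|x|^{-\alpha}w=0$ in the sense of distributions, i.e. $\langle\hat w,|\xi|^\alpha\hat\varphi\rangle=c\,\langle|x|^{-\alpha}w,\varphi\rangle$ for all Schwartz functions $\varphi$. Let $Q^c$ be the quadratic form in $L^2(\Omega,w_c^2dx)$ defined by $$D(Q^c)=\{f: w_cf\in W_0^{\alpha/2,2}(\Omega)\},\qquad Q^c[f]=\mathcal E_\Omega^{V_c}[w_cf].$$ Then: 1. If $0<c<c^*$, the form $Q^c$ is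 a regular Dirichlet form in $L^2(\Omega,w_c^2dx)$, and $\mathcal E_\Omega^{V_c}$ is closed in $L^2(\Omega)$. 2. If $c=c^*$, the form $Q^{c^*}$ is closable and its closure is a regular Dirichlet form in $L^2(\Omega,w_{c^*}^2dx)$, and $\dot{\mathcal E}_\Omega^{V_{c^*}}$ is closable in $L^2(\Omega)$. 3. In both cases, for all $f\in D(Q^c)$, $$Q^c[f]=\frac{\mathcal A(d,\alpha)}{2}\int_{\mathbb R^d}\int_{\mathbb R^d}\frac{(f(x)-f(y))^2}{|x-y|^{d+\alpha}}\,w_c(x)\,w_c(y)\,dx\,dy .$$ Here a Dirichlet form is a densely defined, closed, nonnegative symmetric form such that, whenever $f$ is in the domain, so is $(0\vee f)\wedge 1$, with no larger value of the form. It is regular on $\Omega$ if $C_c(\Omega)\cap D$ is dense in the domain $D$ for the form norm (the square root of the form plus the squared $L^2$ norm), and in $C_c(\Omega)$ for the uniform norm. -/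

import Mathlib

open MeasureTheory Filter Topology
open scoped SchwartzMap FourierTransform ENNReal

noncomputable section

namespace FractionalHardy

/-! ### Symmetric forms in Hilbert spaces -/

/-- A nonnegative symmetric bilinear form in a real Hilbert space `H`, defined on a linear
subspace of `H`. -/
structure SymmForm (H : Type*) [NormedAddCommGroup H] [InnerProductSpace ℝ H] where
  dom : Submodule ℝ H
  form : dom →ₗ[ℝ] dom →ₗ[ℝ] ℝ
  symm : ∀ f g, form f g = form g f
  nonneg : ∀ f, 0 ≤ form f f

namespace SymmForm

section Hilbert

variable {H : Type*} [NormedAddCommGroup H] [InnerProductSpace ℝ H]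

/-- `u` is a Cauchy sequence for the seminorm `a[·]^{1/2}`. -/
def IsFormCauchy (a : SymmForm H) (u : ℕ → a.dom) : Prop :=
  ∀ ε > 0, ∃ N, ∀ m ≥ N, ∀ n ≥ N, a.form (u m - u n) (u m - u n) < ε

/-- Closed form: if `u n` is form-Cauchy and converges to `f` in `H`, then `f` is in the domain
and `u n` converges to `f` for the form. -/
def IsClosed (a : SymmForm H) : Prop :=
  ∀ (u : ℕ → a.dom) (f : H), a.IsFormCauchy u → Tendsto (fun n => (u n : H)) atTop (𝓝 f) →
    ∃ g : a.dom, (g : H) = f ∧ Tendsto (fun n => a.form (u n - g) (u n - g)) atTop (𝓝 0)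

/-- Closable form: if `u n` is form-Cauchy and converges to `0` in `H`, then `a[u n] → 0`. -/
def IsClosable (a : SymmForm H) : Prop :=
  ∀ u : ℕ → a.dom, a.IsFormCauchy u → Tendsto (fun n => (u n : H)) atTop (𝓝 0) →
    Tendsto (fun n => a.form (u n) (u n)) atTop (𝓝 0)

/-- `b` is the closure of `a`: a closed form which extends `a` and in whose domain the domain of
`a` is dense for the form norm `(b[·] + ‖·‖²)^{1/2}`. -/
def IsClosureOf (b a : SymmForm H) : Prop :=
  b.IsClosed ∧
  (∃ h : a.dom ≤ b.dom, ∀ f g : a.dom,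
    b.form (Submodule.inclusion h f) (Submodule.inclusion h g) = a.form f g) ∧
  ∀ f : b.dom, ∀ ε > 0, ∃ g : b.dom, (g : H) ∈ a.dom ∧
    b.form (f - g) (f - g) + ‖(f : H) - g‖ ^ 2 < ε

end Hilbert

section Lebesgue

variable {X : Type*} [MeasurableSpace X] {μ : Measure X}

/-- A (symmetric) Dirichlet form in `L²(X, μ)`: densely defined, closed and Markovian, the latter
meaning that `(0 ∨ f) ∧ 1` operates. -/
def IsDirichletForm (a : SymmForm (Lp ℝ 2 μ)) : Prop :=
  Dense (a.dom : Set (Lp ℝ 2 μ)) ∧ a.IsClosed ∧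
  ∀ f : a.dom, ∃ g : a.dom,
    (((g : Lp ℝ 2 μ) : X → ℝ) =ᵐ[μ] fun x => min (max 0 ((f : Lp ℝ 2 μ) x)) 1) ∧
    a.form g g ≤ a.form f f

/-- `φ ∈ C_c(Ω)`, where a function on the open set `Ω` is identified with its extension by zero. -/
def IsCc [TopologicalSpace X] (Ω : Set X) (φ : X → ℝ) : Prop :=
  Continuous φ ∧ HasCompactSupport φ ∧ tsupport φ ⊆ Ω

/-- Regularity on the open set `Ω`, for a form in `L²(Ω, μ)` (so `μ` is carried by `Ω`):
`C_c(Ω) ∩ dom` is dense in the domain for the form norm, and in `C_c(Ω)` for the uniform norm. -/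
def IsRegular [TopologicalSpace X] (a : SymmForm (Lp ℝ 2 μ)) (Ω : Set X) : Prop :=
  (∀ f : a.dom, ∀ ε > 0, ∃ φ : X → ℝ, IsCc Ω φ ∧
    ∃ g : a.dom, (((g : Lp ℝ 2 μ) : X → ℝ) =ᵐ[μ] φ) ∧
      a.form (f - g) (f - g) + ‖(f : Lp ℝ 2 μ) - g‖ ^ 2 < ε) ∧
  (∀ φ : X → ℝ, IsCc Ω φ → ∀ ε > 0, ∃ ψ : X → ℝ, IsCc Ω ψ ∧
    (∃ g : a.dom, ((g : Lp ℝ 2 μ) : X → ℝ) =ᵐ[μ] ψ) ∧ ∀ x, |φ x - ψ x| < ε)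

end Lebesgue

end SymmForm

/-! ### The fractional Dirichlet form, capacity, and `W_0^{α/2,2}(Ω)` -/

section Fractional

variable {d : ℕ}

/-- The normalising constant `𝒜(d, α)`. -/
def constA (d : ℕ) (α : ℝ) : ℝ :=
  α * Real.Gamma ((d + α) / 2) /
    (2 ^ (1 - α) * Real.pi ^ ((d : ℝ) / 2) * Real.Gamma (1 - α / 2))

/-- The critical constant `c*`. -/
def criticalConst (d : ℕ) (α : ℝ) : ℝ :=
  2 ^ α * Real.Gamma ((d + α) / 4) ^ 2 / Real.Gamma ((d - α) / 4) ^ 2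

/-- The integrand `(f(x) - f(y))² / |x - y|^{d+α}`. -/
def gagliardoKernel (α : ℝ) (f : EuclideanSpace ℝ (Fin d) → ℝ)
    (z : EuclideanSpace ℝ (Fin d) × EuclideanSpace ℝ (Fin d)) : ℝ :=
  (f z.1 - f z.2) ^ 2 / ‖z.1 - z.2‖ ^ ((d : ℝ) + α)

/-- `𝓔[f]`. -/
def energy (α : ℝ) (f : EuclideanSpace ℝ (Fin d) → ℝ) : ℝ :=
  constA d α / 2 * ∫ z, gagliardoKernel α f z ∂(volume.prod volume)

/-- `f ∈ W^{α/2,2}(ℝ^d)`: `f` is square integrable and `𝓔[f] < ∞`. -/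
def MemW (α : ℝ) (f : EuclideanSpace ℝ (Fin d) → ℝ) : Prop :=
  MemLp f 2 volume ∧ Integrable (gagliardoKernel α f) (volume.prod volume)

/-- The capacity induced by `𝓔`: the infimum of `𝓔[f] + ‖f‖²` over all `f ∈ W^{α/2,2}(ℝ^d)` with
`f ≥ 1` a.e. on an open neighbourhood of `A`. -/
def capacity (α : ℝ) (A : Set (EuclideanSpace ℝ (Fin d))) : ℝ≥0∞ :=
  ⨅ (f : EuclideanSpace ℝ (Fin d) → ℝ)
    (_ : MemW α f ∧ ∃ U, IsOpen U ∧ A ⊆ U ∧ ∀ᵐ x, x ∈ U → 1 ≤ f x),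
    ENNReal.ofReal (energy α f + ∫ x, f x ^ 2)

/-- Quasi-continuity: continuity off open sets of arbitrarily small capacity. -/
def QuasiContinuous (α : ℝ) (f : EuclideanSpace ℝ (Fin d) → ℝ) : Prop :=
  ∀ ε : ℝ≥0∞, 0 < ε → ∃ G, IsOpen G ∧ capacity α G < ε ∧ ContinuousOn f Gᶜ

/-- `f ∈ W_0^{α/2,2}(Ω)`: `f ∈ W^{α/2,2}(ℝ^d)` and `f = 0` quasi-everywhere on `Ωᶜ`, where as
always the pointwise values are those of a quasi-continuous version of `f`. -/
def MemW0 (α : ℝ) (Ω : Set (EuclideanSpace ℝ (Fin d)))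
    (f : EuclideanSpace ℝ (Fin d) → ℝ) : Prop :=
  MemW α f ∧ ∃ f' : EuclideanSpace ℝ (Fin d) → ℝ, f' =ᵐ[volume] f ∧ QuasiContinuous α f' ∧
    capacity α {x | x ∈ Ωᶜ ∧ f' x ≠ 0} = 0

/-! ### The Hardy-perturbed form and its transform -/

/-- The integrand `f²(x) V_c(x)`, with `V_c(x) = c / |x|^α`. -/
def hardyIntegrand (α c : ℝ) (f : EuclideanSpace ℝ (Fin d) → ℝ)
    (x : EuclideanSpace ℝ (Fin d)) : ℝ :=
  f x ^ 2 * (c / ‖x‖ ^ α)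

/-- `𝓔_Ω^{V_c}[f] = 𝓔_Ω[f] - ∫_Ω f² V_c`, for `f ∈ W_0^{α/2,2}(Ω)`. -/
def hardyEnergy (α c : ℝ) (Ω : Set (EuclideanSpace ℝ (Fin d)))
    (f : EuclideanSpace ℝ (Fin d) → ℝ) : ℝ :=
  energy α f - ∫ x in Ω, hardyIntegrand α c f x

/-- The power weight `|x|^{-β}`. -/
def weight (β : ℝ) (x : EuclideanSpace ℝ (Fin d)) : ℝ := ‖x‖ ^ (-β)

/-- The exponent `β = β(c)`: `β ∈ (0, (d-α)/2]` and `w = |x|^{-β}` solves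
`(-Δ)^{α/2} w - c |x|^{-α} w = 0` in the sense of distributions, that is
`⟨ŵ, |ξ|^α φ̂⟩ = c ⟨|x|^{-α} w, φ⟩` for all Schwartz functions `φ`. Here `g` is the (locally
integrable) distributional Fourier transform of `w`; as the Fourier transform `𝓕` has the kernel
`exp (-2πi ⟨x, ξ⟩)`, the multiplier of `(-Δ)^{α/2}` reads `(2π|ξ|)^α`. -/
def IsHardyExponent (d : ℕ) (α c β : ℝ) : Prop :=
  0 < β ∧ β ≤ (d - α) / 2 ∧
  ∃ g : EuclideanSpace ℝ (Fin d) → ℂ, LocallyIntegrable g volume ∧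
    (∀ ψ : 𝓢(EuclideanSpace ℝ (Fin d), ℂ),
      ∫ x, (weight β x : ℂ) * (𝓕 ψ) x = ∫ ξ, g ξ * ψ ξ) ∧
    ∀ φ : 𝓢(EuclideanSpace ℝ (Fin d), ℂ),
      ∫ ξ, g ξ * (((2 * Real.pi * ‖ξ‖) ^ α : ℝ) : ℂ) * (𝓕 φ) ξ =
        (c : ℂ) * ∫ x, ((‖x‖ ^ (-α) * weight β x : ℝ) : ℂ) * φ x

/-- The measure `w² dx` on `Ω`, for `w = |x|^{-β}`. -/
def weightedMeasure (β : ℝ) (Ω : Set (EuclideanSpace ℝ (Fin d))) :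
    Measure (EuclideanSpace ℝ (Fin d)) :=
  (volume.restrict Ω).withDensity fun x => ENNReal.ofReal (weight β x ^ 2)

/-- `w f`, for a function `f` on `Ω`, extended by zero to `ℝ^d`. -/
def timesWeight (β : ℝ) (Ω : Set (EuclideanSpace ℝ (Fin d)))
    (f : EuclideanSpace ℝ (Fin d) → ℝ) : EuclideanSpace ℝ (Fin d) → ℝ :=
  Ω.indicator fun x => weight β x * f x

/-- `a` is the form `𝓔_Ω^{V_c}` in `L²(Ω)`, with domain `W_0^{α/2,2}(Ω)`; functions on `Ω` are
extended by zero to `ℝ^d`. -/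
def IsHardyForm (α c : ℝ) (Ω : Set (EuclideanSpace ℝ (Fin d)))
    (a : SymmForm (Lp ℝ 2 ((volume : Measure (EuclideanSpace ℝ (Fin d))).restrict Ω))) : Prop :=
  (∀ f, f ∈ a.dom ↔ MemW0 α Ω (Ω.indicator f)) ∧
  ∀ f : a.dom,
    IntegrableOn (hardyIntegrand α c (Ω.indicator f.1)) Ω ∧
    a.form f f = hardyEnergy α c Ω (Ω.indicator f.1)

/-- `a` is the `w`-transform of `𝓔_Ω^{V_c}`, for `w = |x|^{-β}`: the form in `L²(Ω, w² dx)` with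
domain `{f | w f ∈ W_0^{α/2,2}(Ω)}` and `a[f] = 𝓔_Ω^{V_c}[w f]`. -/
def IsTransformedForm (α c β : ℝ) (Ω : Set (EuclideanSpace ℝ (Fin d)))
    (a : SymmForm (Lp ℝ 2 (weightedMeasure β Ω))) : Prop :=
  (∀ f, f ∈ a.dom ↔ MemW0 α Ω (timesWeight β Ω f)) ∧
  ∀ f : a.dom,
    IntegrableOn (hardyIntegrand α c (timesWeight β Ω f.1)) Ω ∧
    a.form f f = hardyEnergy α c Ω (timesWeight β Ω f.1)

/-- The integrand `(f(x) - f(y))² |x - y|^{-d-α} w(x) w(y)`, for `w = |x|^{-β}`. -/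
def weightedKernel (α β : ℝ) (f : EuclideanSpace ℝ (Fin d) → ℝ)
    (z : EuclideanSpace ℝ (Fin d) × EuclideanSpace ℝ (Fin d)) : ℝ :=
  (f z.1 - f z.2) ^ 2 / ‖z.1 - z.2‖ ^ ((d : ℝ) + α) * weight β z.1 * weight β z.2

end Fractional

end FractionalHardy

end

open FractionalHardy

open MeasureTheory Filter Topology
open scoped SchwartzMap FourierTransform ENNReal Pointwise

noncomputable section

namespace FractionalHardy

variable {d : ℕ}

/-! Write w = |x|^{-β} and u = w f. Everything rests on the ground state representation: for u in
W^{α/2,2}, the energy 𝓔[u] equals the weighted energy (𝒜/2) ∬ (f(x) - f(y))² |x-y|^{-d-α} w(x) w(y)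
dx dy plus c ∫ u² |x|^{-α}. It comes from the pointwise identity (u(x)-u(y))² - u(x)² (1 -
w(y)/w(x)) - u(y)² (1 - w(x)/w(y)) = (f(x)-f(y))² w(x) w(y). Integrated against the Lévy kernel
truncated to |x-y| ≥ s, the two middle terms produce u²/w times the truncated fractional Laplacian
of w (`wETrunc_groundState`); letting s → 0 gives `wE_groundState`. By homogeneity and rotation
invariance the Laplacian of w is a constant times |x|^{-α} w. Testing against a Gaussian identifies
the constant (`constA_mul_limLap`), and the distributional equation that defines β gives the same
number (`eq_hardyConst_of_isHardyExponent`).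

Statement 3 follows at once. Dropping the weighted energy gives Hardy's inequality
(`hardy_inequality`), with constant c* when β = (d-α)/2.

The weighted energy is the squared norm of a closed difference operator on L² (`isClosed_maxForm`),
so its restriction to W_0 is closable for every c. If c < c*, Hardy's inequality bounds 𝓔 by a
multiple of the weighted energy; since W_0 is complete for the norm of W (`MemW0.of_tendsto`), the
form is then closed.

Markov property: (0 ∨ f) ∧ 1 shrinks the differences of f. The delicate point is that w times the
contracted function stays in W_0 (`MemW0.weight_mul_unit`).

Regularity: the elements of W_0 that lie in C_c(Ω) are dense in W_0 for the norm of W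
(`MemW0.exists_approx`), which dominates the form norm. For uniform density, C¹ functions ψ with
compact support in Ω must lie in the domain of the closure. If c = c* and ψ(0) ≠ 0, the Hardy
integral of wψ diverges, so ψ is first cut off near the origin. Scaling keeps the energies of the
cut-off functions bounded because α + 2β ≤ d, and lower semicontinuity of closed forms
(`SymmForm.IsClosed.exists_of_tendsto_of_le`) puts ψ in the domain. -/

/-- Euclidean space of dimension `d`. -/
abbrev Eu (d : ℕ) := EuclideanSpace ℝ (Fin d)



/-! ### Power functions and the Lévy kernel -/

theorem measurable_norm_rpow (s : ℝ) : Measurable fun x : Eu d => ‖x‖ ^ s := by fun_prop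

theorem integrableOn_ball_norm_rpow (hd : 0 < d) {s : ℝ} (hs : s < d) (R : ℝ) :
    IntegrableOn (fun x : Eu d => ‖x‖ ^ (-s)) (Metric.ball 0 R) := by
  refine integrableOn_ball_of_norm_le_rpow (C := 1) (α := s) ?_ ?_ ?_ ?_
  · rw [finrank_euclideanSpace_fin]; exact hd
  · simpa using hs
  · refine Eventually.of_forall fun x => ?_
    rw [Real.norm_of_nonneg (by positivity), one_mul]
  · exact (measurable_norm_rpow _).aestronglyMeasurable

theorem integrableOn_compl_ball_norm_rpow {s : ℝ} (hs : d < s) {R : ℝ} (hR : 0 < R) :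
    IntegrableOn (fun x : Eu d => ‖x‖ ^ (-s)) (Metric.ball 0 R)ᶜ := by
  -- For ‖x‖ ≥ R one has ‖x‖ ≥ (R / (1 + R)) (1 + ‖x‖), which gives the constant.
  have h1 : Integrable (fun x : Eu d => (R / (1 + R)) ^ (-s) * (1 + ‖x‖) ^ (-s)) :=
    (integrable_one_add_norm (by simpa using hs)).const_mul _
  refine Integrable.mono' h1.integrableOn (measurable_norm_rpow _).aestronglyMeasurable ?_
  refine (ae_restrict_iff' Metric.isOpen_ball.measurableSet.compl).2
    (Eventually.of_forall fun x hx => ?_)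
  have hx' : R ≤ ‖x‖ := by simpa using hx
  rw [Real.norm_of_nonneg (by positivity), ← Real.mul_rpow (by positivity) (by positivity)]
  refine Real.rpow_le_rpow_of_nonpos (by positivity) ?_ ?_
  · rw [div_mul_eq_mul_div, div_le_iff₀ (by positivity)]
    nlinarith
  · have : (0 : ℝ) ≤ d := Nat.cast_nonneg d
    linarith

/-- The Lévy kernel `|z|^{-d-α}`. -/
def levy (α : ℝ) (z : Eu d) : ℝ := ‖z‖ ^ (-((d : ℝ) + α))

theorem levy_nonneg (α : ℝ) (z : Eu d) : 0 ≤ levy α z := by unfold levy; positivity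

theorem measurable_levy (α : ℝ) : Measurable (levy α : Eu d → ℝ) := measurable_norm_rpow _

theorem levy_neg (α : ℝ) (z : Eu d) : levy α (-z) = levy α z := by simp [levy]

theorem div_norm_rpow_eq_mul_levy (α a : ℝ) (z : Eu d) :
    a / ‖z‖ ^ ((d : ℝ) + α) = a * levy α z := by
  rw [levy, Real.rpow_neg (norm_nonneg _), div_eq_mul_inv]

theorem integrableOn_levy {α : ℝ} (hα : 0 < α) {R : ℝ} (hR : 0 < R) :
    IntegrableOn (levy α : Eu d → ℝ) (Metric.ball 0 R)ᶜ :=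
  integrableOn_compl_ball_norm_rpow (by linarith) hR

theorem integrableOn_sq_mul_levy (hd : 0 < d) {α : ℝ} (hα' : α < 2) (R : ℝ) :
    IntegrableOn (fun z : Eu d => ‖z‖ ^ 2 * levy α z) (Metric.ball 0 R) := by
  refine (integrableOn_ball_norm_rpow hd (s := d + α - 2) (by linarith) R).congr ?_
  have h0 : ∀ᵐ z : Eu d, z ≠ 0 := by
    have : Nonempty (Fin d) := ⟨⟨0, hd⟩⟩
    exact Measure.ae_ne volume 0
  filter_upwards [ae_restrict_of_ae h0] with z hz
  have hz' : 0 < ‖z‖ := norm_pos_iff.2 hz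
  rw [levy, ← Real.rpow_natCast, ← Real.rpow_add hz']
  congr 1
  push_cast
  ring

theorem ae_ne_zero (hd : 0 < d) : ∀ᵐ z : Eu d, z ≠ 0 := by
  have : Nonempty (Fin d) := ⟨⟨0, hd⟩⟩
  exact Measure.ae_ne volume 0

theorem integrable_min_mul_levy (hd : 0 < d) {α : ℝ} (hα : 0 < α) (hα' : α < 2) :
    Integrable (fun z : Eu d => min 1 (‖z‖ ^ 2) * levy α z) := by
  have hm : Measurable (fun z : Eu d => min 1 (‖z‖ ^ 2) * levy α z) :=
    (by fun_prop : Measurable fun z : Eu d => min 1 (‖z‖ ^ 2)).mul (measurable_levy α)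
  rw [← integrableOn_univ, ← Set.union_compl_self (Metric.ball (0 : Eu d) 1)]
  refine IntegrableOn.union ?_ ?_
  · refine Integrable.mono' (integrableOn_sq_mul_levy hd hα' 1) hm.aestronglyMeasurable
      (Eventually.of_forall fun z => ?_)
    rw [Real.norm_of_nonneg (mul_nonneg (by positivity) (levy_nonneg α z))]
    exact mul_le_mul_of_nonneg_right (min_le_right _ _) (levy_nonneg α z)
  · refine Integrable.mono' (integrableOn_levy hα one_pos) hm.aestronglyMeasurable
      (Eventually.of_forall fun z => ?_)
    rw [Real.norm_of_nonneg (mul_nonneg (by positivity) (levy_nonneg α z))]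
    exact mul_le_of_le_one_left (levy_nonneg α z) (min_le_left _ _)

/-! ### The fractional Laplacian of a power function -/

/-- Mean value inequality. The interval is the range of |e + z|² - 1 for |e| = 1 and |z| ≤ 1/2, so
`1 + a` stays above 1/4. -/
theorem abs_one_add_rpow_sub_one_le {p : ℝ} (hp : p ≤ 0) :
    ∃ C, 0 ≤ C ∧ ∀ a ∈ Set.Icc (-(3 / 4) : ℝ) (5 / 4), |(1 + a) ^ p - 1| ≤ C * |a| := by
  refine ⟨|p| * (1 / 4) ^ (p - 1), by positivity, fun a ha => ?_⟩
  have h := Convex.norm_image_sub_le_of_norm_hasDerivWithin_le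
    (f := fun a : ℝ => (1 + a) ^ p) (f' := fun a => p * (1 + a) ^ (p - 1))
    (s := Set.Icc (-(3 / 4) : ℝ) (5 / 4)) (C := |p| * (1 / 4) ^ (p - 1)) (x := 0) (y := a)
    ?_ ?_ (convex_Icc _ _) (by norm_num) ha
  · simpa using h
  · intro x hx
    have h1 : HasDerivAt (fun a : ℝ => 1 + a) 1 x := (hasDerivAt_id x).const_add 1
    have := h1.rpow_const (p := p) (Or.inl (by linarith [hx.1]))
    simpa using this.hasDerivWithinAt
  · intro x hx
    have hx1 : (1 / 4 : ℝ) ≤ 1 + x := by linarith [hx.1]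
    rw [norm_mul, Real.norm_eq_abs, Real.norm_of_nonneg (by positivity)]
    exact mul_le_mul_of_nonneg_left (Real.rpow_le_rpow_of_nonpos (by norm_num) hx1 (by linarith))
      (abs_nonneg _)

/-- The derivative of the remainder is `p * ((1 + x) ^ (p - 1) - 1)`. The first-order bound for the
exponent `p - 1` controls it on the segment from 0 to `a`, and a second mean value inequality
finishes. -/
theorem abs_one_add_rpow_sub_sub_le {p : ℝ} (hp : p ≤ 0) :
    ∃ C, 0 ≤ C ∧ ∀ a ∈ Set.Icc (-(3 / 4) : ℝ) (5 / 4), |(1 + a) ^ p - 1 - p * a| ≤ C * a ^ 2 := by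
  obtain ⟨C, hC, h⟩ := abs_one_add_rpow_sub_one_le (p := p - 1) (by linarith)
  refine ⟨|p| * C, by positivity, fun a ha => ?_⟩
  have hsub : Set.uIcc 0 a ⊆ Set.Icc (-(3 / 4) : ℝ) (5 / 4) := by
    intro x hx
    rcases Set.mem_uIcc.1 hx with hx | hx
    · exact ⟨by linarith [hx.1], by linarith [hx.2, ha.2]⟩
    · exact ⟨by linarith [hx.1, ha.1], by linarith [hx.2]⟩
  have h2 := Convex.norm_image_sub_le_of_norm_hasDerivWithin_le
    (f := fun a : ℝ => (1 + a) ^ p - 1 - p * a) (f' := fun a => p * (1 + a) ^ (p - 1) - p)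
    (s := Set.uIcc 0 a) (C := |p| * C * |a|) (x := 0) (y := a)
    ?_ ?_ (convex_uIcc _ _) Set.left_mem_uIcc Set.right_mem_uIcc
  · simp only [add_zero, Real.one_rpow, mul_zero, sub_self, sub_zero, Real.norm_eq_abs] at h2
    rwa [mul_assoc, abs_mul_abs_self, ← pow_two] at h2
  · intro x hx
    have hx' := hsub hx
    have h1 : HasDerivAt (fun a : ℝ => 1 + a) 1 x := (hasDerivAt_id x).const_add 1
    have h3 := h1.rpow_const (p := p) (Or.inl (by linarith [hx'.1]))
    exact (((h3.sub_const 1).sub ((hasDerivAt_id x).const_mul p)).congr_deriv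
      (by simp)).hasDerivWithinAt
  · intro x hx
    have hx' := hsub hx
    have e : p * (1 + x) ^ (p - 1) - p = p * ((1 + x) ^ (p - 1) - 1) := by ring
    rw [e, norm_mul, Real.norm_eq_abs, Real.norm_eq_abs, mul_assoc]
    refine mul_le_mul_of_nonneg_left ((h x hx').trans ?_) (abs_nonneg _)
    have := Set.abs_sub_left_of_mem_uIcc hx
    simp only [sub_zero] at this
    exact mul_le_mul_of_nonneg_left this hC

theorem norm_rpow_eq_sq_rpow (β : ℝ) (x : Eu d) : ‖x‖ ^ (-β) = (‖x‖ ^ 2) ^ (-(β / 2)) := by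
  rw [← Real.rpow_natCast, ← Real.rpow_mul (norm_nonneg _)]
  congr 1
  push_cast
  ring

theorem abs_second_difference_le {β : ℝ} (hβ : 0 ≤ β) :
    ∃ C, 0 ≤ C ∧ ∀ e z : Eu d, ‖e‖ = 1 → ‖z‖ ≤ 1 / 2 →
      |2 - ‖e + z‖ ^ (-β) - ‖e - z‖ ^ (-β)| ≤ C * ‖z‖ ^ 2 := by
  obtain ⟨C, hC, h⟩ := abs_one_add_rpow_sub_sub_le (p := -(β / 2)) (by linarith)
  -- In the two expansions of (|e ± z|²)^{-β/2} the terms ±2⟨e, z⟩ cancel at first order. The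
  -- surviving linear part is at most β|z|² in absolute value, and each of the two quadratic
  -- remainders is at most 8C|z|².
  refine ⟨β + C * 16, by positivity, fun e z he hz => ?_⟩
  have hz0 := norm_nonneg z
  have hi : |inner ℝ e z| ≤ ‖z‖ := by
    have := abs_real_inner_le_norm e z
    rwa [he, one_mul] at this
  have hi' := abs_le.1 hi
  have e1 : ‖e + z‖ ^ 2 = 1 + (2 * inner ℝ e z + ‖z‖ ^ 2) := by
    rw [norm_add_sq_real, he]; ring
  have e2 : ‖e - z‖ ^ 2 = 1 + (-(2 * inner ℝ e z) + ‖z‖ ^ 2) := by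
    rw [norm_sub_sq_real, he]; ring
  rw [norm_rpow_eq_sq_rpow, norm_rpow_eq_sq_rpow, e1, e2]
  have n1 : -1 ≤ inner ℝ e z * 2 := by linarith [hi'.1]
  have n2 : inner ℝ e z * 2 ≤ 1 := by linarith [hi'.2]
  have q0 : 0 ≤ ‖z‖ ^ 2 := by positivity
  have q1 : ‖z‖ ^ 2 ≤ 1 / 4 := by nlinarith
  have q2 : (inner ℝ e z) ^ 2 ≤ ‖z‖ ^ 2 := sq_le_sq' hi'.1 hi'.2
  have lower : ∀ t : ℝ, |t| ≤ ‖z‖ → -(3 / 4) ≤ 2 * t + ‖z‖ ^ 2 := fun t ht => by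
    nlinarith [(abs_le.1 ht).1, sq_nonneg (‖z‖ - 1 / 2)]
  have h1 := h (2 * inner ℝ e z + ‖z‖ ^ 2) ⟨lower _ hi, by linarith⟩
  have h2 := h (-(2 * inner ℝ e z) + ‖z‖ ^ 2)
    ⟨by have := lower (-(inner ℝ e z)) (by rwa [abs_neg]); linarith, by linarith⟩
  set i := inner ℝ e z
  set n := ‖z‖
  have b1 : (2 * i + n ^ 2) ^ 2 ≤ 8 * n ^ 2 := by nlinarith [sq_nonneg (2 * i - n ^ 2)]
  have b2 : (-(2 * i) + n ^ 2) ^ 2 ≤ 8 * n ^ 2 := by nlinarith [sq_nonneg (2 * i + n ^ 2)]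
  have c1 := mul_le_mul_of_nonneg_left b1 hC
  have c2 := mul_le_mul_of_nonneg_left b2 hC
  rw [abs_le] at h1 h2 ⊢
  have bb : 0 ≤ β * n ^ 2 := by positivity
  constructor <;> nlinarith [h1.1, h1.2, h2.1, h2.2]

/-- The symmetrised integrand of the fractional Laplacian of `|x|^{-β}` at the unit vector `e`. -/
def secondDiff (α β : ℝ) (e z : Eu d) : ℝ :=
  (2 - ‖e + z‖ ^ (-β) - ‖e - z‖ ^ (-β)) * levy α z

/-- The integrand of the fractional Laplacian of `|x|^{-β}` at the unit vector `e`. -/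
def firstDiff (α β : ℝ) (e z : Eu d) : ℝ := (1 - ‖e + z‖ ^ (-β)) * levy α z

theorem measurable_secondDiff (α β : ℝ) (e : Eu d) : Measurable (secondDiff α β e) := by
  unfold secondDiff
  exact (by fun_prop : Measurable fun z : Eu d => 2 - ‖e + z‖ ^ (-β) - ‖e - z‖ ^ (-β)).mul
    (measurable_levy α)

theorem integrableOn_ball_center_norm_rpow (hd : 0 < d) {s : ℝ} (hs : s < d) (e : Eu d) (R : ℝ) :
    IntegrableOn (fun x : Eu d => ‖e + x‖ ^ (-s)) (Metric.ball (-e) R) := by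
  have h := (integrableOn_ball_norm_rpow hd hs R)
  rw [← integrable_indicator_iff Metric.isOpen_ball.measurableSet] at h ⊢
  refine (h.comp_add_left e).congr (Eventually.of_forall fun x => ?_)
  simp [Set.indicator, dist_eq_norm, add_comm]

theorem levy_le_of_le_norm {α : ℝ} (hα : 0 < α) {r : ℝ} (hr : 0 < r) {z : Eu d} (hz : r ≤ ‖z‖) :
    levy α z ≤ r ^ (-((d : ℝ) + α)) := by
  have : (0 : ℝ) ≤ d := Nat.cast_nonneg d
  exact Real.rpow_le_rpow_of_nonpos hr hz (by linarith)

/-- Within distance 1 of the singularity `-e` the Lévy kernel is bounded and the power is locally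
integrable; elsewhere the power is at most 1 and the kernel is integrable off the ball. -/
theorem integrableOn_rpow_mul_levy (hd : 0 < d) {α β : ℝ} (hα : 0 < α) (hβ : 0 ≤ β) (hβd : β < d)
    (e : Eu d) {s : ℝ} (hs : 0 < s) :
    IntegrableOn (fun z => ‖e + z‖ ^ (-β) * levy α z) (Metric.ball 0 s)ᶜ := by
  have hint : Integrable (fun z => ((Metric.ball (0 : Eu d) s)ᶜ).indicator (levy α) z +
      s ^ (-((d : ℝ) + α)) * (Metric.ball (-e) 1).indicator (fun x => ‖e + x‖ ^ (-β)) z) := by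
    refine Integrable.add ?_ (Integrable.const_mul ?_ _)
    · exact (integrable_indicator_iff Metric.isOpen_ball.measurableSet.compl).2
        (integrableOn_levy hα hs)
    · exact (integrable_indicator_iff Metric.isOpen_ball.measurableSet).2
        (integrableOn_ball_center_norm_rpow hd hβd e 1)
  have hm : Measurable (fun z : Eu d => ‖e + z‖ ^ (-β) * levy α z) :=
    (by fun_prop : Measurable fun z : Eu d => ‖e + z‖ ^ (-β)).mul (measurable_levy α)
  refine Integrable.mono' hint.integrableOn hm.aestronglyMeasurable ?_
  refine (ae_restrict_iff' Metric.isOpen_ball.measurableSet.compl).2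
    (Eventually.of_forall fun z hz => ?_)
  have hz' : s ≤ ‖z‖ := by simpa using hz
  have hl := levy_nonneg α z
  rw [Real.norm_of_nonneg (by positivity), Set.indicator_of_mem hz]
  by_cases h1 : z ∈ Metric.ball (-e) 1
  · rw [Set.indicator_of_mem h1]
    have := mul_le_mul_of_nonneg_left (levy_le_of_le_norm hα hs hz')
      (by positivity : 0 ≤ ‖e + z‖ ^ (-β))
    linarith [mul_comm (s ^ (-((d : ℝ) + α))) (‖e + z‖ ^ (-β))]
  · rw [Set.indicator_of_notMem h1, mul_zero, add_zero]
    have h2 : 1 ≤ ‖e + z‖ := by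
      simpa [dist_eq_norm, add_comm] using h1
    exact mul_le_of_le_one_left hl (Real.rpow_le_one_of_one_le_of_nonpos h2 (by linarith))

theorem integrableOn_firstDiff (hd : 0 < d) {α β : ℝ} (hα : 0 < α) (hβ : 0 ≤ β) (hβd : β < d)
    (e : Eu d) {s : ℝ} (hs : 0 < s) :
    IntegrableOn (firstDiff α β e) (Metric.ball 0 s)ᶜ := by
  refine ((integrableOn_levy hα hs).sub (integrableOn_rpow_mul_levy hd hα hβ hβd e hs)).congr
    (Eventually.of_forall fun z => ?_)
  simp only [firstDiff, Pi.sub_apply]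
  ring

theorem secondDiff_eq (α β : ℝ) (e z : Eu d) :
    secondDiff α β e z = firstDiff α β e z + firstDiff α β e (-z) := by
  rw [secondDiff, firstDiff, firstDiff, levy_neg, ← sub_eq_add_neg]
  ring

theorem integrableOn_firstDiff_neg (hd : 0 < d) {α β : ℝ} (hα : 0 < α) (hβ : 0 ≤ β) (hβd : β < d)
    (e : Eu d) {s : ℝ} (hs : 0 < s) :
    IntegrableOn (fun z => firstDiff α β e (-z)) (Metric.ball 0 s)ᶜ := by
  have h := integrableOn_firstDiff hd hα hβ hβd e hs
  rw [← integrable_indicator_iff Metric.isOpen_ball.measurableSet.compl] at h ⊢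
  refine h.comp_neg.congr (Eventually.of_forall fun x => ?_)
  simp [Set.indicator]

theorem integrable_secondDiff (hd : 0 < d) {α β : ℝ} (hα : 0 < α) (hα' : α < 2) (hβ : 0 ≤ β)
    (hβd : β < d) {e : Eu d} (he : ‖e‖ = 1) : Integrable (secondDiff α β e) := by
  rw [← integrableOn_univ, ← Set.union_compl_self (Metric.ball (0 : Eu d) (1 / 2))]
  refine IntegrableOn.union ?_ ?_
  · obtain ⟨C, hC, h⟩ := abs_second_difference_le (d := d) hβ
    refine Integrable.mono' ((integrableOn_sq_mul_levy hd hα' (1 / 2)).const_mul C)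
      (measurable_secondDiff α β e).aestronglyMeasurable ?_
    refine (ae_restrict_iff' Metric.isOpen_ball.measurableSet).2
      (Eventually.of_forall fun z hz => ?_)
    have hz' : ‖z‖ < 1 / 2 := by simpa using hz
    rw [secondDiff, norm_mul, Real.norm_eq_abs, Real.norm_of_nonneg (levy_nonneg α z), ← mul_assoc]
    exact mul_le_mul_of_nonneg_right (h e z he hz'.le) (levy_nonneg α z)
  · refine ((integrableOn_firstDiff hd hα hβ hβd e (by norm_num)).add
      (integrableOn_firstDiff_neg hd hα hβ hβd e (by norm_num))).congr
      (Eventually.of_forall fun z => (secondDiff_eq α β e z).symm)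

/-- The truncated fractional Laplacian of `|x|^{-β}` at the unit vector `e`. -/
def truncLap (α β : ℝ) (e : Eu d) (s : ℝ) : ℝ := ∫ z in (Metric.ball 0 s)ᶜ, firstDiff α β e z

/-- The fractional Laplacian of `|x|^{-β}` at the unit vector `e`, up to the factor `𝒜(d, α)`. -/
def limLap (α β : ℝ) (e : Eu d) : ℝ := (∫ z, secondDiff α β e z) / 2

/-- The complement of a centred ball is invariant under z ↦ -z. Averaging over the reflection
replaces the first difference by the second one, which is integrable up to the origin, so the limit
s → 0 needs no principal value. -/
theorem truncLap_eq (hd : 0 < d) {α β : ℝ} (hα : 0 < α) (hβ : 0 ≤ β) (hβd : β < d)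
    (e : Eu d) {s : ℝ} (hs : 0 < s) :
    truncLap α β e s = (∫ z in (Metric.ball 0 s)ᶜ, secondDiff α β e z) / 2 := by
  have h1 : ∫ z in (Metric.ball 0 s)ᶜ, firstDiff α β e (-z) = truncLap α β e s := by
    rw [truncLap, ← integral_indicator Metric.isOpen_ball.measurableSet.compl,
      ← integral_indicator Metric.isOpen_ball.measurableSet.compl,
      ← integral_neg_eq_self (((Metric.ball (0 : Eu d) s)ᶜ).indicator (firstDiff α β e))]
    congr 1
    ext z
    simp [Set.indicator]
  have h2 : ∫ z in (Metric.ball 0 s)ᶜ, secondDiff α β e z =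
      truncLap α β e s + truncLap α β e s := by
    nth_rw 2 [← h1]
    rw [truncLap, ← integral_add (integrableOn_firstDiff hd hα hβ hβd e hs)
      (integrableOn_firstDiff_neg hd hα hβ hβd e hs)]
    exact integral_congr_ae (Eventually.of_forall fun z => secondDiff_eq α β e z)
  linarith

/-- The bound does not depend on `s`. It is the dominating constant whenever the truncated Laplacian
is evaluated at `s / ‖x‖` and `s` tends to zero under an integral over `x`. -/
theorem exists_abs_truncLap_le (hd : 0 < d) {α β : ℝ} (hα : 0 < α) (hα' : α < 2) (hβ : 0 ≤ β)
    (hβd : β < d) {e : Eu d} (he : ‖e‖ = 1) :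
    ∃ M, 0 ≤ M ∧ ∀ s, 0 < s → |truncLap α β e s| ≤ M := by
  have hi := integrable_secondDiff hd hα hα' hβ hβd he
  refine ⟨(∫ z, ‖secondDiff α β e z‖) / 2, by positivity, fun s hs => ?_⟩
  rw [truncLap_eq hd hα hβ hβd e hs, abs_div, abs_two]
  refine div_le_div_of_nonneg_right ?_ (by norm_num)
  exact (norm_integral_le_integral_norm _).trans
    (setIntegral_le_integral hi.norm (Eventually.of_forall fun _ => norm_nonneg _))

theorem tendsto_truncLap (hd : 0 < d) {α β : ℝ} (hα : 0 < α) (hα' : α < 2) (hβ : 0 ≤ β)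
    (hβd : β < d) {e : Eu d} (he : ‖e‖ = 1) {u : ℕ → ℝ} (hu : ∀ n, 0 < u n)
    (hu0 : Tendsto u atTop (𝓝 0)) :
    Tendsto (fun n => truncLap α β e (u n)) atTop (𝓝 (limLap α β e)) := by
  have hi := integrable_secondDiff hd hα hα' hβ hβd he
  simp_rw [fun n => truncLap_eq hd hα hβ hβd e (hu n)]
  refine Tendsto.div_const ?_ 2
  have hind : ∀ n, ∫ z in (Metric.ball 0 (u n))ᶜ, secondDiff α β e z =
      ∫ z, ((Metric.ball 0 (u n))ᶜ).indicator (secondDiff α β e) z := fun n =>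
    (integral_indicator Metric.isOpen_ball.measurableSet.compl).symm
  simp_rw [hind]
  refine tendsto_integral_of_dominated_convergence (fun z => ‖secondDiff α β e z‖)
    (fun n => ((measurable_secondDiff α β e).indicator
      Metric.isOpen_ball.measurableSet.compl).aestronglyMeasurable) hi.norm ?_ ?_
  · intro n
    refine Eventually.of_forall fun z => ?_
    exact norm_indicator_le_norm_self _ _
  · filter_upwards [ae_ne_zero hd] with z hz
    have hz' : 0 < ‖z‖ := norm_pos_iff.2 hz
    refine tendsto_const_nhds.congr' ?_
    filter_upwards [hu0.eventually (gt_mem_nhds hz')] with n hn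
    rw [Set.indicator_of_mem]
    simpa using hn.le

/-! ### Superposition of Gaussians -/

theorem integrableOn_rpow_mul_exp {a r : ℝ} (ha : 0 < a) (hr : 0 < r) :
    IntegrableOn (fun t : ℝ => t ^ (a - 1) * Real.exp (-(r * t))) (Set.Ioi 0) := by
  have h := integrableOn_rpow_mul_exp_neg_mul_rpow (p := 1) (s := a - 1) (b := r) (by linarith)
    one_pos hr
  simpa using h

theorem integral_rpow_mul_exp {a r : ℝ} (ha : 0 < a) (hr : 0 < r) :
    ∫ t in Set.Ioi (0 : ℝ), t ^ (a - 1) * Real.exp (-(r * t)) = r ^ (-a) * Real.Gamma a := by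
  rw [Real.integral_rpow_mul_exp_neg_mul_Ioi ha hr, one_div, Real.inv_rpow hr.le,
    Real.rpow_neg hr.le]

/-- The integrand produced by the substitution t ↦ t^p on (0, ∞) at p = -1. -/
theorem inv_substitution {a : ℝ} {g : ℝ → ℝ} {t : ℝ} (ht : 0 < t) :
    (|(-1 : ℝ)| * t ^ ((-1 : ℝ) - 1)) • ((t ^ (-1 : ℝ)) ^ (a - 1) * g (t ^ (-1 : ℝ))) =
      t ^ (-a - 1) * g (1 / t) := by
  rw [← Real.rpow_mul ht.le, smul_eq_mul, abs_neg, abs_one, one_mul, ← mul_assoc,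
    ← Real.rpow_add ht, Real.rpow_neg_one, one_div]
  congr 2
  ring

theorem integrableOn_rpow_comp_inv {a : ℝ} {g : ℝ → ℝ}
    (h : IntegrableOn (fun t : ℝ => t ^ (a - 1) * g t) (Set.Ioi 0)) :
    IntegrableOn (fun t : ℝ => t ^ (-a - 1) * g (1 / t)) (Set.Ioi 0) := by
  rw [← integrableOn_Ioi_comp_rpow_iff _ (show (-1 : ℝ) ≠ 0 by norm_num)] at h
  exact h.congr_fun (fun t ht => inv_substitution ht) measurableSet_Ioi

theorem integral_rpow_comp_inv (a : ℝ) (g : ℝ → ℝ) :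
    ∫ t in Set.Ioi (0 : ℝ), t ^ (-a - 1) * g (1 / t) =
      ∫ t in Set.Ioi (0 : ℝ), t ^ (a - 1) * g t := by
  rw [← integral_comp_rpow_Ioi (fun t : ℝ => t ^ (a - 1) * g t) (show (-1 : ℝ) ≠ 0 by norm_num)]
  exact setIntegral_congr_fun measurableSet_Ioi (fun t ht => (inv_substitution ht).symm)

/-- Fubini for a superposition `∫ k(t, x) dt` of nonnegative functions against `h`. -/
theorem integral_superposition {F : Type*} [NormedAddCommGroup F] [NormedSpace ℝ F]
    [CompleteSpace F] {k : ℝ → Eu d → ℝ} (hk : Measurable (Function.uncurry k)) (hk0 : ∀ t x, 0 < t → 0 ≤ k t x)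
    {m : Eu d → ℝ}
    (hki : ∀ᵐ x, IntegrableOn (fun t => k t x) (Set.Ioi 0) ∧ ∫ t in Set.Ioi 0, k t x = m x)
    {h : Eu d → F} (hh : AEStronglyMeasurable h) (hmh : Integrable fun x => m x • h x) :
    ∫ x, m x • h x = ∫ t in Set.Ioi 0, ∫ x, k t x • h x := by
  have hm : AEStronglyMeasurable (Function.uncurry fun t x => k t x • h x)
      ((volume.restrict (Set.Ioi (0 : ℝ))).prod (volume : Measure (Eu d))) :=
    hk.aestronglyMeasurable.smul hh.comp_snd
  have hint : Integrable (Function.uncurry fun t x => k t x • h x)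
      ((volume.restrict (Set.Ioi (0 : ℝ))).prod (volume : Measure (Eu d))) := by
    rw [integrable_prod_iff' hm]
    refine ⟨?_, ?_⟩
    · filter_upwards [hki] with x hx
      exact hx.1.smul_const (h x)
    · refine hmh.norm.congr ?_
      filter_upwards [hki] with x hx
      simp only [Function.uncurry_apply_pair, norm_smul]
      rw [integral_mul_const, ← hx.2]
      congr 1
      rw [setIntegral_congr_fun measurableSet_Ioi
        (fun t ht => Real.norm_of_nonneg (hk0 t x ht))]
      exact Real.norm_of_nonneg (setIntegral_nonneg measurableSet_Ioi fun t ht => hk0 t x ht)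
  rw [integral_integral_swap hint]
  refine integral_congr_ae ?_
  filter_upwards [hki] with x hx
  rw [integral_smul_const, hx.2]

/-- Superposition of the Gaussians `exp (-π t |x|²)` with the density `t ^ (a - 1)`. -/
theorem gaussian_superposition (hd : 0 < d) {a : ℝ} (ha : 0 < a) :
    ∀ᵐ x : Eu d, IntegrableOn (fun t : ℝ => t ^ (a - 1) * Real.exp (-(Real.pi * ‖x‖ ^ 2 * t)))
        (Set.Ioi 0) ∧
      ∫ t in Set.Ioi (0 : ℝ), t ^ (a - 1) * Real.exp (-(Real.pi * ‖x‖ ^ 2 * t)) =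
        Real.pi ^ (-a) * Real.Gamma a * ‖x‖ ^ (-(2 * a)) := by
  filter_upwards [ae_ne_zero hd] with x hx
  have hx' : 0 < ‖x‖ := norm_pos_iff.2 hx
  refine ⟨integrableOn_rpow_mul_exp ha (by positivity), ?_⟩
  rw [integral_rpow_mul_exp ha (by positivity), Real.mul_rpow Real.pi_pos.le (by positivity),
    norm_rpow_eq_sq_rpow, mul_div_cancel_left₀ _ (two_ne_zero' ℝ)]
  ring

/-- Superposition of the Gaussians `exp (-π |x|² / t)` with the density `t ^ (-a - 1)`. -/
theorem gaussian_superposition_inv (hd : 0 < d) {a : ℝ} (ha : 0 < a) :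
    ∀ᵐ x : Eu d, IntegrableOn (fun t : ℝ => t ^ (-a - 1) *
        Real.exp (-(Real.pi * ‖x‖ ^ 2 * (1 / t)))) (Set.Ioi 0) ∧
      ∫ t in Set.Ioi (0 : ℝ), t ^ (-a - 1) * Real.exp (-(Real.pi * ‖x‖ ^ 2 * (1 / t))) =
        Real.pi ^ (-a) * Real.Gamma a * ‖x‖ ^ (-(2 * a)) := by
  filter_upwards [gaussian_superposition hd ha] with x hx
  refine ⟨integrableOn_rpow_comp_inv (g := fun s => Real.exp (-(Real.pi * ‖x‖ ^ 2 * s))) hx.1, ?_⟩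
  rw [← hx.2, integral_rpow_comp_inv a (fun s => Real.exp (-(Real.pi * ‖x‖ ^ 2 * s)))]

/-! ### The Fourier transform of a power function -/

/-- The multiplication formula ∫ ĝ ψ = ∫ g ψ̂ for a Gaussian g, whose transform is again Gaussian
with reciprocal width. -/
theorem integral_gaussian_mul_fourier {ψ : Eu d → ℂ} (hψ : Integrable ψ) {t : ℝ} (ht : 0 < t) :
    ∫ x : Eu d, Real.exp (-(Real.pi * ‖x‖ ^ 2 * t)) • 𝓕 ψ x =
      ∫ ξ : Eu d, (t ^ (-((d : ℝ) / 2)) * Real.exp (-(Real.pi * ‖ξ‖ ^ 2 * (1 / t)))) • ψ ξ := by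
  have hb : 0 < ((Real.pi * t : ℝ) : ℂ).re := by
    rw [Complex.ofReal_re]; positivity
  have hg : Integrable (fun x : Eu d => Complex.exp (-((Real.pi * t : ℝ) : ℂ) * ‖x‖ ^ 2)) := by
    simpa using GaussianFourier.integrable_cexp_neg_mul_sq_norm_add hb 0 (0 : Eu d)
  have h := VectorFourier.integral_fourierIntegral_smul_eq_flip (L := innerₗ (Eu d))
    Real.continuous_fourierChar continuous_inner hg hψ
  have hf : ∀ w : Eu d, 𝓕 (fun x : Eu d => Complex.exp (-((Real.pi * t : ℝ) : ℂ) * ‖x‖ ^ 2)) w =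
      ((t ^ (-((d : ℝ) / 2)) * Real.exp (-(Real.pi * ‖w‖ ^ 2 * (1 / t))) : ℝ) : ℂ) := by
    intro w
    rw [fourier_gaussian_innerProductSpace hb]
    have h1 : (Real.pi / ((Real.pi * t : ℝ) : ℂ)) = ((t⁻¹ : ℝ) : ℂ) := by
      rw [← Complex.ofReal_div]
      congr 1
      field_simp
    rw [h1, Complex.ofReal_mul (t ^ _), Complex.ofReal_exp]
    congr 1
    · rw [finrank_euclideanSpace_fin, Real.rpow_neg ht.le, ← Real.inv_rpow ht.le,
        Complex.ofReal_cpow (by positivity)]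
      push_cast
      rfl
    · congr 1
      push_cast
      have : (t : ℂ) ≠ 0 := by exact_mod_cast ht.ne'
      have : (Real.pi : ℂ) ≠ 0 := by exact_mod_cast Real.pi_pos.ne'
      field_simp
  have h' : ∫ ξ : Eu d, 𝓕 (fun x : Eu d => Complex.exp (-((Real.pi * t : ℝ) : ℂ) * ‖x‖ ^ 2)) ξ •
      ψ ξ = ∫ x : Eu d, Complex.exp (-((Real.pi * t : ℝ) : ℂ) * ‖x‖ ^ 2) • 𝓕 ψ x := by
    simpa using! h
  simp_rw [hf] at h'
  symm
  convert! h' using 2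
  ext x
  rw [Complex.real_smul, smul_eq_mul]
  congr 1
  rw [Complex.ofReal_exp]
  congr 1
  push_cast
  ring

/-- The constant `γ_β` with `𝓕 |x|^{-β} = γ_β |ξ|^{β-d}`. -/
def rieszConst (d : ℕ) (β : ℝ) : ℝ :=
  Real.pi ^ (β - (d : ℝ) / 2) * Real.Gamma ((d - β) / 2) / Real.Gamma (β / 2)

theorem rieszConst_pos {β : ℝ} (hβ : 0 < β) (hβd : β < d) : 0 < rieszConst d β := by
  have h1 := Real.Gamma_pos_of_pos (show 0 < (d - β) / 2 by linarith)
  have h2 := Real.Gamma_pos_of_pos (show 0 < β / 2 by linarith)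
  have := Real.pi_pos
  unfold rieszConst
  positivity

/-- Both powers are superpositions of Gaussians: |x|^{-β} with density t^{β/2-1}, and |ξ|^{-(d-β)}
in the inverse widths. The multiplication formula matches them for each t, and Fubini carries the
equality over to the superpositions. -/
theorem integral_rpow_mul_fourier (hd : 0 < d) {β : ℝ} (hβ : 0 < β) (hβd : β < d) {ψ : Eu d → ℂ}
    (hψ : Integrable ψ) (h1 : Integrable fun x => ‖x‖ ^ (-β) • 𝓕 ψ x)
    (h2 : Integrable fun ξ => ‖ξ‖ ^ (-(d - β)) • ψ ξ) :
    ∫ x, ‖x‖ ^ (-β) • 𝓕 ψ x = rieszConst d β • ∫ ξ, ‖ξ‖ ^ (-(d - β)) • ψ ξ := by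
  have hF : AEStronglyMeasurable (𝓕 ψ) :=
    (VectorFourier.fourierIntegral_continuous Real.continuous_fourierChar
      (by exact continuous_inner) hψ).aestronglyMeasurable
  have A := integral_superposition (k := fun t x => t ^ (β / 2 - 1) *
      Real.exp (-(Real.pi * ‖x‖ ^ 2 * t)))
      (m := fun x => Real.pi ^ (-(β / 2)) * Real.Gamma (β / 2) * ‖x‖ ^ (-(2 * (β / 2))))
      (by unfold Function.uncurry; fun_prop) (fun t x ht => by positivity)
      (gaussian_superposition hd (by linarith)) hF
      (by
        refine (h1.smul (Real.pi ^ (-(β / 2)) * Real.Gamma (β / 2))).congr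
          (Eventually.of_forall fun x => ?_)
        simp only [Pi.smul_apply, smul_smul]
        congr 3
        ring)
  have B := integral_superposition (k := fun t x => t ^ (-((d - β) / 2) - 1) *
      Real.exp (-(Real.pi * ‖x‖ ^ 2 * (1 / t))))
      (m := fun x => Real.pi ^ (-((d - β) / 2)) * Real.Gamma ((d - β) / 2) *
        ‖x‖ ^ (-(2 * ((d - β) / 2))))
      (by unfold Function.uncurry; fun_prop) (fun t x ht => by positivity)
      (gaussian_superposition_inv hd (by linarith)) hψ.1
      (by
        refine (h2.smul (Real.pi ^ (-((d - β) / 2)) * Real.Gamma ((d - β) / 2))).congr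
          (Eventually.of_forall fun x => ?_)
        simp only [Pi.smul_apply, smul_smul]
        congr 3
        ring)
  have C : ∫ t in Set.Ioi (0 : ℝ), ∫ x, (t ^ (β / 2 - 1) *
      Real.exp (-(Real.pi * ‖x‖ ^ 2 * t))) • 𝓕 ψ x =
      ∫ t in Set.Ioi (0 : ℝ), ∫ x, (t ^ (-((d - β) / 2) - 1) *
      Real.exp (-(Real.pi * ‖x‖ ^ 2 * (1 / t)))) • ψ x := by
    refine setIntegral_congr_fun measurableSet_Ioi fun t ht => ?_
    simp only [mul_smul _ (Real.exp _)]
    rw [integral_smul, integral_smul, integral_gaussian_mul_fourier hψ ht]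
    simp only [mul_smul _ (Real.exp _)]
    rw [integral_smul, smul_smul, ← Real.rpow_add ht]
    congr 2
    ring
  rw [← A, ← B] at C
  have e1 : 2 * (β / 2) = β := by ring
  have e2 : 2 * (((d : ℝ) - β) / 2) = d - β := by ring
  simp only [e1, e2, fun (b e : ℝ) (x : Eu d) (y : ℂ) => mul_smul b (‖x‖ ^ e) y] at C
  rw [integral_smul, integral_smul] at C
  have g1 := Real.Gamma_pos_of_pos (show 0 < β / 2 by linarith)
  have hp := Real.pi_pos
  have hc : Real.pi ^ (-(β / 2)) * Real.Gamma (β / 2) ≠ 0 := by positivity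
  rw [← smul_right_injective _ hc |>.eq_iff]
  rw [C, smul_smul]
  congr 1
  rw [rieszConst]
  have e3 : Real.pi ^ (-((d - β) / 2)) = Real.pi ^ (-(β / 2)) * Real.pi ^ (β - (d : ℝ) / 2) := by
    rw [← Real.rpow_add hp]; congr 1; ring
  rw [e3]
  field_simp

/-! ### Identification of the constant -/

theorem integrable_rpow_smul_of_bounded {F : Type*} [NormedAddCommGroup F] [NormedSpace ℝ F]
    (hd : 0 < d) {s : ℝ} (hs : 0 ≤ s) (hsd : s < d) (e : Eu d) {f : Eu d → F} (hf : Integrable f)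
    {C : ℝ} (hC : ∀ x, ‖f x‖ ≤ C) : Integrable fun x => ‖e + x‖ ^ (-s) • f x := by
  have hint : Integrable (fun x => ‖f x‖ +
      C * (Metric.ball (-e) 1).indicator (fun x => ‖e + x‖ ^ (-s)) x) := by
    refine hf.norm.add (Integrable.const_mul ?_ _)
    exact (integrable_indicator_iff Metric.isOpen_ball.measurableSet).2
      (integrableOn_ball_center_norm_rpow hd hsd e 1)
  refine hint.mono' ((by fun_prop : Measurable fun x : Eu d =>
    ‖e + x‖ ^ (-s)).aestronglyMeasurable.smul hf.1) (Eventually.of_forall fun x => ?_)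
  rw [norm_smul, Real.norm_of_nonneg (by positivity)]
  by_cases h1 : x ∈ Metric.ball (-e) 1
  · rw [Set.indicator_of_mem h1]
    have := mul_le_mul_of_nonneg_left (hC x) (by positivity : 0 ≤ ‖e + x‖ ^ (-s))
    linarith [norm_nonneg (f x), mul_comm C (‖e + x‖ ^ (-s))]
  · rw [Set.indicator_of_notMem h1, mul_zero, add_zero]
    have h2 : 1 ≤ ‖e + x‖ := by
      simpa [dist_eq_norm, add_comm] using h1
    exact mul_le_of_le_one_left (norm_nonneg _)
      (Real.rpow_le_one_of_one_le_of_nonpos h2 (by linarith))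

theorem integrable_rpow_smul_schwartz (hd : 0 < d) {s : ℝ} (hs : 0 ≤ s) (hsd : s < d)
    (f : 𝓢(Eu d, ℂ)) : Integrable fun x => ‖x‖ ^ (-s) • f x := by
  have h := integrable_rpow_smul_of_bounded hd hs hsd 0 f.integrable
    (C := SchwartzMap.seminorm ℝ 0 0 f) (fun x => SchwartzMap.norm_le_seminorm ℝ f x)
  simpa using h

theorem integral_rpow_mul_fourier_schwartz (hd : 0 < d) {β : ℝ} (hβ : 0 < β) (hβd : β < d)
    (ψ : 𝓢(Eu d, ℂ)) :
    ∫ x, ‖x‖ ^ (-β) • (𝓕 ψ) x = rieszConst d β • ∫ ξ, ‖ξ‖ ^ (-(d - β)) • ψ ξ := by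
  rw [SchwartzMap.fourier_coe]
  refine integral_rpow_mul_fourier hd hβ hβd ψ.integrable ?_ ?_
  · rw [← SchwartzMap.fourier_coe]
    exact integrable_rpow_smul_schwartz hd hβ.le hβd (𝓕 ψ)
  · exact integrable_rpow_smul_schwartz hd (by linarith) (by linarith) ψ

/-- The constant `c` for which `|x|^{-β}` solves `(-Δ)^{α/2} w = c |x|^{-α} w`. -/
def hardyConst (d : ℕ) (α β : ℝ) : ℝ :=
  (2 * Real.pi) ^ α * rieszConst d β * rieszConst d (d - α - β)

/-- At the midpoint d - α - β = β, so the two Riesz constants coincide and the powers of π cancel.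
-/
theorem hardyConst_critical {α : ℝ} (hα : 0 < α) (hαd : α < d) :
    hardyConst d α ((d - α) / 2) = criticalConst d α := by
  have hp := Real.pi_pos
  have g1 := Real.Gamma_pos_of_pos (show 0 < (d - α) / 4 by linarith)
  have e1 : ((d : ℝ) - (d - α) / 2) / 2 = (d + α) / 4 := by ring
  have e2 : ((d : ℝ) - (d - α - (d - α) / 2)) / 2 = (d + α) / 4 := by ring
  have e3 : ((d : ℝ) - α - (d - α) / 2) / 2 = (d - α) / 4 := by ring
  have e4 : ((d : ℝ) - α) / 2 / 2 = (d - α) / 4 := by ring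
  have e5 : (d : ℝ) - α - (d - α) / 2 - d / 2 = -(α / 2) := by ring
  have e6 : ((d : ℝ) - α) / 2 - d / 2 = -(α / 2) := by ring
  have e7 : Real.pi ^ α = Real.pi ^ (α / 2) * Real.pi ^ (α / 2) := by
    rw [← Real.rpow_add hp]; congr 1; ring
  rw [hardyConst, rieszConst, rieszConst, criticalConst, e1, e2, e3, e4, e5, e6,
    Real.mul_rpow (by norm_num) hp.le, Real.rpow_neg hp.le, e7]
  field_simp

/-- Smooth compactly supported test functions force `g` to be the Riesz kernel `rieszConst d β` ·
|ξ|^{β-d} almost everywhere. The equation, tested against a single function for which the right-hand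
integral is nonzero, then determines `c`. -/
theorem eq_hardyConst_of_isHardyExponent (hd : 0 < d) {α c β : ℝ} (hα : 0 < α)
    (h : IsHardyExponent d α c β) : c = hardyConst d α β := by
  obtain ⟨hβ, hβ', g, hg, h1, h2⟩ := h
  have hβd : β < d := by linarith
  have hg' : ∀ᵐ ξ, g ξ = rieszConst d β • ((‖ξ‖ ^ (-((d : ℝ) - β)) : ℝ) : ℂ) := by
    refine ae_eq_of_integral_contDiff_smul_eq hg ?_ ?_
    · refine locallyIntegrable_of_norm_le_rpow (C := rieszConst d β) (α := d - β) ?_ ?_ ?_ ?_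
      · rw [finrank_euclideanSpace_fin]; exact hd
      · rw [finrank_euclideanSpace_fin]; linarith
      · refine Eventually.of_forall fun x => ?_
        rw [norm_smul, Complex.norm_real, Real.norm_of_nonneg (rieszConst_pos hβ hβd).le,
          Real.norm_of_nonneg (by positivity)]
      · exact (Complex.measurable_ofReal.comp (measurable_norm_rpow
          (-((d : ℝ) - β)))).aestronglyMeasurable.const_smul (rieszConst d β)
    · intro f hf hfc
      have hfs : ContDiff ℝ ((⊤ : ℕ∞) : WithTop ℕ∞) (fun x => (f x : ℂ)) :=
        Complex.ofRealCLM.contDiff.comp hf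
      have hfc' : HasCompactSupport (fun x => (f x : ℂ)) := hfc.comp_left Complex.ofReal_zero
      have h3 := h1 (hfc'.toSchwartzMap hfs)
      have h4 := integral_rpow_mul_fourier_schwartz hd hβ hβd (hfc'.toSchwartzMap hfs)
      have h5 : ∫ x, (weight β x : ℂ) * (𝓕 (hfc'.toSchwartzMap hfs)) x =
          ∫ x, ‖x‖ ^ (-β) • (𝓕 (hfc'.toSchwartzMap hfs)) x := by
        simp only [weight, Complex.real_smul]
      rw [← h5, h3] at h4
      calc ∫ x, f x • g x = ∫ ξ, g ξ * (hfc'.toSchwartzMap hfs) ξ := by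
            congr 1
            ext x
            simp [mul_comm]
        _ = _ := h4
        _ = _ := by
            rw [← integral_smul]
            congr 1
            ext x
            have hx : (hfc'.toSchwartzMap hfs) x = (f x : ℂ) := rfl
            simp only [hx, Complex.real_smul]
            ring
  let b : ContDiffBump (0 : Eu d) := ⟨1, 2, one_pos, one_lt_two⟩
  have hbs : ContDiff ℝ ((⊤ : ℕ∞) : WithTop ℕ∞) (fun x => (b x : ℂ)) :=
    Complex.ofRealCLM.contDiff.comp b.contDiff
  have hbc : HasCompactSupport (fun x => (b x : ℂ)) :=
    b.hasCompactSupport.comp_left Complex.ofReal_zero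
  set φ := hbc.toSchwartzMap hbs with hφ
  have h3 := h2 φ
  -- Multiplying |ξ|^{β-d} by |ξ|^α leaves |ξ|^{-(d-α-β)}, to which the transform formula applies a
  -- second time; hence the second Riesz constant in `hardyConst`.
  have h4 := integral_rpow_mul_fourier_schwartz hd (β := d - α - β) (by linarith) (by linarith) φ
  have e : -((d : ℝ) - (d - α - β)) = -α + -β := by ring
  have h5 : ∫ ξ, g ξ * (((2 * Real.pi * ‖ξ‖) ^ α : ℝ) : ℂ) * (𝓕 φ) ξ =
      (((2 * Real.pi) ^ α * rieszConst d β : ℝ) : ℂ) *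
        ∫ x, ‖x‖ ^ (-((d : ℝ) - α - β)) • (𝓕 φ) x := by
    rw [← integral_const_mul]
    refine integral_congr_ae ?_
    filter_upwards [hg', ae_ne_zero hd] with ξ hξ hξ0
    have hn : 0 < ‖ξ‖ := norm_pos_iff.2 hξ0
    have e2 : -((d : ℝ) - α - β) = -(d - β) + α := by ring
    rw [hξ, e2, Real.rpow_add hn, Real.mul_rpow (by positivity) hn.le]
    simp only [Complex.real_smul]
    push_cast
    ring
  rw [h5, h4] at h3
  have hI : ∀ x, x ≠ 0 → ((‖x‖ ^ (-α) * weight β x : ℝ) : ℂ) * φ x =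
      ((‖x‖ ^ (-α + -β) * b x : ℝ) : ℂ) := by
    intro x hx
    rw [weight, Real.rpow_add (norm_pos_iff.2 hx)]
    simp [hφ]
  have h6 : ∫ x, ((‖x‖ ^ (-α) * weight β x : ℝ) : ℂ) * φ x =
      ((∫ x : Eu d, ‖x‖ ^ (-α + -β) * b x : ℝ) : ℂ) := by
    rw [← integral_complex_ofReal]
    refine integral_congr_ae ?_
    filter_upwards [ae_ne_zero hd] with x hx using hI x hx
  have h7 : ∫ x, ‖x‖ ^ (-((d : ℝ) - (d - α - β))) • φ x =
      ((∫ x : Eu d, ‖x‖ ^ (-α + -β) * b x : ℝ) : ℂ) := by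
    rw [← integral_complex_ofReal, e]
    congr 1
    ext x
    simp [hφ]
  rw [h6, h7] at h3
  -- Positivity of the bump makes this factor nonzero, so it can be cancelled.
  have hpos : 0 < ∫ x : Eu d, ‖x‖ ^ (-α + -β) * b x := by
    have hint := integrable_rpow_smul_of_bounded hd (s := α + β) (by linarith) (by linarith) 0
      (b.continuous.integrable_of_hasCompactSupport (μ := volume) b.hasCompactSupport) (C := 1)
      (fun x => by rw [Real.norm_of_nonneg b.nonneg]; exact b.le_one)
    simp only [zero_add, smul_eq_mul, neg_add] at hint
    rw [integral_pos_iff_support_of_nonneg (fun x => mul_nonneg (by positivity) b.nonneg) hint]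
    have hsub : Metric.ball (0 : Eu d) 1 \ {0} ⊆
        Function.support fun x : Eu d => ‖x‖ ^ (-α + -β) * b x := by
      rintro x ⟨hx, hx0⟩
      have hn : 0 < ‖x‖ := norm_pos_iff.2 hx0
      have hb : b x = 1 := b.one_of_mem_closedBall (Metric.ball_subset_closedBall hx)
      rw [Function.mem_support, hb]
      positivity
    refine lt_of_lt_of_le ?_ (measure_mono hsub)
    have : Nonempty (Fin d) := ⟨⟨0, hd⟩⟩
    rw [measure_sdiff_null (measure_singleton _)]
    exact Metric.measure_ball_pos _ _ one_pos
  have h8 : (2 * Real.pi) ^ α * rieszConst d β *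
      (rieszConst d (d - α - β) * ∫ x : Eu d, ‖x‖ ^ (-α + -β) * b x) =
      c * ∫ x : Eu d, ‖x‖ ^ (-α + -β) * b x := by
    rw [Complex.real_smul] at h3
    exact_mod_cast h3
  rw [← mul_assoc] at h8
  exact (mul_right_cancel₀ hpos.ne' h8).symm

/-! ### The Lévy constant -/

theorem integrable_one_sub_cos_mul_levy (hd : 0 < d) {α : ℝ} (hα : 0 < α) (hα' : α < 2)
    (ξ : Eu d) : Integrable fun z => (1 - Real.cos (2 * Real.pi * inner ℝ z ξ)) * levy α z := by
  have hm : Measurable fun z : Eu d => (1 - Real.cos (2 * Real.pi * inner ℝ z ξ)) * levy α z :=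
    (by fun_prop : Measurable fun z : Eu d => 1 - Real.cos (2 * Real.pi * inner ℝ z ξ)).mul
      (measurable_levy α)
  refine ((integrable_min_mul_levy hd hα hα').const_mul
    (2 + (2 * Real.pi * ‖ξ‖) ^ 2)).mono' hm.aestronglyMeasurable (Eventually.of_forall fun z => ?_)
  have h1 := Real.cos_le_one (2 * Real.pi * inner ℝ z ξ)
  have h2 := Real.neg_one_le_cos (2 * Real.pi * inner ℝ z ξ)
  have h3 := Real.one_sub_sq_div_two_le_cos (x := 2 * Real.pi * inner ℝ z ξ)
  have h4 : (inner ℝ z ξ) ^ 2 ≤ (‖z‖ * ‖ξ‖) ^ 2 := by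
    rw [← sq_abs]
    exact pow_le_pow_left₀ (abs_nonneg _) (abs_real_inner_le_norm z ξ) 2
  rw [Real.norm_of_nonneg (mul_nonneg (by linarith) (levy_nonneg α z)), ← mul_assoc]
  refine mul_le_mul_of_nonneg_right ?_ (levy_nonneg α z)
  have hp := Real.pi_pos
  rcases min_cases 1 (‖z‖ ^ 2) with ⟨h, h'⟩ | ⟨h, h'⟩ <;> rw [h]
  · nlinarith [sq_nonneg (2 * Real.pi * ‖ξ‖)]
  · have h5 : (2 * Real.pi * inner ℝ z ξ) ^ 2 ≤ (2 * Real.pi * ‖ξ‖) ^ 2 * ‖z‖ ^ 2 := by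
      have := mul_le_mul_of_nonneg_left h4 (sq_nonneg (2 * Real.pi))
      nlinarith
    nlinarith [sq_nonneg ‖z‖]

theorem integral_cos_mul_gaussian {t : ℝ} (ht : 0 < t) (ξ : Eu d) :
    ∫ z : Eu d, Real.cos (2 * Real.pi * inner ℝ z ξ) * Real.exp (-(Real.pi * ‖z‖ ^ 2 * t)) =
      t ^ (-((d : ℝ) / 2)) * Real.exp (-(Real.pi * ‖ξ‖ ^ 2 * (1 / t))) := by
  have hb : 0 < ((Real.pi * t : ℝ) : ℂ).re := by
    rw [Complex.ofReal_re]; positivity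
  have hi : Integrable (fun v : Eu d => Complex.exp (-((Real.pi * t : ℝ) : ℂ) * ‖v‖ ^ 2 +
      (2 * Real.pi * Complex.I) * ((inner ℝ ξ v : ℝ) : ℂ))) :=
    GaussianFourier.integrable_cexp_neg_mul_sq_norm_add hb (2 * Real.pi * Complex.I) ξ
  have h := GaussianFourier.integral_cexp_neg_mul_sq_norm_add hb (2 * Real.pi * Complex.I) ξ
  have h2 := congrArg Complex.re h
  have h3 := integral_re hi
  simp only [RCLike.re_to_complex] at h3
  rw [← h3] at h2
  refine Eq.trans ?_ (h2.trans ?_)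
  · congr 1
    ext z
    rw [Complex.exp_re]
    have e1 : (-((Real.pi * t : ℝ) : ℂ) * ‖z‖ ^ 2 +
      (2 * Real.pi * Complex.I) * ((inner ℝ ξ z : ℝ) : ℂ)) =
      ((-(Real.pi * ‖z‖ ^ 2 * t) : ℝ) : ℂ) + ((2 * Real.pi * inner ℝ z ξ : ℝ) : ℂ) * Complex.I := by
      rw [real_inner_comm]
      push_cast
      ring
    rw [e1]
    simp only [Complex.add_re, Complex.add_im, Complex.ofReal_re, Complex.ofReal_im,
      Complex.re_ofReal_mul, Complex.im_ofReal_mul, Complex.I_re, Complex.I_im, mul_zero,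
      add_zero, zero_add, mul_one]
    ring
  · have h1 : (Real.pi / ((Real.pi * t : ℝ) : ℂ)) = ((t⁻¹ : ℝ) : ℂ) := by
      rw [← Complex.ofReal_div]
      congr 1
      field_simp
    have e2 : (2 * Real.pi * Complex.I) ^ 2 * ‖ξ‖ ^ 2 / (4 * ((Real.pi * t : ℝ) : ℂ)) =
        ((-(Real.pi * ‖ξ‖ ^ 2 * (1 / t)) : ℝ) : ℂ) := by
      have h1 : (t : ℂ) ≠ 0 := by exact_mod_cast ht.ne'
      have h2 : (Real.pi : ℂ) ≠ 0 := by exact_mod_cast Real.pi_pos.ne'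
      push_cast
      rw [mul_pow, mul_pow, Complex.I_sq]
      field_simp
      ring
    have e3 : ((t⁻¹ : ℝ) : ℂ) ^ ((Module.finrank ℝ (Eu d) : ℂ) / 2) =
        ((t ^ (-((d : ℝ) / 2)) : ℝ) : ℂ) := by
      rw [finrank_euclideanSpace_fin, Real.rpow_neg ht.le, ← Real.inv_rpow ht.le,
        Complex.ofReal_cpow (by positivity)]
      push_cast
      rfl
    rw [h1, e2, e3, ← Complex.ofReal_exp, ← Complex.ofReal_mul, Complex.ofReal_re]

theorem integral_gaussian {t : ℝ} (ht : 0 < t) :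
    ∫ z : Eu d, Real.exp (-(Real.pi * ‖z‖ ^ 2 * t)) = t ^ (-((d : ℝ) / 2)) := by
  have h := integral_cos_mul_gaussian ht (0 : Eu d)
  simpa using h

theorem integrable_gaussian {t : ℝ} (ht : 0 < t) :
    Integrable fun z : Eu d => Real.exp (-(Real.pi * ‖z‖ ^ 2 * t)) := by
  -- A non-integrable function has Bochner integral 0, whereas the value just computed is positive.
  by_contra h
  have := integral_gaussian (d := d) ht
  rw [integral_undef h] at this
  have := Real.rpow_pos_of_pos ht (-((d : ℝ) / 2))
  linarith

theorem constA_pos (hd : 0 < d) {α : ℝ} (hα : 0 < α) (hα' : α < 2) : 0 < constA d α := by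
  have h0 : (0 : ℝ) < d := Nat.cast_pos.2 hd
  have h1 := Real.Gamma_pos_of_pos (show 0 < ((d : ℝ) + α) / 2 by linarith)
  have h2 := Real.Gamma_pos_of_pos (show 0 < 1 - α / 2 by linarith)
  have := Real.pi_pos
  unfold constA
  positivity

theorem one_sub_exp_nonneg {r s : ℝ} (hr : 0 < r) (hs : 0 < s) : 0 ≤ 1 - Real.exp (-(r * s)) := by
  have : Real.exp (-(r * s)) ≤ 1 := Real.exp_le_one_iff.2 (by nlinarith)
  linarith

theorem one_sub_exp_le (r s : ℝ) : 1 - Real.exp (-(r * s)) ≤ r * s := by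
  linarith [Real.add_one_le_exp (-(r * s))]

theorem integrableOn_rpow_mul_one_sub_exp {a r : ℝ} (ha : 0 < a) (ha1 : a < 1) (hr : 0 < r) :
    IntegrableOn (fun s : ℝ => s ^ (-a - 1) * (1 - Real.exp (-(r * s)))) (Set.Ioi 0) := by
  have hm : Measurable (fun s : ℝ => s ^ (-a - 1) * (1 - Real.exp (-(r * s)))) := by fun_prop
  rw [← Set.Ioo_union_Ici_eq_Ioi one_pos, integrableOn_union, integrableOn_Ici_iff_integrableOn_Ioi]
  constructor
  · refine Integrable.mono' (((intervalIntegral.integrableOn_Ioo_rpow_iff one_pos).2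
      (show -1 < -a by linarith)).const_mul r) hm.aestronglyMeasurable ?_
    refine (ae_restrict_iff' measurableSet_Ioo).2 (Eventually.of_forall fun s hs => ?_)
    have h0 := one_sub_exp_nonneg hr hs.1
    have hs0 : 0 < s := hs.1
    rw [Real.norm_of_nonneg (by positivity)]
    have h1 : s ^ (-a) = s ^ (-a - 1) * s := by
      rw [← Real.rpow_add_one hs0.ne']; congr 1; ring
    rw [h1]
    have := mul_le_mul_of_nonneg_left (one_sub_exp_le r s) (by positivity : 0 ≤ s ^ (-a - 1))
    linarith
  · refine Integrable.mono' (integrableOn_Ioi_rpow_of_lt (show -a - 1 < -1 by linarith) one_pos)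
      hm.aestronglyMeasurable ?_
    refine (ae_restrict_iff' measurableSet_Ioi).2 (Eventually.of_forall fun s hs => ?_)
    have hs0 : 0 < s := one_pos.trans hs
    have h0 := one_sub_exp_nonneg hr hs0
    rw [Real.norm_of_nonneg (by positivity)]
    exact mul_le_of_le_one_right (by positivity) (by linarith [Real.exp_pos (-(r * s))])

/-- Integration by parts against the primitive -a⁻¹ s^{-a} turns this into a Gamma integral. The
boundary terms vanish at 0 because 1 - e^{-rs} ≤ rs and a < 1, and at infinity because a > 0. -/
theorem integral_rpow_mul_one_sub_exp {a r : ℝ} (ha : 0 < a) (ha1 : a < 1) (hr : 0 < r) :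
    ∫ s in Set.Ioi (0 : ℝ), s ^ (-a - 1) * (1 - Real.exp (-(r * s))) =
      a⁻¹ * r ^ a * Real.Gamma (1 - a) := by
  have h := integral_Ioi_mul_deriv_eq_deriv_mul (a := (0 : ℝ)) (a' := (0 : ℝ)) (b' := (0 : ℝ))
    (u := fun s => 1 - Real.exp (-(r * s))) (u' := fun s => r * Real.exp (-(r * s)))
    (v := fun s => -a⁻¹ * s ^ (-a)) (v' := fun s => s ^ (-a - 1)) ?_ ?_ ?_ ?_ ?_ ?_
  · have h1 := integral_rpow_mul_exp (a := 1 - a) (by linarith) hr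
    have e : ∫ s in Set.Ioi (0 : ℝ), r * Real.exp (-(r * s)) * (-a⁻¹ * s ^ (-a)) =
        -(a⁻¹ * r) * ∫ s in Set.Ioi (0 : ℝ), s ^ (1 - a - 1) * Real.exp (-(r * s)) := by
      rw [← integral_const_mul]
      congr 1
      ext s
      rw [show 1 - a - 1 = -a by ring]
      ring
    rw [e, h1] at h
    have e2 : r ^ a = r * r ^ (-(1 - a)) := by
      nth_rw 2 [← Real.rpow_one r]
      rw [← Real.rpow_add hr]; congr 1; ring
    simp_rw [mul_comm (_ ^ (-a - 1))]
    rw [h, e2]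
    ring
  · intro s _
    have h1 : HasDerivAt (fun s : ℝ => -(r * s)) (-r) s := by
      exact (((hasDerivAt_id s).const_mul r).neg).congr_deriv (by simp)
    have h2 := (h1.exp).const_sub 1
    exact h2.congr_deriv (by ring)
  · intro s hs
    have h1 := (Real.hasDerivAt_rpow_const (x := s) (p := -a) (Or.inl (ne_of_gt hs))).const_mul
      (-a⁻¹)
    exact h1.congr_deriv (by field_simp)
  · refine (integrableOn_rpow_mul_one_sub_exp ha ha1 hr).congr (Eventually.of_forall fun s => ?_)
    simp only [Pi.mul_apply]
    ring
  · refine ((integrableOn_rpow_mul_exp (a := 1 - a) (by linarith) hr).const_mul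
      (-(a⁻¹ * r))).congr (Eventually.of_forall fun s => ?_)
    simp only [Pi.mul_apply]
    rw [show 1 - a - 1 = -a by ring]
    ring
  · have hlim : Tendsto (fun s : ℝ => a⁻¹ * r * s ^ (1 - a)) (𝓝[>] 0) (𝓝 0) := by
      have : ContinuousAt (fun s : ℝ => a⁻¹ * r * s ^ (1 - a)) 0 :=
        (Real.continuousAt_rpow_const 0 (1 - a) (Or.inr (by linarith))).const_mul _
      have h0 := this.tendsto
      rw [Real.zero_rpow (by linarith), mul_zero] at h0
      exact h0.mono_left nhdsWithin_le_nhds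
    refine squeeze_zero_norm' ?_ hlim
    filter_upwards [self_mem_nhdsWithin] with s hs
    have hs0 : 0 < s := hs
    have h0 := one_sub_exp_nonneg hr hs0
    have h1 : s ^ (1 - a) = s * s ^ (-a) := by
      nth_rw 2 [← Real.rpow_one s]
      rw [← Real.rpow_add hs0]; congr 1
    rw [Pi.mul_apply, norm_mul, norm_mul, Real.norm_of_nonneg h0, norm_neg,
      Real.norm_of_nonneg (by positivity : 0 ≤ a⁻¹),
      Real.norm_of_nonneg (by positivity : 0 ≤ s ^ (-a)), h1]
    have := mul_le_mul_of_nonneg_right (one_sub_exp_le r s)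
      (by positivity : 0 ≤ a⁻¹ * s ^ (-a))
    nlinarith
  · have hlim : Tendsto (fun s : ℝ => a⁻¹ * s ^ (-a)) atTop (𝓝 0) := by
      have := (tendsto_rpow_neg_atTop ha).const_mul a⁻¹
      rwa [mul_zero] at this
    refine squeeze_zero_norm' ?_ hlim
    filter_upwards [eventually_gt_atTop 0] with s hs0
    have h0 := one_sub_exp_nonneg hr hs0
    rw [Pi.mul_apply, norm_mul, norm_mul, Real.norm_of_nonneg h0, norm_neg,
      Real.norm_of_nonneg (by positivity : 0 ≤ a⁻¹),
      Real.norm_of_nonneg (by positivity : 0 ≤ s ^ (-a))]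
    exact mul_le_of_le_one_left (by positivity) (by linarith [Real.exp_pos (-(r * s))])

/-- This is the property that the normalisation 𝒜(d, α) is designed for. The Lévy kernel is a
superposition of Gaussians, each Gaussian average of 1 - cos is explicit, and after t ↦ 1/t the
remaining integral over the widths is the one of `integral_rpow_mul_one_sub_exp` with a = α/2. -/
theorem constA_mul_integral_one_sub_cos (hd : 0 < d) {α : ℝ} (hα : 0 < α) (hα' : α < 2)
    (ξ : Eu d) :
    constA d α * ∫ z, (1 - Real.cos (2 * Real.pi * inner ℝ z ξ)) * levy α z =
      (2 * Real.pi * ‖ξ‖) ^ α := by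
  by_cases hξ : ξ = 0
  · simp [hξ, Real.zero_rpow hα.ne']
  have hn : 0 < ‖ξ‖ := norm_pos_iff.2 hξ
  have hp := Real.pi_pos
  have hd0 : (0 : ℝ) < d := Nat.cast_pos.2 hd
  have e1 : 2 * (((d : ℝ) + α) / 2) = d + α := by ring
  have A := integral_superposition (d := d) (k := fun t x => t ^ (((d : ℝ) + α) / 2 - 1) *
      Real.exp (-(Real.pi * ‖x‖ ^ 2 * t)))
      (m := fun x => Real.pi ^ (-(((d : ℝ) + α) / 2)) * Real.Gamma (((d : ℝ) + α) / 2) *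
        ‖x‖ ^ (-(2 * (((d : ℝ) + α) / 2))))
      (h := fun z => 1 - Real.cos (2 * Real.pi * inner ℝ z ξ))
      (by unfold Function.uncurry; fun_prop) (fun t x ht => by positivity)
      (gaussian_superposition hd (by linarith))
      (by fun_prop : Measurable fun z : Eu d =>
        1 - Real.cos (2 * Real.pi * inner ℝ z ξ)).aestronglyMeasurable
      (by
        refine ((integrable_one_sub_cos_mul_levy hd hα hα' ξ).const_mul
          (Real.pi ^ (-(((d : ℝ) + α) / 2)) * Real.Gamma (((d : ℝ) + α) / 2))).congr
          (Eventually.of_forall fun x => ?_)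
        simp only [levy, e1, smul_eq_mul]
        ring)
  have B : ∫ x : Eu d, (Real.pi ^ (-(((d : ℝ) + α) / 2)) * Real.Gamma (((d : ℝ) + α) / 2) *
        ‖x‖ ^ (-(2 * (((d : ℝ) + α) / 2)))) • (1 - Real.cos (2 * Real.pi * inner ℝ x ξ)) =
      (Real.pi ^ (-(((d : ℝ) + α) / 2)) * Real.Gamma (((d : ℝ) + α) / 2)) *
        ∫ z, (1 - Real.cos (2 * Real.pi * inner ℝ z ξ)) * levy α z := by
    rw [← integral_const_mul]
    congr 1
    ext x
    simp only [levy, e1, smul_eq_mul]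
    ring
  have C : ∫ t in Set.Ioi (0 : ℝ), ∫ x : Eu d, (t ^ (((d : ℝ) + α) / 2 - 1) *
      Real.exp (-(Real.pi * ‖x‖ ^ 2 * t))) • (1 - Real.cos (2 * Real.pi * inner ℝ x ξ)) =
      ∫ t in Set.Ioi (0 : ℝ), t ^ (-(-(α / 2)) - 1) *
        (fun s => 1 - Real.exp (-(Real.pi * ‖ξ‖ ^ 2 * s))) (1 / t) := by
    refine setIntegral_congr_fun measurableSet_Ioi fun t ht => ?_
    have ht0 : 0 < t := ht
    have hi := integrable_gaussian (d := d) ht0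
    have hic : Integrable fun z : Eu d => Real.cos (2 * Real.pi * inner ℝ z ξ) *
        Real.exp (-(Real.pi * ‖z‖ ^ 2 * t)) :=
      hi.bdd_mul (c := 1) (by fun_prop : Measurable fun z : Eu d =>
        Real.cos (2 * Real.pi * inner ℝ z ξ)).aestronglyMeasurable
        (Eventually.of_forall fun z => Real.abs_cos_le_one _)
    have e3 : ∀ x : Eu d, (t ^ (((d : ℝ) + α) / 2 - 1) *
        Real.exp (-(Real.pi * ‖x‖ ^ 2 * t))) • (1 - Real.cos (2 * Real.pi * inner ℝ x ξ)) =
        t ^ (((d : ℝ) + α) / 2 - 1) * (Real.exp (-(Real.pi * ‖x‖ ^ 2 * t)) -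
          Real.cos (2 * Real.pi * inner ℝ x ξ) * Real.exp (-(Real.pi * ‖x‖ ^ 2 * t))) := by
      intro x
      rw [smul_eq_mul]
      ring
    simp only [e3]
    rw [integral_const_mul, integral_sub hi hic, integral_gaussian ht0,
      integral_cos_mul_gaussian ht0, ← mul_one_sub, ← mul_assoc, ← Real.rpow_add ht0]
    congr 2
    ring
  rw [B, C, integral_rpow_comp_inv (-(α / 2)) (fun s => 1 - Real.exp (-(Real.pi * ‖ξ‖ ^ 2 * s))),
    integral_rpow_mul_one_sub_exp (by linarith) (by linarith) (by positivity)] at A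
  have g1 := Real.Gamma_pos_of_pos (show 0 < ((d : ℝ) + α) / 2 by linarith)
  have g2 := Real.Gamma_pos_of_pos (show 0 < 1 - α / 2 by linarith)
  have hJ : ∫ z, (1 - Real.cos (2 * Real.pi * inner ℝ z ξ)) * levy α z =
      (Real.pi ^ (((d : ℝ) + α) / 2) * ((α / 2)⁻¹ * (Real.pi * ‖ξ‖ ^ 2) ^ (α / 2) *
        Real.Gamma (1 - α / 2))) / Real.Gamma (((d : ℝ) + α) / 2) := by
    rw [← A, Real.rpow_neg hp.le]
    field_simp
  have e4 : (Real.pi * ‖ξ‖ ^ 2) ^ (α / 2) = Real.pi ^ (α / 2) * ‖ξ‖ ^ α := by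
    rw [Real.mul_rpow hp.le (by positivity), ← Real.rpow_natCast, ← Real.rpow_mul hn.le]
    congr 2
    push_cast
    ring
  have e5 : Real.pi ^ (((d : ℝ) + α) / 2) = Real.pi ^ ((d : ℝ) / 2) * Real.pi ^ (α / 2) := by
    rw [← Real.rpow_add hp]; congr 1; ring
  have e6 : Real.pi ^ α = Real.pi ^ (α / 2) * Real.pi ^ (α / 2) := by
    rw [← Real.rpow_add hp]; congr 1; ring
  have e7 : (2 : ℝ) ^ (1 - α) = 2 / 2 ^ α := by
    rw [Real.rpow_sub two_pos, Real.rpow_one]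
  rw [hJ, constA, e4, e5, e7, Real.mul_rpow (by positivity) hn.le, Real.mul_rpow two_pos.le hp.le,
    e6]
  generalize Real.Gamma (1 - α / 2) = G at *
  field_simp

/-! ### The fractional Laplacian of a power: scaling and value -/

theorem exists_linearIsometryEquiv {e e' : Eu d} (h : ‖e‖ = ‖e'‖) :
    ∃ R : Eu d ≃ₗᵢ[ℝ] Eu d, R e = e' :=
  ⟨_, Submodule.reflection_sub h⟩

/-- A reflection carries `e` to `e'` and preserves Lebesgue measure, the ball and the Lévy kernel.
-/
theorem truncLap_eq_of_norm_eq (α β : ℝ) {e e' : Eu d} (h : ‖e‖ = ‖e'‖) (s : ℝ) :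
    truncLap α β e s = truncLap α β e' s := by
  obtain ⟨R, hR⟩ := exists_linearIsometryEquiv h.symm
  rw [truncLap, truncLap, ← integral_indicator Metric.isOpen_ball.measurableSet.compl,
    ← integral_indicator Metric.isOpen_ball.measurableSet.compl,
    ← R.measurePreserving.integral_comp R.toHomeomorph.measurableEmbedding]
  congr 1
  ext z
  simp only [Set.indicator, Set.mem_compl_iff, mem_ball_zero_iff, R.norm_map, firstDiff, levy]
  rw [← hR, ← map_add, R.norm_map]

/-- Homogeneity: z ↦ ‖x‖ z reduces to the unit vector x/‖x‖, rotation invariance moves it to `e`,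
and the truncation radius becomes `s / ‖x‖`. -/
theorem integral_weight_sub_mul_levy (α β : ℝ) {e : Eu d} (he : ‖e‖ = 1) {x : Eu d}
    (hx : x ≠ 0) (s : ℝ) :
    ∫ z in (Metric.ball 0 s)ᶜ, (‖x‖ ^ (-β) - ‖x + z‖ ^ (-β)) * levy α z =
      ‖x‖ ^ (-(α + β)) * truncLap α β e (s / ‖x‖) := by
  have hn : 0 < ‖x‖ := norm_pos_iff.2 hx
  set r := ‖x‖ with hr
  set y : Eu d := r⁻¹ • x with hy
  have hy1 : ‖y‖ = 1 := by
    rw [hy, norm_smul, norm_inv, norm_norm, inv_mul_cancel₀ hn.ne']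
  have hxy : x = r • y := by rw [hy, smul_inv_smul₀ hn.ne']
  have hset : r • (Metric.ball (0 : Eu d) (s / r))ᶜ = (Metric.ball 0 s)ᶜ := by
    ext z
    rw [Set.mem_smul_set_iff_inv_smul_mem₀ hn.ne', Set.mem_compl_iff, Set.mem_compl_iff,
      mem_ball_zero_iff, mem_ball_zero_iff, norm_smul, norm_inv, Real.norm_of_nonneg hn.le,
      inv_mul_eq_div, div_lt_div_iff_of_pos_right hn]
  have h := Measure.setIntegral_comp_smul_of_pos (volume : Measure (Eu d))
    (fun z => (r ^ (-β) - ‖x + z‖ ^ (-β)) * levy α z) (Metric.ball 0 (s / r))ᶜ hn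
  rw [hset, finrank_euclideanSpace_fin] at h
  have h2 : ∀ z : Eu d, (r ^ (-β) - ‖x + r • z‖ ^ (-β)) * levy α (r • z) =
      r ^ (-β) * r ^ (-((d : ℝ) + α)) * firstDiff α β y z := by
    intro z
    rw [hxy, ← smul_add, levy, norm_smul, norm_smul, Real.norm_of_nonneg hn.le,
      Real.mul_rpow hn.le (norm_nonneg _), Real.mul_rpow hn.le (norm_nonneg _), firstDiff, levy]
    ring
  simp only [h2] at h
  rw [integral_const_mul, smul_eq_mul] at h
  have h3 : ∫ z in (Metric.ball 0 s)ᶜ, (r ^ (-β) - ‖x + z‖ ^ (-β)) * levy α z =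
      r ^ d * (r ^ (-β) * r ^ (-((d : ℝ) + α)) * truncLap α β y (s / r)) := by
    rw [truncLap, h, mul_inv_cancel_left₀ (pow_pos hn d).ne']
  rw [h3, truncLap_eq_of_norm_eq α β (hy1.trans he.symm), ← mul_assoc, ← mul_assoc,
    ← Real.rpow_natCast, ← Real.rpow_add hn, ← Real.rpow_add hn]
  congr 2
  ring

/-- The Gaussian `exp (-π |x|²)`. -/
def gauss (x : Eu d) : ℝ := Real.exp (-(Real.pi * ‖x‖ ^ 2))

theorem gauss_pos (x : Eu d) : 0 < gauss x := Real.exp_pos _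

theorem continuous_gauss : Continuous (gauss : Eu d → ℝ) := by unfold gauss; fun_prop

theorem gauss_le_one (x : Eu d) : gauss x ≤ 1 :=
  Real.exp_le_one_iff.2 (neg_nonpos.2 (by positivity))

theorem integrable_gauss : Integrable (gauss : Eu d → ℝ) := by
  simpa [gauss] using! integrable_gaussian (d := d) one_pos

theorem integrable_rpow_mul_gauss (hd : 0 < d) {s : ℝ} (hs : 0 ≤ s) (hsd : s < d) (e : Eu d) :
    Integrable fun x => ‖e + x‖ ^ (-s) * gauss x :=
  integrable_rpow_smul_of_bounded hd hs hsd e integrable_gauss (C := 1) fun x => by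
    rw [Real.norm_of_nonneg (gauss_pos x).le]; exact gauss_le_one x

theorem integrable_rpow_mul_gauss' (hd : 0 < d) {s : ℝ} (hs : 0 ≤ s) (hsd : s < d) :
    Integrable fun x : Eu d => ‖x‖ ^ (-s) * gauss x := by
  simpa using integrable_rpow_mul_gauss hd hs hsd (0 : Eu d)

/-- The transform of a modulated Gaussian is a translated Gaussian. The transform formula for
|x|^{-β} is applied to it and real parts are taken. -/
theorem integral_norm_add_rpow_mul_gauss (hd : 0 < d) {β : ℝ} (hβ : 0 < β) (hβd : β < d)
    (z : Eu d) :
    ∫ x, ‖x + z‖ ^ (-β) * gauss x = rieszConst d β *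
      ∫ ξ, ‖ξ‖ ^ (-(d - β)) * (Real.cos (2 * Real.pi * inner ℝ z ξ) * gauss ξ) := by
  have hp := Real.pi_pos
  have hb : 0 < ((Real.pi : ℝ) : ℂ).re := by rw [Complex.ofReal_re]; positivity
  set ψ : Eu d → ℂ := fun v => Complex.exp (-(Real.pi : ℂ) * ‖v‖ ^ 2 +
    2 * Real.pi * Complex.I * ((inner ℝ z v : ℝ) : ℂ)) with hψ
  have hψi : Integrable ψ :=
    GaussianFourier.integrable_cexp_neg_mul_sq_norm_add hb (2 * Real.pi * Complex.I) z
  have hψre : ∀ v, (ψ v).re = Real.cos (2 * Real.pi * inner ℝ z v) * gauss v := by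
    intro v
    have e1 : (-(Real.pi : ℂ) * ‖v‖ ^ 2 + 2 * Real.pi * Complex.I * ((inner ℝ z v : ℝ) : ℂ)) =
        ((-(Real.pi * ‖v‖ ^ 2) : ℝ) : ℂ) +
          ((2 * Real.pi * inner ℝ z v : ℝ) : ℂ) * Complex.I := by
      push_cast
      ring
    rw [hψ]
    simp only [e1]
    rw [Complex.exp_re, gauss]
    simp only [Complex.add_re, Complex.add_im, Complex.ofReal_re, Complex.ofReal_im,
      Complex.re_ofReal_mul, Complex.im_ofReal_mul, Complex.I_re, Complex.I_im, mul_zero,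
      add_zero, zero_add, mul_one]
    ring
  have hψn : ∀ v, ‖ψ v‖ = gauss v := by
    intro v
    have e1 : (-(Real.pi : ℂ) * ‖v‖ ^ 2 + 2 * Real.pi * Complex.I * ((inner ℝ z v : ℝ) : ℂ)) =
        ((-(Real.pi * ‖v‖ ^ 2) : ℝ) : ℂ) +
          ((2 * Real.pi * inner ℝ z v : ℝ) : ℂ) * Complex.I := by
      push_cast
      ring
    rw [hψ]
    simp only [e1]
    rw [Complex.norm_exp, gauss]
    congr 1
    rw [Complex.add_re, Complex.ofReal_re, Complex.re_ofReal_mul, Complex.I_re, mul_zero, add_zero]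
  have hF : 𝓕 ψ = fun w => ((gauss (-z + w) : ℝ) : ℂ) := by
    ext w
    rw [hψ, fourier_gaussian_innerProductSpace' hb, div_self (by exact_mod_cast hp.ne'),
      Complex.one_cpow, one_mul, gauss, Complex.ofReal_exp]
    congr 1
    have : (Real.pi : ℂ) ≠ 0 := by exact_mod_cast hp.ne'
    have e2 : ‖z - w‖ = ‖-z + w‖ := by rw [← norm_neg]; congr 1; abel
    rw [e2]
    push_cast
    field_simp
  have h1 : Integrable fun x => ‖x‖ ^ (-β) • 𝓕 ψ x := by
    rw [hF]
    refine (integrable_rpow_smul_of_bounded hd hβ.le hβd 0 (f := fun x => (gauss (-z + x) : ℂ))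
      (integrable_gauss.comp_add_left (-z)).ofReal (C := 1) (fun x => ?_)).congr ?_
    · rw [Complex.norm_real, Real.norm_of_nonneg (gauss_pos _).le]; exact gauss_le_one _
    · exact Eventually.of_forall fun x => by simp
  have h2 : Integrable fun ξ => ‖ξ‖ ^ (-(d - β)) • ψ ξ := by
    simpa using integrable_rpow_smul_of_bounded hd (s := d - β) (by linarith) (by linarith) 0 hψi
      (C := 1) (fun x => by rw [hψn]; exact gauss_le_one x)
  have h := congrArg Complex.re (integral_rpow_mul_fourier hd hβ hβd hψi h1 h2)
  have r1 := integral_re h1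
  have r2 := integral_re h2
  simp only [RCLike.re_to_complex] at r1 r2
  rw [Complex.smul_re, ← r1, ← r2] at h
  simp only [Complex.smul_re, hψre, hF, Complex.ofReal_re, smul_eq_mul] at h
  rw [← h, ← integral_add_left_eq_self (fun x => ‖x‖ ^ (-β) * gauss (-z + x)) z]
  congr 1
  ext x
  rw [neg_add_cancel_left, add_comm x z]

theorem integral_rpow_mul_gauss (hd : 0 < d) {β : ℝ} (hβ : 0 < β) (hβd : β < d) :
    ∫ x : Eu d, ‖x‖ ^ (-β) * gauss x = rieszConst d β *
      ∫ ξ : Eu d, ‖ξ‖ ^ (-(d - β)) * gauss ξ := by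
  simpa using integral_norm_add_rpow_mul_gauss hd hβ hβd (0 : Eu d)

theorem integral_rpow_sub_mul_gauss (hd : 0 < d) {β : ℝ} (hβ : 0 < β) (hβd : β < d) (z : Eu d) :
    ∫ x, (‖x‖ ^ (-β) - ‖x + z‖ ^ (-β)) * gauss x = rieszConst d β *
      ∫ ξ, ‖ξ‖ ^ (-(d - β)) * ((1 - Real.cos (2 * Real.pi * inner ℝ z ξ)) * gauss ξ) := by
  have i1 := integrable_rpow_mul_gauss' hd hβ.le hβd
  have i2 := integrable_rpow_mul_gauss hd hβ.le hβd z
  have i3 := integrable_rpow_mul_gauss' (s := d - β) hd (by linarith) (by linarith)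
  have i4 : Integrable fun ξ : Eu d =>
      ‖ξ‖ ^ (-(d - β)) * (Real.cos (2 * Real.pi * inner ℝ z ξ) * gauss ξ) := by
    refine (i3.bdd_mul (c := 1) (f := fun ξ : Eu d => Real.cos (2 * Real.pi * inner ℝ z ξ))
      (by fun_prop : Measurable fun ξ : Eu d =>
        Real.cos (2 * Real.pi * inner ℝ z ξ)).aestronglyMeasurable
      (Eventually.of_forall fun z => Real.abs_cos_le_one _)).congr
      (Eventually.of_forall fun ξ => ?_)
    simp only
    ring
  simp only [sub_mul, mul_sub, one_mul]
  simp only [add_comm z] at i2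
  rw [integral_sub i1 i2, integral_sub i3 i4, mul_sub, integral_rpow_mul_gauss hd hβ hβd,
    integral_norm_add_rpow_mul_gauss hd hβ hβd]

/-- Tonelli: integrating in `z` first produces the symbol (2π|ξ|)^α by
`constA_mul_integral_one_sub_cos`, which raises the power of |ξ| by α. The same evaluation proves
integrability on the product. -/
theorem integral_levy_mul_integral_one_sub_cos (hd : 0 < d) {α β : ℝ} (hα : 0 < α) (hα' : α < 2)
    (hβ : 0 < β) (hβd : α + β < d) :
    Integrable (fun z : Eu d => levy α z * ∫ ξ : Eu d, ‖ξ‖ ^ (-(d - β)) *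
      ((1 - Real.cos (2 * Real.pi * inner ℝ z ξ)) * gauss ξ)) ∧
    constA d α * ∫ z : Eu d, levy α z * ∫ ξ : Eu d, ‖ξ‖ ^ (-(d - β)) *
      ((1 - Real.cos (2 * Real.pi * inner ℝ z ξ)) * gauss ξ) =
      (2 * Real.pi) ^ α * ∫ ξ : Eu d, ‖ξ‖ ^ (-(d - α - β)) * gauss ξ := by
  have hA := constA_pos hd hα hα'
  set J : Eu d → ℝ := fun ξ => ∫ z, (1 - Real.cos (2 * Real.pi * inner ℝ z ξ)) * levy α z with hJ
  have hJv : ∀ ξ, J ξ = (2 * Real.pi * ‖ξ‖) ^ α / constA d α := fun ξ => by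
    rw [← constA_mul_integral_one_sub_cos hd hα hα', mul_div_cancel_left₀ _ hA.ne']
  set G : Eu d → Eu d → ℝ := fun z ξ => levy α z * (‖ξ‖ ^ (-(d - β)) *
      ((1 - Real.cos (2 * Real.pi * inner ℝ z ξ)) * gauss ξ)) with hG
  have hG0 : ∀ z ξ, 0 ≤ G z ξ := fun z ξ => by
    have h1 := Real.cos_le_one (2 * Real.pi * inner ℝ z ξ)
    have h2 := levy_nonneg α z
    have h3 := (gauss_pos ξ).le
    have h4 : 0 ≤ 1 - Real.cos (2 * Real.pi * inner ℝ z ξ) := by linarith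
    rw [hG]
    positivity
  have hGz : ∀ ξ, ∫ z, G z ξ = ‖ξ‖ ^ (-(d - β)) * gauss ξ * J ξ := fun ξ => by
    rw [hJ, ← integral_const_mul]
    congr 1
    ext z
    rw [hG]
    ring
  have hval : ∀ ξ : Eu d, ξ ≠ 0 → ‖ξ‖ ^ (-(d - β)) * gauss ξ * J ξ =
      (2 * Real.pi) ^ α / constA d α * (‖ξ‖ ^ (-(d - α - β)) * gauss ξ) := fun ξ hξ => by
    have hn : 0 < ‖ξ‖ := norm_pos_iff.2 hξ
    have e2 : -((d : ℝ) - α - β) = -(d - β) + α := by ring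
    have hp := Real.pi_pos
    rw [hJv, e2, Real.rpow_add hn, Real.mul_rpow (by positivity) hn.le]
    ring
  have hm : Measurable (Function.uncurry G) := by
    have h1 : Measurable fun p : Eu d × Eu d => levy α p.1 := (measurable_levy α).comp measurable_fst
    have h2 : Measurable fun p : Eu d × Eu d => gauss p.2 :=
      continuous_gauss.measurable.comp measurable_snd
    have h3 : Measurable fun p : Eu d × Eu d => ‖p.2‖ ^ (-(d - β)) := by fun_prop
    have h4 : Measurable fun p : Eu d × Eu d => 1 - Real.cos (2 * Real.pi * inner ℝ p.1 p.2) := by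
      fun_prop
    exact h1.mul (h3.mul (h4.mul h2))
  have hint : Integrable (Function.uncurry G) (volume.prod volume) := by
    rw [integrable_prod_iff' hm.aestronglyMeasurable]
    refine ⟨Eventually.of_forall fun ξ => ?_, ?_⟩
    · refine ((integrable_one_sub_cos_mul_levy hd hα hα' ξ).const_mul
        (‖ξ‖ ^ (-(d - β)) * gauss ξ)).congr (Eventually.of_forall fun z => ?_)
      simp only [Function.uncurry_apply_pair, hG]
      ring
    · refine ((integrable_rpow_mul_gauss' hd (s := d - α - β) (by linarith)
        (by linarith)).const_mul ((2 * Real.pi) ^ α / constA d α)).congr ?_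
      filter_upwards [ae_ne_zero hd] with ξ hξ
      simp only [Function.uncurry_apply_pair]
      rw [← hval ξ hξ, ← hGz]
      congr 1
      ext z
      rw [Real.norm_of_nonneg (hG0 z ξ)]
  have hz : ∀ z, ∫ ξ, G z ξ = levy α z * ∫ ξ : Eu d, ‖ξ‖ ^ (-(d - β)) *
      ((1 - Real.cos (2 * Real.pi * inner ℝ z ξ)) * gauss ξ) := fun z => by
    rw [← integral_const_mul]
  refine ⟨?_, ?_⟩
  · refine hint.integral_prod_left.congr (Eventually.of_forall fun z => ?_)
    exact hz z
  · simp only [← hz]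
    rw [integral_integral_swap hint]
    simp only [hGz]
    rw [integral_congr_ae ((ae_ne_zero hd).mono hval), integral_const_mul]
    field_simp

/-- Fubini for the truncated fractional Laplacian of a power tested against a Gaussian. -/
theorem integral_gauss_mul_truncLap (hd : 0 < d) {α β : ℝ} (hα : 0 < α)
    (hβ : 0 < β) (hβd : β < d) {e : Eu d} (he : ‖e‖ = 1) {s : ℝ} (hs : 0 < s) :
    ∫ z in (Metric.ball (0 : Eu d) s)ᶜ, levy α z *
        ∫ x, (‖x‖ ^ (-β) - ‖x + z‖ ^ (-β)) * gauss x =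
      ∫ x : Eu d, ‖x‖ ^ (-(α + β)) * gauss x * truncLap α β e (s / ‖x‖) := by
  set G : Eu d → Eu d → ℝ := fun z x =>
    levy α z * ((‖x‖ ^ (-β) - ‖x + z‖ ^ (-β)) * gauss x) with hG
  have i1 := integrable_rpow_mul_gauss' hd hβ.le hβd
  have i2 : ∀ z : Eu d, Integrable fun x => ‖x + z‖ ^ (-β) * gauss x := fun z => by
    simpa only [add_comm z] using integrable_rpow_mul_gauss hd hβ.le hβd z
  have hm : Measurable (Function.uncurry G) := by
    have h1 : Measurable fun p : Eu d × Eu d => levy α p.1 := (measurable_levy α).comp measurable_fst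
    have h2 : Measurable fun p : Eu d × Eu d => gauss p.2 :=
      continuous_gauss.measurable.comp measurable_snd
    have h3 : Measurable fun p : Eu d × Eu d => ‖p.2‖ ^ (-β) - ‖p.2 + p.1‖ ^ (-β) := by fun_prop
    exact h1.mul (h3.mul h2)
  set T0 : ℝ := ∫ x : Eu d, ‖x‖ ^ (-β) * gauss x with hT0
  -- On the Fourier side a translation only inserts a cosine, and cos ≤ 1 makes the Gaussian average
  -- of |x + z|^{-β} largest at z = 0. This bound, uniform in `z`, justifies Fubini.
  have hT : ∀ z : Eu d, ∫ x, ‖x + z‖ ^ (-β) * gauss x ≤ T0 := by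
    intro z
    have h := integral_rpow_sub_mul_gauss hd hβ hβd z
    simp only [sub_mul] at h
    rw [integral_sub i1 (i2 z)] at h
    have h5 : 0 ≤ rieszConst d β * ∫ ξ : Eu d, ‖ξ‖ ^ (-(d - β)) *
        (1 * gauss ξ - Real.cos (2 * Real.pi * inner ℝ z ξ) * gauss ξ) := by
      refine mul_nonneg (rieszConst_pos hβ hβd).le (integral_nonneg fun ξ => ?_)
      have h1 := Real.cos_le_one (2 * Real.pi * inner ℝ z ξ)
      have h3 := (gauss_pos ξ).le
      refine mul_nonneg (by positivity) ?_
      nlinarith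
    linarith
  have hint : Integrable (Function.uncurry G)
      ((volume.restrict (Metric.ball (0 : Eu d) s)ᶜ).prod volume) := by
    rw [integrable_prod_iff hm.aestronglyMeasurable]
    refine ⟨Eventually.of_forall fun z => ?_, ?_⟩
    · refine ((i1.sub (i2 z)).const_mul (levy α z)).congr (Eventually.of_forall fun x => ?_)
      simp only [Function.uncurry_apply_pair, hG, Pi.sub_apply]
      ring
    · refine Integrable.mono' ((integrableOn_levy hα hs).mul_const (T0 + T0))
        hm.aestronglyMeasurable.norm.integral_prod_right' (Eventually.of_forall fun z => ?_)
      rw [Real.norm_of_nonneg (integral_nonneg fun x => norm_nonneg _)]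
      simp only [Function.uncurry_apply_pair, hG, norm_mul, Real.norm_of_nonneg (levy_nonneg α z)]
      rw [integral_const_mul]
      refine mul_le_mul_of_nonneg_left ?_ (levy_nonneg α z)
      calc ∫ x, ‖‖x‖ ^ (-β) - ‖x + z‖ ^ (-β)‖ * ‖gauss x‖ ≤
            ∫ x, (‖x‖ ^ (-β) * gauss x + ‖x + z‖ ^ (-β) * gauss x) := by
            refine integral_mono_of_nonneg (Eventually.of_forall fun x => by positivity)
              (i1.add (i2 z)) (Eventually.of_forall fun x => ?_)
            simp only [Real.norm_of_nonneg (gauss_pos x).le, ← add_mul]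
            refine mul_le_mul_of_nonneg_right ?_ (gauss_pos x).le
            refine (norm_sub_le _ _).trans ?_
            rw [Real.norm_of_nonneg (by positivity), Real.norm_of_nonneg (by positivity)]
        _ = T0 + ∫ x, ‖x + z‖ ^ (-β) * gauss x := integral_add i1 (i2 z)
        _ ≤ T0 + T0 := by linarith [hT z]
  have hz : ∀ z, ∫ x, G z x = levy α z * ∫ x, (‖x‖ ^ (-β) - ‖x + z‖ ^ (-β)) * gauss x :=
    fun z => by rw [← integral_const_mul]
  simp only [← hz]
  rw [integral_integral_swap hint]
  refine integral_congr_ae ?_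
  filter_upwards [ae_ne_zero hd] with x hx
  rw [mul_right_comm, ← integral_weight_sub_mul_levy α β he hx, mul_comm, ← integral_const_mul]
  congr 1
  ext z
  rw [hG]
  ring

/-- The truncated Laplacian of |x|^{-β} is integrated against a Gaussian. As the truncation radius
tends to 0, one side tends to `limLap` times ∫ |x|^{-(α+β)} gauss, while on the Fourier side the
limit is a known multiple of the same integral. That integral is positive and cancels. -/
theorem constA_mul_limLap (hd : 0 < d) {α β : ℝ} (hα : 0 < α) (hα' : α < 2)
    (hβ : 0 < β) (hβd : α + β < d) {e : Eu d} (he : ‖e‖ = 1) :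
    constA d α * limLap α β e = hardyConst d α β := by
  have hβd' : β < d := by linarith
  obtain ⟨hi, hv⟩ := integral_levy_mul_integral_one_sub_cos hd hα hα' hβ hβd
  set H : Eu d → ℝ := fun z => levy α z * ∫ ξ : Eu d, ‖ξ‖ ^ (-(d - β)) *
      ((1 - Real.cos (2 * Real.pi * inner ℝ z ξ)) * gauss ξ) with hH
  set s : ℕ → ℝ := fun n => 1 / ((n : ℝ) + 1) with hs
  have hs0 : ∀ n, 0 < s n := fun n => by positivity
  have hsl : Tendsto s atTop (𝓝 0) := tendsto_one_div_add_atTop_nhds_zero_nat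
  have iI := integrable_rpow_mul_gauss' (d := d) (s := α + β) hd (by linarith) hβd
  have hU : (⋃ n, (Metric.ball (0 : Eu d) (s n))ᶜ) = {0}ᶜ := by
    ext z
    simp only [Set.mem_iUnion, Set.mem_compl_iff, mem_ball_zero_iff, Set.mem_singleton_iff, not_lt]
    constructor
    · rintro ⟨n, hn⟩ rfl
      rw [norm_zero] at hn
      exact absurd (hs0 n) (not_lt.2 hn)
    · intro hz
      obtain ⟨n, hn⟩ := (hsl.eventually (gt_mem_nhds (norm_pos_iff.2 hz))).exists
      exact ⟨n, hn.le⟩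
  have L1 : Tendsto (fun n => ∫ z in (Metric.ball (0 : Eu d) (s n))ᶜ, H z) atTop
      (𝓝 (∫ z, H z)) := by
    have h := tendsto_setIntegral_of_monotone (f := H) (μ := volume)
      (s := fun n => (Metric.ball (0 : Eu d) (s n))ᶜ)
      (fun n => Metric.isOpen_ball.measurableSet.compl) ?_ hi.integrableOn
    · rw [hU] at h
      have : Nonempty (Fin d) := ⟨⟨0, hd⟩⟩
      rwa [restrict_compl_singleton] at h
    · intro m n hmn
      refine Set.compl_subset_compl.2 (Metric.ball_subset_ball ?_)
      exact one_div_le_one_div_of_le (by positivity) (by gcongr)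
  have L2 : Tendsto (fun n => ∫ x : Eu d, ‖x‖ ^ (-(α + β)) * gauss x * truncLap α β e (s n / ‖x‖))
      atTop (𝓝 (∫ x : Eu d, ‖x‖ ^ (-(α + β)) * gauss x * limLap α β e)) := by
    obtain ⟨M, hM0, hM⟩ := exists_abs_truncLap_le hd hα hα' hβ.le hβd' he
    refine tendsto_integral_filter_of_dominated_convergence
      (fun x => ‖x‖ ^ (-(α + β)) * gauss x * M) ?_ ?_ (iI.mul_const M) ?_
    · refine Eventually.of_forall fun n => ?_
      -- Written as a parameter integral, the function x ↦ `truncLap α β e (s n / ‖x‖)` is seen to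
      -- be measurable off the origin.
      have hm : ∀ᵐ x : Eu d, gauss x * ∫ z in (Metric.ball 0 (s n))ᶜ,
          (‖x‖ ^ (-β) - ‖x + z‖ ^ (-β)) * levy α z =
          ‖x‖ ^ (-(α + β)) * gauss x * truncLap α β e (s n / ‖x‖) := by
        filter_upwards [ae_ne_zero hd] with x hx
        rw [integral_weight_sub_mul_levy α β he hx]
        ring
      refine AEStronglyMeasurable.congr ?_ hm
      refine continuous_gauss.aestronglyMeasurable.mul ?_
      have hm2 : Measurable fun p : Eu d × Eu d =>
          (‖p.1‖ ^ (-β) - ‖p.1 + p.2‖ ^ (-β)) * levy α p.2 :=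
        (by fun_prop : Measurable fun p : Eu d × Eu d => ‖p.1‖ ^ (-β) - ‖p.1 + p.2‖ ^ (-β)).mul
          ((measurable_levy α).comp measurable_snd)
      exact (hm2.stronglyMeasurable.integral_prod_right').aestronglyMeasurable
    · refine Eventually.of_forall fun n => ?_
      filter_upwards [ae_ne_zero hd] with x hx
      have hn : 0 < ‖x‖ := norm_pos_iff.2 hx
      have hg := gauss_pos x
      rw [norm_mul, Real.norm_of_nonneg (by positivity), Real.norm_eq_abs]
      exact mul_le_mul_of_nonneg_left (hM _ (by have := hs0 n; positivity)) (by positivity)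
    · filter_upwards [ae_ne_zero hd] with x hx
      have hn : 0 < ‖x‖ := norm_pos_iff.2 hx
      refine Tendsto.const_mul _ (tendsto_truncLap hd hα hα' hβ.le hβd' he
        (fun n => div_pos (hs0 n) hn) ?_)
      simpa using hsl.div_const ‖x‖
  have hEq : ∀ n, ∫ x : Eu d, ‖x‖ ^ (-(α + β)) * gauss x * truncLap α β e (s n / ‖x‖) =
      rieszConst d β * ∫ z in (Metric.ball (0 : Eu d) (s n))ᶜ, H z := by
    intro n
    rw [← integral_gauss_mul_truncLap hd hα hβ hβd' he (hs0 n), ← integral_const_mul]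
    congr 1
    ext z
    rw [integral_rpow_sub_mul_gauss hd hβ hβd', hH]
    ring
  simp only [hEq] at L2
  have hlim := tendsto_nhds_unique L2 (L1.const_mul (rieszConst d β))
  rw [integral_mul_const] at hlim
  have hI := integral_rpow_mul_gauss (d := d) (β := d - α - β) hd (by linarith) (by linarith)
  have e1 : -((d : ℝ) - (d - α - β)) = -(α + β) := by ring
  rw [e1] at hI
  have hpos : 0 < ∫ x : Eu d, ‖x‖ ^ (-(α + β)) * gauss x := by
    rw [integral_pos_iff_support_of_nonneg
      (fun x => mul_nonneg (by positivity) (gauss_pos x).le) iI]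
    have hsub : ({0}ᶜ : Set (Eu d)) ⊆
        Function.support fun x : Eu d => ‖x‖ ^ (-(α + β)) * gauss x := by
      intro x hx0
      have hn : 0 < ‖x‖ := norm_pos_iff.2 hx0
      have := gauss_pos x
      rw [Function.mem_support]
      positivity
    refine lt_of_lt_of_le ?_ (measure_mono hsub)
    have : Nonempty (Fin d) := ⟨⟨0, hd⟩⟩
    rw [measure_compl (measurableSet_singleton _) (by simp), measure_singleton, tsub_zero]
    exact (Metric.measure_ball_pos volume (0 : Eu d) one_pos).trans_le
      (measure_mono (Set.subset_univ _))
  refine mul_left_cancel₀ hpos.ne' ?_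
  calc (∫ x : Eu d, ‖x‖ ^ (-(α + β)) * gauss x) * (constA d α * limLap α β e)
      = constA d α * ((∫ x : Eu d, ‖x‖ ^ (-(α + β)) * gauss x) * limLap α β e) := by ring
    _ = rieszConst d β * (constA d α * ∫ z, H z) := by rw [hlim]; ring
    _ = _ := by rw [hv, hI, hardyConst]; ring

/-! ### Weighted energies with values in `[0, ∞]` -/

/-- The weighted energy, with values in `[0, ∞]`. -/
def wE (α β : ℝ) (f : Eu d → ℝ) : ℝ≥0∞ :=
  ∫⁻ z, ENNReal.ofReal (weightedKernel α β f z) ∂(volume.prod volume)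

theorem weightedKernel_eq (α β : ℝ) (f : Eu d → ℝ) (z : Eu d × Eu d) :
    weightedKernel α β f z =
      (f z.1 - f z.2) ^ 2 * levy α (z.1 - z.2) * weight β z.1 * weight β z.2 := by
  rw [weightedKernel, div_norm_rpow_eq_mul_levy]

theorem weight_zero (x : Eu d) : weight 0 x = 1 := by simp [weight]

theorem weight_nonneg (β : ℝ) (x : Eu d) : 0 ≤ weight β x := by unfold weight; positivity

theorem measurable_weight (β : ℝ) : Measurable (weight β : Eu d → ℝ) := measurable_norm_rpow _

theorem weight_pos (β : ℝ) {x : Eu d} (hx : x ≠ 0) : 0 < weight β x :=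
  Real.rpow_pos_of_pos (norm_pos_iff.2 hx) _

theorem weightedKernel_zero (α : ℝ) (f : Eu d → ℝ) (z : Eu d × Eu d) :
    weightedKernel α 0 f z = gagliardoKernel α f z := by
  rw [weightedKernel, gagliardoKernel, weight_zero, weight_zero, mul_one, mul_one]

theorem weightedKernel_nonneg (α β : ℝ) (f : Eu d → ℝ) (z : Eu d × Eu d) :
    0 ≤ weightedKernel α β f z := by
  rw [weightedKernel_eq]
  have h1 := levy_nonneg α (z.1 - z.2)
  have h2 := weight_nonneg β z.1
  have h3 := weight_nonneg β z.2
  positivity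

theorem measurable_levy_sub (α : ℝ) : Measurable fun z : Eu d × Eu d => levy α (z.1 - z.2) :=
  (measurable_levy α).comp (measurable_fst.sub measurable_snd)

theorem ae_fst {p : Eu d → Prop} (h : ∀ᵐ x, p x) :
    ∀ᵐ z : Eu d × Eu d ∂(volume.prod volume), p z.1 :=
  Measure.quasiMeasurePreserving_fst.ae h

theorem ae_snd {p : Eu d → Prop} (h : ∀ᵐ x, p x) :
    ∀ᵐ z : Eu d × Eu d ∂(volume.prod volume), p z.2 :=
  Measure.quasiMeasurePreserving_snd.ae h

theorem aemeasurable_fst {f : Eu d → ℝ} (hf : AEMeasurable f) :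
    AEMeasurable (fun z : Eu d × Eu d => f z.1) (volume.prod volume) :=
  hf.comp_quasiMeasurePreserving Measure.quasiMeasurePreserving_fst

theorem aemeasurable_snd {f : Eu d → ℝ} (hf : AEMeasurable f) :
    AEMeasurable (fun z : Eu d × Eu d => f z.2) (volume.prod volume) :=
  hf.comp_quasiMeasurePreserving Measure.quasiMeasurePreserving_snd

theorem aemeasurable_weightedKernel (α β : ℝ) {f : Eu d → ℝ} (hf : AEMeasurable f) :
    AEMeasurable (weightedKernel α β f) (volume.prod volume) := by
  have h : weightedKernel α β f = fun z : Eu d × Eu d =>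
      (f z.1 - f z.2) ^ 2 * levy α (z.1 - z.2) * weight β z.1 * weight β z.2 :=
    funext fun z => weightedKernel_eq α β f z
  rw [h]
  exact (((((aemeasurable_fst hf).sub (aemeasurable_snd hf)).pow_const 2).mul
    (measurable_levy_sub α).aemeasurable).mul
    (aemeasurable_fst (measurable_weight β).aemeasurable)).mul
    (aemeasurable_snd (measurable_weight β).aemeasurable)

theorem weightedKernel_congr (α β : ℝ) {f g : Eu d → ℝ} (h : f =ᵐ[volume] g) :
    weightedKernel α β f =ᵐ[volume.prod volume] weightedKernel α β g := by
  filter_upwards [ae_fst h, ae_snd h] with z h1 h2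
  rw [weightedKernel, weightedKernel, h1, h2]

theorem wE_congr (α β : ℝ) {f g : Eu d → ℝ} (h : f =ᵐ[volume] g) : wE α β f = wE α β g :=
  lintegral_congr_ae ((weightedKernel_congr α β h).mono fun z hz => by simp only [hz])

theorem wE_mono (α β : ℝ) {f g : Eu d → ℝ} (h : ∀ x y, |f x - f y| ≤ |g x - g y|) :
    wE α β f ≤ wE α β g := by
  refine lintegral_mono fun z => ENNReal.ofReal_le_ofReal ?_
  rw [weightedKernel_eq, weightedKernel_eq]
  have h1 := levy_nonneg α (z.1 - z.2)
  have h2 := weight_nonneg β z.1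
  have h3 := weight_nonneg β z.2
  have h4 := sq_le_sq.2 (h z.1 z.2)
  gcongr

theorem integrable_weightedKernel_iff (α β : ℝ) {f : Eu d → ℝ} (hf : AEMeasurable f) :
    Integrable (weightedKernel α β f) (volume.prod volume) ↔ wE α β f < ∞ := by
  rw [Integrable, hasFiniteIntegral_iff_ofReal (Eventually.of_forall (weightedKernel_nonneg α β f)),
    wE]
  exact and_iff_right (aemeasurable_weightedKernel α β hf).aestronglyMeasurable

theorem integral_weightedKernel (α β : ℝ) {f : Eu d → ℝ} (hf : AEMeasurable f) :
    ∫ z, weightedKernel α β f z ∂(volume.prod volume) = (wE α β f).toReal :=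
  integral_eq_lintegral_of_nonneg_ae (Eventually.of_forall (weightedKernel_nonneg α β f))
    (aemeasurable_weightedKernel α β hf).aestronglyMeasurable

/-! ### The ground state representation -/

/-- The truncated Lévy kernel. -/
def levyTrunc (α s : ℝ) : Eu d → ℝ := (Metric.ball 0 s)ᶜ.indicator (levy α)

theorem levyTrunc_nonneg (α s : ℝ) (z : Eu d) : 0 ≤ levyTrunc α s z :=
  Set.indicator_nonneg (fun z _ => levy_nonneg α z) z

theorem measurable_levyTrunc (α s : ℝ) : Measurable (levyTrunc α s : Eu d → ℝ) :=
  (measurable_levy α).indicator Metric.isOpen_ball.measurableSet.compl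

theorem integrable_levyTrunc {α s : ℝ} (hα : 0 < α) (hs : 0 < s) :
    Integrable (levyTrunc α s : Eu d → ℝ) :=
  (integrable_indicator_iff Metric.isOpen_ball.measurableSet.compl).2 (integrableOn_levy hα hs)

theorem levyTrunc_neg (α s : ℝ) (z : Eu d) : levyTrunc α s (-z) = levyTrunc α s z := by
  simp [levyTrunc, Set.indicator, levy_neg]

theorem measurable_levyTrunc_sub (α s : ℝ) :
    Measurable fun z : Eu d × Eu d => levyTrunc α s (z.1 - z.2) :=
  (measurable_levyTrunc α s).comp (measurable_fst.sub measurable_snd)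

theorem integrable_mul_levyTrunc {α s : ℝ} (hα : 0 < α) (hs : 0 < s) {g : Eu d → ℝ}
    (hg : Integrable g) :
    Integrable (fun z : Eu d × Eu d => g z.1 * levyTrunc α s (z.1 - z.2)) (volume.prod volume) := by
  have hτ := integrable_levyTrunc (d := d) hα hs
  have hm : AEStronglyMeasurable (fun z : Eu d × Eu d => g z.1 * levyTrunc α s (z.1 - z.2))
      (volume.prod volume) :=
    hg.1.comp_fst.mul (measurable_levyTrunc_sub α s).aestronglyMeasurable
  rw [integrable_prod_iff hm]
  refine ⟨Eventually.of_forall fun x => (hτ.comp_sub_left x).const_mul (g x), ?_⟩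
  refine (hg.norm.mul_const (∫ z : Eu d, ‖levyTrunc α s z‖)).congr
    (Eventually.of_forall fun x => ?_)
  simp only [norm_mul]
  rw [integral_const_mul, integral_sub_left_eq_self (fun z => ‖levyTrunc α s z‖) volume x]

theorem integrable_mul_levyTrunc_swap {α s : ℝ} (hα : 0 < α) (hs : 0 < s) {g : Eu d → ℝ}
    (hg : Integrable g) :
    Integrable (fun z : Eu d × Eu d => g z.2 * levyTrunc α s (z.1 - z.2)) (volume.prod volume) := by
  refine (integrable_mul_levyTrunc hα hs hg).swap.congr (Eventually.of_forall fun z => ?_)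
  simp only [Function.comp, Prod.fst_swap, Prod.snd_swap]
  rw [← levyTrunc_neg, neg_sub]

theorem integrable_weight_sub_mul_levyTrunc (hd : 0 < d) {α β s : ℝ} (hα : 0 < α) (hβ : 0 ≤ β)
    (hβd : β < d) (hs : 0 < s) (x : Eu d) :
    Integrable (fun y => (weight β x + weight β y) * levyTrunc α s (x - y)) := by
  have h1 : Integrable fun z : Eu d => (weight β x + weight β (x + z)) * levyTrunc α s z := by
    have h2 : IntegrableOn (fun z => (weight β x + weight β (x + z)) * levy α z)
        (Metric.ball (0 : Eu d) s)ᶜ := by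
      simp only [add_mul]
      exact ((integrableOn_levy hα hs).const_mul _).add
        (integrableOn_rpow_mul_levy hd hα hβ hβd x hs)
    refine ((integrable_indicator_iff Metric.isOpen_ball.measurableSet.compl).2 h2).congr
      (Eventually.of_forall fun z => ?_)
    simp [levyTrunc, Set.indicator]
  refine (h1.comp_sub_right x).congr (Eventually.of_forall fun y => ?_)
  simp only [add_sub_cancel]
  rw [← levyTrunc_neg, neg_sub]

theorem integral_weight_sub_mul_levyTrunc {α β s : ℝ} {e : Eu d} (he : ‖e‖ = 1) {x : Eu d}
    (hx : x ≠ 0) :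
    ∫ y, (weight β x - weight β y) * levyTrunc α s (x - y) =
      ‖x‖ ^ (-(α + β)) * truncLap α β e (s / ‖x‖) := by
  rw [← integral_weight_sub_mul_levy α β he hx,
    ← integral_indicator Metric.isOpen_ball.measurableSet.compl,
    ← integral_add_left_eq_self (fun y => (weight β x - weight β y) * levyTrunc α s (x - y)) x]
  congr 1
  ext z
  rw [← levyTrunc_neg]
  simp [levyTrunc, Set.indicator, weight]

/-- The first middle term of the ground state identity: the factor u²‖x‖^β = u²/w times the
truncated difference of w. Its integral in y is the truncated Laplacian of w, which turns it into
u²|x|^{-α} times a bounded function. -/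
theorem integrable_truncated_potential (hd : 0 < d) {α β s : ℝ} (hα : 0 < α) (hα' : α < 2)
    (hβ : 0 ≤ β) (hβd : β < d) (hs : 0 < s) {u : Eu d → ℝ} (hu : AEMeasurable u)
    (h2 : Integrable fun x => u x ^ 2) (hH : Integrable fun x => u x ^ 2 * ‖x‖ ^ (-α))
    {e : Eu d} (he : ‖e‖ = 1) :
    Integrable (fun z : Eu d × Eu d => u z.1 ^ 2 * ‖z.1‖ ^ β *
      ((weight β z.1 - weight β z.2) * levyTrunc α s (z.1 - z.2))) (volume.prod volume) ∧
    ∫ z : Eu d × Eu d, u z.1 ^ 2 * ‖z.1‖ ^ β *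
      ((weight β z.1 - weight β z.2) * levyTrunc α s (z.1 - z.2)) ∂(volume.prod volume) =
      ∫ x, u x ^ 2 * ‖x‖ ^ (-α) * truncLap α β e (s / ‖x‖) := by
  obtain ⟨M, hM0, hM⟩ := exists_abs_truncLap_le hd hα hα' hβ hβd he
  set G : Eu d → Eu d → ℝ := fun x y => u x ^ 2 * ‖x‖ ^ β *
      ((weight β x - weight β y) * levyTrunc α s (x - y)) with hG
  have hpow : ∀ x : Eu d, x ≠ 0 → ‖x‖ ^ β * ‖x‖ ^ (-(α + β)) = ‖x‖ ^ (-α) := fun x hx => by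
    rw [← Real.rpow_add (norm_pos_iff.2 hx)]; congr 1; ring
  have hpow' : ∀ x : Eu d, x ≠ 0 → ‖x‖ ^ β * weight β x = 1 := fun x hx => by
    rw [weight, ← Real.rpow_add (norm_pos_iff.2 hx), add_neg_cancel, Real.rpow_zero]
  have hm : AEStronglyMeasurable (Function.uncurry G)
      ((volume : Measure (Eu d)).prod volume) := by
    refine AEMeasurable.aestronglyMeasurable ?_
    exact (((aemeasurable_fst hu).pow_const 2).mul
      (aemeasurable_fst (measurable_norm_rpow β).aemeasurable)).mul
      (((aemeasurable_fst (measurable_weight β).aemeasurable).sub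
        (aemeasurable_snd (measurable_weight β).aemeasurable)).mul
        (measurable_levyTrunc_sub α s).aemeasurable)
  have hsub : ∀ x : Eu d, Integrable fun y : Eu d => (weight β x - weight β y) * levyTrunc α s (x - y) := by
    intro x
    refine (integrable_weight_sub_mul_levyTrunc hd hα hβ hβd hs x).mono'
      (((measurable_const.sub (measurable_weight β)).mul ((measurable_levyTrunc α s).comp
        (measurable_const.sub measurable_id))).aestronglyMeasurable)
      (Eventually.of_forall fun y => ?_)
    rw [norm_mul, Real.norm_of_nonneg (levyTrunc_nonneg α s _)]
    refine mul_le_mul_of_nonneg_right ?_ (levyTrunc_nonneg α s _)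
    refine (norm_sub_le _ _).trans ?_
    rw [Real.norm_of_nonneg (weight_nonneg β x), Real.norm_of_nonneg (weight_nonneg β y)]
  have hin : ∀ x, x ≠ 0 → ∫ y, G x y = u x ^ 2 * ‖x‖ ^ (-α) * truncLap α β e (s / ‖x‖) := by
    intro x hx
    rw [hG, integral_const_mul, integral_weight_sub_mul_levyTrunc he hx, ← hpow x hx]
    ring
  set K : ℝ := ∫ z : Eu d, levyTrunc α s z with hK
  have hint : Integrable (Function.uncurry G) ((volume : Measure (Eu d)).prod volume) := by
    rw [integrable_prod_iff hm]
    refine ⟨Eventually.of_forall fun x => (hsub x).const_mul (u x ^ 2 * ‖x‖ ^ β), ?_⟩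
    refine Integrable.mono' ((h2.const_mul (2 * K)).add (hH.const_mul M))
      hm.norm.integral_prod_right' ?_
    filter_upwards [ae_ne_zero hd] with x hx
    have hn : 0 < ‖x‖ := norm_pos_iff.2 hx
    rw [Real.norm_of_nonneg (integral_nonneg fun x => norm_nonneg _)]
    simp only [Function.uncurry_apply_pair, hG, norm_mul, Real.norm_of_nonneg (sq_nonneg (u x)),
      Real.norm_of_nonneg (Real.rpow_nonneg (norm_nonneg x) β),
      Real.norm_of_nonneg (levyTrunc_nonneg α s _)]
    rw [integral_const_mul, Pi.add_apply]
    -- Since |w(x) - w(y)| ≤ w(x) + w(y) = 2w(x) - (w(x) - w(y)), the absolute integral is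
    -- controlled by the total mass of the kernel and by the signed integral, both already known.
    have e1 : ∫ y, ‖weight β x - weight β y‖ * levyTrunc α s (x - y) ≤
        2 * weight β x * K - ‖x‖ ^ (-(α + β)) * truncLap α β e (s / ‖x‖) := by
      rw [← integral_weight_sub_mul_levyTrunc he hx, hK,
        ← integral_sub_left_eq_self (levyTrunc α s) volume x, ← integral_const_mul,
        ← integral_sub (((integrable_levyTrunc hα hs).comp_sub_left x).const_mul _) (hsub x)]
      refine integral_mono_of_nonneg (Eventually.of_forall fun y =>
        mul_nonneg (norm_nonneg _) (levyTrunc_nonneg α s _))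
        ((((integrable_levyTrunc hα hs).comp_sub_left x).const_mul _).sub (hsub x))
        (Eventually.of_forall fun y => ?_)
      simp only [← sub_mul]
      refine mul_le_mul_of_nonneg_right ?_ (levyTrunc_nonneg α s _)
      refine (norm_sub_le _ _).trans ?_
      rw [Real.norm_of_nonneg (weight_nonneg β x), Real.norm_of_nonneg (weight_nonneg β y)]
      linarith
    have e2 := (abs_le.1 (hM (s / ‖x‖) (div_pos hs hn))).1
    have e3 : 0 ≤ ‖x‖ ^ (-(α + β)) := by positivity
    have e4 : 2 * weight β x * K - ‖x‖ ^ (-(α + β)) * truncLap α β e (s / ‖x‖) ≤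
        2 * weight β x * K + ‖x‖ ^ (-(α + β)) * M := by nlinarith
    calc u x ^ 2 * ‖x‖ ^ β * ∫ y, ‖weight β x - weight β y‖ * levyTrunc α s (x - y)
        ≤ u x ^ 2 * ‖x‖ ^ β * (2 * weight β x * K + ‖x‖ ^ (-(α + β)) * M) :=
          mul_le_mul_of_nonneg_left (e1.trans e4) (by positivity)
      _ = 2 * K * u x ^ 2 * (‖x‖ ^ β * weight β x) +
            M * (u x ^ 2 * (‖x‖ ^ β * ‖x‖ ^ (-(α + β)))) := by ring
      _ = _ := by rw [hpow x hx, hpow' x hx, mul_one]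
  refine ⟨hint, ?_⟩
  have h := integral_prod _ hint
  refine Eq.trans ?_ (h.trans (integral_congr_ae ((ae_ne_zero hd).mono hin)))
  rfl

/-- The weighted energy with the truncated Lévy kernel. -/
def wETrunc (α β s : ℝ) (f : Eu d → ℝ) : ℝ≥0∞ :=
  ∫⁻ z : Eu d × Eu d, ENNReal.ofReal ((f z.1 - f z.2) ^ 2 * levyTrunc α s (z.1 - z.2) *
    weight β z.1 * weight β z.2) ∂(volume.prod volume)

theorem tendsto_wETrunc (α β : ℝ) {f : Eu d → ℝ} (hf : AEMeasurable f) :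
    Tendsto (fun n : ℕ => wETrunc α β (1 / ((n : ℝ) + 1)) f) atTop (𝓝 (wE α β f)) := by
  refine lintegral_tendsto_of_tendsto_of_monotone (fun n => ?_) ?_ ?_
  · exact (((((((aemeasurable_fst hf).sub (aemeasurable_snd hf)).pow_const 2).mul
      (measurable_levyTrunc_sub α _).aemeasurable).mul
      (aemeasurable_fst (measurable_weight β).aemeasurable)).mul
      (aemeasurable_snd (measurable_weight β).aemeasurable))).ennreal_ofReal
  · refine Eventually.of_forall fun z m n hmn => ENNReal.ofReal_le_ofReal ?_
    have h2 := weight_nonneg β z.1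
    have h3 := weight_nonneg β z.2
    have h4 : levyTrunc α (1 / ((m : ℝ) + 1)) (z.1 - z.2) ≤
        levyTrunc α (1 / ((n : ℝ) + 1)) (z.1 - z.2) := by
      refine Set.indicator_le_indicator_of_subset ?_ (levy_nonneg α) _
      refine Set.compl_subset_compl.2 (Metric.ball_subset_ball ?_)
      exact one_div_le_one_div_of_le (by positivity) (by gcongr)
    gcongr
  · refine Eventually.of_forall fun z => ?_
    simp only [weightedKernel_eq]
    by_cases hz : z.1 = z.2
    · simp [hz]
    · have hn : 0 < ‖z.1 - z.2‖ := norm_pos_iff.2 (sub_ne_zero.2 hz)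
      refine tendsto_const_nhds.congr' ?_
      filter_upwards [(tendsto_one_div_add_atTop_nhds_zero_nat (𝕜 := ℝ)).eventually
        (gt_mem_nhds hn)] with n hn'
      rw [levyTrunc, Set.indicator_of_mem]
      simpa using hn'.le

theorem exists_norm_eq_one (hd : 0 < d) : ∃ e : Eu d, ‖e‖ = 1 :=
  ⟨EuclideanSpace.single ⟨0, hd⟩ 1, by simp⟩

/-- The truncated ground state representation. -/
theorem wETrunc_groundState (hd : 0 < d) {α β s : ℝ} (hα : 0 < α) (hα' : α < 2)
    (hβ : 0 ≤ β) (hβd : β < d) (hs : 0 < s) {u : Eu d → ℝ} (hu : AEMeasurable u)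
    (h2 : Integrable fun x => u x ^ 2) (hH : Integrable fun x => u x ^ 2 * ‖x‖ ^ (-α))
    {e : Eu d} (he : ‖e‖ = 1) :
    ∃ a b : ℝ, 0 ≤ a ∧ 0 ≤ b ∧ wETrunc α 0 s u = ENNReal.ofReal a ∧
      wETrunc α β s (fun x => u x * ‖x‖ ^ β) = ENNReal.ofReal b ∧
      a = b + 2 * ∫ x, u x ^ 2 * ‖x‖ ^ (-α) * truncLap α β e (s / ‖x‖) := by
  obtain ⟨hp, hpv⟩ := integrable_truncated_potential hd hα hα' hβ hβd hs hu h2 hH he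
  have hp' := hp.swap
  have hpv' := integral_prod_swap (μ := (volume : Measure (Eu d))) (ν := (volume : Measure (Eu d)))
    (fun z : Eu d × Eu d => u z.1 ^ 2 * ‖z.1‖ ^ β *
      ((weight β z.1 - weight β z.2) * levyTrunc α s (z.1 - z.2)))
  rw [hpv] at hpv'
  have hdiff : Integrable (fun z : Eu d × Eu d =>
      (u z.1 - u z.2) ^ 2 * levyTrunc α s (z.1 - z.2)) (volume.prod volume) := by
    refine (((integrable_mul_levyTrunc hα hs h2).const_mul 2).add
      ((integrable_mul_levyTrunc_swap hα hs h2).const_mul 2)).mono'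
      ((((aemeasurable_fst hu).sub (aemeasurable_snd hu)).pow_const 2).mul
        (measurable_levyTrunc_sub α s).aemeasurable).aestronglyMeasurable
      (Eventually.of_forall fun z => ?_)
    have h1 := levyTrunc_nonneg α s (z.1 - z.2)
    rw [Real.norm_of_nonneg (by positivity)]
    simp only [Pi.add_apply]
    nlinarith [mul_nonneg (sq_nonneg (u z.1 + u z.2)) h1]
  -- The pointwise identity behind the ground state representation. It divides by w at both points,
  -- so it holds off the null set where one of them is the origin.
  have hae : ∀ᵐ z : Eu d × Eu d ∂(volume.prod volume),
      (u z.1 - u z.2) ^ 2 * levyTrunc α s (z.1 - z.2) -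
      (u z.1 ^ 2 * ‖z.1‖ ^ β * ((weight β z.1 - weight β z.2) * levyTrunc α s (z.1 - z.2)) +
       (u z.2 ^ 2 * ‖z.2‖ ^ β * ((weight β z.2 - weight β z.1) * levyTrunc α s (z.2 - z.1)))) =
      (u z.1 * ‖z.1‖ ^ β - u z.2 * ‖z.2‖ ^ β) ^ 2 * levyTrunc α s (z.1 - z.2) *
        weight β z.1 * weight β z.2 := by
    filter_upwards [ae_fst (ae_ne_zero hd), ae_snd (ae_ne_zero hd)] with z hz1 hz2
    have hn1 : ‖z.1‖ ^ β ≠ 0 := (Real.rpow_pos_of_pos (norm_pos_iff.2 hz1) β).ne'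
    have hn2 : ‖z.2‖ ^ β ≠ 0 := (Real.rpow_pos_of_pos (norm_pos_iff.2 hz2) β).ne'
    rw [weight, weight, Real.rpow_neg (norm_nonneg _), Real.rpow_neg (norm_nonneg _),
      ← levyTrunc_neg α s (z.2 - z.1), neg_sub]
    field_simp
    ring
  have hI := (hdiff.sub (hp.add hp'))
  have hI2 := hI.congr hae
  refine ⟨_, _, ?_, ?_, Eq.trans ?_ (ofReal_integral_eq_lintegral_ofReal hdiff ?_).symm,
    (ofReal_integral_eq_lintegral_ofReal (hI2) ?_).symm, ?_⟩
  · exact integral_nonneg fun z => mul_nonneg (sq_nonneg _) (levyTrunc_nonneg α s _)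
  · exact integral_nonneg fun z => mul_nonneg (mul_nonneg (mul_nonneg (sq_nonneg _)
      (levyTrunc_nonneg α s _)) (weight_nonneg β _)) (weight_nonneg β _)
  · simp only [wETrunc, weight_zero, mul_one]
  · exact Eventually.of_forall fun z => mul_nonneg (sq_nonneg _) (levyTrunc_nonneg α s _)
  · exact Eventually.of_forall fun z => mul_nonneg (mul_nonneg (mul_nonneg (sq_nonneg _)
      (levyTrunc_nonneg α s _)) (weight_nonneg β _)) (weight_nonneg β _)
  · have h := integral_congr_ae hae
    have h3 := (integral_sub hdiff (hp.add hp')).symm.trans h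
    have h4 := integral_add' hp hp'
    have h5 : ∫ z : Eu d × Eu d, ((fun z : Eu d × Eu d => u z.1 ^ 2 * ‖z.1‖ ^ β *
        ((weight β z.1 - weight β z.2) * levyTrunc α s (z.1 - z.2))) ∘ Prod.swap) z
        ∂(volume.prod volume) = ∫ x, u x ^ 2 * ‖x‖ ^ (-α) * truncLap α β e (s / ‖x‖) := hpv'
    rw [hpv, h5] at h4
    linarith [h3, h4]

theorem hardyConst_pos {α β : ℝ} (hα : 0 < α) (hβ : 0 < β) (hβd : α + β < d) :
    0 < hardyConst d α β := by
  have h1 := rieszConst_pos hβ (by linarith : β < d)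
  have h2 := rieszConst_pos (d := d) (β := d - α - β) (by linarith) (by linarith)
  have := Real.pi_pos
  unfold hardyConst
  positivity

/-- The ground state representation for the power weight `|x|^{-β}`. -/
theorem wE_groundState (hd : 0 < d) {α β : ℝ} (hα : 0 < α) (hα' : α < 2) (hβ : 0 < β)
    (hβd : α + β < d) {u : Eu d → ℝ} (hu : AEMeasurable u)
    (h2 : Integrable fun x => u x ^ 2) (hH : Integrable fun x => u x ^ 2 * ‖x‖ ^ (-α)) :
    wE α 0 u = wE α β (fun x => u x * ‖x‖ ^ β) +
      ENNReal.ofReal (2 * (hardyConst d α β / constA d α) * ∫ x, u x ^ 2 * ‖x‖ ^ (-α)) := by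
  obtain ⟨e, he⟩ := exists_norm_eq_one hd
  have hA := constA_pos hd hα hα'
  have hc := hardyConst_pos hα hβ hβd
  have hL : limLap α β e = hardyConst d α β / constA d α := by
    rw [← constA_mul_limLap hd hα hα' hβ hβd he, mul_div_cancel_left₀ _ hA.ne']
  have hβd' : β < d := by linarith
  set s : ℕ → ℝ := fun n => 1 / ((n : ℝ) + 1) with hs
  have hs0 : ∀ n, 0 < s n := fun n => by positivity
  have hsl : Tendsto s atTop (𝓝 0) := tendsto_one_div_add_atTop_nhds_zero_nat
  choose a b ha hb hwa hwb hab using fun n =>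
    wETrunc_groundState hd hα hα' hβ.le hβd' (hs0 n) hu h2 hH he
  set r : ℕ → ℝ := fun n => 2 * ∫ x, u x ^ 2 * ‖x‖ ^ (-α) * truncLap α β e (s n / ‖x‖) with hr
  have hrl : Tendsto r atTop (𝓝 (2 * limLap α β e * ∫ x, u x ^ 2 * ‖x‖ ^ (-α))) := by
    rw [mul_assoc, ← integral_const_mul]
    refine Tendsto.const_mul 2 ?_
    obtain ⟨M, hM0, hM⟩ := exists_abs_truncLap_le hd hα hα' hβ.le hβd' he
    have hmeas : ∀ n, AEStronglyMeasurable
        fun x => u x ^ 2 * ‖x‖ ^ (-α) * truncLap α β e (s n / ‖x‖) := by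
      intro n
      obtain ⟨hp, -⟩ := integrable_truncated_potential hd hα hα' hβ.le hβd' (hs0 n) hu h2 hH he
      refine hp.integral_prod_left.aestronglyMeasurable.congr ?_
      filter_upwards [ae_ne_zero hd] with x hx
      rw [integral_const_mul, integral_weight_sub_mul_levyTrunc he hx]
      have : ‖x‖ ^ β * ‖x‖ ^ (-(α + β)) = ‖x‖ ^ (-α) := by
        rw [← Real.rpow_add (norm_pos_iff.2 hx)]; congr 1; ring
      rw [← this]
      ring
    refine tendsto_integral_filter_of_dominated_convergence
      (fun x => u x ^ 2 * ‖x‖ ^ (-α) * M) (Eventually.of_forall hmeas) ?_ (hH.mul_const M) ?_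
    · refine Eventually.of_forall fun n => ?_
      filter_upwards [ae_ne_zero hd] with x hx
      have hn : 0 < ‖x‖ := norm_pos_iff.2 hx
      rw [norm_mul, Real.norm_of_nonneg (by positivity), Real.norm_eq_abs]
      exact mul_le_mul_of_nonneg_left (hM _ (div_pos (hs0 n) hn)) (by positivity)
    · filter_upwards [ae_ne_zero hd] with x hx
      have hn : 0 < ‖x‖ := norm_pos_iff.2 hx
      rw [mul_comm (limLap α β e)]
      refine Tendsto.const_mul _ (tendsto_truncLap hd hα hα' hβ.le hβd' he
        (fun n => div_pos (hs0 n) hn) ?_)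
      simpa using hsl.div_const ‖x‖
  have hfm : AEMeasurable fun x => u x * ‖x‖ ^ β := hu.mul (measurable_norm_rpow β).aemeasurable
  -- The remainder `r n` may be negative before the limit, and the energies may tend to infinity.
  -- Placing its negative and positive parts on opposite sides gives an identity in [0, ∞] that
  -- passes to the limit; the limit of `r n` is nonnegative, so the extra term on the left
  -- disappears.
  have hid : ∀ n, wETrunc α 0 (s n) u + ENNReal.ofReal (-r n) =
      wETrunc α β (s n) (fun x => u x * ‖x‖ ^ β) + ENNReal.ofReal (r n) := by
    intro n
    rw [hwa, hwb]
    have h := hab n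
    have hr' : a n = b n + r n := h
    rcases le_total 0 (r n) with h0 | h0
    · rw [ENNReal.ofReal_of_nonpos (by linarith : -r n ≤ 0), add_zero, hr',
        ENNReal.ofReal_add (hb n) h0]
    · rw [ENNReal.ofReal_of_nonpos h0, add_zero, ← ENNReal.ofReal_add (ha n) (by linarith), hr']
      congr 1
      ring
  have hI0 : 0 ≤ ∫ x, u x ^ 2 * ‖x‖ ^ (-α) := integral_nonneg fun x => by positivity
  have hr0 : 0 ≤ 2 * limLap α β e * ∫ x, u x ^ 2 * ‖x‖ ^ (-α) := by
    rw [hL]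
    exact mul_nonneg (mul_nonneg two_pos.le (div_nonneg hc.le hA.le)) hI0
  have t1 : Tendsto (fun n => wETrunc α 0 (s n) u + ENNReal.ofReal (-r n)) atTop
      (𝓝 (wE α 0 u + ENNReal.ofReal (-(2 * limLap α β e * ∫ x, u x ^ 2 * ‖x‖ ^ (-α))))) :=
    (tendsto_wETrunc α 0 hu).add (ENNReal.tendsto_ofReal hrl.neg)
  have t2 : Tendsto (fun n => wETrunc α β (s n) (fun x => u x * ‖x‖ ^ β) + ENNReal.ofReal (r n))
      atTop (𝓝 (wE α β (fun x => u x * ‖x‖ ^ β) +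
        ENNReal.ofReal (2 * limLap α β e * ∫ x, u x ^ 2 * ‖x‖ ^ (-α)))) :=
    (tendsto_wETrunc α β hfm).add (ENNReal.tendsto_ofReal hrl)
  simp only [hid] at t1
  have h := tendsto_nhds_unique t1 t2
  rw [ENNReal.ofReal_of_nonpos (neg_nonpos.2 hr0), add_zero, hL] at h
  exact h

/-! ### Hardy's inequality -/

/-- Truncation of a real number to `[-t, t]`. -/
def clamp (t s : ℝ) : ℝ := max (-t) (min t s)

theorem abs_clamp_sub_clamp_le (t s s' : ℝ) : |clamp t s - clamp t s'| ≤ |s - s'| := by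
  unfold clamp
  refine (abs_max_sub_max_le_max _ _ _ _).trans ?_
  rw [sub_self, abs_zero]
  refine max_le (abs_nonneg _) ((abs_min_sub_min_le_max _ _ _ _).trans ?_)
  rw [sub_self, abs_zero]
  exact max_le (abs_nonneg _) le_rfl

theorem abs_clamp_le (t s : ℝ) (ht : 0 ≤ t) : |clamp t s| ≤ t :=
  abs_le.2 ⟨le_max_left _ _, max_le (by linarith) (min_le_left _ _)⟩

theorem abs_clamp_le_abs (t s : ℝ) (ht : 0 ≤ t) : |clamp t s| ≤ |s| := by
  have h := abs_clamp_sub_clamp_le t s 0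
  have h0 : clamp t 0 = 0 := by simp [clamp, ht]
  rwa [h0, sub_zero, sub_zero] at h

theorem clamp_of_abs_le {t s : ℝ} (h : |s| ≤ t) : clamp t s = s := by
  rw [clamp, min_eq_right (abs_le.1 h).2, max_eq_right (abs_le.1 h).1]

theorem continuous_clamp (t : ℝ) : Continuous (clamp t) := by unfold clamp; fun_prop

theorem integrable_sq_mul_rpow_of_bounded (hd : 0 < d) {α : ℝ} (hα : 0 < α) (hαd : α < d)
    {u : Eu d → ℝ} (h2 : Integrable fun x => u x ^ 2) {C : ℝ} (hC : ∀ x, |u x| ≤ C) :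
    Integrable fun x => u x ^ 2 * ‖x‖ ^ (-α) := by
  refine (integrable_rpow_smul_of_bounded hd hα.le hαd 0 h2 (C := C ^ 2) fun x => ?_).congr
    (Eventually.of_forall fun x => ?_)
  · rw [norm_pow]
    exact pow_le_pow_left₀ (norm_nonneg _) (hC x) 2
  · simp only [zero_add, smul_eq_mul]
    ring

/-- Hardy's inequality. -/
theorem hardy_inequality (hd : 0 < d) {α β : ℝ} (hα : 0 < α) (hα' : α < 2) (hβ : 0 < β)
    (hβd : α + β < d) {u : Eu d → ℝ} (hu : AEMeasurable u) (h2 : Integrable fun x => u x ^ 2) :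
    ENNReal.ofReal (2 * (hardyConst d α β / constA d α)) *
      ∫⁻ x, ENNReal.ofReal (u x ^ 2 * ‖x‖ ^ (-α)) ≤ wE α 0 u := by
  have hA := constA_pos hd hα hα'
  have hc := hardyConst_pos hα hβ hβd
  -- A bounded square integrable function has finite Hardy integral, so the ground state
  -- representation applies to the truncations. The weighted energy is dropped, truncation does not
  -- increase the energy, and Fatou's lemma recovers `u`.
  set v : ℕ → Eu d → ℝ := fun n x => clamp n (u x) with hv
  have hvm : ∀ n, AEMeasurable (v n) := fun n => (continuous_clamp n).measurable.comp_aemeasurable hu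
  have hv2 : ∀ n, Integrable fun x => v n x ^ 2 := fun n => by
    refine h2.mono' ((hvm n).pow_const 2).aestronglyMeasurable (Eventually.of_forall fun x => ?_)
    rw [norm_pow, ← sq_abs (u x)]
    exact pow_le_pow_left₀ (norm_nonneg _) (abs_clamp_le_abs _ _ (Nat.cast_nonneg n)) 2
  have hb : ∀ n, ENNReal.ofReal (2 * (hardyConst d α β / constA d α)) *
      ∫⁻ x, ENNReal.ofReal (v n x ^ 2 * ‖x‖ ^ (-α)) ≤ wE α 0 u := by
    intro n
    have hvH := integrable_sq_mul_rpow_of_bounded hd hα (by linarith) (hv2 n) (C := n)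
      (fun x => abs_clamp_le _ _ (Nat.cast_nonneg n))
    have h := wE_groundState hd hα hα' hβ hβd (hvm n) (hv2 n) hvH
    rw [ENNReal.ofReal_mul (by positivity), ofReal_integral_eq_lintegral_ofReal hvH
      (Eventually.of_forall fun x => by positivity)] at h
    exact (le_add_self.trans h.ge).trans (wE_mono α 0 fun x y => abs_clamp_sub_clamp_le _ _ _)
  have hlim : ∫⁻ x, ENNReal.ofReal (u x ^ 2 * ‖x‖ ^ (-α)) ≤
      liminf (fun n => ∫⁻ x, ENNReal.ofReal (v n x ^ 2 * ‖x‖ ^ (-α))) atTop := by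
    refine le_trans (le_of_eq ?_) (lintegral_liminf_le' fun n =>
      (((hvm n).pow_const 2).mul (measurable_norm_rpow _).aemeasurable).ennreal_ofReal)
    refine lintegral_congr fun x => ?_
    symm
    refine Tendsto.liminf_eq (tendsto_const_nhds.congr' ?_)
    obtain ⟨N, hN⟩ := exists_nat_ge |u x|
    filter_upwards [eventually_ge_atTop N] with n hn
    simp only [hv]
    rw [clamp_of_abs_le (hN.trans (Nat.cast_le.2 hn))]
  have hpos : ENNReal.ofReal (2 * (hardyConst d α β / constA d α)) ≠ 0 := by
    rw [Ne, ENNReal.ofReal_eq_zero, not_le]; positivity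
  rw [mul_comm, ← ENNReal.le_div_iff_mul_le (Or.inl hpos) (Or.inl ENNReal.ofReal_ne_top)]
  refine hlim.trans ?_
  have hbd : ∀ n, ∫⁻ x, ENNReal.ofReal (v n x ^ 2 * ‖x‖ ^ (-α)) ≤
      wE α 0 u / ENNReal.ofReal (2 * (hardyConst d α β / constA d α)) := fun n =>
    (ENNReal.le_div_iff_mul_le (Or.inl hpos) (Or.inl ENNReal.ofReal_ne_top)).2
      (by rw [mul_comm]; exact hb n)
  exact liminf_le_of_frequently_le' (Frequently.of_forall hbd)

theorem integrable_sq_mul_rpow (hd : 0 < d) {α : ℝ} (hα : 0 < α) (hα' : α < 2) (hαd : α < d)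
    {u : Eu d → ℝ} (hu : AEMeasurable u) (h2 : Integrable fun x => u x ^ 2) (hE : wE α 0 u < ∞) :
    Integrable fun x => u x ^ 2 * ‖x‖ ^ (-α) := by
  have h := hardy_inequality hd hα hα' (β := (d - α) / 2) (by linarith) (by linarith) hu h2
  have hA := constA_pos hd hα hα'
  have hc := hardyConst_pos (d := d) (β := (d - α) / 2) hα (by linarith) (by linarith)
  have hpos : ENNReal.ofReal (2 * (hardyConst d α ((d - α) / 2) / constA d α)) ≠ 0 := by
    rw [Ne, ENNReal.ofReal_eq_zero, not_le]; positivity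
  refine ⟨((hu.pow_const 2).mul (measurable_norm_rpow _).aemeasurable).aestronglyMeasurable, ?_⟩
  rw [hasFiniteIntegral_iff_ofReal (Eventually.of_forall fun x => by positivity)]
  by_contra htop
  rw [not_lt, top_le_iff] at htop
  rw [htop, ENNReal.mul_top hpos, top_le_iff] at h
  exact hE.ne h

namespace SymmForm

/-! ### Abstract symmetric forms -/

section Hilbert

variable {H K : Type*} [NormedAddCommGroup H] [InnerProductSpace ℝ H] [NormedAddCommGroup K]
  [InnerProductSpace ℝ K]

theorem form_add_add (a : SymmForm H) (x y : a.dom) :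
    a.form (x + y) (x + y) = a.form x x + 2 * a.form x y + a.form y y := by
  simp only [map_add, LinearMap.add_apply]
  rw [a.symm y x]
  ring

theorem form_sub_sub (a : SymmForm H) (x y : a.dom) :
    a.form (x - y) (x - y) = a.form x x - 2 * a.form x y + a.form y y := by
  simp only [map_sub, LinearMap.sub_apply]
  rw [a.symm y x]
  ring

theorem form_smul_smul (a : SymmForm H) (c : ℝ) (x : a.dom) :
    a.form (c • x) (c • x) = c ^ 2 * a.form x x := by
  simp only [map_smul, LinearMap.smul_apply, smul_eq_mul]
  ring

/-- Young's inequality, read off from a[δx - y] ≥ 0. A small δ keeps the constant in front of a[x]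
close to 1, which sharp limits of form values require. -/
theorem form_add_le (a : SymmForm H) {δ : ℝ} (hδ : 0 < δ) (x y : a.dom) :
    a.form (x + y) (x + y) ≤ (1 + δ) * a.form x x + (1 + δ⁻¹) * a.form y y := by
  have h := a.nonneg (δ • x - y)
  rw [form_sub_sub, form_smul_smul, map_smul, LinearMap.smul_apply, smul_eq_mul] at h
  rw [form_add_add]
  have h2 := mul_nonneg (inv_nonneg.2 hδ.le) h
  have e : δ⁻¹ * (δ ^ 2 * a.form x x - 2 * (δ * a.form x y) + a.form y y) =
      δ * a.form x x - 2 * a.form x y + δ⁻¹ * a.form y y := by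
    field_simp
  linarith

theorem form_add_le_two (a : SymmForm H) (x y : a.dom) :
    a.form (x + y) (x + y) ≤ 2 * a.form x x + 2 * a.form y y := by
  have h := form_add_le a one_pos x y
  rw [inv_one] at h
  linarith

theorem form_sub_comm (a : SymmForm H) (x y : a.dom) :
    a.form (x - y) (x - y) = a.form (y - x) (y - x) := by
  rw [form_sub_sub, form_sub_sub, a.symm x y]
  ring

/-- Restriction of a form to a smaller domain. -/
def restrict (a : SymmForm H) (D : Submodule ℝ H) (h : D ≤ a.dom) : SymmForm H where
  dom := D
  form := a.form.compl₁₂ (Submodule.inclusion h) (Submodule.inclusion h)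
  symm _ _ := a.symm _ _
  nonneg _ := a.nonneg _

/-- Pullback of a form along a linear map. -/
def comap (U : H →ₗ[ℝ] K) (a : SymmForm K) : SymmForm H where
  dom := a.dom.comap U
  form := a.form.compl₁₂ (U.submoduleComap a.dom) (U.submoduleComap a.dom)
  symm _ _ := a.symm _ _
  nonneg _ := a.nonneg _

/-- The linear map induced on the domains by a pullback of forms. -/
def comapDom (U : H →ₗ[ℝ] K) (a : SymmForm K) : (a.comap U).dom →ₗ[ℝ] a.dom :=
  U.submoduleComap a.dom

theorem IsClosed.comap {a : SymmForm K} (ha : a.IsClosed) (U : H →ₗᵢ[ℝ] K) :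
    (a.comap U.toLinearMap).IsClosed := by
  intro u f hu hf
  obtain ⟨g, hg, hlim⟩ := ha (fun n => comapDom U.toLinearMap a (u n)) (U f)
    (fun ε hε => by
      obtain ⟨N, hN⟩ := hu ε hε
      refine ⟨N, fun m hm n hn => ?_⟩
      dsimp only
      rw [← map_sub]
      exact hN m hm n hn) ((U.continuous.tendsto f).comp hf)
  have hfd : f ∈ (a.comap U.toLinearMap).dom := by
    change U f ∈ a.dom
    rw [← hg]
    exact g.2
  refine ⟨⟨f, hfd⟩, rfl, ?_⟩
  have e : g = comapDom U.toLinearMap a ⟨f, hfd⟩ := Subtype.ext hg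
  rw [e] at hlim
  refine hlim.congr fun n => ?_
  rw [← map_sub]
  rfl

theorem IsClosed.isClosable {a : SymmForm H} (ha : a.IsClosed) : a.IsClosable := by
  intro u hu h0
  obtain ⟨g, hg, hlim⟩ := ha u 0 hu h0
  have e : g = 0 := Subtype.ext hg
  simpa [e] using hlim

theorem IsClosed.isClosureOf_self {a : SymmForm H} (ha : a.IsClosed) : a.IsClosureOf a := by
  refine ⟨ha, ⟨le_rfl, fun f g => rfl⟩, fun f ε hε => ⟨f, f.2, ?_⟩⟩
  simpa using hε

theorem IsClosed.isClosable_restrict {b : SymmForm H} (hb : b.IsClosed) (D : Submodule ℝ H)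
    (h : D ≤ b.dom) : (b.restrict D h).IsClosable := by
  intro u hu h0
  exact hb.isClosable (fun n => Submodule.inclusion h (u n)) hu h0

/-- The form-norm closure of a subspace of the domain of a form. -/
def closureDom (b : SymmForm H) (D : Submodule ℝ H) (h : D ≤ b.dom) : Submodule ℝ H where
  carrier := {f | ∃ hf : f ∈ b.dom, ∀ ε > 0, ∃ g : D,
    b.form (⟨f, hf⟩ - Submodule.inclusion h g) (⟨f, hf⟩ - Submodule.inclusion h g) +
      ‖f - g‖ ^ 2 < ε}
  zero_mem' := ⟨b.dom.zero_mem, fun ε hε => ⟨0, by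
    have e : (⟨0, b.dom.zero_mem⟩ - Submodule.inclusion h 0 : b.dom) = 0 := by
      apply Subtype.ext; simp
    rw [e]
    simpa using hε⟩⟩
  add_mem' := by
    rintro x y ⟨hx, hx'⟩ ⟨hy, hy'⟩
    refine ⟨b.dom.add_mem hx hy, fun ε hε => ?_⟩
    obtain ⟨g, hg⟩ := hx' (ε / 4) (by positivity)
    obtain ⟨k, hk⟩ := hy' (ε / 4) (by positivity)
    refine ⟨g + k, ?_⟩
    have e : (⟨x + y, b.dom.add_mem hx hy⟩ - Submodule.inclusion h (g + k) : b.dom) =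
        (⟨x, hx⟩ - Submodule.inclusion h g) + (⟨y, hy⟩ - Submodule.inclusion h k) := by
      apply Subtype.ext
      simp only [Submodule.coe_sub, Submodule.coe_add, Submodule.coe_inclusion]
      abel
    rw [e]
    have e2 : x + y - ((g + k : D) : H) = (x - g) + (y - k) := by
      rw [Submodule.coe_add]; abel
    rw [e2]
    have h1 := form_add_le_two b (⟨x, hx⟩ - Submodule.inclusion h g)
      (⟨y, hy⟩ - Submodule.inclusion h k)
    have h2 := norm_add_le (x - g) (y - k)
    have h3 := pow_le_pow_left₀ (norm_nonneg _) h2 2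
    nlinarith [sq_nonneg (‖x - g‖ - ‖y - k‖)]
  smul_mem' := by
    rintro c x ⟨hx, hx'⟩
    refine ⟨b.dom.smul_mem c hx, fun ε hε => ?_⟩
    obtain ⟨g, hg⟩ := hx' (ε / (c ^ 2 + 1)) (by positivity)
    refine ⟨c • g, ?_⟩
    have e : (⟨c • x, b.dom.smul_mem c hx⟩ - Submodule.inclusion h (c • g) : b.dom) =
        c • (⟨x, hx⟩ - Submodule.inclusion h g) := by
      apply Subtype.ext
      simp [smul_sub]
    have e2 : c • x - ((c • g : D) : H) = c • (x - g) := by simp [smul_sub]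
    rw [e, e2, form_smul_smul, norm_smul, mul_pow, Real.norm_eq_abs, sq_abs, ← mul_add]
    rw [lt_div_iff₀ (by positivity)] at hg
    have h1 := b.nonneg (⟨x, hx⟩ - Submodule.inclusion h g)
    nlinarith [sq_nonneg ‖x - (g : H)‖]

theorem closureDom_le (b : SymmForm H) (D : Submodule ℝ H) (h : D ≤ b.dom) :
    b.closureDom D h ≤ b.dom := fun _ hf => hf.1

theorem le_closureDom (b : SymmForm H) (D : Submodule ℝ H) (h : D ≤ b.dom) :
    D ≤ b.closureDom D h := fun f hf => ⟨h hf, fun ε hε => ⟨⟨f, hf⟩, by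
  have e : (⟨f, h hf⟩ - Submodule.inclusion h ⟨f, hf⟩ : b.dom) = 0 := by
    apply Subtype.ext; simp
  rw [e]
  simpa using hε⟩⟩

/-- The closure of the restriction of a closed form `b` to a subspace `D` of its domain. -/
def closureOn (b : SymmForm H) (D : Submodule ℝ H) (h : D ≤ b.dom) : SymmForm H :=
  b.restrict (b.closureDom D h) (b.closureDom_le D h)

/-- The limit supplied by closedness of `b` is approximated first by some `u n` and then by an
element of `D`, so it stays in the form closure of `D`. -/
theorem IsClosed.isClosureOf_closureOn {b : SymmForm H} (hb : b.IsClosed) (D : Submodule ℝ H)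
    (h : D ≤ b.dom) : (b.closureOn D h).IsClosureOf (b.restrict D h) := by
  refine ⟨?_, ⟨b.le_closureDom D h, fun f g => rfl⟩, ?_⟩
  · intro u f hu hf
    obtain ⟨g, hg, hlim⟩ := hb (fun n => Submodule.inclusion (b.closureDom_le D h) (u n)) f hu hf
    have hfd : f ∈ b.closureDom D h := by
      refine ⟨hg ▸ g.2, fun ε hε => ?_⟩
      have hlim2 : Tendsto (fun n => ‖f - u n‖ ^ 2) atTop (𝓝 0) := by
        have := ((tendsto_const_nhds (x := f)).sub hf).norm.pow 2
        simpa using this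
      obtain ⟨n, hn1, hn2⟩ := ((hlim.eventually (gt_mem_nhds (show 0 < ε / 8 by positivity))).and
        (hlim2.eventually (gt_mem_nhds (show 0 < ε / 8 by positivity)))).exists
      obtain ⟨hx, hx'⟩ := (u n).2
      obtain ⟨k, hk⟩ := hx' (ε / 8) (by positivity)
      refine ⟨k, ?_⟩
      subst hg
      have e : (⟨(g : H), g.2⟩ - Submodule.inclusion h k : b.dom) =
          (g - Submodule.inclusion (b.closureDom_le D h) (u n)) +
          (⟨(u n : H), hx⟩ - Submodule.inclusion h k) := by
        apply Subtype.ext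
        exact (sub_add_sub_cancel (g : H) (u n) k).symm
      have e2 : (g : H) - k = (g - u n) + (u n - k) := (sub_add_sub_cancel _ _ _).symm
      have h1 := form_add_le_two b (g - Submodule.inclusion (b.closureDom_le D h) (u n))
        (⟨(u n : H), hx⟩ - Submodule.inclusion h k)
      rw [form_sub_comm b g] at h1
      have h2 := norm_add_le ((g : H) - u n) (u n - k)
      have h3 := pow_le_pow_left₀ (norm_nonneg _) h2 2
      rw [← e2] at h3
      rw [e]
      have h4 := b.nonneg (⟨(u n : H), hx⟩ - Submodule.inclusion h k)
      nlinarith [sq_nonneg (‖(g : H) - u n‖ - ‖(u n : H) - k‖), sq_nonneg ‖(u n : H) - k‖]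
    refine ⟨⟨f, hfd⟩, rfl, ?_⟩
    have e : g = Submodule.inclusion (b.closureDom_le D h) ⟨f, hfd⟩ := Subtype.ext hg
    rw [e] at hlim
    exact hlim
  · intro f ε hε
    obtain ⟨hf, hf'⟩ := f.2
    obtain ⟨g, hg⟩ := hf' ε hε
    exact ⟨⟨g, b.le_closureDom D h g.2⟩, g.2, hg⟩

/-- Lower semicontinuity of closed forms. -/
theorem IsClosed.exists_of_tendsto_of_le {a : SymmForm H} (ha : a.IsClosed) {u : ℕ → a.dom} {f : H}
    (hf : Tendsto (fun n => (u n : H)) atTop (𝓝 f)) {M : ℝ} (hM : ∀ n, a.form (u n) (u n) ≤ M) :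
    ∃ g : a.dom, (g : H) = f ∧ a.form g g ≤ M := by
  -- Near-minimisers of the form over the convex hulls of the tails replace weak compactness. They
  -- are form-Cauchy because the infima increase to a finite limit, and they converge to `f` in norm
  -- because balls are convex.
  set C : ℕ → Set a.dom := fun N => convexHull ℝ (u '' Set.Ici N) with hC
  have hCm : ∀ m n, m ≤ n → C n ⊆ C m := fun m n hmn =>
    convexHull_mono (Set.image_mono (Set.Ici_subset_Ici.2 hmn))
  have huC : ∀ n, u n ∈ C n := fun n =>
    subset_convexHull ℝ _ (Set.mem_image_of_mem _ Set.self_mem_Ici)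
  set δ : ℕ → ℝ := fun N => sInf ((fun x => a.form x x) '' C N) with hδ
  have hbdd : ∀ N, BddBelow ((fun x => a.form x x) '' C N) := fun N =>
    ⟨0, by rintro _ ⟨x, -, rfl⟩; exact a.nonneg x⟩
  have hne : ∀ N, ((fun x => a.form x x) '' C N).Nonempty := fun N => ⟨_, u N, huC N, rfl⟩
  have hδle : ∀ N x, x ∈ C N → δ N ≤ a.form x x := fun N x hx => csInf_le (hbdd N) ⟨x, hx, rfl⟩
  have hδmono : Monotone δ := fun m n hmn =>
    csInf_le_csInf (hbdd m) (hne n) (Set.image_mono (hCm m n hmn))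
  have hδM : ∀ N, δ N ≤ M := fun N => (hδle N _ (huC N)).trans (hM N)
  have hlimδ : Tendsto δ atTop (𝓝 (⨆ N, δ N)) :=
    tendsto_atTop_ciSup hδmono ⟨M, by rintro _ ⟨N, rfl⟩; exact hδM N⟩
  have hex : ∀ N : ℕ, ∃ x ∈ C N, a.form x x < δ N + 1 / ((N : ℝ) + 1) := by
    intro N
    obtain ⟨_, ⟨x, hx, rfl⟩, hlt⟩ := exists_lt_of_csInf_lt (hne N)
      (show δ N < δ N + 1 / ((N : ℝ) + 1) by
        have : 0 < 1 / ((N : ℝ) + 1) := by positivity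
        linarith)
    exact ⟨x, hx, hlt⟩
  choose g hgC hg using hex
  -- Parallelogram law: the midpoint lies in `C n`, so its form value is at least `δ n`.
  have hkey : ∀ m n, n ≤ m → a.form (g m - g n) (g m - g n) ≤
      2 * (δ m - δ n) + 2 * (1 / ((n : ℝ) + 1)) + 2 * (1 / ((m : ℝ) + 1)) := by
    intro m n hnm
    have hmid : (1 / 2 : ℝ) • g m + (1 / 2 : ℝ) • g n ∈ C n :=
      (convex_convexHull ℝ _) (hCm n m hnm (hgC m)) (hgC n) (by norm_num) (by norm_num)
        (by norm_num)
    have h1 := hδle n _ hmid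
    rw [← smul_add, form_smul_smul, form_add_add] at h1
    rw [form_sub_sub]
    have h2 := hg m
    have h3 := hg n
    linarith
  have hone : Tendsto (fun n : ℕ => 1 / ((n : ℝ) + 1)) atTop (𝓝 0) :=
    tendsto_one_div_add_atTop_nhds_zero_nat
  have hcau : a.IsFormCauchy g := by
    intro ε hε
    obtain ⟨N1, hN1⟩ := eventually_atTop.1 (hone.eventually (gt_mem_nhds
      (show 0 < ε / 8 by positivity)))
    obtain ⟨N2, hN2⟩ := Metric.cauchySeq_iff.1 hlimδ.cauchySeq (ε / 8) (by positivity)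
    refine ⟨max N1 N2, fun m hm n hn => ?_⟩
    have a1 := hN1 m (le_of_max_le_left hm)
    have a2 := hN1 n (le_of_max_le_left hn)
    have a3 := hN2 m (le_of_max_le_right hm) n (le_of_max_le_right hn)
    rw [Real.dist_eq, abs_lt] at a3
    rcases le_total n m with h | h
    · have := hkey m n h
      linarith
    · have := hkey n m h
      rw [form_sub_comm]
      linarith
  have hgf : Tendsto (fun n => (g n : H)) atTop (𝓝 f) := by
    rw [Metric.tendsto_atTop] at hf ⊢
    intro ε hε
    obtain ⟨N, hN⟩ := hf ε hε
    refine ⟨N, fun n hn => ?_⟩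
    have hsub : C n ⊆ a.dom.subtype ⁻¹' Metric.ball f ε := by
      refine convexHull_min ?_ ((convex_ball f ε).linear_preimage a.dom.subtype)
      rintro _ ⟨k, hk, rfl⟩
      exact hN k (hn.trans hk)
    exact hsub (hgC n)
  obtain ⟨g₀, hg₀, hlim⟩ := ha g f hcau hgf
  refine ⟨g₀, hg₀, ?_⟩
  -- Young's inequality with parameter η, then n → ∞, and afterwards η → 0 to reach the exact bound.
  have hle : ∀ η : ℝ, 0 < η → a.form g₀ g₀ ≤ (1 + η) * M := by
    intro η hη
    have ht : Tendsto (fun n : ℕ => (1 + η) * (M + 1 / ((n : ℝ) + 1)) +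
        (1 + η⁻¹) * a.form (g n - g₀) (g n - g₀)) atTop (𝓝 ((1 + η) * (M + 0) + (1 + η⁻¹) * 0)) :=
      ((hone.const_add M).const_mul _).add (hlim.const_mul _)
    rw [mul_zero, add_zero, add_zero] at ht
    refine ge_of_tendsto' ht fun n => ?_
    have h1 := form_add_le a hη (g n) (g₀ - g n)
    rw [add_sub_cancel, form_sub_comm a g₀] at h1
    have h2 := (hg n).le.trans (add_le_add_left (hδM n) _)
    have h3 : (0 : ℝ) ≤ 1 + η := by positivity
    have := mul_le_mul_of_nonneg_left h2 h3
    linarith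
  have ht : Tendsto (fun n : ℕ => (1 + 1 / ((n : ℝ) + 1)) * M) atTop (𝓝 ((1 + 0) * M)) :=
    (hone.const_add 1).mul_const M
  rw [add_zero, one_mul] at ht
  exact ge_of_tendsto' ht fun n => hle _ (by positivity)

end Hilbert

section Lebesgue

variable {X : Type*} [MeasurableSpace X] {μ : Measure X}

/-- The operation `f ↦ (0 ∨ f) ∧ 1` on `L²`. -/
def unitContraction (f : Lp ℝ 2 μ) : Lp ℝ 2 μ :=
  LipschitzWith.compLp (c := 1) (g := fun s : ℝ => min (max 0 s) 1)
    ((LipschitzWith.id.const_max 0).min_const 1) (by simp) f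

theorem coeFn_unitContraction (f : Lp ℝ 2 μ) :
    (unitContraction f : X → ℝ) =ᵐ[μ] fun x => min (max 0 (f x)) 1 :=
  LipschitzWith.coeFn_compLp _ _ f

theorem continuous_unitContraction : Continuous (unitContraction : Lp ℝ 2 μ → Lp ℝ 2 μ) :=
  LipschitzWith.continuous_compLp (c := 1) (g := fun s : ℝ => min (max 0 s) 1)
    ((LipschitzWith.id.const_max 0).min_const 1) (by simp)

/-- The closure of a densely defined Markovian form is a Dirichlet form. -/
theorem IsClosureOf.isDirichletForm {a b : SymmForm (Lp ℝ 2 μ)} (h : b.IsClosureOf a)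
    (hdense : Dense (a.dom : Set (Lp ℝ 2 μ)))
    (hmarkov : ∀ f : a.dom, ∃ g : a.dom, (g : Lp ℝ 2 μ) = unitContraction (f : Lp ℝ 2 μ) ∧
      a.form g g ≤ a.form f f) : b.IsDirichletForm := by
  obtain ⟨hcl, ⟨hle, hext⟩, happ⟩ := h
  refine ⟨hdense.mono hle, hcl, fun f => ?_⟩
  have hone : Tendsto (fun n : ℕ => 1 / ((n : ℝ) + 1)) atTop (𝓝 0) :=
    tendsto_one_div_add_atTop_nhds_zero_nat
  choose k hka hk using fun n : ℕ => happ f (1 / ((n : ℝ) + 1)) (by positivity)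
  have hkn : ∀ n, ‖(f : Lp ℝ 2 μ) - k n‖ ^ 2 ≤ 1 / ((n : ℝ) + 1) := fun n => by
    have := b.nonneg (f - k n)
    linarith [hk n]
  have hkf : ∀ n, b.form (f - k n) (f - k n) ≤ 1 / ((n : ℝ) + 1) := fun n => by
    linarith [hk n, sq_nonneg ‖(f : Lp ℝ 2 μ) - k n‖]
  have hlimk : Tendsto (fun n => (k n : Lp ℝ 2 μ)) atTop (𝓝 f) := by
    rw [tendsto_iff_norm_sub_tendsto_zero]
    have h1 : Tendsto (fun n => ‖(f : Lp ℝ 2 μ) - k n‖ ^ 2) atTop (𝓝 0) :=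
      squeeze_zero (fun n => by positivity) hkn hone
    have h2 := h1.sqrt
    simp only [Real.sqrt_zero, Real.sqrt_sq (norm_nonneg _)] at h2
    simpa only [norm_sub_rev] using h2
  choose g hg hgle using fun n => hmarkov ⟨k n, hka n⟩
  have hgb : ∀ n, b.form (Submodule.inclusion hle (g n)) (Submodule.inclusion hle (g n)) ≤
      b.form (k n) (k n) := fun n => by
    rw [hext]
    refine (hgle n).trans ?_
    rw [← hext]
    exact le_rfl
  have hglim : Tendsto (fun n => (g n : Lp ℝ 2 μ)) atTop (𝓝 (unitContraction f)) := by
    simp only [hg]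
    exact (continuous_unitContraction.tendsto _).comp hlimk
  -- The contractions of the approximants converge in L² since the operation is Lipschitz. Only the
  -- tail beyond `N` is used, where the approximation error costs at most η; lower semicontinuity
  -- then passes the bound to the limit. The element found does not depend on η, so η → 0 is allowed
  -- at the end.
  have hM : ∀ η : ℝ, 0 < η → ∃ G : b.dom, (G : Lp ℝ 2 μ) = unitContraction (f : Lp ℝ 2 μ) ∧
      b.form G G ≤ (1 + η) * b.form f f + η := by
    intro η hη
    obtain ⟨N, hN⟩ := eventually_atTop.1 ((hone.const_mul (1 + η⁻¹)).eventually (gt_mem_nhds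
      (show (1 + η⁻¹) * 0 < η by simpa using hη)))
    refine hcl.exists_of_tendsto_of_le
      (u := fun n => Submodule.inclusion hle (g (n + N)))
      ((tendsto_add_atTop_iff_nat (f := fun n => (g n : Lp ℝ 2 μ)) N).2 hglim) fun n => ?_
    refine (hgb (n + N)).trans ?_
    have h1 := form_add_le b hη f (k (n + N) - f)
    rw [add_sub_cancel, form_sub_comm] at h1
    have h2 := hN (n + N) (Nat.le_add_left _ _)
    have h3 := mul_le_mul_of_nonneg_left (hkf (n + N)) (show 0 ≤ 1 + η⁻¹ by positivity)
    linarith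
  obtain ⟨G, hG, -⟩ := hM 1 one_pos
  refine ⟨G, ?_, ?_⟩
  · rw [hG]
    exact coeFn_unitContraction _
  · have hGle : ∀ n : ℕ, b.form G G ≤
        (1 + 1 / ((n : ℝ) + 1)) * b.form f f + 1 / ((n : ℝ) + 1) := by
      intro n
      obtain ⟨G', hG', hle'⟩ := hM (1 / ((n : ℝ) + 1)) (by positivity)
      have : G' = G := Subtype.ext (hG'.trans hG.symm)
      rwa [this] at hle'
    have ht : Tendsto (fun n : ℕ => (1 + 1 / ((n : ℝ) + 1)) * b.form f f + 1 / ((n : ℝ) + 1)) atTop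
        (𝓝 ((1 + 0) * b.form f f + 0)) := ((hone.const_add 1).mul_const _).add hone
    simp only [add_zero, one_mul] at ht
    exact ge_of_tendsto' ht hGle

/-- Regularity of the closure of a form, from density of `C_c(Ω)` in the original domain. -/
theorem IsClosureOf.isRegular [TopologicalSpace X] {a b : SymmForm (Lp ℝ 2 μ)}
    (h : b.IsClosureOf a) {Ω : Set X}
    (h1 : ∀ f : a.dom, ∀ ε > 0, ∃ φ : X → ℝ, IsCc Ω φ ∧
      ∃ g : a.dom, (((g : Lp ℝ 2 μ) : X → ℝ) =ᵐ[μ] φ) ∧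
        a.form (f - g) (f - g) + ‖(f : Lp ℝ 2 μ) - g‖ ^ 2 < ε)
    (h2 : ∀ φ : X → ℝ, IsCc Ω φ → ∀ ε > 0, ∃ ψ : X → ℝ, IsCc Ω ψ ∧
      (∃ g : b.dom, ((g : Lp ℝ 2 μ) : X → ℝ) =ᵐ[μ] ψ) ∧ ∀ x, |φ x - ψ x| < ε) :
    b.IsRegular Ω := by
  obtain ⟨hcl, ⟨hle, hext⟩, happ⟩ := h
  refine ⟨fun f ε hε => ?_, h2⟩
  obtain ⟨k, hka, hk⟩ := happ f (ε / 4) (by positivity)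
  obtain ⟨φ, hφ, g, hg, hfg⟩ := h1 ⟨k, hka⟩ (ε / 4) (by positivity)
  refine ⟨φ, hφ, Submodule.inclusion hle g, hg, ?_⟩
  have e : f - Submodule.inclusion hle g =
      (f - k) + Submodule.inclusion hle (⟨k, hka⟩ - g) := by
    apply Subtype.ext
    simp
  have e2 : (f : Lp ℝ 2 μ) - (Submodule.inclusion hle g : b.dom) = (f - k) + (k - g) := by
    rw [Submodule.coe_inclusion]
    abel
  have i1 := form_add_le_two b (f - k) (Submodule.inclusion hle (⟨k, hka⟩ - g))
  rw [hext] at i1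
  have i2 := norm_add_le ((f : Lp ℝ 2 μ) - k) (k - g)
  have i3 := pow_le_pow_left₀ (norm_nonneg _) i2 2
  rw [e, e2]
  nlinarith [sq_nonneg (‖(f : Lp ℝ 2 μ) - k‖ - ‖(k : Lp ℝ 2 μ) - g‖)]

end Lebesgue

end SymmForm

/-! ### The norm of `W^{α/2,2}` -/

theorem wE_const_mul (α β c : ℝ) (u : Eu d → ℝ) :
    wE α β (fun x => c * u x) = ENNReal.ofReal (c ^ 2) * wE α β u := by
  rw [wE, wE, ← lintegral_const_mul' _ _ ENNReal.ofReal_ne_top]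
  refine lintegral_congr fun z => ?_
  rw [← ENNReal.ofReal_mul (sq_nonneg c)]
  congr 1
  rw [weightedKernel_eq, weightedKernel_eq]
  ring

theorem wE_add_le (α β : ℝ) {u v : Eu d → ℝ} (hu : AEMeasurable u) :
    wE α β (fun x => u x + v x) ≤ 2 * wE α β u + 2 * wE α β v := by
  rw [wE, wE, wE, ← lintegral_const_mul' _ _ (by simp), ← lintegral_const_mul' _ _ (by simp),
    ← lintegral_add_left' ((aemeasurable_weightedKernel α β hu).ennreal_ofReal.const_mul _)]
  refine lintegral_mono fun z => ?_
  have e : (2 : ℝ≥0∞) = ENNReal.ofReal 2 := by simp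
  have h1 := weightedKernel_nonneg α β u z
  have h2 := weightedKernel_nonneg α β v z
  rw [e, ← ENNReal.ofReal_mul (by norm_num), ← ENNReal.ofReal_mul (by norm_num),
    ← ENNReal.ofReal_add (by positivity) (by positivity)]
  refine ENNReal.ofReal_le_ofReal ?_
  simp only [weightedKernel_eq]
  have h3 := levy_nonneg α (z.1 - z.2)
  have h4 := weight_nonneg β z.1
  have h5 := weight_nonneg β z.2
  have h6 : (u z.1 + v z.1 - (u z.2 + v z.2)) ^ 2 ≤
      2 * (u z.1 - u z.2) ^ 2 + 2 * (v z.1 - v z.2) ^ 2 := by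
    nlinarith [sq_nonneg ((u z.1 - u z.2) - (v z.1 - v z.2))]
  calc _ ≤ (2 * (u z.1 - u z.2) ^ 2 + 2 * (v z.1 - v z.2) ^ 2) * levy α (z.1 - z.2) *
        weight β z.1 * weight β z.2 := by gcongr
    _ = _ := by ring

theorem lintegral_sq_add_le {u v : Eu d → ℝ} (hu : AEMeasurable u) :
    ∫⁻ x, ENNReal.ofReal ((u x + v x) ^ 2) ≤
      2 * (∫⁻ x, ENNReal.ofReal (u x ^ 2)) + 2 * ∫⁻ x, ENNReal.ofReal (v x ^ 2) := by
  rw [← lintegral_const_mul' _ _ (by simp), ← lintegral_const_mul' _ _ (by simp),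
    ← lintegral_add_left' ((hu.pow_const 2).ennreal_ofReal.const_mul _)]
  refine lintegral_mono fun z => ?_
  have e : (2 : ℝ≥0∞) = ENNReal.ofReal 2 := by simp
  rw [e, ← ENNReal.ofReal_mul (by norm_num), ← ENNReal.ofReal_mul (by norm_num),
    ← ENNReal.ofReal_add (by positivity) (by positivity)]
  refine ENNReal.ofReal_le_ofReal ?_
  nlinarith [sq_nonneg (u z - v z)]

theorem lintegral_sq_const_mul (c : ℝ) (u : Eu d → ℝ) :
    ∫⁻ x, ENNReal.ofReal ((c * u x) ^ 2) =
      ENNReal.ofReal (c ^ 2) * ∫⁻ x, ENNReal.ofReal (u x ^ 2) := by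
  rw [← lintegral_const_mul' _ _ ENNReal.ofReal_ne_top]
  refine lintegral_congr fun x => ?_
  rw [← ENNReal.ofReal_mul (sq_nonneg c), mul_pow]

theorem wE_zero (α β : ℝ) : wE α β (fun _ : Eu d => (0 : ℝ)) = 0 := by
  simp [wE, weightedKernel]

/-- The square of the norm of `W^{α/2,2}(ℝ^d)`, with values in `[0, ∞]`. -/
def energyOne (α : ℝ) (u : Eu d → ℝ) : ℝ≥0∞ :=
  ENNReal.ofReal (constA d α / 2) * wE α 0 u + ∫⁻ x, ENNReal.ofReal (u x ^ 2)

theorem energyOne_congr (α : ℝ) {u v : Eu d → ℝ} (h : u =ᵐ[volume] v) :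
    energyOne α u = energyOne α v := by
  rw [energyOne, energyOne, wE_congr α 0 h]
  congr 1
  exact lintegral_congr_ae (h.mono fun x hx => by simp only [hx])

theorem energyOne_add_le (α : ℝ) {u v : Eu d → ℝ} (hu : AEMeasurable u) :
    energyOne α (fun x => u x + v x) ≤ 2 * energyOne α u + 2 * energyOne α v := by
  refine (add_le_add (mul_le_mul_right (wE_add_le α 0 hu) _) (lintegral_sq_add_le hu)).trans
    (le_of_eq ?_)
  unfold energyOne
  ring

theorem energyOne_const_mul (α c : ℝ) (u : Eu d → ℝ) :
    energyOne α (fun x => c * u x) = ENNReal.ofReal (c ^ 2) * energyOne α u := by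
  rw [energyOne, energyOne, wE_const_mul, lintegral_sq_const_mul]
  ring

theorem energyOne_neg (α : ℝ) (u : Eu d → ℝ) : energyOne α (fun x => -u x) = energyOne α u := by
  have := energyOne_const_mul α (-1) u
  simpa using this

theorem energyOne_zero (α : ℝ) : energyOne α (fun _ : Eu d => (0 : ℝ)) = 0 := by
  simp [energyOne, wE_zero]

theorem energyOne_mono (α : ℝ) {u v : Eu d → ℝ} (h : ∀ x y, |u x - u y| ≤ |v x - v y|)
    (h' : ∀ x, |u x| ≤ |v x|) : energyOne α u ≤ energyOne α v :=
  add_le_add (mul_le_mul_right (wE_mono α 0 h) _)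
    (lintegral_mono fun x => ENNReal.ofReal_le_ofReal (sq_le_sq.2 (h' x)))

theorem energyOne_sub_triangle (α : ℝ) {u v w : Eu d → ℝ} (hu : AEMeasurable u)
    (hv : AEMeasurable v) :
    energyOne α (fun x => u x - w x) ≤
      2 * energyOne α (fun x => u x - v x) + 2 * energyOne α (fun x => v x - w x) := by
  have := energyOne_add_le α (u := fun x => u x - v x) (v := fun x => v x - w x) (hu.sub hv)
  simpa using this

theorem energyOne_sub_comm (α : ℝ) (u v : Eu d → ℝ) :
    energyOne α (fun x => u x - v x) = energyOne α (fun x => v x - u x) := by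
  rw [← energyOne_neg]
  simp

theorem aemeasurable_of_memW {α : ℝ} {u : Eu d → ℝ} (h : MemW α u) : AEMeasurable u :=
  h.1.1.aemeasurable

theorem integrable_sq_iff {u : Eu d → ℝ} (hu : AEMeasurable u) :
    Integrable (fun x => u x ^ 2) ↔ ∫⁻ x, ENNReal.ofReal (u x ^ 2) < ∞ := by
  rw [Integrable, hasFiniteIntegral_iff_ofReal (Eventually.of_forall fun x => sq_nonneg (u x))]
  exact and_iff_right (hu.pow_const 2).aestronglyMeasurable

theorem memW_iff' (α : ℝ) {u : Eu d → ℝ} (hu : AEMeasurable u) :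
    MemW α u ↔ Integrable (fun x => u x ^ 2) ∧ wE α 0 u < ∞ := by
  have e : gagliardoKernel α u = weightedKernel α 0 u :=
    funext fun z => (weightedKernel_zero α u z).symm
  rw [MemW, memLp_two_iff_integrable_sq hu.aestronglyMeasurable, e,
    integrable_weightedKernel_iff α 0 hu]

theorem memW_iff (hd : 0 < d) {α : ℝ} (hα : 0 < α) (hα' : α < 2) {u : Eu d → ℝ}
    (hu : AEMeasurable u) : MemW α u ↔ energyOne α u < ∞ := by
  have hA := constA_pos hd hα hα'
  rw [memW_iff' α hu, integrable_sq_iff hu, energyOne, ENNReal.add_lt_top,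
    ENNReal.mul_lt_top_iff]
  have h1 : ENNReal.ofReal (constA d α / 2) ≠ 0 := by
    rw [Ne, ENNReal.ofReal_eq_zero, not_le]; positivity
  simp only [ENNReal.ofReal_lt_top, true_and, h1, false_or]
  constructor
  · rintro ⟨h, h'⟩
    exact ⟨Or.inl h', h⟩
  · rintro ⟨h | h, h'⟩
    · exact ⟨h', h⟩
    · exact ⟨h', h ▸ ENNReal.zero_lt_top⟩

theorem energy_eq (α : ℝ) {u : Eu d → ℝ} (hu : AEMeasurable u) :
    energy α u = constA d α / 2 * (wE α 0 u).toReal := by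
  have e : gagliardoKernel α u = weightedKernel α 0 u :=
    funext fun z => (weightedKernel_zero α u z).symm
  rw [energy, e, integral_weightedKernel α 0 hu]

theorem lintegral_sq_eq {u : Eu d → ℝ} (h : Integrable fun x => u x ^ 2) :
    ENNReal.ofReal (∫ x, u x ^ 2) = ∫⁻ x, ENNReal.ofReal (u x ^ 2) :=
  ofReal_integral_eq_lintegral_ofReal h (Eventually.of_forall fun x => sq_nonneg (u x))

theorem ofReal_energy_add (hd : 0 < d) {α : ℝ} (hα : 0 < α) (hα' : α < 2) {u : Eu d → ℝ}
    (h : MemW α u) : ENNReal.ofReal (energy α u + ∫ x, u x ^ 2) = energyOne α u := by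
  have hu := aemeasurable_of_memW h
  obtain ⟨h1, h2⟩ := (memW_iff' α hu).1 h
  have hA := constA_pos hd hα hα'
  rw [energy_eq α hu, ENNReal.ofReal_add (by positivity) (integral_nonneg fun x => sq_nonneg _),
    lintegral_sq_eq h1, ENNReal.ofReal_mul (by positivity), ENNReal.ofReal_toReal h2.ne, energyOne]

theorem memW_congr {α : ℝ} {u v : Eu d → ℝ} (h : u =ᵐ[volume] v) (hu : MemW α u) : MemW α v := by
  have hu' := aemeasurable_of_memW hu
  rw [memW_iff' α (hu'.congr h), ← wE_congr α 0 h]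
  rw [memW_iff' α hu'] at hu
  exact ⟨hu.1.congr (h.mono fun x hx => by simp only [hx]), hu.2⟩

/-! ### Capacity -/

theorem capacity_le (hd : 0 < d) {α : ℝ} (hα : 0 < α) (hα' : α < 2) {A U : Set (Eu d)}
    {u : Eu d → ℝ} (hu : AEMeasurable u) (hU : IsOpen U) (hAU : A ⊆ U)
    (h1 : ∀ᵐ x, x ∈ U → 1 ≤ u x) : capacity α A ≤ energyOne α u := by
  rcases eq_top_or_lt_top (energyOne α u) with h | h
  · rw [h]; exact le_top
  · have hW := (memW_iff hd hα hα' hu).2 h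
    rw [← ofReal_energy_add hd hα hα' hW]
    exact iInf₂_le u ⟨hW, U, hU, hAU, h1⟩

theorem capacity_mono (α : ℝ) {A B : Set (Eu d)} (h : A ⊆ B) : capacity α A ≤ capacity α B := by
  refine le_iInf₂ fun u hu => ?_
  obtain ⟨hW, U, hU, hBU, h1⟩ := hu
  exact iInf₂_le u ⟨hW, U, hU, h.trans hBU, h1⟩

theorem capacity_empty (hd : 0 < d) {α : ℝ} (hα : 0 < α) (hα' : α < 2) :
    capacity α (∅ : Set (Eu d)) = 0 := by
  refine le_antisymm ?_ bot_le
  have := capacity_le hd hα hα' (A := ∅) (U := ∅) (u := fun _ => 0) aemeasurable_const isOpen_empty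
    le_rfl (Eventually.of_forall fun x hx => absurd hx (Set.notMem_empty x))
  rwa [energyOne_zero] at this

theorem abs_unit_sub_unit_le (s t : ℝ) : |min (max 0 s) 1 - min (max 0 t) 1| ≤ |s - t| := by
  refine (abs_min_sub_min_le_max _ _ _ _).trans ?_
  rw [sub_self, abs_zero, max_eq_left (abs_nonneg _)]
  refine (abs_max_sub_max_le_max _ _ _ _).trans ?_
  rw [sub_self, abs_zero, max_eq_right (abs_nonneg _)]

theorem abs_unit_le (s : ℝ) : |min (max 0 s) 1| ≤ |s| := by
  have := abs_unit_sub_unit_le s 0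
  simpa using this

/-- Sets of small capacity have a nice potential of small energy. -/
theorem exists_potential (hd : 0 < d) {α : ℝ} (hα : 0 < α) (hα' : α < 2) {A : Set (Eu d)}
    {r : ℝ≥0∞} (h : capacity α A < r) :
    ∃ (e : Eu d → ℝ) (U : Set (Eu d)), Measurable e ∧ IsOpen U ∧ A ⊆ U ∧ (∀ x ∈ U, e x = 1) ∧
      (∀ x, 0 ≤ e x) ∧ (∀ x, e x ≤ 1) ∧ energyOne α e < r := by
  simp only [capacity, iInf_lt_iff] at h
  obtain ⟨f, ⟨hW, U, hU, hAU, h1⟩, hlt⟩ := h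
  rw [ofReal_energy_add hd hα hα' hW] at hlt
  classical
  have hf := aemeasurable_of_memW hW
  have hg0 : Measurable fun x => min (max 0 (hf.mk f x)) 1 :=
    (measurable_const.max hf.measurable_mk).min measurable_const
  -- Contracting to [0, 1] does not raise the energy. The competitor is at least 1 almost everywhere
  -- on `U`, so setting it to 1 at every point of `U` changes it only on a null set.
  refine ⟨U.piecewise (fun _ => 1) fun x => min (max 0 (hf.mk f x)) 1, U,
    measurable_const.piecewise hU.measurableSet hg0, hU, hAU, fun x hx => by simp [hx],
    fun x => ?_, fun x => ?_, ?_⟩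
  · by_cases hx : x ∈ U <;> simp [hx]
  · by_cases hx : x ∈ U <;> simp [hx]
  · refine lt_of_eq_of_lt (energyOne_congr α (v := fun x => min (max 0 (f x)) 1) ?_)
      ((energyOne_mono α (fun x y => abs_unit_sub_unit_le _ _) fun x => abs_unit_le _).trans_lt hlt)
    filter_upwards [hf.ae_eq_mk, h1] with x hx hx1
    by_cases hxU : x ∈ U
    · have := hx1 hxU
      simp [hxU, this]
    · simp [hxU, ← hx]

/-- A potential equal to 1 on an open neighbourhood has squared L² norm at least the volume of that
neighbourhood. Quasi-everywhere statements therefore hold almost everywhere. -/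
theorem volume_le_capacity (hd : 0 < d) {α : ℝ} (hα : 0 < α) (hα' : α < 2) (A : Set (Eu d)) :
    volume A ≤ capacity α A := by
  refine le_of_forall_gt fun r hr => ?_
  obtain ⟨e, U, he, hU, hAU, h1, -, -, hlt⟩ := exists_potential hd hα hα' hr
  refine lt_of_le_of_lt ((measure_mono hAU).trans ?_) hlt
  refine le_trans ?_ (le_add_left le_rfl : ∫⁻ x, ENNReal.ofReal (e x ^ 2) ≤ energyOne α e)
  calc volume U = ∫⁻ x in U, 1 := by simp
    _ = ∫⁻ x in U, ENNReal.ofReal (e x ^ 2) :=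
        setLIntegral_congr_fun hU.measurableSet fun x hx => by simp [h1 x hx]
    _ ≤ _ := setLIntegral_le_lintegral _ _

/-- Suprema are contractive: |sup a - sup b| ≤ sup |a - b|, and each |a i - b i|² is bounded by the
sum. Applied at pairs of points, this bounds the energy of a supremum of potentials by the sum of
their energies, which is what countable subadditivity needs. -/
theorem ofReal_sq_iSup_sub_le {a b : ℕ → ℝ} (ha : BddAbove (Set.range a))
    (hb : BddAbove (Set.range b)) :
    ENNReal.ofReal (((⨆ i, a i) - ⨆ i, b i) ^ 2) ≤ ∑' i, ENNReal.ofReal ((a i - b i) ^ 2) := by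
  rcases eq_top_or_lt_top (∑' i, ENNReal.ofReal ((a i - b i) ^ 2)) with h | h
  · rw [h]; exact le_top
  set S := ∑' i, ENNReal.ofReal ((a i - b i) ^ 2) with hS
  have hi : ∀ i, |a i - b i| ≤ Real.sqrt S.toReal := fun i => by
    refine Real.abs_le_sqrt ?_
    have := ENNReal.toReal_mono h.ne (ENNReal.le_tsum (f := fun i => ENNReal.ofReal ((a i - b i) ^ 2)) i)
    rwa [ENNReal.toReal_ofReal (sq_nonneg _)] at this
  have h1 : (⨆ i, a i) ≤ (⨆ i, b i) + Real.sqrt S.toReal := ciSup_le fun i => by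
    have := (abs_le.1 (hi i)).2
    linarith [le_ciSup hb i]
  have h2 : (⨆ i, b i) ≤ (⨆ i, a i) + Real.sqrt S.toReal := ciSup_le fun i => by
    have := (abs_le.1 (hi i)).1
    linarith [le_ciSup ha i]
  have h3 : |(⨆ i, a i) - ⨆ i, b i| ≤ Real.sqrt S.toReal := abs_le.2 ⟨by linarith, by linarith⟩
  rw [← ENNReal.ofReal_toReal h.ne]
  refine ENNReal.ofReal_le_ofReal ?_
  rw [← sq_abs]
  refine (pow_le_pow_left₀ (abs_nonneg _) h3 2).trans (le_of_eq (Real.sq_sqrt ENNReal.toReal_nonneg))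

theorem wE_le_tsum (α β : ℝ) {f : Eu d → ℝ} {u : ℕ → Eu d → ℝ} (hu : ∀ i, AEMeasurable (u i))
    (h : ∀ x y, ENNReal.ofReal ((f x - f y) ^ 2) ≤ ∑' i, ENNReal.ofReal ((u i x - u i y) ^ 2)) :
    wE α β f ≤ ∑' i, wE α β (u i) := by
  simp only [wE]
  rw [← lintegral_tsum fun i => (aemeasurable_weightedKernel α β (hu i)).ennreal_ofReal]
  refine lintegral_mono fun z => ?_
  have hw : 0 ≤ levy α (z.1 - z.2) * weight β z.1 * weight β z.2 :=
    mul_nonneg (mul_nonneg (levy_nonneg _ _) (weight_nonneg _ _)) (weight_nonneg _ _)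
  have e : ∀ g : Eu d → ℝ, ENNReal.ofReal (weightedKernel α β g z) =
      ENNReal.ofReal ((g z.1 - g z.2) ^ 2) *
        ENNReal.ofReal (levy α (z.1 - z.2) * weight β z.1 * weight β z.2) := fun g => by
    rw [← ENNReal.ofReal_mul (sq_nonneg _), weightedKernel_eq]
    congr 1
    ring
  simp only [e]
  rw [ENNReal.tsum_mul_right]
  exact mul_le_mul_left (h z.1 z.2) _

/-- Countable subadditivity of the capacity. -/
theorem capacity_iUnion_le (hd : 0 < d) {α : ℝ} (hα : 0 < α) (hα' : α < 2)
    (A : ℕ → Set (Eu d)) : capacity α (⋃ i, A i) ≤ ∑' i, capacity α (A i) := by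
  rcases eq_top_or_lt_top (∑' i, capacity α (A i)) with h | h
  · rw [h]; exact le_top
  refine ENNReal.le_of_forall_pos_le_add fun ε hε _ => ?_
  obtain ⟨ε', hε', hsum⟩ := ENNReal.exists_pos_sum_of_countable
    (ENNReal.coe_ne_zero.2 hε.ne') ℕ
  have hi : ∀ i, capacity α (A i) < capacity α (A i) + ε' i := fun i =>
    ENNReal.lt_add_right (ENNReal.ne_top_of_tsum_ne_top h.ne i) (ENNReal.coe_ne_zero.2 (hε' i).ne')
  choose e U he hU hAU h1 h0 hle hlt using fun i => exists_potential hd hα hα' (hi i)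
  have hbdd : ∀ x, BddAbove (Set.range fun i => e i x) := fun x =>
    ⟨1, by rintro _ ⟨i, rfl⟩; exact hle i x⟩
  have key : energyOne α (fun x => ⨆ i, e i x) ≤ ∑' i, energyOne α (e i) := by
    unfold energyOne
    rw [ENNReal.tsum_add, ENNReal.tsum_mul_left]
    refine add_le_add (mul_le_mul_right (wE_le_tsum α 0 (fun i => (he i).aemeasurable)
      fun x y => ofReal_sq_iSup_sub_le (hbdd x) (hbdd y)) _) ?_
    rw [← lintegral_tsum fun i => ((he i).pow_const 2).aemeasurable.ennreal_ofReal]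
    refine lintegral_mono fun x => ?_
    have := ofReal_sq_iSup_sub_le (a := fun i => e i x) (b := fun _ => 0) (hbdd x)
      ⟨0, by rintro _ ⟨i, rfl⟩; exact le_rfl⟩
    simpa using this
  calc capacity α (⋃ i, A i) ≤ energyOne α (fun x => ⨆ i, e i x) :=
        capacity_le hd hα hα' (Measurable.iSup he).aemeasurable (isOpen_iUnion hU)
          (Set.iUnion_mono hAU) (Eventually.of_forall fun x hx => by
            obtain ⟨i, hi⟩ := Set.mem_iUnion.1 hx
            rw [← h1 i x hi]
            exact le_ciSup (hbdd x) i)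
    _ ≤ ∑' i, energyOne α (e i) := key
    _ ≤ ∑' i, (capacity α (A i) + ε' i) := ENNReal.tsum_le_tsum fun i => (hlt i).le
    _ ≤ _ := by rw [ENNReal.tsum_add]; gcongr

theorem capacity_union_le (hd : 0 < d) {α : ℝ} (hα : 0 < α) (hα' : α < 2) (A B : Set (Eu d)) :
    capacity α (A ∪ B) ≤ capacity α A + capacity α B := by
  set s : ℕ → Set (Eu d) := fun i => if i = 0 then A else if i = 1 then B else ∅ with hs
  have h1 : A ∪ B ⊆ ⋃ i, s i := Set.union_subset
    (Set.subset_iUnion_of_subset 0 (by simp [hs])) (Set.subset_iUnion_of_subset 1 (by simp [hs]))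
  refine ((capacity_mono α h1).trans (capacity_iUnion_le hd hα hα' s)).trans ?_
  rw [tsum_eq_sum (s := Finset.range 2) fun i hi => ?_]
  · simp [Finset.sum_range_succ, hs]
  · have h2 : i ≠ 0 ∧ i ≠ 1 := by
      rw [Finset.mem_range] at hi; omega
    simp [hs, h2.1, h2.2, capacity_empty hd hα hα']

/-! ### Quasi-continuity and `W_0^{α/2,2}(Ω)` -/

theorem Continuous.quasiContinuous (hd : 0 < d) {α : ℝ} (hα : 0 < α) (hα' : α < 2)
    {f : Eu d → ℝ} (hf : Continuous f) : QuasiContinuous α f := fun ε hε =>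
  ⟨∅, isOpen_empty, by rwa [capacity_empty hd hα hα'], hf.continuousOn⟩

theorem QuasiContinuous.comp {α : ℝ} {f : Eu d → ℝ} (hf : QuasiContinuous α f) {φ : ℝ → ℝ}
    (hφ : Continuous φ) : QuasiContinuous α fun x => φ (f x) := fun ε hε => by
  obtain ⟨G, hG, hGε, hc⟩ := hf ε hε
  exact ⟨G, hG, hGε, hφ.comp_continuousOn hc⟩

theorem QuasiContinuous.comp₂ (hd : 0 < d) {α : ℝ} (hα : 0 < α) (hα' : α < 2)
    {f g : Eu d → ℝ} (hf : QuasiContinuous α f) (hg : QuasiContinuous α g) {φ : ℝ × ℝ → ℝ}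
    (hφ : Continuous φ) : QuasiContinuous α fun x => φ (f x, g x) := fun ε hε => by
  obtain ⟨G, hG, hGε, hc⟩ := hf (ε / 2) (ENNReal.half_pos hε.ne')
  obtain ⟨G', hG', hGε', hc'⟩ := hg (ε / 2) (ENNReal.half_pos hε.ne')
  refine ⟨G ∪ G', hG.union hG', ?_, hφ.comp_continuousOn ((hc.mono ?_).prodMk (hc'.mono ?_))⟩
  · refine (capacity_union_le hd hα hα' G G').trans_lt ?_
    calc _ < ε / 2 + ε / 2 := ENNReal.add_lt_add hGε hGε'
      _ = ε := ENNReal.add_halves ε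
  · exact Set.compl_subset_compl.2 Set.subset_union_left
  · exact Set.compl_subset_compl.2 Set.subset_union_right

/-- Chebyshev's inequality for quasi-continuous functions. -/
theorem QuasiContinuous.exists_isOpen_superset (hd : 0 < d) {α : ℝ} (hα : 0 < α) (hα' : α < 2)
    {f : Eu d → ℝ} (hf : QuasiContinuous α f) (hfm : AEMeasurable f) {t : ℝ} (ht : 0 < t)
    {ε : ℝ≥0∞} (hε : 0 < ε) :
    ∃ O, IsOpen O ∧ {x | t < |f x|} ⊆ O ∧
      capacity α O ≤ 2 * (ENNReal.ofReal ((t⁻¹) ^ 2) * energyOne α f) + ε := by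
  obtain ⟨G, hG, hGε, hc⟩ := hf (ε / 2) (ENNReal.half_pos hε.ne')
  -- Off `G` the set where |f| > t is relatively open. The competitor t⁻¹|f| + e is at least 1 on
  -- all of `O ∪ G`, the potential `e` paying for `G`.
  obtain ⟨e, U, he, hU, hGU, h1, h0, -, hlt⟩ := exists_potential hd hα hα' hGε
  obtain ⟨O, hO, hOeq⟩ := (continuousOn_iff'.1 hc) ((fun s : ℝ => |s|) ⁻¹' Set.Ioi t)
    (isOpen_Ioi.preimage continuous_abs)
  have hmem : ∀ x, x ∉ G → (x ∈ O ↔ t < |f x|) := fun x hx => by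
    have := Set.ext_iff.1 hOeq x
    simp only [Set.mem_inter_iff, Set.mem_preimage, Set.mem_Ioi, Set.mem_compl_iff, hx,
      not_false_eq_true, and_true] at this
    exact this.symm
  refine ⟨O ∪ G, hO.union hG, fun x hx => ?_, ?_⟩
  · by_cases hxG : x ∈ G
    · exact Or.inr hxG
    · exact Or.inl ((hmem x hxG).2 hx)
  · have hm : AEMeasurable fun x => t⁻¹ * |f x| := (hfm.abs.const_mul _)
    refine (capacity_le hd hα hα' (hm.add he.aemeasurable) (hO.union hG) le_rfl
      (Eventually.of_forall fun x hx => ?_)).trans ((energyOne_add_le α hm).trans ?_)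
    · change 1 ≤ t⁻¹ * |f x| + e x
      by_cases hxG : x ∈ G
      · rw [h1 x (hGU hxG)]
        have : 0 ≤ t⁻¹ * |f x| := by positivity
        linarith
      · have h2 := (hmem x hxG).1 (hx.resolve_right hxG)
        have h3 : 1 ≤ t⁻¹ * |f x| := by
          rw [inv_mul_eq_div, one_le_div ht]
          exact h2.le
        linarith [h0 x]
    · refine add_le_add ?_ ?_
      · rw [energyOne_const_mul]
        gcongr
        exact energyOne_mono α (fun x y => abs_abs_sub_abs_le_abs_sub _ _) fun x => by simp
      · calc 2 * energyOne α e ≤ 2 * (ε / 2) := by gcongr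
          _ = ε := ENNReal.mul_div_cancel (by simp) (by simp)

theorem memW0_congr {α : ℝ} {Ω : Set (Eu d)} {u v : Eu d → ℝ} (h : u =ᵐ[volume] v)
    (hu : MemW0 α Ω u) : MemW0 α Ω v := by
  obtain ⟨hW, f, hf, hq, h0⟩ := hu
  exact ⟨memW_congr h hW, f, hf.trans h, hq, h0⟩

theorem MemW0.of_continuous (hd : 0 < d) {α : ℝ} (hα : 0 < α) (hα' : α < 2) {Ω : Set (Eu d)}
    {u : Eu d → ℝ} (hu : MemW α u) (hc : Continuous u) (h0 : ∀ x, x ∉ Ω → u x = 0) :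
    MemW0 α Ω u := by
  refine ⟨hu, u, EventuallyEq.rfl, Continuous.quasiContinuous hd hα hα' hc, ?_⟩
  have : {x | x ∈ Ωᶜ ∧ u x ≠ 0} = ∅ := by
    ext x
    simp only [Set.mem_ofPred_eq, Set.mem_empty_iff_false, iff_false, not_and, not_not]
    exact h0 x
  rw [this, capacity_empty hd hα hα']

theorem MemW.add (hd : 0 < d) {α : ℝ} (hα : 0 < α) (hα' : α < 2) {u v : Eu d → ℝ}
    (hu : MemW α u) (hv : MemW α v) : MemW α fun x => u x + v x := by
  have hum := aemeasurable_of_memW hu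
  have hvm := aemeasurable_of_memW hv
  rw [memW_iff hd hα hα' hum] at hu
  rw [memW_iff hd hα hα' hvm] at hv
  rw [memW_iff hd hα hα' (hum.fun_add hvm)]
  exact (energyOne_add_le α hum).trans_lt
    (ENNReal.add_lt_top.2 ⟨ENNReal.mul_lt_top (by simp) hu, ENNReal.mul_lt_top (by simp) hv⟩)

theorem MemW.const_mul (hd : 0 < d) {α : ℝ} (hα : 0 < α) (hα' : α < 2) {u : Eu d → ℝ} (c : ℝ)
    (hu : MemW α u) : MemW α fun x => c * u x := by
  have hum := aemeasurable_of_memW hu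
  rw [memW_iff hd hα hα' hum] at hu
  rw [memW_iff hd hα hα' (hum.const_mul c), energyOne_const_mul]
  exact ENNReal.mul_lt_top (by simp) hu

theorem MemW.of_abs_le (hd : 0 < d) {α : ℝ} (hα : 0 < α) (hα' : α < 2) {u v : Eu d → ℝ}
    (hu : AEMeasurable u) (hv : MemW α v) (h : ∀ x y, |u x - u y| ≤ |v x - v y|)
    (h' : ∀ x, |u x| ≤ |v x|) : MemW α u := by
  rw [memW_iff hd hα hα' hu]
  exact (energyOne_mono α h h').trans_lt ((memW_iff hd hα hα' (aemeasurable_of_memW hv)).1 hv)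

theorem MemW0.add (hd : 0 < d) {α : ℝ} (hα : 0 < α) (hα' : α < 2) {Ω : Set (Eu d)}
    {u v : Eu d → ℝ} (hu : MemW0 α Ω u) (hv : MemW0 α Ω v) : MemW0 α Ω fun x => u x + v x := by
  obtain ⟨hW, f, hf, hq, h0⟩ := hu
  obtain ⟨hW', f', hf', hq', h0'⟩ := hv
  refine ⟨hW.add hd hα hα' hW', fun x => f x + f' x, hf.add hf',
    hq.comp₂ hd hα hα' hq' (φ := fun p => p.1 + p.2) (by fun_prop), ?_⟩
  refine le_antisymm ((capacity_mono α (?_ : _ ⊆ {x | x ∈ Ωᶜ ∧ f x ≠ 0} ∪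
    {x | x ∈ Ωᶜ ∧ f' x ≠ 0})).trans
    ((capacity_union_le hd hα hα' _ _).trans (by rw [h0, h0', add_zero]))) bot_le
  rintro x ⟨hx, hne⟩
  by_cases h : f x = 0
  · exact Or.inr ⟨hx, fun h2 => hne (by simp [h, h2])⟩
  · exact Or.inl ⟨hx, h⟩

/-- Continuous operations vanishing at zero act on `W_0` as soon as they act on `W`. -/
theorem MemW0.comp {α : ℝ} {Ω : Set (Eu d)} {u : Eu d → ℝ} (hu : MemW0 α Ω u) {φ : ℝ → ℝ}
    (hφ : Continuous φ) (hφ0 : φ 0 = 0) (hW : MemW α fun x => φ (u x)) :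
    MemW0 α Ω fun x => φ (u x) := by
  obtain ⟨-, f, hf, hq, h0⟩ := hu
  refine ⟨hW, fun x => φ (f x), hf.fun_comp φ, hq.comp hφ, le_antisymm ?_ bot_le⟩
  rw [← h0]
  refine capacity_mono α ?_
  rintro x ⟨hx, hne⟩
  exact ⟨hx, fun h => hne (by simp only [h, hφ0])⟩

theorem MemW0.const_mul (hd : 0 < d) {α : ℝ} (hα : 0 < α) (hα' : α < 2) {Ω : Set (Eu d)}
    {u : Eu d → ℝ} (c : ℝ) (hu : MemW0 α Ω u) : MemW0 α Ω fun x => c * u x :=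
  hu.comp (φ := fun s => c * s) (by fun_prop) (mul_zero c) (hu.1.const_mul hd hα hα' c)

theorem MemW0.zero (hd : 0 < d) {α : ℝ} (hα : 0 < α) (hα' : α < 2) {Ω : Set (Eu d)} :
    MemW0 α Ω fun _ => 0 := by
  refine MemW0.of_continuous hd hα hα' ?_ continuous_const fun _ _ => rfl
  rw [memW_iff hd hα hα' aemeasurable_const, energyOne_zero]
  exact ENNReal.zero_lt_top

/-- `W_0` is closed for the norm of `W`. -/
theorem MemW0.of_tendsto (hd : 0 < d) {α : ℝ} (hα : 0 < α) (hα' : α < 2) {Ω : Set (Eu d)}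
    {u : Eu d → ℝ} (hu : AEMeasurable u)
    (h : ∀ ε : ℝ≥0∞, 0 < ε → ∃ v, MemW0 α Ω v ∧ energyOne α (fun x => u x - v x) < ε) :
    MemW0 α Ω u := by
  -- With the threshold 2^{-k}, Chebyshev's inequality costs a factor 4^k. Squared distances of
  -- order 16^{-k} leave capacities of order 4^{-k}, hence at most a constant times 2^{-k}, which is
  -- summable.
  have hq : ∀ k : ℕ, (0 : ℝ≥0∞) < (16 : ℝ≥0∞)⁻¹ ^ k := fun k =>
    ENNReal.pow_pos (ENNReal.inv_pos.2 (by simp)) k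
  have hw : ∀ k : ℕ, ∃ v, MemW0 α Ω v ∧
      energyOne α (fun x => u x - v x) < ((16 : ℝ≥0∞)⁻¹ ^ k) := fun k => h _ (hq k)
  choose w hw0 hw using hw
  have hWu : MemW α u := by
    have h1 := (hw0 0).1
    have hm := aemeasurable_of_memW h1
    have h2 : MemW α fun x => u x - w 0 x := by
      rw [memW_iff hd hα hα' (hu.fun_sub hm)]
      exact (hw 0).trans (by simp)
    simpa using h2.add hd hα hα' h1
  refine ⟨hWu, ?_⟩
  choose hwW f hf hfq hf0 using hw0
  have hfm : ∀ k, AEMeasurable (f k) := fun k => (aemeasurable_of_memW (hwW k)).congr (hf k).symm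
  have hfu : ∀ k, energyOne α (fun x => u x - f k x) < (16 : ℝ≥0∞)⁻¹ ^ k := fun k => by
    rw [energyOne_congr α (v := fun x => u x - w k x)]
    · exact hw k
    · filter_upwards [hf k] with x hx
      rw [hx]
  have hff : ∀ k, energyOne α (fun x => f k x - f (k + 1) x) ≤ 4 * (16 : ℝ≥0∞)⁻¹ ^ k := fun k => by
    refine (energyOne_sub_triangle α (hfm k) hu).trans ?_
    rw [energyOne_sub_comm]
    have h1 : (16 : ℝ≥0∞)⁻¹ ^ (k + 1) ≤ 16⁻¹ ^ k :=
      pow_le_pow_right_of_le_one' (by simp) (Nat.le_succ k)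
    calc _ ≤ 2 * (16 : ℝ≥0∞)⁻¹ ^ k + 2 * 16⁻¹ ^ k := by
          gcongr
          · exact (hfu k).le
          · exact (hfu (k + 1)).le.trans h1
      _ = 4 * (16 : ℝ≥0∞)⁻¹ ^ k := by ring
  have hO : ∀ k : ℕ, ∃ O : Set (Eu d), IsOpen O ∧
      {x | (1 / 2 : ℝ) ^ k < |f k x - f (k + 1) x|} ⊆ O ∧
      capacity α O ≤ 9 * (2 : ℝ≥0∞)⁻¹ ^ k := by
    intro k
    have hqc : QuasiContinuous α fun x => f k x - f (k + 1) x :=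
      (hfq k).comp₂ hd hα hα' (hfq (k + 1)) (φ := fun p => p.1 - p.2) (by fun_prop)
    obtain ⟨O, hO1, hO2, hO3⟩ := hqc.exists_isOpen_superset hd hα hα' ((hfm k).sub (hfm (k + 1)))
      (t := (1 / 2) ^ k) (by positivity) (ε := (2 : ℝ≥0∞)⁻¹ ^ k)
      (ENNReal.pow_pos (ENNReal.inv_pos.2 (by simp)) k)
    refine ⟨O, hO1, hO2, hO3.trans ?_⟩
    have e1 : ENNReal.ofReal ((((1 / 2 : ℝ) ^ k)⁻¹) ^ 2) = 4 ^ k := by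
      rw [← inv_pow, ← pow_mul, mul_comm, pow_mul, ENNReal.ofReal_pow (by positivity)]
      norm_num
    have e2 : (4 : ℝ≥0∞) ^ k * 16⁻¹ ^ k ≤ 2⁻¹ ^ k := by
      rw [← mul_pow]
      refine pow_le_pow_left₀ bot_le ?_ k
      rw [← div_eq_mul_inv, ENNReal.div_le_iff (by simp) (by simp)]
      rw [show (16 : ℝ≥0∞) = 2 * 8 by norm_num, ← mul_assoc,
        ENNReal.inv_mul_cancel (by simp) (by simp), one_mul]
      norm_num
    calc _ ≤ 2 * (4 ^ k * (4 * (16 : ℝ≥0∞)⁻¹ ^ k)) + 2⁻¹ ^ k := by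
          rw [e1]; gcongr; exact hff k
      _ = 8 * (4 ^ k * (16 : ℝ≥0∞)⁻¹ ^ k) + 2⁻¹ ^ k := by ring
      _ ≤ 8 * 2⁻¹ ^ k + 2⁻¹ ^ k := by gcongr
      _ = 9 * 2⁻¹ ^ k := by ring
  choose O hOo hOs hOc using hO
  have htail : ∀ m, capacity α (⋃ k, O (k + m)) ≤ 18 * (2 : ℝ≥0∞)⁻¹ ^ m := fun m => by
    refine (capacity_iUnion_le hd hα hα' _).trans
      ((ENNReal.tsum_le_tsum fun k => hOc (k + m)).trans (le_of_eq ?_))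
    simp only [pow_add]
    rw [ENNReal.tsum_mul_left, ENNReal.tsum_mul_right, ENNReal.tsum_geometric,
      ENNReal.one_sub_inv_two, inv_inv]
    ring
  have htail0 : Tendsto (fun m : ℕ => 18 * (2 : ℝ≥0∞)⁻¹ ^ m) atTop (𝓝 0) := by
    have := ENNReal.Tendsto.const_mul (a := 18)
      (ENNReal.tendsto_pow_atTop_nhds_zero_of_lt_one (r := 2⁻¹) (by simp)) (Or.inr (by simp))
    simpa using this
  -- Where the sequence diverges `limUnder` returns an arbitrary value; that can happen only inside
  -- every tail union of the sets `O`, a set of capacity zero.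
  set F : Eu d → ℝ := fun x => limUnder atTop fun k => f k x with hF
  have hunif : ∀ m k x, x ∉ ⋃ i, O (i + m) → m ≤ k → |f k x - F x| ≤ 2 * (1 / 2) ^ k ∧
      Tendsto (fun k => f k x) atTop (𝓝 (F x)) := by
    intro m k x hx hmk
    have hstep : ∀ i, dist (f (k + i) x) (f (k + (i + 1)) x) ≤ (1 / 2) ^ k * 2 / 2 / 2 ^ i := by
      intro i
      rw [Real.dist_eq]
      by_contra hcon
      rw [not_le] at hcon
      refine hx (Set.mem_iUnion.2 ⟨k + i - m, ?_⟩)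
      rw [Nat.sub_add_cancel (by omega)]
      refine hOs (k + i) ?_
      refine lt_of_eq_of_lt ?_ hcon
      rw [pow_add, mul_div_assoc, div_self two_ne_zero, mul_one, div_eq_mul_inv ((1 / 2 : ℝ) ^ k),
        ← inv_pow]
      norm_num
    have hc : CauchySeq fun i => f (k + i) x := cauchySeq_of_le_geometric_two hstep
    obtain ⟨a, ha⟩ := cauchySeq_tendsto_of_complete hc
    have ha' : Tendsto (fun i => f i x) atTop (𝓝 a) := by
      rw [← tendsto_add_atTop_iff_nat k]
      simpa only [add_comm] using ha
    have hFa : F x = a := ha'.limUnder_eq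
    rw [hFa]
    refine ⟨?_, ha'⟩
    have := dist_le_of_le_geometric_two_of_tendsto₀ hstep ha
    rw [Real.dist_eq, add_zero] at this
    linarith
  have hcapN : capacity α (⋂ m, ⋃ k, O (k + m)) = 0 := by
    refine le_antisymm (ge_of_tendsto' htail0 fun m => ?_) bot_le
    exact (capacity_mono α (Set.iInter_subset _ m)).trans (htail m)
  refine ⟨F, ?_, ?_, ?_⟩
  · have hae : ∀ᵐ x, Tendsto (fun k => f k x) atTop (𝓝 (F x)) := by
      have h1 : volume (⋂ m, ⋃ k, O (k + m)) = 0 :=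
        le_antisymm ((volume_le_capacity hd hα hα' _).trans hcapN.le) bot_le
      filter_upwards [measure_eq_zero_iff_ae_notMem.1 h1] with x hx
      rw [Set.mem_iInter, not_forall] at hx
      obtain ⟨m, hm⟩ := hx
      exact (hunif m m x hm le_rfl).2
    have hFm : AEMeasurable F := aemeasurable_of_tendsto_metrizable_ae' hfm hae
    -- Fatou's lemma identifies the pointwise limit `F` with the L² limit `u`.
    have h2 : ∫⁻ x, ENNReal.ofReal ((u x - F x) ^ 2) ≤
        liminf (fun k => ∫⁻ x, ENNReal.ofReal ((u x - f k x) ^ 2)) atTop := by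
      refine le_trans (le_of_eq (lintegral_congr_ae ?_))
        (lintegral_liminf_le' fun k => ((hu.sub (hfm k)).pow_const 2).ennreal_ofReal)
      filter_upwards [hae] with x hx
      exact (((ENNReal.continuous_ofReal.tendsto _).comp
        ((hx.const_sub (u x)).pow 2)).liminf_eq).symm
    have h3 : Tendsto (fun k => ∫⁻ x, ENNReal.ofReal ((u x - f k x) ^ 2)) atTop (𝓝 0) := by
      refine tendsto_of_tendsto_of_tendsto_of_le_of_le tendsto_const_nhds
        (ENNReal.tendsto_pow_atTop_nhds_zero_of_lt_one (r := 16⁻¹) (by simp)) (fun _ => bot_le)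
        fun k => ?_
      exact (le_add_left le_rfl : _ ≤ energyOne α fun x => u x - f k x).trans (hfu k).le
    rw [h3.liminf_eq, nonpos_iff_eq_zero,
      lintegral_eq_zero_iff' ((hu.fun_sub hFm).pow_const 2).ennreal_ofReal] at h2
    filter_upwards [h2] with x hx
    have h4 : ENNReal.ofReal ((u x - F x) ^ 2) = 0 := hx
    rw [ENNReal.ofReal_eq_zero] at h4
    have h5 : u x - F x = 0 := pow_eq_zero_iff two_ne_zero |>.1 (le_antisymm h4 (sq_nonneg _))
    linarith
  · intro ε hε
    obtain ⟨m, hm⟩ := (htail0.eventually (gt_mem_nhds (ENNReal.half_pos hε.ne'))).exists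
    obtain ⟨ε', hε', hsum⟩ := ENNReal.exists_pos_sum_of_countable
      (ENNReal.half_pos hε.ne').ne' ℕ
    choose G hGo hGc hGcont using fun k => hfq k (ε' k) (ENNReal.coe_pos.2 (hε' k))
    -- Off the sets `G k` every `f k` is continuous, and off the tail of the `O k` the convergence
    -- is uniform, so the limit is continuous there.
    refine ⟨(⋃ k, O (k + m)) ∪ ⋃ k, G k, (isOpen_iUnion fun k => hOo _).union (isOpen_iUnion hGo),
      ?_, ?_⟩
    · calc _ ≤ capacity α (⋃ k, O (k + m)) + capacity α (⋃ k, G k) := capacity_union_le hd hα hα' _ _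
        _ ≤ 18 * (2 : ℝ≥0∞)⁻¹ ^ m + ∑' k, (ε' k : ℝ≥0∞) := add_le_add (htail m)
            ((capacity_iUnion_le hd hα hα' _).trans (ENNReal.tsum_le_tsum fun k => (hGc k).le))
        _ < ε / 2 + ε / 2 := ENNReal.add_lt_add hm hsum
        _ = ε := ENNReal.add_halves ε
    · have hlim : TendstoUniformlyOn (fun k => f k) F atTop ((⋃ k, O (k + m)) ∪ ⋃ k, G k)ᶜ := by
        rw [Metric.tendstoUniformlyOn_iff]
        intro δ hδ
        have h2 : Tendsto (fun k : ℕ => 2 * (1 / 2 : ℝ) ^ k) atTop (𝓝 0) := by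
          simpa using (tendsto_pow_atTop_nhds_zero_of_lt_one (r := (1 / 2 : ℝ)) (by norm_num)
            (by norm_num)).const_mul 2
        filter_upwards [h2.eventually (gt_mem_nhds hδ), eventually_ge_atTop m] with k hk hmk x hx
        rw [dist_comm, Real.dist_eq]
        exact ((hunif m k x (fun h => hx (Or.inl h)) hmk).1).trans_lt hk
      refine hlim.continuousOn (Frequently.of_forall fun k => (hGcont k).mono ?_)
      exact Set.compl_subset_compl.2 ((Set.subset_iUnion G k).trans Set.subset_union_right)
  · refine le_antisymm ((capacity_mono α (?_ : _ ⊆ (⋂ m, ⋃ k, O (k + m)) ∪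
      ⋃ k, {x | x ∈ Ωᶜ ∧ f k x ≠ 0})).trans ((capacity_union_le hd hα hα' _ _).trans ?_)) bot_le
    · rintro x ⟨hx, hne⟩
      by_contra hcon
      simp only [Set.mem_union, not_or, Set.mem_iInter, not_forall] at hcon
      obtain ⟨⟨m, hm⟩, hcon2⟩ := hcon
      have h0 : ∀ k, f k x = 0 := fun k => by
        by_contra h1
        exact hcon2 (Set.mem_iUnion.2 ⟨k, hx, h1⟩)
      have h1 := (hunif m m x hm le_rfl).2
      simp only [h0] at h1
      exact hne (tendsto_nhds_unique tendsto_const_nhds h1).symm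
    · rw [hcapN, zero_add]
      refine (capacity_iUnion_le hd hα hα' _).trans ?_
      rw [ENNReal.tsum_eq_zero.2 hf0]

/-! ### Truncation, cutoff and small perturbations in `W^{α/2,2}` -/

/-- A dominated convergence theorem for energies. -/
theorem tendsto_wE_of_dominated (α β : ℝ) {u : ℕ → Eu d → ℝ} {b : Eu d × Eu d → ℝ}
    (hu : ∀ n, AEMeasurable (u n))
    (hb : ∫⁻ z, ENNReal.ofReal (b z) ∂(volume.prod volume) < ∞)
    (hub : ∀ n z, weightedKernel α β (u n) z ≤ b z)
    (h : ∀ᵐ z ∂(volume.prod volume),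
      Tendsto (fun n => weightedKernel α β (u n) z) atTop (𝓝 0)) :
    Tendsto (fun n => wE α β (u n)) atTop (𝓝 0) := by
  have := tendsto_lintegral_of_dominated_convergence' (μ := (volume : Measure (Eu d)).prod volume)
    (F := fun n z => ENNReal.ofReal (weightedKernel α β (u n) z)) (f := fun _ => 0)
    (fun z => ENNReal.ofReal (b z))
    (fun n => (aemeasurable_weightedKernel α β (hu n)).ennreal_ofReal)
    (fun n => Eventually.of_forall fun z => ENNReal.ofReal_le_ofReal (hub n z)) hb.ne
    (h.mono fun z hz => by
      have := (ENNReal.continuous_ofReal.tendsto 0).comp hz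
      rwa [ENNReal.ofReal_zero] at this)
  rw [lintegral_zero] at this
  exact this

theorem tendsto_weightedKernel (α β : ℝ) {u : ℕ → Eu d → ℝ} {z : Eu d × Eu d}
    (h1 : Tendsto (fun n => u n z.1) atTop (𝓝 0)) (h2 : Tendsto (fun n => u n z.2) atTop (𝓝 0)) :
    Tendsto (fun n => weightedKernel α β (u n) z) atTop (𝓝 0) := by
  simp only [weightedKernel_eq]
  have := ((((h1.sub h2).pow 2).mul_const (levy α (z.1 - z.2))).mul_const
    (weight β z.1)).mul_const (weight β z.2)
  simpa using this

theorem tendsto_lintegral_sq_of_dominated {u : ℕ → Eu d → ℝ} {v : Eu d → ℝ}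
    (hu : ∀ n, AEMeasurable (u n)) (hv : ∫⁻ x, ENNReal.ofReal (v x ^ 2) < ∞)
    (huv : ∀ n x, |u n x| ≤ |v x|) (h : ∀ᵐ x, Tendsto (fun n => u n x) atTop (𝓝 0)) :
    Tendsto (fun n => ∫⁻ x, ENNReal.ofReal (u n x ^ 2)) atTop (𝓝 0) := by
  have := tendsto_lintegral_of_dominated_convergence' (μ := (volume : Measure (Eu d)))
    (F := fun n x => ENNReal.ofReal (u n x ^ 2)) (f := fun _ => 0)
    (fun x => ENNReal.ofReal (v x ^ 2))
    (fun n => ((hu n).pow_const 2).ennreal_ofReal)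
    (fun n => Eventually.of_forall fun x => ENNReal.ofReal_le_ofReal (sq_le_sq.2 (huv n x))) hv.ne
    (h.mono fun x hx => by
      have := (ENNReal.continuous_ofReal.tendsto _).comp (hx.pow 2)
      simpa [Function.comp_def] using this)
  simpa using this

theorem tendsto_energyOne {α : ℝ} {u : ℕ → Eu d → ℝ}
    (h1 : Tendsto (fun n => wE α 0 (u n)) atTop (𝓝 0))
    (h2 : Tendsto (fun n => ∫⁻ x, ENNReal.ofReal (u n x ^ 2)) atTop (𝓝 0)) :
    Tendsto (fun n => energyOne α (u n)) atTop (𝓝 0) := by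
  have := (ENNReal.Tendsto.const_mul (a := ENNReal.ofReal (constA d α / 2)) h1
    (Or.inr ENNReal.ofReal_ne_top)).add h2
  simpa [energyOne] using this

/-- Normal contractions which converge pointwise to zero converge to zero in `W`. -/
theorem tendsto_energyOne_of_dominated {α : ℝ} {u : ℕ → Eu d → ℝ} {v : Eu d → ℝ}
    (hu : ∀ n, AEMeasurable (u n)) (hv : MemW α v) (huv : ∀ n x y, |u n x - u n y| ≤ |v x - v y|)
    (huv' : ∀ n x, |u n x| ≤ |v x|) (h : ∀ x, Tendsto (fun n => u n x) atTop (𝓝 0)) :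
    Tendsto (fun n => energyOne α (u n)) atTop (𝓝 0) := by
  have hvm := aemeasurable_of_memW hv
  obtain ⟨h1, h2⟩ := (memW_iff' α hvm).1 hv
  refine tendsto_energyOne (tendsto_wE_of_dominated α 0 (b := weightedKernel α 0 v) hu h2
    (fun n z => ?_) (Eventually.of_forall fun z => tendsto_weightedKernel α 0 (h _) (h _)))
    (tendsto_lintegral_sq_of_dominated hu ((integrable_sq_iff hvm).1 h1) huv'
      (Eventually.of_forall h))
  rw [weightedKernel_eq, weightedKernel_eq]
  have h1 := levy_nonneg α (z.1 - z.2)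
  have h2 := weight_nonneg 0 z.1
  have h3 := weight_nonneg 0 z.2
  have h4 := sq_le_sq.2 (huv n z.1 z.2)
  gcongr

/-! ### Truncation of small and large values -/

/-- Truncation at the heights `n⁻¹` and `n`. -/
def bandTrunc (n : ℕ) (s : ℝ) : ℝ := clamp ((n : ℝ) + 1) s - clamp (((n : ℝ) + 1)⁻¹) s

theorem continuous_bandTrunc (n : ℕ) : Continuous (bandTrunc n) :=
  (continuous_clamp _).sub (continuous_clamp _)

theorem clamp_mono (t : ℝ) {s s' : ℝ} (h : s ≤ s') : clamp t s ≤ clamp t s' := by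
  unfold clamp; gcongr

theorem clamp_sub_le (t : ℝ) {s s' : ℝ} (h : s ≤ s') : clamp t s' - clamp t s ≤ s' - s :=
  (le_abs_self _).trans ((abs_clamp_sub_clamp_le t s' s).trans (by rw [abs_of_nonneg (by linarith)]))

theorem clamp_clamp {t t' : ℝ} (ht : 0 ≤ t) (h : t ≤ t') (s : ℝ) :
    clamp t (clamp t' s) = clamp t s := by
  unfold clamp
  rcases le_total t' s with h1 | h1
  · rw [min_eq_left h1, max_eq_right (by linarith : -t' ≤ t'), min_eq_left h,
      min_eq_left (h.trans h1)]
  · rw [min_eq_right h1]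
    rcases le_total (-t') s with h2 | h2
    · rw [max_eq_right h2]
    · rw [max_eq_left h2, min_eq_right (by linarith : -t' ≤ t), max_eq_left (by linarith),
        min_eq_right (by linarith), max_eq_left (by linarith)]

/-- Applied with g the identity, both to a truncation and to the identity minus it: if both are
nondecreasing, both are normal contractions. -/
theorem abs_sub_le_of_monotone {f g : ℝ → ℝ} (hf : ∀ s s', s ≤ s' → f s ≤ f s')
    (hfg : ∀ s s', s ≤ s' → f s' - f s ≤ g s' - g s) (s s' : ℝ) : |f s - f s'| ≤ |g s - g s'| := by
  rcases le_total s s' with h | h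
  · rw [abs_sub_comm, abs_sub_comm (g s), abs_of_nonneg (sub_nonneg.2 (hf _ _ h))]
    exact (hfg _ _ h).trans (le_abs_self _)
  · rw [abs_of_nonneg (sub_nonneg.2 (hf _ _ h))]
    exact (hfg _ _ h).trans (le_abs_self _)

theorem inv_succ_le_succ (n : ℕ) : (((n : ℝ) + 1)⁻¹) ≤ (n : ℝ) + 1 := by
  have h1 : (1 : ℝ) ≤ (n : ℝ) + 1 := by
    have : (0 : ℝ) ≤ n := Nat.cast_nonneg n
    linarith
  exact (inv_le_one_of_one_le₀ h1).trans h1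

/-- By `clamp_clamp` the band truncation is r ↦ r - clamp (n+1)⁻¹ r evaluated at clamp (n+1) s, a
composition of nondecreasing maps. -/
theorem bandTrunc_mono (n : ℕ) {s s' : ℝ} (h : s ≤ s') : bandTrunc n s ≤ bandTrunc n s' := by
  have h1 : (0 : ℝ) ≤ ((n : ℝ) + 1)⁻¹ := by positivity
  unfold bandTrunc
  have h3 := clamp_sub_le (((n : ℝ) + 1)⁻¹) (clamp_mono ((n : ℝ) + 1) h)
  rw [clamp_clamp h1 (inv_succ_le_succ n), clamp_clamp h1 (inv_succ_le_succ n)] at h3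
  linarith

theorem bandTrunc_sub_le (n : ℕ) {s s' : ℝ} (h : s ≤ s') :
    bandTrunc n s' - bandTrunc n s ≤ s' - s := by
  unfold bandTrunc
  have h1 := clamp_sub_le ((n : ℝ) + 1) h
  have h2 := clamp_mono (((n : ℝ) + 1)⁻¹) h
  linarith

theorem bandTrunc_eq_zero {n : ℕ} {s : ℝ} (h : |s| ≤ ((n : ℝ) + 1)⁻¹) : bandTrunc n s = 0 := by
  rw [bandTrunc, clamp_of_abs_le h, clamp_of_abs_le (h.trans (inv_succ_le_succ n)), sub_self]

theorem bandTrunc_zero (n : ℕ) : bandTrunc n 0 = 0 :=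
  bandTrunc_eq_zero (by rw [abs_zero]; positivity)

theorem abs_bandTrunc_le (n : ℕ) (s : ℝ) : |bandTrunc n s| ≤ (n : ℝ) + 1 := by
  have h0 : (0 : ℝ) ≤ (n : ℝ) + 1 := by positivity
  have h := abs_sub_le_of_monotone (f := fun r => r - clamp (((n : ℝ) + 1)⁻¹) r) (g := fun r => r)
    (fun s s' h => by linarith [clamp_sub_le (((n : ℝ) + 1)⁻¹) h])
    (fun s s' h => by linarith [clamp_mono (((n : ℝ) + 1)⁻¹) h]) (clamp ((n : ℝ) + 1) s) 0
  have h2 : clamp (((n : ℝ) + 1)⁻¹) 0 = 0 := clamp_of_abs_le (by rw [abs_zero]; positivity)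
  simp only [h2, sub_zero] at h
  rw [clamp_clamp (by positivity) (inv_succ_le_succ n)] at h
  exact h.trans (abs_clamp_le _ _ h0)

theorem abs_bandTrunc_sub_le (n : ℕ) (s s' : ℝ) : |bandTrunc n s - bandTrunc n s'| ≤ |s - s'| :=
  abs_sub_le_of_monotone (f := bandTrunc n) (g := fun r => r) (fun _ _ h => bandTrunc_mono n h)
    (fun _ _ h => bandTrunc_sub_le n h) s s'

theorem abs_sub_bandTrunc_sub_le (n : ℕ) (s s' : ℝ) :
    |(s - bandTrunc n s) - (s' - bandTrunc n s')| ≤ |s - s'| :=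
  abs_sub_le_of_monotone (f := fun r => r - bandTrunc n r) (g := fun r => r)
    (fun _ _ h => by linarith [bandTrunc_sub_le n h])
    (fun _ _ h => by linarith [bandTrunc_mono n h]) s s'

theorem tendsto_bandTrunc (s : ℝ) : Tendsto (fun n : ℕ => s - bandTrunc n s) atTop (𝓝 0) := by
  have h1 : Tendsto (fun n : ℕ => ((n : ℝ) + 1)⁻¹) atTop (𝓝 0) := by
    simpa using tendsto_one_div_add_atTop_nhds_zero_nat (𝕜 := ℝ)
  refine squeeze_zero_norm' ?_ h1
  filter_upwards [eventually_ge_atTop ⌈|s|⌉₊] with n hn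
  have h2 : |s| ≤ (n : ℝ) + 1 := (Nat.le_ceil _).trans (by
    have : (⌈|s|⌉₊ : ℝ) ≤ n := by exact_mod_cast hn
    linarith)
  rw [bandTrunc, clamp_of_abs_le h2, sub_sub_cancel, Real.norm_eq_abs]
  exact abs_clamp_le _ _ (by positivity)

theorem tendsto_energyOne_sub_bandTrunc {α : ℝ} {u : Eu d → ℝ} (hu : MemW α u) :
    Tendsto (fun n => energyOne α fun x => u x - bandTrunc n (u x)) atTop (𝓝 0) := by
  have hm := aemeasurable_of_memW hu
  refine tendsto_energyOne_of_dominated (v := u)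
    (fun n => hm.sub ((continuous_bandTrunc n).measurable.comp_aemeasurable hm)) hu
    (fun n x y => abs_sub_bandTrunc_sub_le n _ _) (fun n x => ?_) fun x => tendsto_bandTrunc _
  have := abs_sub_bandTrunc_sub_le n (u x) 0
  simpa [bandTrunc_zero] using this

theorem two_mul_ofReal (s : ℝ) : 2 * ENNReal.ofReal s = ENNReal.ofReal (2 * s) := by
  rw [ENNReal.ofReal_mul zero_le_two, ENNReal.ofReal_ofNat]

theorem sq_mul_sub_mul_le (a b s t : ℝ) :
    (a * s - b * t) ^ 2 ≤ 2 * (s ^ 2 * (a - b) ^ 2) + 2 * (b ^ 2 * (s - t) ^ 2) := by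
  nlinarith [sq_nonneg (s * (a - b) - b * (s - t))]

/-- Multiplication of a function of finite energy by small bounded functions. -/
theorem tendsto_wE_mul {α : ℝ} {v : Eu d → ℝ} {e : ℕ → Eu d → ℝ}
    (hv : AEMeasurable v) (he : ∀ n, AEMeasurable (e n)) (hvE : wE α 0 v < ∞)
    (he1 : ∀ n x, |e n x| ≤ 1)
    (he0 : ∀ᵐ x, Tendsto (fun n => e n x) atTop (𝓝 0))
    (heE : Tendsto (fun n => ∫⁻ z, ENNReal.ofReal (v z.2 ^ 2 * (e n z.1 - e n z.2) ^ 2 *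
      levy α (z.1 - z.2)) ∂(volume.prod volume)) atTop (𝓝 0)) :
    Tendsto (fun n => wE α 0 fun x => v x * e n x) atTop (𝓝 0) := by
  have hmeas : ∀ n, AEMeasurable (fun z : Eu d × Eu d =>
      ENNReal.ofReal (e n z.1 ^ 2 * weightedKernel α 0 v z)) (volume.prod volume) := fun n =>
    (((aemeasurable_fst (he n)).pow_const 2).mul
      (aemeasurable_weightedKernel α 0 hv)).ennreal_ofReal
  -- Product rule: v e at two points differs by e(x)(v(x) - v(y)) + v(y)(e(x) - e(y)). The first
  -- part tends to zero by dominated convergence, the second by the hypothesis `heE`.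
  have h1 : Tendsto (fun n => ∫⁻ z, ENNReal.ofReal (e n z.1 ^ 2 * weightedKernel α 0 v z)
      ∂(volume.prod volume)) atTop (𝓝 0) := by
    have := tendsto_lintegral_of_dominated_convergence'
      (μ := (volume : Measure (Eu d)).prod volume)
      (F := fun n z => ENNReal.ofReal (e n z.1 ^ 2 * weightedKernel α 0 v z)) (f := fun _ => 0)
      (fun z => ENNReal.ofReal (weightedKernel α 0 v z))
      hmeas
      (fun n => Eventually.of_forall fun z => ENNReal.ofReal_le_ofReal
        (mul_le_of_le_one_left (weightedKernel_nonneg α 0 v z)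
          ((sq_le_one_iff_abs_le_one _).2 (he1 n z.1)))) hvE.ne
      ((ae_fst he0).mono fun z hz => by
        have := (ENNReal.continuous_ofReal.tendsto _).comp
          ((hz.pow 2).mul_const (weightedKernel α 0 v z))
        simpa [Function.comp_def] using this)
    simpa using this
  have h2 : Tendsto (fun n => 2 * (∫⁻ z, ENNReal.ofReal (e n z.1 ^ 2 * weightedKernel α 0 v z)
      ∂(volume.prod volume)) + 2 * ∫⁻ z, ENNReal.ofReal (v z.2 ^ 2 * (e n z.1 - e n z.2) ^ 2 *
      levy α (z.1 - z.2)) ∂(volume.prod volume)) atTop (𝓝 0) := by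
    have := (ENNReal.Tendsto.const_mul (a := 2) h1 (Or.inr (by simp))).add
      (ENNReal.Tendsto.const_mul (a := 2) heE (Or.inr (by simp)))
    simpa using this
  refine tendsto_of_tendsto_of_tendsto_of_le_of_le tendsto_const_nhds h2 (fun _ => bot_le)
    fun n => ?_
  dsimp only
  rw [wE, ← lintegral_const_mul' _ _ (by simp), ← lintegral_const_mul' _ _ (by simp),
    ← lintegral_add_left' ((hmeas n).const_mul _)]
  refine lintegral_mono fun z => ?_
  have h3 := levy_nonneg α (z.1 - z.2)
  have h4 := weightedKernel_nonneg α 0 v z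
  rw [two_mul_ofReal, two_mul_ofReal, ← ENNReal.ofReal_add (by positivity) (by positivity)]
  refine ENNReal.ofReal_le_ofReal ?_
  rw [weightedKernel_eq, weightedKernel_eq, weight_zero, weight_zero, mul_one, mul_one, mul_one,
    mul_one]
  calc (v z.1 * e n z.1 - v z.2 * e n z.2) ^ 2 * levy α (z.1 - z.2) ≤
      (2 * (e n z.1 ^ 2 * (v z.1 - v z.2) ^ 2) + 2 * (v z.2 ^ 2 * (e n z.1 - e n z.2) ^ 2)) *
        levy α (z.1 - z.2) := mul_le_mul_of_nonneg_right (sq_mul_sub_mul_le _ _ _ _) h3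
    _ = _ := by ring

theorem lintegral_prod_mul_sub {g : Eu d → ℝ≥0∞} {k : Eu d → ℝ≥0∞} (hg : AEMeasurable g)
    (hk : Measurable k) :
    ∫⁻ z : Eu d × Eu d, g z.2 * k (z.1 - z.2) ∂(volume.prod volume) =
      (∫⁻ x, g x) * ∫⁻ x, k x := by
  have hm : AEMeasurable (fun z : Eu d × Eu d => g z.2 * k (z.1 - z.2)) (volume.prod volume) :=
    (hg.comp_quasiMeasurePreserving Measure.quasiMeasurePreserving_snd).mul
      (hk.comp (measurable_fst.sub measurable_snd)).aemeasurable
  rw [lintegral_prod_symm _ hm]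
  simp only
  have : ∀ y : Eu d, ∫⁻ x, g y * k (x - y) = g y * ∫⁻ x, k x := fun y => by
    rw [lintegral_const_mul _ (by fun_prop), lintegral_sub_right_eq_self]
  simp only [this]
  rw [lintegral_mul_const'' _ hg]

/-! ### Cutoff at large radius -/

/-- The cutoff function at radius `n + 1`. -/
def radialCut (n : ℕ) (x : Eu d) : ℝ := min (max 0 (2 - ‖x‖ / ((n : ℝ) + 1))) 1

theorem continuous_radialCut (n : ℕ) : Continuous (radialCut n : Eu d → ℝ) := by
  unfold radialCut; fun_prop

theorem radialCut_nonneg (n : ℕ) (x : Eu d) : 0 ≤ radialCut n x :=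
  le_min (le_max_left _ _) zero_le_one

theorem radialCut_le_one (n : ℕ) (x : Eu d) : radialCut n x ≤ 1 := min_le_right _ _

theorem radialCut_eq_zero {n : ℕ} {x : Eu d} (h : 2 * ((n : ℝ) + 1) ≤ ‖x‖) : radialCut n x = 0 := by
  have : 2 ≤ ‖x‖ / ((n : ℝ) + 1) := by rwa [le_div_iff₀ (by positivity)]
  rw [radialCut, max_eq_left (by linarith), min_eq_left zero_le_one]

theorem radialCut_eq_one {n : ℕ} {x : Eu d} (h : ‖x‖ ≤ (n : ℝ) + 1) : radialCut n x = 1 := by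
  have : ‖x‖ / ((n : ℝ) + 1) ≤ 1 := by rwa [div_le_one (by positivity)]
  rw [radialCut, max_eq_right (by linarith), min_eq_right (by linarith)]

theorem tendsto_radialCut (x : Eu d) :
    Tendsto (fun n => 1 - radialCut n x) atTop (𝓝 0) := by
  refine tendsto_const_nhds.congr' ?_
  filter_upwards [eventually_ge_atTop ⌈‖x‖⌉₊] with n hn
  have h2 : ‖x‖ ≤ (n : ℝ) + 1 := (Nat.le_ceil _).trans (by
    have : (⌈‖x‖⌉₊ : ℝ) ≤ n := by exact_mod_cast hn
    linarith)
  rw [radialCut_eq_one h2, sub_self]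

theorem abs_radialCut_sub_le (n : ℕ) (x y : Eu d) : |radialCut n x - radialCut n y| ≤ ‖x - y‖ := by
  refine (abs_unit_sub_unit_le _ _).trans ?_
  have h1 : (1 : ℝ) ≤ (n : ℝ) + 1 := by
    have : (0 : ℝ) ≤ n := Nat.cast_nonneg n
    linarith
  rw [sub_sub_sub_cancel_left, ← sub_div, abs_div, abs_of_pos (show 0 < (n : ℝ) + 1 by positivity)]
  calc |‖y‖ - ‖x‖| / ((n : ℝ) + 1) ≤ |‖y‖ - ‖x‖| := div_le_self (abs_nonneg _) h1
    _ ≤ ‖y - x‖ := abs_norm_sub_norm_le _ _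
    _ = ‖x - y‖ := norm_sub_rev _ _

theorem sq_sub_le_min {f : Eu d → ℝ} {K : ℝ} (hK : 1 ≤ K) (h1 : ∀ x, |f x| ≤ K)
    (h2 : ∀ x y, |f x - f y| ≤ K * ‖x - y‖) (x y : Eu d) :
    (f x - f y) ^ 2 ≤ 4 * K ^ 2 * min 1 (‖x - y‖ ^ 2) := by
  rw [← sq_abs]
  rcases min_choice 1 (‖x - y‖ ^ 2) with h | h <;> rw [h]
  · have : |f x - f y| ≤ 2 * K := (abs_sub _ _).trans (by linarith [h1 x, h1 y])
    nlinarith [abs_nonneg (f x - f y)]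
  · have := pow_le_pow_left₀ (abs_nonneg _) (h2 x y) 2
    nlinarith [sq_nonneg (K * ‖x - y‖)]

theorem lintegral_min_mul_levy_lt_top (hd : 0 < d) {α : ℝ} (hα : 0 < α) (hα' : α < 2)
    {u : Eu d → ℝ} (hm : AEMeasurable u) (h2 : Integrable fun x => u x ^ 2) (K : ℝ) (hK : 0 ≤ K) :
    ∫⁻ z : Eu d × Eu d, ENNReal.ofReal (u z.2 ^ 2 *
      (K * min 1 (‖z.1 - z.2‖ ^ 2)) * levy α (z.1 - z.2)) ∂(volume.prod volume) < ∞ := by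
  have hlevy : ∀ z : Eu d, 0 ≤ K * (min 1 (‖z‖ ^ 2) * levy α z) := fun z =>
    mul_nonneg hK (mul_nonneg (le_min zero_le_one (sq_nonneg _)) (levy_nonneg _ _))
  have e : ∀ z : Eu d × Eu d, ENNReal.ofReal (u z.2 ^ 2 *
      (K * min 1 (‖z.1 - z.2‖ ^ 2)) * levy α (z.1 - z.2)) = ENNReal.ofReal (u z.2 ^ 2) *
        ENNReal.ofReal (K * (min 1 (‖z.1 - z.2‖ ^ 2) * levy α (z.1 - z.2))) := fun z => by
    rw [← ENNReal.ofReal_mul (sq_nonneg _)]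
    congr 1
    ring
  have hk : Measurable fun z : Eu d => ENNReal.ofReal (K * (min 1 (‖z‖ ^ 2) * levy α z)) :=
    (((measurable_const.min (measurable_norm.pow_const 2)).mul
      (measurable_levy α)).const_mul K).ennreal_ofReal
  rw [lintegral_congr e, lintegral_prod_mul_sub (g := fun x => ENNReal.ofReal (u x ^ 2))
    (k := fun z => ENNReal.ofReal (K * (min 1 (‖z‖ ^ 2) * levy α z)))
    (hm.pow_const 2).ennreal_ofReal hk]
  refine ENNReal.mul_lt_top ((integrable_sq_iff hm).1 h2) ?_
  have h3 := (integrable_min_mul_levy hd hα hα').const_mul K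
  exact (hasFiniteIntegral_iff_ofReal (Eventually.of_forall hlevy)).1 h3.2

theorem tendsto_lintegral_radialCut (hd : 0 < d) {α : ℝ} (hα : 0 < α) (hα' : α < 2)
    {u : Eu d → ℝ} (hm : AEMeasurable u) (h2 : Integrable fun x => u x ^ 2) :
    Tendsto (fun n => ∫⁻ z : Eu d × Eu d, ENNReal.ofReal (u z.2 ^ 2 *
      ((1 - radialCut n z.1) - (1 - radialCut n z.2)) ^ 2 * levy α (z.1 - z.2))
      ∂(volume.prod volume)) atTop (𝓝 0) := by
  have hcm : ∀ n, AEMeasurable (fun x : Eu d => 1 - radialCut n x) := fun n =>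
    (continuous_const.sub (continuous_radialCut n)).measurable.aemeasurable
  have hmeas : ∀ n, AEMeasurable (fun z : Eu d × Eu d => ENNReal.ofReal (u z.2 ^ 2 *
      ((1 - radialCut n z.1) - (1 - radialCut n z.2)) ^ 2 * levy α (z.1 - z.2)))
      (volume.prod volume) := fun n =>
    ((((aemeasurable_snd hm).pow_const 2).mul
      (((aemeasurable_fst (hcm n)).sub (aemeasurable_snd (hcm n))).pow_const 2)).mul
      (measurable_levy_sub α).aemeasurable).ennreal_ofReal
  have hbound : ∀ n (z : Eu d × Eu d), ENNReal.ofReal (u z.2 ^ 2 *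
      ((1 - radialCut n z.1) - (1 - radialCut n z.2)) ^ 2 * levy α (z.1 - z.2)) ≤
      ENNReal.ofReal (u z.2 ^ 2 * (4 * min 1 (‖z.1 - z.2‖ ^ 2)) * levy α (z.1 - z.2)) := by
    intro n z
    refine ENNReal.ofReal_le_ofReal (mul_le_mul_of_nonneg_right
      (mul_le_mul_of_nonneg_left ?_ (sq_nonneg _)) (levy_nonneg _ _))
    have h4 := sq_sub_le_min (f := radialCut n) (K := 1) le_rfl (fun x => abs_le.2
      ⟨by linarith [radialCut_nonneg n x], radialCut_le_one n x⟩)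
      (fun x y => by rw [one_mul]; exact abs_radialCut_sub_le n x y) z.1 z.2
    nlinarith
  have hlim : ∀ z : Eu d × Eu d, Tendsto (fun n => ENNReal.ofReal (u z.2 ^ 2 *
      ((1 - radialCut n z.1) - (1 - radialCut n z.2)) ^ 2 * levy α (z.1 - z.2))) atTop (𝓝 0) := by
    intro z
    have h6 := (ENNReal.continuous_ofReal.tendsto _).comp
      (((((tendsto_radialCut z.1).sub (tendsto_radialCut z.2)).pow 2).const_mul
        (u z.2 ^ 2)).mul_const (levy α (z.1 - z.2)))
    rw [sub_zero, zero_pow two_ne_zero, mul_zero, zero_mul, ENNReal.ofReal_zero] at h6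
    exact h6
  have := tendsto_lintegral_of_dominated_convergence' _ hmeas
    (fun n => Eventually.of_forall (hbound n))
    (lintegral_min_mul_levy_lt_top hd hα hα' hm h2 4 (by norm_num)).ne (Eventually.of_forall hlim)
  rw [lintegral_zero] at this
  exact this

theorem tendsto_energyOne_sub_mul_radialCut (hd : 0 < d) {α : ℝ} (hα : 0 < α) (hα' : α < 2)
    {u : Eu d → ℝ} (hu : MemW α u) :
    Tendsto (fun n => energyOne α fun x => u x - u x * radialCut n x) atTop (𝓝 0) := by
  have hm := aemeasurable_of_memW hu
  obtain ⟨h2, hE⟩ := (memW_iff' α hm).1 hu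
  have e : ∀ n, (fun x => u x - u x * radialCut n x) = fun x => u x * (1 - radialCut n x) :=
    fun n => funext fun x => by ring
  have hcm : ∀ n, AEMeasurable (fun x : Eu d => 1 - radialCut n x) := fun n =>
    (continuous_const.sub (continuous_radialCut n)).measurable.aemeasurable
  have hc1 : ∀ n (x : Eu d), |1 - radialCut n x| ≤ 1 := fun n x => by
    rw [abs_le]
    constructor <;> linarith [radialCut_nonneg n x, radialCut_le_one n x]
  simp only [e]
  refine tendsto_energyOne (tendsto_wE_mul hm hcm hE hc1
    (Eventually.of_forall fun x => tendsto_radialCut x)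
    (tendsto_lintegral_radialCut hd hα hα' hm h2))
    (tendsto_lintegral_sq_of_dominated (fun n => hm.mul (hcm n)) ((integrable_sq_iff hm).1 h2)
      (fun n x => ?_) (Eventually.of_forall fun x => ?_))
  · rw [abs_mul]
    exact mul_le_of_le_one_right (abs_nonneg _) (hc1 n x)
  · simpa using (tendsto_radialCut x).const_mul (u x)

/-- Multiplication by functions which tend to zero fast in `W`. -/
theorem tendsto_energyOne_mul {α : ℝ} (hA : 0 < constA d α) {v : Eu d → ℝ} {e : ℕ → Eu d → ℝ}
    {M : ℝ} (hv : MemW α v) (he : ∀ n, AEMeasurable (e n)) (hM : ∀ x, |v x| ≤ M)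
    (he1 : ∀ n x, |e n x| ≤ 1) (heN : ∀ n, energyOne α (e n) ≤ (2 : ℝ≥0∞)⁻¹ ^ n) :
    Tendsto (fun n => energyOne α fun x => v x * e n x) atTop (𝓝 0) := by
  have hm := aemeasurable_of_memW hv
  obtain ⟨h2, hE⟩ := (memW_iff' α hm).1 hv
  have hgeom := ENNReal.tendsto_pow_atTop_nhds_zero_of_lt_one (r := 2⁻¹) (by simp)
  -- The geometric rate makes Σ e_n² integrable, so the whole sequence tends to zero almost
  -- everywhere, without passing to a subsequence.
  have he0 : ∀ᵐ x, Tendsto (fun n => e n x) atTop (𝓝 0) := by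
    have h1 : ∫⁻ x, ∑' n, ENNReal.ofReal (e n x ^ 2) ≠ ∞ := by
      rw [lintegral_tsum fun n => ((he n).pow_const 2).ennreal_ofReal]
      refine ne_top_of_le_ne_top ?_ (ENNReal.tsum_le_tsum fun n =>
        (le_add_left le_rfl : _ ≤ energyOne α (e n)).trans (heN n))
      rw [ENNReal.tsum_geometric, ENNReal.one_sub_inv_two, inv_inv]
      simp
    filter_upwards [ae_lt_top' (AEMeasurable.tsum fun n =>
      ((he n).pow_const 2).ennreal_ofReal) h1] with x hx
    have h3 := ENNReal.tendsto_atTop_zero_of_tsum_ne_top hx.ne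
    have h4 := (ENNReal.tendsto_toReal (by simp)).comp h3
    simp only [Function.comp_def, ENNReal.toReal_ofReal (sq_nonneg _), ENNReal.toReal_zero] at h4
    have h5 := h4.sqrt
    simp only [Real.sqrt_sq_eq_abs, Real.sqrt_zero] at h5
    exact (tendsto_zero_iff_abs_tendsto_zero _).2 h5
  refine tendsto_energyOne (tendsto_wE_mul hm he hE he1 he0 ?_)
    (tendsto_lintegral_sq_of_dominated (fun n => hm.mul (he n)) ((integrable_sq_iff hm).1 h2)
      (fun n x => ?_) (he0.mono fun x hx => ?_))
  · have h6 : ∀ n, wE α 0 (e n) ≤ (ENNReal.ofReal (constA d α / 2))⁻¹ * (2 : ℝ≥0∞)⁻¹ ^ n := by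
      intro n
      rw [mul_comm, ← div_eq_mul_inv, ENNReal.le_div_iff_mul_le
        (Or.inl (by rw [Ne, ENNReal.ofReal_eq_zero, not_le]; positivity))
        (Or.inl ENNReal.ofReal_ne_top), mul_comm]
      exact (le_add_right le_rfl : _ ≤ energyOne α (e n)).trans (heN n)
    have h7 : Tendsto (fun n : ℕ => ENNReal.ofReal (M ^ 2) *
        ((ENNReal.ofReal (constA d α / 2))⁻¹ * (2 : ℝ≥0∞)⁻¹ ^ n)) atTop (𝓝 0) := by
      have := ENNReal.Tendsto.const_mul (a := ENNReal.ofReal (M ^ 2))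
        (ENNReal.Tendsto.const_mul (a := (ENNReal.ofReal (constA d α / 2))⁻¹) hgeom
        (Or.inr (by
          rw [Ne, ENNReal.inv_eq_top, ENNReal.ofReal_eq_zero, not_le]; positivity)))
        (Or.inr ENNReal.ofReal_ne_top)
      simpa using this
    refine tendsto_of_tendsto_of_tendsto_of_le_of_le tendsto_const_nhds h7 (fun _ => bot_le)
      fun n => ?_
    refine le_trans ?_ (mul_le_mul_right (h6 n) _)
    rw [wE, ← lintegral_const_mul' _ _ ENNReal.ofReal_ne_top]
    refine lintegral_mono fun z => ?_
    rw [← ENNReal.ofReal_mul (sq_nonneg _)]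
    refine ENNReal.ofReal_le_ofReal ?_
    rw [weightedKernel_eq, weight_zero, weight_zero, mul_one, mul_one, mul_assoc]
    have h8 := levy_nonneg α (z.1 - z.2)
    have h9 : v z.2 ^ 2 ≤ M ^ 2 := by
      rw [← sq_abs]
      exact pow_le_pow_left₀ (abs_nonneg _) (hM _) 2
    gcongr
  · rw [abs_mul]
    exact mul_le_of_le_one_right (abs_nonneg _) (he1 n x)
  · simpa using hx.const_mul (v x)

/-! ### Mollification -/

theorem lintegral_sq_eq_eLpNorm {X : Type*} [MeasurableSpace X] (μ : Measure X) (f : X → ℝ) :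
    ∫⁻ x, ENNReal.ofReal (f x ^ 2) ∂μ = eLpNorm f 2 μ ^ 2 := by
  have h := eLpNorm_nnreal_pow_eq_lintegral (μ := μ) (f := f) (p := 2) two_ne_zero
  have e : ((2 : NNReal) : ℝ) = ((2 : ℕ) : ℝ) := by simp
  rw [e, ENNReal.rpow_natCast] at h
  have e2 : ((2 : NNReal) : ℝ≥0∞) = 2 := by simp
  rw [e2] at h
  rw [h]
  refine lintegral_congr fun x => ?_
  rw [ENNReal.rpow_natCast, ← ofReal_norm, ← ENNReal.ofReal_pow (norm_nonneg _),
    Real.norm_eq_abs, sq_abs]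

/-- Strong continuity in L² of a continuous family of measure preserving maps. The space is left
general so that it covers translations of ℝ^d and diagonal translations of the product. -/
theorem tendsto_lintegral_sq_sub_comp {X : Type*} [TopologicalSpace X] [MeasurableSpace X]
    [BorelSpace X] [R1Space X] {μ : Measure X} [μ.InnerRegularCompactLTTop]
    [IsLocallyFiniteMeasure μ] {F : X → ℝ} (hF : AEStronglyMeasurable F μ)
    (hF2 : ∫⁻ x, ENNReal.ofReal (F x ^ 2) ∂μ < ∞) {T : Eu d → X → X}
    (hT : Continuous fun p : Eu d × X => T p.1 p.2) (hTm : ∀ y, MeasurePreserving (T y) μ μ)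
    (hT0 : ∀ x, T 0 x = x) :
    Tendsto (fun y => ∫⁻ x, ENNReal.ofReal ((F x - F (T y x)) ^ 2) ∂μ) (𝓝 0) (𝓝 0) := by
  have hL : MemLp F 2 μ := by
    refine ⟨hF, ?_⟩
    rw [lintegral_sq_eq_eLpNorm] at hF2
    by_contra h
    rw [not_lt, top_le_iff] at h
    rw [h] at hF2
    simp at hF2
  set g : Eu d → C(X, X) := fun y => ⟨T y, hT.comp (continuous_const.prodMk continuous_id)⟩ with hg
  have hgc : Continuous g := ContinuousMap.continuous_of_continuous_uncurry g hT
  have hc : Continuous fun y => Lp.compMeasurePreserving (g y) (hTm y) (hL.toLp F) :=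
    Continuous.compMeasurePreservingLp (p := 2) continuous_const hgc (fun y => hTm y) (by simp)
  have h1 := (hc.tendsto 0).edist (tendsto_const_nhds (x := hL.toLp F))
  have e0 : Lp.compMeasurePreserving (g 0) (hTm 0) (hL.toLp F) = hL.toLp F := by
    rw [Lp.toLp_compMeasurePreserving]
    congr 1
    funext x
    exact congrArg F (hT0 x)
  rw [e0, edist_self] at h1
  have h2 := (ENNReal.continuous_pow 2).tendsto 0 |>.comp h1
  rw [zero_pow two_ne_zero] at h2
  refine h2.congr fun y => ?_
  rw [Function.comp, Lp.toLp_compMeasurePreserving, edist_comm, Lp.edist_toLp_toLp,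
    ← lintegral_sq_eq_eLpNorm]
  rfl

/-- Continuity of translations in `W^{α/2,2}`. -/
theorem tendsto_energyOne_sub_translate {α : ℝ} {u : Eu d → ℝ} (hu : MemW α u) :
    Tendsto (fun y : Eu d => energyOne α fun x => u x - u (x - y)) (𝓝 0) (𝓝 0) := by
  have hm := aemeasurable_of_memW hu
  obtain ⟨h2, hE⟩ := (memW_iff' α hm).1 hu
  have t1 : Tendsto (fun y : Eu d => ∫⁻ x, ENNReal.ofReal ((u x - u (x - y)) ^ 2)) (𝓝 0) (𝓝 0) :=
    tendsto_lintegral_sq_sub_comp (T := fun y x => x - y) hm.aestronglyMeasurable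
      ((integrable_sq_iff hm).1 h2) (by fun_prop) (fun y => measurePreserving_sub_right volume y)
      (fun x => sub_zero x)
  -- The energy is the squared L² norm of `F` on the product. The kernel depends only on the
  -- difference, so translating `u` translates `F` diagonally.
  set F : Eu d × Eu d → ℝ := fun z => (u z.1 - u z.2) * Real.sqrt (levy α (z.1 - z.2)) with hF
  have hFm : AEMeasurable F (volume.prod volume) :=
    ((aemeasurable_fst hm).sub (aemeasurable_snd hm)).mul (measurable_levy_sub α).sqrt.aemeasurable
  have hF2 : ∫⁻ z, ENNReal.ofReal (F z ^ 2) ∂(volume.prod volume) < ∞ := by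
    refine lt_of_eq_of_lt (lintegral_congr fun z => ?_) hE
    rw [hF, weightedKernel_eq, weight_zero, weight_zero, mul_one, mul_one, mul_pow,
      Real.sq_sqrt (levy_nonneg _ _)]
  have t2 := tendsto_lintegral_sq_sub_comp (T := fun (y : Eu d) (z : Eu d × Eu d) =>
    (z.1 - y, z.2 - y)) hFm.aestronglyMeasurable hF2 (by fun_prop)
    (fun y => (measurePreserving_sub_right volume y).prod (measurePreserving_sub_right volume y))
    (fun z => by simp)
  have t3 : Tendsto (fun y : Eu d => wE α 0 fun x => u x - u (x - y)) (𝓝 0) (𝓝 0) := by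
    refine t2.congr fun y => lintegral_congr fun z => ?_
    rw [weightedKernel_eq, weight_zero, weight_zero, mul_one, mul_one, hF]
    simp only [sub_sub_sub_cancel_right]
    rw [← sub_mul, mul_pow, Real.sq_sqrt (levy_nonneg _ _)]
    congr 2
    ring
  have := (ENNReal.Tendsto.const_mul (a := ENNReal.ofReal (constA d α / 2)) t3
    (Or.inr ENNReal.ofReal_ne_top)).add t1
  simpa [energyOne] using this

/-- Jensen's inequality for the square, in the form of nonnegativity of the variance. -/
theorem sq_integral_le {X : Type*} [MeasurableSpace X] {μ : Measure X} [IsProbabilityMeasure μ]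
    {g : X → ℝ} (hg : Measurable g) {M : ℝ} (hM : ∀ x, |g x| ≤ M) :
    ENNReal.ofReal ((∫ x, g x ∂μ) ^ 2) ≤ ∫⁻ x, ENNReal.ofReal (g x ^ 2) ∂μ := by
  have hL : MemLp g 2 μ := MemLp.of_bound hg.aestronglyMeasurable M (Eventually.of_forall hM)
  have h1 := ProbabilityTheory.variance_nonneg g μ
  rw [ProbabilityTheory.variance_eq_sub hL] at h1
  rw [← ofReal_integral_eq_lintegral_ofReal hL.integrable_sq
    (Eventually.of_forall fun x => sq_nonneg _)]
  exact ENNReal.ofReal_le_ofReal (sub_nonneg.1 h1)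

/-- Convexity of the energy. -/
theorem energyOne_integral_le {α : ℝ} {μ : Measure (Eu d)} [IsProbabilityMeasure μ]
    {D : Eu d → Eu d → ℝ} (hD : Measurable fun p : Eu d × Eu d => D p.1 p.2) {M : ℝ}
    (hM : ∀ x y, |D x y| ≤ M) :
    energyOne α (fun x => ∫ y, D x y ∂μ) ≤ ∫⁻ y, energyOne α (fun x => D x y) ∂μ := by
  have hDx : ∀ x, Measurable (D x) := fun x => hD.comp (measurable_const.prodMk measurable_id)
  have hint : ∀ x, Integrable (D x) μ := fun x =>
    (MemLp.of_bound (p := 1) (hDx x).aestronglyMeasurable M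
      (Eventually.of_forall (hM x))).integrable le_rfl
  have m1 : Measurable fun p : (Eu d × Eu d) × Eu d =>
      ENNReal.ofReal (weightedKernel α 0 (fun x => D x p.2) p.1) := by
    simp only [weightedKernel_eq, weight_zero, mul_one]
    have a1 : Measurable fun p : (Eu d × Eu d) × Eu d => D p.1.1 p.2 :=
      hD.comp ((measurable_fst.comp measurable_fst).prodMk measurable_snd)
    have a2 : Measurable fun p : (Eu d × Eu d) × Eu d => D p.1.2 p.2 :=
      hD.comp ((measurable_snd.comp measurable_fst).prodMk measurable_snd)
    exact (((a1.sub a2).pow_const 2).mul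
      ((measurable_levy_sub α).comp measurable_fst)).ennreal_ofReal
  have m2 : Measurable fun p : Eu d × Eu d => ENNReal.ofReal (D p.1 p.2 ^ 2) :=
    (hD.pow_const 2).ennreal_ofReal
  have i1 : wE α 0 (fun x => ∫ y, D x y ∂μ) ≤ ∫⁻ y, wE α 0 (fun x => D x y) ∂μ := by
    unfold wE
    rw [← lintegral_lintegral_swap m1.aemeasurable]
    refine lintegral_mono fun z => ?_
    have e : ∀ g : Eu d → ℝ, ENNReal.ofReal (weightedKernel α 0 g z) =
        ENNReal.ofReal ((g z.1 - g z.2) ^ 2) * ENNReal.ofReal (levy α (z.1 - z.2)) := fun g => by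
      rw [← ENNReal.ofReal_mul (sq_nonneg _), weightedKernel_eq, weight_zero, weight_zero, mul_one,
        mul_one]
    simp only [e]
    rw [lintegral_mul_const' _ _ ENNReal.ofReal_ne_top, ← integral_sub (hint _) (hint _)]
    refine mul_le_mul_left ?_ _
    exact sq_integral_le (M := M + M) ((hDx _).sub (hDx _)) fun y =>
      (abs_sub _ _).trans (add_le_add (hM _ _) (hM _ _))
  have i2 : ∫⁻ x, ENNReal.ofReal ((∫ y, D x y ∂μ) ^ 2) ≤
      ∫⁻ y, (∫⁻ x, ENNReal.ofReal (D x y ^ 2)) ∂μ := by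
    rw [← lintegral_lintegral_swap m2.aemeasurable]
    exact lintegral_mono fun x => sq_integral_le (hDx x) (hM x)
  unfold energyOne
  rw [lintegral_add_right _ ?_, lintegral_const_mul' _ _ ENNReal.ofReal_ne_top]
  · exact add_le_add (mul_le_mul_right i1 _) i2
  · exact m2.lintegral_prod_left'

/-- Functions carried by a compact subset of `Ω` are limits of continuous ones. -/
theorem exists_continuous_approx {α : ℝ} {Ω K : Set (Eu d)} (hΩ : IsOpen Ω) (hK : IsCompact K)
    (hKΩ : K ⊆ Ω) {u : Eu d → ℝ} (hu : Measurable u) (hW : MemW α u) {M : ℝ}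
    (hM : ∀ x, |u x| ≤ M) (h0 : ∀ x, x ∉ K → u x = 0) {δ : ℝ≥0∞} (hδ : 0 < δ) :
    ∃ ψ : Eu d → ℝ, SymmForm.IsCc Ω ψ ∧ energyOne α (fun x => u x - ψ x) ≤ δ := by
  obtain ⟨r₁, hr₁, hr₁Ω⟩ := hK.exists_cthickening_subset_open hΩ hKΩ
  obtain ⟨r₂, hr₂, hr₂δ⟩ := Metric.eventually_nhds_iff.1
    ((tendsto_energyOne_sub_translate hW).eventually (gt_mem_nhds hδ))
  -- Radius `r₁` keeps the support of the mollification inside `Ω`; radius `r₂` makes translations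
  -- by less than `r₂` move `u` by less than `δ`.
  set r := min r₁ r₂ with hr
  have hr0 : 0 < r := lt_min hr₁ hr₂
  let φ : ContDiffBump (0 : Eu d) := ⟨r / 2, r, by positivity, by linarith⟩
  set ρ : Eu d → ℝ := φ.normed volume with hρ
  have hρc : Continuous ρ := φ.continuous_normed
  have hρ0 : ∀ y, 0 ≤ ρ y := fun y => φ.nonneg_normed y
  have hρs : ∀ y, ρ y ≠ 0 → ‖y‖ < r := fun y hy => by
    have : y ∈ Function.support (φ.normed volume) := hy
    rw [φ.support_normed_eq, mem_ball_zero_iff] at this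
    exact this
  set μ : Measure (Eu d) := volume.withDensity fun y => ENNReal.ofReal (ρ y) with hμ
  have hρm : Measurable fun y => ENNReal.ofReal (ρ y) := hρc.measurable.ennreal_ofReal
  have : IsProbabilityMeasure μ := ⟨by
    rw [hμ, withDensity_apply _ MeasurableSet.univ, Measure.restrict_univ,
      ← ofReal_integral_eq_lintegral_ofReal φ.integrable_normed (Eventually.of_forall hρ0),
      φ.integral_normed, ENNReal.ofReal_one]⟩
  have hμae : ∀ᵐ y ∂μ, ‖y‖ < r := by
    rw [hμ, ae_withDensity_iff hρm]
    refine Eventually.of_forall fun y hy => hρs y fun h => hy ?_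
    rw [h, ENNReal.ofReal_zero]
  have hμint : ∀ g : Eu d → ℝ, ∫ y, g y ∂μ = ∫ y, ρ y * g y := fun g => by
    rw [hμ, integral_withDensity_eq_integral_toReal_smul hρm (Eventually.of_forall fun _ =>
      ENNReal.ofReal_lt_top)]
    refine integral_congr_ae (Eventually.of_forall fun y => ?_)
    simp only [ENNReal.toReal_ofReal (hρ0 y), smul_eq_mul]
  set ψ : Eu d → ℝ := fun x => ∫ y, u (x - y) ∂μ with hψ
  have huL : LocallyIntegrable u := by
    have h1 : Integrable u := by
      have h3 : IntegrableOn u K := Measure.integrableOn_of_bounded hK.measure_lt_top.ne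
        hu.aestronglyMeasurable (Eventually.of_forall hM)
      have h4 := (integrable_indicator_iff hK.measurableSet).2 h3
      refine h4.congr (Eventually.of_forall fun x => ?_)
      by_cases hx : x ∈ K
      · simp [hx]
      · simp [hx, h0 x hx]
    exact h1.locallyIntegrable
  have hψc : Continuous ψ := by
    have h1 := HasCompactSupport.continuous_convolution_left (ContinuousLinearMap.lsmul ℝ ℝ)
      (φ.hasCompactSupport_normed (μ := volume)) φ.continuous_normed huL
    have e : ψ = convolution (φ.normed volume) u (ContinuousLinearMap.lsmul ℝ ℝ) volume := by
      funext x
      rw [convolution_lsmul]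
      exact hμint _
    rw [e]
    exact h1
  have hψ0 : ∀ x, x ∉ Metric.cthickening r₁ K → ψ x = 0 := fun x hx => by
    rw [hψ]
    refine integral_eq_zero_of_ae (hμae.mono fun y hy => h0 _ fun hxy => hx ?_)
    refine Metric.mem_cthickening_of_dist_le x (x - y) r₁ K hxy ?_
    rw [dist_eq_norm, sub_sub_cancel]
    exact hy.le.trans (min_le_left _ _)
  have hψs : tsupport ψ ⊆ Metric.cthickening r₁ K :=
    closure_minimal (fun x hx => by
      by_contra h
      exact hx (hψ0 x h)) Metric.isClosed_cthickening
  refine ⟨ψ, ⟨hψc, ?_, hψs.trans hr₁Ω⟩, ?_⟩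
  · exact hK.cthickening.of_isClosed_subset (isClosed_tsupport ψ) hψs
  · have hint : ∀ x, Integrable (fun y => u (x - y)) μ := fun x =>
      (MemLp.of_bound (p := 1) (hu.comp (by fun_prop)).aestronglyMeasurable M
        (Eventually.of_forall fun y => hM _)).integrable le_rfl
    -- The error is an average of translation errors against a probability measure, so convexity of
    -- the energy bounds it by their average.
    have e : (fun x => u x - ψ x) = fun x => ∫ y, (u x - u (x - y)) ∂μ := by
      funext x
      rw [integral_sub (integrable_const _) (hint x), integral_const]
      simp [hψ]
    rw [e]
    refine (energyOne_integral_le (M := M + M) (D := fun x y => u x - u (x - y)) ?_ fun x y =>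
      (abs_sub _ _).trans (add_le_add (hM _) (hM _))).trans ?_
    · exact (hu.comp measurable_fst).sub (hu.comp (measurable_fst.sub measurable_snd))
    · calc _ ≤ ∫⁻ _, δ ∂μ := lintegral_mono_ae (hμae.mono fun y hy => (hr₂δ (by
            rw [dist_zero_right]
            exact hy.trans_le (min_le_right _ _))).le)
        _ = δ := by simp

/-- Functions in `W_0^{α/2,2}(Ω)` are limits of continuous ones with compact support in `Ω`. -/
theorem MemW0.exists_approx (hd : 0 < d) {α : ℝ} (hα : 0 < α) (hα' : α < 2) {Ω : Set (Eu d)}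
    (hΩ : IsOpen Ω) {u : Eu d → ℝ} (hu : MemW0 α Ω u) {ε : ℝ≥0∞} (hε : 0 < ε) :
    ∃ ψ : Eu d → ℝ, SymmForm.IsCc Ω ψ ∧ energyOne α (fun x => u x - ψ x) ≤ ε := by
  obtain ⟨hW, f, hfu, hq, hf0⟩ := hu
  have hfW := memW_congr hfu.symm hW
  have hfm := aemeasurable_of_memW hfW
  have hA := constA_pos hd hα hα'
  -- Four successive approximations with a factor 2 in each triangle inequality cost at most 22δ.
  have hδ : (0 : ℝ≥0∞) < ε / 32 := ENNReal.div_pos hε.ne' (by simp)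
  set δ := ε / 32 with hδdef
  obtain ⟨n, hn⟩ := ((tendsto_energyOne_sub_bandTrunc hfW).eventually (gt_mem_nhds hδ)).exists
  set v₁ : Eu d → ℝ := fun x => bandTrunc n (f x) with hv₁
  have hv₁m : AEMeasurable v₁ := (continuous_bandTrunc n).measurable.comp_aemeasurable hfm
  have hv₁W : MemW α v₁ := MemW.of_abs_le hd hα hα' hv₁m hfW
    (fun x y => abs_bandTrunc_sub_le n _ _) fun x => by
      have := abs_bandTrunc_sub_le n (f x) 0
      simpa [bandTrunc_zero] using this
  have hv₁b : ∀ x, |v₁ x| ≤ (n : ℝ) + 1 := fun x => abs_bandTrunc_le n _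
  obtain ⟨m, hm⟩ := ((tendsto_energyOne_sub_mul_radialCut hd hα hα' hv₁W).eventually
    (gt_mem_nhds hδ)).exists
  set v₂ : Eu d → ℝ := fun x => v₁ x * radialCut m x with hv₂
  have hv₂m : AEMeasurable v₂ := hv₁m.mul (continuous_radialCut m).measurable.aemeasurable
  have hadd : ∀ {p q : Eu d → ℝ} (_ : MemW α p) (_ : AEMeasurable q),
      energyOne α (fun x => p x - q x) < ∞ → MemW α q := fun {p q} hp hqm h => by
    have h1 : MemW α fun x => p x - q x :=
      (memW_iff hd hα hα' ((aemeasurable_of_memW hp).fun_sub hqm)).2 h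
    have h2 := hp.add hd hα hα' (h1.const_mul hd hα hα' (-1))
    have e : (fun x => p x + -1 * (p x - q x)) = q := funext fun x => by ring
    rwa [e] at h2
  have hv₂W : MemW α v₂ := hadd hv₁W hv₂m (hm.trans_le le_top)
  have hv₂b : ∀ x, |v₂ x| ≤ (n : ℝ) + 1 := fun x => by
    rw [hv₂, abs_mul]
    refine (mul_le_of_le_one_right (abs_nonneg _) ?_).trans (hv₁b x)
    rw [abs_of_nonneg (radialCut_nonneg m x)]
    exact radialCut_le_one m x
  -- One open set of small capacity absorbs both exceptional sets: off it `f` is continuous and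
  -- vanishes outside `Ω` at every point. Multiplying by `1 - e` removes this set at small cost in
  -- energy.
  have hG : ∀ k : ℕ, ∃ (G : Set (Eu d)) (e : Eu d → ℝ), IsOpen G ∧ ContinuousOn f Gᶜ ∧
      (∀ x, x ∉ G → x ∉ Ω → f x = 0) ∧ Measurable e ∧ (∀ x ∈ G, e x = 1) ∧
      (∀ x, |e x| ≤ 1) ∧ energyOne α e ≤ (2 : ℝ≥0∞)⁻¹ ^ k := by
    intro k
    have hk : (0 : ℝ≥0∞) < (2 : ℝ≥0∞)⁻¹ ^ k / 2 :=
      ENNReal.half_pos (ENNReal.pow_pos (ENNReal.inv_pos.2 (by simp)) k).ne'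
    obtain ⟨G, hGo, hGc, hGf⟩ := hq _ hk
    obtain ⟨e', U, he', hUo, hU, h1, h0, hle, hlt⟩ := exists_potential hd hα hα' (hf0 ▸ hk :
      capacity α {x | x ∈ Ωᶜ ∧ f x ≠ 0} < _)
    have hGU : capacity α (G ∪ U) < (2 : ℝ≥0∞)⁻¹ ^ k := by
      refine (capacity_union_le hd hα hα' G U).trans_lt ?_
      have h2 : capacity α U ≤ energyOne α e' := capacity_le hd hα hα' he'.aemeasurable hUo le_rfl
        (Eventually.of_forall fun x hx => (h1 x hx).ge)
      calc _ < (2 : ℝ≥0∞)⁻¹ ^ k / 2 + (2 : ℝ≥0∞)⁻¹ ^ k / 2 :=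
            ENNReal.add_lt_add hGc (h2.trans_lt hlt)
        _ = _ := ENNReal.add_halves _
    obtain ⟨e, V, he, hVo, hV, e1, e0, ele, elt⟩ := exists_potential hd hα hα' hGU
    refine ⟨G ∪ U, e, hGo.union hUo,
      hGf.mono (Set.compl_subset_compl.2 Set.subset_union_left), fun x hx hxΩ => ?_, he,
      fun x hx => e1 x (hV hx), fun x => abs_le.2 ⟨by linarith [e0 x], ele x⟩, elt.le⟩
    by_contra hne
    exact hx (Or.inr (hU ⟨hxΩ, hne⟩))
  choose G e hGo hGf hGΩ hem he1 heb heN using hG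
  obtain ⟨k, hk⟩ := ((tendsto_energyOne_mul hA hv₂W (fun k => (hem k).aemeasurable) hv₂b heb
    heN).eventually (gt_mem_nhds hδ)).exists
  set h : Eu d → ℝ := fun x => v₂ x * (1 - e k x) with hh
  have hhm : AEMeasurable h := hv₂m.mul (measurable_const.sub (hem k)).aemeasurable
  have hv₂h : energyOne α (fun x => v₂ x - h x) < δ := by
    refine lt_of_eq_of_lt ?_ hk
    congr 1
    funext x
    rw [hh]
    ring
  have hhW : MemW α h := hadd hv₂W hhm (hv₂h.trans_le le_top)
  -- Continuity of `f` on the closed set `(G k)ᶜ` makes `K` closed. The band truncation vanishes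
  -- where |f| is small, so the modified function lives on `K`; and `f` is 0 off `Ω` away from `G
  -- k`, so `K` lies inside `Ω`.
  set K : Set (Eu d) := ((G k)ᶜ ∩ f ⁻¹' {s | ((n : ℝ) + 1)⁻¹ ≤ |s|}) ∩
    Metric.closedBall 0 (2 * ((m : ℝ) + 1)) with hK
  have hKc : IsCompact K := by
    refine (isCompact_closedBall _ _).inter_left ?_
    exact (hGf k).preimage_isClosed_of_isClosed (hGo k).isClosed_compl
      (isClosed_le continuous_const continuous_abs)
  have hKΩ : K ⊆ Ω := fun x hx => by
    by_contra hxΩ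
    have h1 : ((n : ℝ) + 1)⁻¹ ≤ |f x| := hx.1.2
    rw [hGΩ k x hx.1.1 hxΩ, abs_zero] at h1
    have h2 : (0 : ℝ) < ((n : ℝ) + 1)⁻¹ := by positivity
    linarith
  have hhK : ∀ x, x ∉ K → h x = 0 := fun x hx => by
    by_cases h1 : x ∈ G k
    · rw [hh]
      simp only [he1 k x h1, sub_self, mul_zero]
    by_cases h2 : ((n : ℝ) + 1)⁻¹ ≤ |f x|
    · by_cases h3 : ‖x‖ ≤ 2 * ((m : ℝ) + 1)
      · exact absurd ⟨⟨h1, h2⟩, mem_closedBall_zero_iff.2 h3⟩ hx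
      · rw [hh, hv₂]
        simp only [radialCut_eq_zero (not_le.1 h3).le, mul_zero, zero_mul]
    · rw [hh, hv₂, hv₁]
      simp only [bandTrunc_eq_zero (not_le.1 h2).le, zero_mul]
  have hhb : ∀ x, |h x| ≤ 2 * ((n : ℝ) + 1) := fun x => by
    rw [hh, abs_mul]
    have h1 : |1 - e k x| ≤ 2 := by
      have := abs_le.1 (heb k x)
      exact abs_le.2 ⟨by linarith, by linarith⟩
    have := mul_le_mul (hv₂b x) h1 (abs_nonneg _) (by positivity)
    linarith
  -- A Borel representative whose bound and support hold at every point, as the mollification lemma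
  -- requires.
  set h' : Eu d → ℝ := K.indicator fun x => clamp (2 * ((n : ℝ) + 1)) (hhm.mk h x) with hh'
  have hh'm : Measurable h' :=
    ((continuous_clamp _).measurable.comp hhm.measurable_mk).indicator hKc.measurableSet
  have hhh' : h =ᵐ[volume] h' := by
    filter_upwards [hhm.ae_eq_mk] with x hx
    by_cases hxK : x ∈ K
    · rw [hh', Set.indicator_of_mem hxK, ← hx, clamp_of_abs_le (hhb x)]
    · rw [hh', Set.indicator_of_notMem hxK, hhK x hxK]
  obtain ⟨ψ, hψ, hψN⟩ := exists_continuous_approx (α := α) hΩ hKc hKΩ hh'm (memW_congr hhh' hhW)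
    (M := 2 * ((n : ℝ) + 1)) (fun x => by
      by_cases hxK : x ∈ K
      · rw [hh', Set.indicator_of_mem hxK]
        exact abs_clamp_le _ _ (by positivity)
      · rw [hh', Set.indicator_of_notMem hxK, abs_zero]
        positivity) (fun x hx => Set.indicator_of_notMem hx _) hδ
  have hhψ : energyOne α (fun x => h x - ψ x) ≤ δ := by
    rwa [energyOne_congr α (v := fun x => h' x - ψ x)]
    filter_upwards [hhh'] with x hx
    rw [hx]
  refine ⟨ψ, hψ, ?_⟩
  rw [energyOne_congr α (v := fun x => f x - ψ x) (by
    filter_upwards [hfu] with x hx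
    rw [hx])]
  calc energyOne α (fun x => f x - ψ x) ≤ 2 * δ + 2 * (2 * δ + 2 * (2 * δ + 2 * δ)) := by
        refine (energyOne_sub_triangle α hfm hv₁m).trans ?_
        gcongr
        refine (energyOne_sub_triangle α hv₁m hv₂m).trans ?_
        gcongr
        refine (energyOne_sub_triangle α hv₂m hhm).trans ?_
        gcongr
    _ = 22 * δ := by ring
    _ ≤ 32 * δ := by gcongr; norm_num
    _ = ε := by rw [hδdef]; exact ENNReal.mul_div_cancel (by simp) (by simp)

/-! ### The maximal weighted form in `L²(ℝ^d)` -/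

/-- The measure `|x - y|^{-d-α} w(x) w(y) dx dy`. -/
def pairMeasure (d : ℕ) (α β : ℝ) : Measure (Eu d × Eu d) :=
  ((volume : Measure (Eu d)).prod volume).withDensity fun z =>
    ENNReal.ofReal (levy α (z.1 - z.2) * weight β z.1 * weight β z.2)

theorem measurable_pairDensity (α β : ℝ) : Measurable fun z : Eu d × Eu d =>
    ENNReal.ofReal (levy α (z.1 - z.2) * weight β z.1 * weight β z.2) :=
  (((measurable_levy_sub α).mul ((measurable_weight β).comp measurable_fst)).mul
    ((measurable_weight β).comp measurable_snd)).ennreal_ofReal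

theorem ae_pairMeasure (α β : ℝ) {p : Eu d × Eu d → Prop}
    (h : ∀ᵐ z ∂((volume : Measure (Eu d)).prod volume), p z) : ∀ᵐ z ∂(pairMeasure d α β), p z :=
  (withDensity_absolutelyContinuous _ _).ae_le h

/-- The difference `u(x)/w(x) - u(y)/w(y)`. -/
def pairDiff (β : ℝ) (u : Eu d → ℝ) (z : Eu d × Eu d) : ℝ :=
  u z.1 * ‖z.1‖ ^ β - u z.2 * ‖z.2‖ ^ β

theorem lintegral_pairDiff (α β : ℝ) (u : Eu d → ℝ) :
    ∫⁻ z, ENNReal.ofReal (pairDiff β u z ^ 2) ∂(pairMeasure d α β) =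
      wE α β fun x => u x * ‖x‖ ^ β := by
  rw [pairMeasure, lintegral_withDensity_eq_lintegral_mul_non_measurable _
    (measurable_pairDensity α β) (Eventually.of_forall fun _ => ENNReal.ofReal_lt_top), wE]
  refine lintegral_congr fun z => ?_
  rw [Pi.mul_apply, ← ENNReal.ofReal_mul (mul_nonneg (mul_nonneg (levy_nonneg _ _)
    (weight_nonneg _ _)) (weight_nonneg _ _)), weightedKernel_eq, pairDiff]
  congr 1
  ring

theorem aemeasurable_mul_rpow (β : ℝ) {u : Eu d → ℝ} (hu : AEMeasurable u) :
    AEMeasurable fun x => u x * ‖x‖ ^ β :=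
  hu.mul (measurable_norm_rpow β).aemeasurable

theorem aemeasurable_pairDiff (α β : ℝ) {u : Eu d → ℝ} (hu : AEMeasurable u) :
    AEMeasurable (pairDiff β u) (pairMeasure d α β) := by
  have h := aemeasurable_mul_rpow β hu
  exact ((aemeasurable_fst h).sub (aemeasurable_snd h)).mono_ac (withDensity_absolutelyContinuous _ _)

theorem memLp_two_iff_lintegral {X : Type*} [MeasurableSpace X] {μ : Measure X} {f : X → ℝ}
    (hf : AEMeasurable f μ) : MemLp f 2 μ ↔ ∫⁻ x, ENNReal.ofReal (f x ^ 2) ∂μ < ∞ := by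
  rw [MemLp, lintegral_sq_eq_eLpNorm, ENNReal.pow_lt_top_iff]
  simp [hf.aestronglyMeasurable]

theorem memLp_pairDiff_iff (α β : ℝ) {u : Eu d → ℝ} (hu : AEMeasurable u) :
    MemLp (pairDiff β u) 2 (pairMeasure d α β) ↔ wE α β (fun x => u x * ‖x‖ ^ β) < ∞ := by
  rw [memLp_two_iff_lintegral (aemeasurable_pairDiff α β hu), lintegral_pairDiff]

theorem pairDiff_congr (α β : ℝ) {u v : Eu d → ℝ} (h : u =ᵐ[volume] v) :
    pairDiff β u =ᵐ[pairMeasure d α β] pairDiff β v := by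
  refine ae_pairMeasure α β ?_
  filter_upwards [ae_fst h, ae_snd h] with z h1 h2
  rw [pairDiff, pairDiff, h1, h2]

theorem pairDiff_add (α β : ℝ) (u v : Lp ℝ 2 (volume : Measure (Eu d))) :
    pairDiff β (u + v : Lp ℝ 2 (volume : Measure (Eu d))) =ᵐ[pairMeasure d α β]
      pairDiff β u + pairDiff β v := by
  filter_upwards [pairDiff_congr α β (Lp.coeFn_add u v)] with z hz
  rw [hz]
  simp only [pairDiff, Pi.add_apply]
  ring

theorem pairDiff_smul (α β : ℝ) (c : ℝ) (u : Lp ℝ 2 (volume : Measure (Eu d))) :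
    pairDiff β (c • u : Lp ℝ 2 (volume : Measure (Eu d))) =ᵐ[pairMeasure d α β]
      c • pairDiff β u := by
  filter_upwards [pairDiff_congr α β (Lp.coeFn_smul c u)] with z hz
  rw [hz]
  simp only [pairDiff, Pi.smul_apply, smul_eq_mul]
  ring

/-- The functions of finite weighted energy in `L²`. -/
def maxDom (d : ℕ) (α β : ℝ) : Submodule ℝ (Lp ℝ 2 (volume : Measure (Eu d))) where
  carrier := {u | MemLp (pairDiff β u) 2 (pairMeasure d α β)}
  zero_mem' := by
    refine (MemLp.zero (ε := ℝ) (μ := pairMeasure d α β)).ae_eq ?_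
    filter_upwards [pairDiff_congr α β (Lp.coeFn_zero ℝ 2 (volume : Measure (Eu d)))] with z hz
    rw [hz]
    simp [pairDiff]
  add_mem' {u v} hu hv := (MemLp.add hu hv).ae_eq (pairDiff_add α β u v).symm
  smul_mem' c u hu := (MemLp.const_smul hu c).ae_eq (pairDiff_smul α β c u).symm

theorem mem_maxDom_iff {α β : ℝ} {u : Lp ℝ 2 (volume : Measure (Eu d))} :
    u ∈ maxDom d α β ↔ wE α β (fun x => u x * ‖x‖ ^ β) < ∞ :=
  memLp_pairDiff_iff α β (Lp.aestronglyMeasurable u).aemeasurable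

theorem memLp_of_mem_maxDom {α β : ℝ} (u : maxDom d α β) :
    MemLp (pairDiff β (u : Lp ℝ 2 (volume : Measure (Eu d)))) 2 (pairMeasure d α β) := u.2

/-- The difference operator on functions of finite weighted energy. -/
def pairMap (d : ℕ) (α β : ℝ) : maxDom d α β →ₗ[ℝ] Lp ℝ 2 (pairMeasure d α β) where
  toFun u := MemLp.toLp (pairDiff β (u : Lp ℝ 2 (volume : Measure (Eu d)))) (memLp_of_mem_maxDom u)
  map_add' u v := by
    refine Lp.ext ?_
    refine (MemLp.coeFn_toLp (memLp_of_mem_maxDom (u + v))).trans ?_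
    refine EventuallyEq.trans ?_ (Lp.coeFn_add _ _).symm
    filter_upwards [MemLp.coeFn_toLp (memLp_of_mem_maxDom u),
      MemLp.coeFn_toLp (memLp_of_mem_maxDom v),
      pairDiff_add α β (u : Lp ℝ 2 (volume : Measure (Eu d))) v] with z h1 h2 h3
    rw [Pi.add_apply, h1, h2]
    exact h3
  map_smul' c u := by
    refine Lp.ext ?_
    refine (MemLp.coeFn_toLp (memLp_of_mem_maxDom (c • u))).trans ?_
    refine EventuallyEq.trans ?_ (Lp.coeFn_smul _ _).symm
    filter_upwards [MemLp.coeFn_toLp (memLp_of_mem_maxDom u),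
      pairDiff_smul α β c (u : Lp ℝ 2 (volume : Measure (Eu d)))] with z h1 h3
    rw [Pi.smul_apply, RingHom.id_apply, h1]
    exact h3

theorem norm_sq_toLp {X : Type*} [MeasurableSpace X] {μ : Measure X} {f : X → ℝ}
    (hf : MemLp f 2 μ) : ‖hf.toLp f‖ ^ 2 = (∫⁻ x, ENNReal.ofReal (f x ^ 2) ∂μ).toReal := by
  rw [Lp.norm_toLp, lintegral_sq_eq_eLpNorm, ENNReal.toReal_pow]

/-- The maximal weighted form: `u ↦ 𝒜/2 ∬ (u/w(x) - u/w(y))² |x-y|^{-d-α} w(x) w(y) dx dy`. -/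
def maxForm (d : ℕ) (α β : ℝ) (hA : 0 < constA d α) :
    SymmForm (Lp ℝ 2 (volume : Measure (Eu d))) where
  dom := maxDom d α β
  form := (constA d α / 2) • (innerₗ (Lp ℝ 2 (pairMeasure d α β))).compl₁₂ (pairMap d α β)
    (pairMap d α β)
  symm f g := by
    simp only [LinearMap.smul_apply, LinearMap.compl₁₂_apply, innerₗ_apply_apply]
    rw [real_inner_comm]
  nonneg f := by
    simp only [LinearMap.smul_apply, LinearMap.compl₁₂_apply, innerₗ_apply_apply, smul_eq_mul]
    have := real_inner_self_nonneg (x := pairMap d α β f)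
    positivity

/-- The difference operator on the domain of the maximal weighted form. -/
def formMap (d : ℕ) (α β : ℝ) (hA : 0 < constA d α) :
    (maxForm d α β hA).dom →ₗ[ℝ] Lp ℝ 2 (pairMeasure d α β) := pairMap d α β

theorem coeFn_formMap {α β : ℝ} {hA : 0 < constA d α} (u : (maxForm d α β hA).dom) :
    (formMap d α β hA u : Eu d × Eu d → ℝ) =ᵐ[pairMeasure d α β]
      pairDiff β (u : Lp ℝ 2 (volume : Measure (Eu d))) :=
  MemLp.coeFn_toLp (memLp_of_mem_maxDom u)

theorem maxForm_self (α β : ℝ) (hA : 0 < constA d α) (u : (maxForm d α β hA).dom) :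
    (maxForm d α β hA).form u u = constA d α / 2 * ‖formMap d α β hA u‖ ^ 2 := by
  rw [← real_inner_self_eq_norm_sq]
  rfl

theorem norm_sq_pairMap (α β : ℝ) (u : maxDom d α β) :
    ‖pairMap d α β u‖ ^ 2 = (wE α β fun x => (u : Lp ℝ 2 (volume : Measure (Eu d))) x *
      ‖x‖ ^ β).toReal := by
  rw [← lintegral_pairDiff]
  exact norm_sq_toLp (memLp_of_mem_maxDom u)

theorem maxForm_eq (α β : ℝ) (hA : 0 < constA d α) (u : (maxForm d α β hA).dom) :
    (maxForm d α β hA).form u u = constA d α / 2 * (wE α β fun x =>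
      (u : Lp ℝ 2 (volume : Measure (Eu d))) x * ‖x‖ ^ β).toReal := by
  rw [maxForm_self]
  congr 1
  exact norm_sq_pairMap α β u

/-- The form is a multiple of the squared norm of the difference operator. That operator is closed:
a limit of the functions in L² and a limit of their differences in the weighted L² of pairs must
match, by almost everywhere convergence along subsequences. -/
theorem isClosed_maxForm (α β : ℝ) (hA : 0 < constA d α) : (maxForm d α β hA).IsClosed := by
  intro u f hu hf
  have hc : CauchySeq fun n => formMap d α β hA (u n) := by
    rw [Metric.cauchySeq_iff]
    intro ε hε
    obtain ⟨N, hN⟩ := hu (constA d α / 2 * ε ^ 2) (by positivity)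
    refine ⟨N, fun m hm n hn => ?_⟩
    have h1 := hN m hm n hn
    rw [maxForm_self, map_sub] at h1
    have h2 := lt_of_mul_lt_mul_left h1 (by positivity)
    rw [dist_eq_norm]
    exact lt_of_pow_lt_pow_left₀ 2 hε.le h2
  obtain ⟨G, hG⟩ := cauchySeq_tendsto_of_complete hc
  obtain ⟨ns, hns, hae⟩ := (tendstoInMeasure_of_tendsto_Lp hf).exists_seq_tendsto_ae
  have hG' := hG.comp hns.tendsto_atTop
  obtain ⟨ms, hms, hae'⟩ := (tendstoInMeasure_of_tendsto_Lp hG').exists_seq_tendsto_ae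
  have hcoe : ∀ n, (formMap d α β hA (u n) : Eu d × Eu d → ℝ) =ᵐ[pairMeasure d α β]
      pairDiff β (u n : Lp ℝ 2 (volume : Measure (Eu d))) := fun n => coeFn_formMap (u n)
  have hGf : (G : Eu d × Eu d → ℝ) =ᵐ[pairMeasure d α β] pairDiff β f := by
    filter_upwards [hae', ae_pairMeasure α β (ae_fst hae), ae_pairMeasure α β (ae_snd hae),
      ae_all_iff.2 hcoe] with z hz h1 h2 h3
    refine tendsto_nhds_unique hz ?_
    simp only [Function.comp, h3]
    have h4 := (h1.mul_const (‖z.1‖ ^ β)).sub (h2.mul_const (‖z.2‖ ^ β))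
    exact h4.comp hms.tendsto_atTop
  have hfd : f ∈ maxDom d α β := (Lp.memLp G).ae_eq hGf
  refine ⟨⟨f, hfd⟩, rfl, ?_⟩
  have hGe : formMap d α β hA ⟨f, hfd⟩ = G := by
    refine Lp.ext ?_
    exact (coeFn_formMap _).trans hGf.symm
  have h5 : Tendsto (fun n => constA d α / 2 * ‖formMap d α β hA (u n) - G‖ ^ 2) atTop
      (𝓝 (constA d α / 2 * 0 ^ 2)) :=
    ((tendsto_iff_norm_sub_tendsto_zero.1 hG).pow 2).const_mul _
  rw [zero_pow two_ne_zero, mul_zero] at h5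
  refine h5.congr fun n => ?_
  rw [maxForm_self, ← hGe, ← map_sub]

/-! ### Consequences of the ground state representation -/

theorem MemW.integrable_hardy (hd : 0 < d) {α : ℝ} (hα : 0 < α) (hα' : α < 2) (hαd : α < d)
    {u : Eu d → ℝ} (hu : MemW α u) : Integrable fun x => u x ^ 2 * ‖x‖ ^ (-α) := by
  have hm := aemeasurable_of_memW hu
  obtain ⟨h2, hE⟩ := (memW_iff' α hm).1 hu
  exact integrable_sq_mul_rpow hd hα hα' hαd hm h2 hE

theorem MemW.groundState (hd : 0 < d) {α β : ℝ} (hα : 0 < α) (hα' : α < 2) (hβ : 0 < β)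
    (hβd : α + β < d) {u : Eu d → ℝ} (hu : MemW α u) :
    wE α 0 u = wE α β (fun x => u x * ‖x‖ ^ β) +
      ENNReal.ofReal (2 * (hardyConst d α β / constA d α) * ∫ x, u x ^ 2 * ‖x‖ ^ (-α)) := by
  have hm := aemeasurable_of_memW hu
  exact wE_groundState hd hα hα' hβ hβd hm ((memW_iff' α hm).1 hu).1
    (hu.integrable_hardy hd hα hα' (by linarith))

theorem MemW.wE_le (hd : 0 < d) {α β : ℝ} (hα : 0 < α) (hα' : α < 2) (hβ : 0 < β)
    (hβd : α + β < d) {u : Eu d → ℝ} (hu : MemW α u) :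
    wE α β (fun x => u x * ‖x‖ ^ β) ≤ wE α 0 u := by
  rw [hu.groundState hd hα hα' hβ hβd]
  exact le_add_right le_rfl

/-- The converse direction of the ground state representation. Membership in W is obtained for
functions given through f = u/w, once their L² norm and Hardy integral are known to be finite. -/
theorem memW_of_wE_lt_top (hd : 0 < d) {α β : ℝ} (hα : 0 < α) (hα' : α < 2) (hβ : 0 < β)
    (hβd : α + β < d) {u : Eu d → ℝ} (hu : AEMeasurable u) (h2 : Integrable fun x => u x ^ 2)
    (hH : Integrable fun x => u x ^ 2 * ‖x‖ ^ (-α))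
    (hE : wE α β (fun x => u x * ‖x‖ ^ β) < ∞) : MemW α u := by
  rw [memW_iff' α hu, wE_groundState hd hα hα' hβ hβd hu h2 hH]
  exact ⟨h2, ENNReal.add_lt_top.2 ⟨hE, ENNReal.ofReal_lt_top⟩⟩

theorem hardyIntegrand_eq (α c : ℝ) (u : Eu d → ℝ) (x : Eu d) :
    hardyIntegrand α c u x = c * (u x ^ 2 * ‖x‖ ^ (-α)) := by
  rw [hardyIntegrand, Real.rpow_neg (norm_nonneg x)]
  ring

theorem MemW.integrable_hardyIntegrand (hd : 0 < d) {α : ℝ} (hα : 0 < α) (hα' : α < 2)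
    (hαd : α < d) (c : ℝ) {u : Eu d → ℝ} (hu : MemW α u) : Integrable (hardyIntegrand α c u) :=
  ((hu.integrable_hardy hd hα hα' hαd).const_mul c).congr
    (Eventually.of_forall fun x => (hardyIntegrand_eq α c u x).symm)

/-- The ground state representation of the Hardy form. -/
theorem hardyEnergy_eq (hd : 0 < d) {α β : ℝ} (hα : 0 < α) (hα' : α < 2) (hβ : 0 < β)
    (hβd : α + β < d) {Ω : Set (Eu d)} {u : Eu d → ℝ} (hu : MemW α u)
    (h0 : ∀ᵐ x, x ∉ Ω → u x = 0) :
    hardyEnergy α (hardyConst d α β) Ω u =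
      constA d α / 2 * (wE α β fun x => u x * ‖x‖ ^ β).toReal := by
  have hA := constA_pos hd hα hα'
  have hc := hardyConst_pos (d := d) hα hβ hβd
  have hm := aemeasurable_of_memW hu
  have hE := ((memW_iff' α hm).1 hu).2
  have hint : ∫ x in Ω, hardyIntegrand α (hardyConst d α β) u x =
      hardyConst d α β * ∫ x, u x ^ 2 * ‖x‖ ^ (-α) := by
    rw [setIntegral_eq_integral_of_ae_compl_eq_zero, ← integral_const_mul]
    · exact integral_congr_ae (Eventually.of_forall fun x => hardyIntegrand_eq α _ u x)
    · filter_upwards [h0] with x hx hxΩ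
      rw [hardyIntegrand_eq, hx hxΩ]
      ring
  have hI : 0 ≤ ∫ x, u x ^ 2 * ‖x‖ ^ (-α) := integral_nonneg fun x => by positivity
  rw [hardyEnergy, energy_eq α hm, hint, hu.groundState hd hα hα' hβ hβd, ENNReal.toReal_add
    ((hu.wE_le hd hα hα' hβ hβd).trans_lt hE).ne ENNReal.ofReal_ne_top,
    ENNReal.toReal_ofReal (by positivity)]
  field_simp
  ring

theorem criticalConst_pos {α : ℝ} (hα : 0 < α) (hαd : α < d) : 0 < criticalConst d α := by
  rw [← hardyConst_critical hα hαd]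
  exact hardyConst_pos hα (by linarith) (by linarith)

/-- In the subcritical case the weighted energy controls the energy. -/
theorem MemW.wE_le_of_lt (hd : 0 < d) {α β : ℝ} (hα : 0 < α) (hα' : α < 2) (hβ : 0 < β)
    (hβd : α + β < d) (hc : hardyConst d α β < criticalConst d α) {u : Eu d → ℝ}
    (hu : MemW α u) : (wE α 0 u).toReal ≤
      (1 - hardyConst d α β / criticalConst d α)⁻¹ * (wE α β fun x => u x * ‖x‖ ^ β).toReal := by
  have hαd : α < d := by linarith
  have hA := constA_pos hd hα hα'
  have hc0 := hardyConst_pos (d := d) hα hβ hβd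
  have hc1 := criticalConst_pos (d := d) hα hαd
  have hm := aemeasurable_of_memW hu
  obtain ⟨h2, hE⟩ := (memW_iff' α hm).1 hu
  have hH := hu.integrable_hardy hd hα hα' hαd
  have hI : 0 ≤ ∫ x, u x ^ 2 * ‖x‖ ^ (-α) := integral_nonneg fun x => by positivity
  have h1 := hardy_inequality hd hα hα' (β := (d - α) / 2) (by linarith) (by linarith) hm h2
  rw [hardyConst_critical hα hαd, ← ofReal_integral_eq_lintegral_ofReal hH
    (Eventually.of_forall fun x => by positivity), ← ENNReal.ofReal_mul (by positivity)] at h1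
  have h3 := ENNReal.toReal_mono hE.ne h1
  rw [ENNReal.toReal_ofReal (by positivity)] at h3
  have h4 := congrArg ENNReal.toReal (hu.groundState hd hα hα' hβ hβd)
  rw [ENNReal.toReal_add ((hu.wE_le hd hα hα' hβ hβd).trans_lt hE).ne ENNReal.ofReal_ne_top,
    ENNReal.toReal_ofReal (by positivity)] at h4
  have h5 : 0 < 1 - hardyConst d α β / criticalConst d α := by
    rw [sub_pos, div_lt_one hc1]
    exact hc
  rw [inv_mul_eq_div, le_div_iff₀ h5]
  -- The Hardy term with constant c is the fraction c/c* of the critical one, which the energy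
  -- dominates; it is absorbed because c < c*.
  have h6 : 2 * (hardyConst d α β / constA d α) * ∫ x, u x ^ 2 * ‖x‖ ^ (-α) =
      hardyConst d α β / criticalConst d α *
        (2 * (criticalConst d α / constA d α) * ∫ x, u x ^ 2 * ‖x‖ ^ (-α)) := by
    field_simp
  have h7 := mul_le_mul_of_nonneg_left h3 (div_nonneg hc0.le hc1.le)
  linarith

/-! ### `W_0` as a subspace of `L²`, and the transported forms -/

/-- `W_0^{α/2,2}(Ω)` as a subspace of `L²(ℝ^d)`. -/
def w0Sub (hd : 0 < d) {α : ℝ} (hα : 0 < α) (hα' : α < 2) (Ω : Set (Eu d)) :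
    Submodule ℝ (Lp ℝ 2 (volume : Measure (Eu d))) where
  carrier := {u | MemW0 α Ω u}
  zero_mem' := memW0_congr (Lp.coeFn_zero ℝ 2 (volume : Measure (Eu d))).symm
    (MemW0.zero hd hα hα')
  add_mem' {u v} hu hv := memW0_congr (Lp.coeFn_add u v).symm (MemW0.add hd hα hα' hu hv)
  smul_mem' c u hu := memW0_congr (Lp.coeFn_smul c u).symm (MemW0.const_mul hd hα hα' c hu)

theorem w0Sub_le (hd : 0 < d) {α β : ℝ} (hα : 0 < α) (hα' : α < 2) (hβ : 0 < β)
    (hβd : α + β < d) (Ω : Set (Eu d)) :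
    w0Sub hd hα hα' Ω ≤ (maxForm d α β (constA_pos hd hα hα')).dom := fun u hu => by
  have h : MemW0 α Ω u := hu
  have hm := aemeasurable_of_memW h.1
  exact mem_maxDom_iff.2 ((h.1.wE_le hd hα hα' hβ hβd).trans_lt ((memW_iff' α hm).1 h.1).2)

theorem w0Sub_le_zero (hd : 0 < d) {α : ℝ} (hα : 0 < α) (hα' : α < 2) (Ω : Set (Eu d)) :
    w0Sub hd hα hα' Ω ≤ (maxForm d α 0 (constA_pos hd hα hα')).dom := fun u hu => by
  have h : MemW0 α Ω u := hu
  have hm := aemeasurable_of_memW h.1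
  refine mem_maxDom_iff.2 ?_
  simpa using ((memW_iff' α hm).1 h.1).2

theorem toReal_energyOne {α : ℝ} (hA : 0 < constA d α) {u : Lp ℝ 2 (volume : Measure (Eu d))}
    (h : wE α 0 u < ∞) :
    (energyOne α u).toReal = constA d α / 2 * (wE α 0 u).toReal + ‖u‖ ^ 2 := by
  have h2 : ‖u‖ ^ 2 = (∫⁻ x, ENNReal.ofReal (u x ^ 2)).toReal := by
    rw [Lp.norm_def, lintegral_sq_eq_eLpNorm, ENNReal.toReal_pow]
  rw [energyOne, h2, ENNReal.toReal_add (ENNReal.mul_ne_top ENNReal.ofReal_ne_top h.ne),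
    ENNReal.toReal_mul, ENNReal.toReal_ofReal (by positivity)]
  rw [lintegral_sq_eq_eLpNorm]
  exact ENNReal.pow_ne_top (Lp.eLpNorm_ne_top u)

namespace SymmForm

variable {H K : Type*} [NormedAddCommGroup H] [InnerProductSpace ℝ H] [NormedAddCommGroup K]
  [InnerProductSpace ℝ K]

/-- The restriction of a form to a subspace, transported by a linear map. -/
def transport (b : SymmForm K) (D : Submodule ℝ K) (h : D ≤ b.dom) (U : H →ₗ[ℝ] K) : SymmForm H :=
  (b.comap U).restrict (D.comap U) (Submodule.comap_mono h)

theorem transport_isClosable {b : SymmForm K} (hb : b.IsClosed) (D : Submodule ℝ K)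
    (h : D ≤ b.dom) (U : H →ₗᵢ[ℝ] K) : (b.transport D h U.toLinearMap).IsClosable :=
  (hb.comap U).isClosable_restrict _ _

theorem transport_isClosureOf {b : SymmForm K} (hb : b.IsClosed) (D : Submodule ℝ K)
    (h : D ≤ b.dom) (U : H →ₗᵢ[ℝ] K) :
    ∃ c : SymmForm H, c.IsClosureOf (b.transport D h U.toLinearMap) :=
  ⟨_, (hb.comap U).isClosureOf_closureOn _ _⟩

theorem transport_isClosed {b : SymmForm K} (hb : b.IsClosed) (D : Submodule ℝ K)
    (h : D ≤ b.dom) (U : H →ₗᵢ[ℝ] K)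
    (hD : ∀ (u : ℕ → D) (f : K), b.IsFormCauchy (fun n => Submodule.inclusion h (u n)) →
      Tendsto (fun n => (u n : K)) atTop (𝓝 f) → f ∈ D) :
    (b.transport D h U.toLinearMap).IsClosed := by
  intro u f hu hf
  obtain ⟨g, hg, hlim⟩ := hb.comap U (fun n => Submodule.inclusion (Submodule.comap_mono h) (u n)) f
    hu hf
  have hfD : f ∈ D.comap U.toLinearMap :=
    hD (fun n => U.toLinearMap.submoduleComap D (u n)) (U f) (fun ε hε => by
      obtain ⟨N, hN⟩ := hu ε hε
      refine ⟨N, fun m hm n hn => ?_⟩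
      have e : Submodule.inclusion h (U.toLinearMap.submoduleComap D (u m)) -
          Submodule.inclusion h (U.toLinearMap.submoduleComap D (u n)) =
          (⟨U (u m - u n : (b.transport D h U.toLinearMap).dom), h (u m - u n).2⟩ : b.dom) := by
        apply Subtype.ext
        exact (map_sub U (u m : H) (u n)).symm
      exact lt_of_eq_of_lt (congrArg (fun x : b.dom => b.form x x) e) (hN m hm n hn))
      ((U.continuous.tendsto f).comp hf)
  refine ⟨⟨f, hfD⟩, rfl, ?_⟩
  have e : g = Submodule.inclusion (Submodule.comap_mono h) ⟨f, hfD⟩ := Subtype.ext hg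
  rw [e] at hlim
  exact hlim

end SymmForm

theorem maxForm_sub_eq (α β : ℝ) (hA : 0 < constA d α) (u v : (maxForm d α β hA).dom) :
    (maxForm d α β hA).form (u - v) (u - v) = constA d α / 2 * (wE α β fun x =>
      ((u : Lp ℝ 2 (volume : Measure (Eu d))) - v : Lp ℝ 2 (volume : Measure (Eu d))) x *
        ‖x‖ ^ β).toReal := maxForm_eq α β hA (u - v)

theorem energyOne_sub_eq {α : ℝ} (hA : 0 < constA d α) (u v : (maxForm d α 0 hA).dom) :
    energyOne α (fun x => (u : Lp ℝ 2 (volume : Measure (Eu d))) x -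
      (v : Lp ℝ 2 (volume : Measure (Eu d))) x) =
      ENNReal.ofReal ((maxForm d α 0 hA).form (u - v) (u - v) +
        ‖(u : Lp ℝ 2 (volume : Measure (Eu d))) - v‖ ^ 2) := by
  have hfin : wE α 0 ((u : Lp ℝ 2 (volume : Measure (Eu d))) - v :
      Lp ℝ 2 (volume : Measure (Eu d))) < ∞ := by
    have := mem_maxDom_iff.1 ((maxForm d α 0 hA).dom.sub_mem u.2 v.2)
    simpa only [Real.rpow_zero, mul_one] using this
  rw [maxForm_sub_eq]
  simp only [Real.rpow_zero, mul_one]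
  rw [← toReal_energyOne hA hfin, ENNReal.ofReal_toReal]
  · exact energyOne_congr α (Lp.coeFn_sub _ _).symm
  · rw [energyOne, lintegral_sq_eq_eLpNorm]
    exact ENNReal.add_ne_top.2 ⟨ENNReal.mul_ne_top ENNReal.ofReal_ne_top hfin.ne,
      ENNReal.pow_ne_top (Lp.eLpNorm_ne_top _)⟩

/-- At β = 0 the maximal form is the unweighted energy, so form convergence together with L²
convergence is convergence in W, under which W_0 is closed. -/
theorem w0Sub_closed_zero (hd : 0 < d) {α : ℝ} (hα : 0 < α) (hα' : α < 2) (Ω : Set (Eu d))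
    (u : ℕ → w0Sub hd hα hα' Ω) (f : Lp ℝ 2 (volume : Measure (Eu d)))
    (hu : (maxForm d α 0 (constA_pos hd hα hα')).IsFormCauchy
      fun n => Submodule.inclusion (w0Sub_le_zero hd hα hα' Ω) (u n))
    (hf : Tendsto (fun n => (u n : Lp ℝ 2 (volume : Measure (Eu d)))) atTop (𝓝 f)) :
    f ∈ w0Sub hd hα hα' Ω := by
  have hA := constA_pos hd hα hα'
  obtain ⟨g, hg, hlim⟩ := isClosed_maxForm α 0 hA _ f hu hf
  subst hg
  have hlim2 : Tendsto (fun n => ‖(u n : Lp ℝ 2 (volume : Measure (Eu d))) - g‖ ^ 2) atTop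
      (𝓝 0) := by
    have := (hf.sub_const (g : Lp ℝ 2 (volume : Measure (Eu d)))).norm.pow 2
    simpa using this
  have hfm : AEMeasurable (g : Lp ℝ 2 (volume : Measure (Eu d))) :=
    (Lp.aestronglyMeasurable _).aemeasurable
  change MemW0 α Ω (g : Lp ℝ 2 (volume : Measure (Eu d)))
  refine MemW0.of_tendsto hd hα hα' hfm fun ε hε => ?_
  have hlim3 := (ENNReal.continuous_ofReal.tendsto _).comp (hlim.add hlim2)
  rw [add_zero, ENNReal.ofReal_zero] at hlim3
  obtain ⟨n, hn⟩ := (hlim3.eventually (gt_mem_nhds hε)).exists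
  refine ⟨(u n : Lp ℝ 2 (volume : Measure (Eu d))), (u n).2, lt_of_eq_of_lt ?_ hn⟩
  rw [energyOne_sub_comm]
  exact energyOne_sub_eq hA (Submodule.inclusion (w0Sub_le_zero hd hα hα' Ω) (u n)) g

/-- In the subcritical case, `W_0` is complete for the Hardy form norm. -/
theorem w0Sub_closed (hd : 0 < d) {α β : ℝ} (hα : 0 < α) (hα' : α < 2) (hβ : 0 < β)
    (hβd : α + β < d) (hc : hardyConst d α β < criticalConst d α) (Ω : Set (Eu d))
    (u : ℕ → w0Sub hd hα hα' Ω) (f : Lp ℝ 2 (volume : Measure (Eu d)))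
    (hu : (maxForm d α β (constA_pos hd hα hα')).IsFormCauchy
      fun n => Submodule.inclusion (w0Sub_le hd hα hα' hβ hβd Ω) (u n))
    (hf : Tendsto (fun n => (u n : Lp ℝ 2 (volume : Measure (Eu d)))) atTop (𝓝 f)) :
    f ∈ w0Sub hd hα hα' Ω := by
  have hA := constA_pos hd hα hα'
  have hC : 0 < (1 - hardyConst d α β / criticalConst d α)⁻¹ := by
    rw [inv_pos, sub_pos, div_lt_one (criticalConst_pos hα (by linarith))]
    exact hc
  refine w0Sub_closed_zero hd hα hα' Ω u f (fun ε hε => ?_) hf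
  obtain ⟨N, hN⟩ := hu (ε / (1 - hardyConst d α β / criticalConst d α)⁻¹) (by positivity)
  refine ⟨N, fun m hm n hn => ?_⟩
  have h1 := hN m hm n hn
  rw [maxForm_sub_eq, lt_div_iff₀ hC] at h1
  rw [maxForm_sub_eq]
  simp only [Real.rpow_zero, mul_one]
  refine lt_of_le_of_lt ?_ h1
  have hmem : MemW0 α Ω ((u m - u n : w0Sub hd hα hα' Ω) :
    Lp ℝ 2 (volume : Measure (Eu d))) := (u m - u n).2
  have h2 := hmem.1.wE_le_of_lt hd hα hα' hβ hβd hc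
  refine (mul_le_mul_of_nonneg_left h2 (by positivity)).trans (le_of_eq ?_)
  rw [mul_comm (constA d α / 2 * _), mul_left_comm]
  rfl

/-! ### Weighted energies of Lipschitz functions -/

theorem lintegral_prod_mul_sub' {g : Eu d → ℝ≥0∞} {k : Eu d → ℝ≥0∞} (hg : AEMeasurable g)
    (hk : Measurable k) :
    ∫⁻ z : Eu d × Eu d, g z.1 * k (z.1 - z.2) ∂(volume.prod volume) =
      (∫⁻ x, g x) * ∫⁻ x, k x := by
  have hm : AEMeasurable (fun z : Eu d × Eu d => g z.1 * k (z.1 - z.2)) (volume.prod volume) :=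
    (hg.comp_quasiMeasurePreserving Measure.quasiMeasurePreserving_fst).mul
      (hk.comp (measurable_fst.sub measurable_snd)).aemeasurable
  rw [lintegral_prod _ hm]
  simp only
  have : ∀ x : Eu d, ∫⁻ y, g x * k (x - y) = g x * ∫⁻ y, k y := fun x => by
    rw [lintegral_const_mul _ (by fun_prop), lintegral_sub_left_eq_self]
  simp only [this]
  rw [lintegral_mul_const'' _ hg]

/-- The product of weights is replaced by a sum of functions of one variable, which decouples the
double integral of a compactly supported function. If `y` is outside the ball its weight is at most
1; otherwise 2ab ≤ a² + b². -/
theorem weight_mul_weight_le {β R : ℝ} (hβ : 0 ≤ β) (hR : 1 ≤ R) {x y : Eu d}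
    (hx : x ∈ Metric.ball (0 : Eu d) R) :
    weight β x * weight β y ≤
      (Metric.ball (0 : Eu d) R).indicator (fun x => weight β x + weight β x ^ 2) x +
      (Metric.ball (0 : Eu d) R).indicator (fun x => weight β x + weight β x ^ 2) y := by
  have h1 := weight_nonneg β x
  have h2 := weight_nonneg β y
  rw [Set.indicator_of_mem hx]
  by_cases hy : y ∈ Metric.ball (0 : Eu d) R
  · rw [Set.indicator_of_mem hy]
    nlinarith [sq_nonneg (weight β x - weight β y)]
  · rw [Set.indicator_of_notMem hy]
    rw [mem_ball_zero_iff, not_lt] at hy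
    have h3 : weight β y ≤ 1 := by
      unfold weight
      exact Real.rpow_le_one_of_one_le_of_nonpos (hR.trans hy) (by linarith)
    nlinarith [mul_le_mul_of_nonneg_left h3 h1, sq_nonneg (weight β x)]

theorem integrable_indicator_weight (hd : 0 < d) {β R : ℝ} (hβ : 0 ≤ β) (hβd : 2 * β < d) :
    Integrable ((Metric.ball (0 : Eu d) R).indicator fun x => weight β x + weight β x ^ 2) := by
  rw [integrable_indicator_iff Metric.isOpen_ball.measurableSet]
  refine IntegrableOn.add (integrableOn_ball_norm_rpow hd (by linarith) R) ?_
  refine (integrableOn_ball_norm_rpow (d := d) hd hβd R).congr_fun (fun x _ => ?_)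
    Metric.isOpen_ball.measurableSet
  simp only [weight]
  rw [← Real.rpow_natCast, ← Real.rpow_mul (norm_nonneg x)]
  congr 1
  push_cast
  ring

/-- Differences vanish unless one point lies in the ball of radius `R`, and there the integrand is
dominated by an integrable function of one point times min(1, |z|²)|z|^{-d-α}. The condition 2β < d
makes w² locally integrable. -/
theorem wE_lt_top_of_lipschitz (hd : 0 < d) {α β : ℝ} (hα : 0 < α) (hα' : α < 2) (hβ : 0 ≤ β)
    (hβd : 2 * β < d) {f : Eu d → ℝ} {K R : ℝ} (hK : 1 ≤ K) (hR : 1 ≤ R) (hf : ∀ x, |f x| ≤ K)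
    (hlip : ∀ x y, |f x - f y| ≤ K * ‖x - y‖) (h0 : ∀ x, R ≤ ‖x‖ → f x = 0) :
    wE α β f < ∞ := by
  set G : Eu d → ℝ := (Metric.ball (0 : Eu d) R).indicator fun x => weight β x + weight β x ^ 2
    with hG
  have hGi : Integrable G := integrable_indicator_weight hd hβ hβd
  have hG0 : ∀ x, 0 ≤ G x := fun x => Set.indicator_nonneg (fun x _ => by
    have := weight_nonneg β x
    positivity) x
  set k : Eu d → ℝ := fun z => 4 * K ^ 2 * (min 1 (‖z‖ ^ 2) * levy α z) with hk
  have hk0 : ∀ z, 0 ≤ k z := fun z =>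
    mul_nonneg (by positivity) (mul_nonneg (le_min zero_le_one (sq_nonneg _)) (levy_nonneg _ _))
  have hkm : Measurable k := ((measurable_const.min (measurable_norm.pow_const 2)).mul
      (measurable_levy α)).const_mul _
  have hki : ∫⁻ z, ENNReal.ofReal (k z) < ∞ :=
    (hasFiniteIntegral_iff_ofReal (Eventually.of_forall hk0)).1
      ((integrable_min_mul_levy hd hα hα').const_mul (4 * K ^ 2)).2
  have hGf : ∫⁻ x, ENNReal.ofReal (G x) < ∞ :=
    (hasFiniteIntegral_iff_ofReal (Eventually.of_forall hG0)).1 hGi.2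
  have hGm : AEMeasurable fun x => ENNReal.ofReal (G x) := hGi.1.aemeasurable.ennreal_ofReal
  have hpt : ∀ z : Eu d × Eu d, ENNReal.ofReal (weightedKernel α β f z) ≤
      ENNReal.ofReal (G z.1) * ENNReal.ofReal (k (z.1 - z.2)) +
        ENNReal.ofReal (G z.2) * ENNReal.ofReal (k (z.1 - z.2)) := by
    intro z
    rw [← add_mul, ← ENNReal.ofReal_add (hG0 _) (hG0 _), ← ENNReal.ofReal_mul
      (add_nonneg (hG0 _) (hG0 _))]
    refine ENNReal.ofReal_le_ofReal ?_
    rw [weightedKernel_eq, mul_assoc]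
    have hl := levy_nonneg α (z.1 - z.2)
    have hw : 0 ≤ weight β z.1 * weight β z.2 := mul_nonneg (weight_nonneg _ _) (weight_nonneg _ _)
    by_cases h1 : z.1 ∈ Metric.ball (0 : Eu d) R ∨ z.2 ∈ Metric.ball (0 : Eu d) R
    · have h2 : weight β z.1 * weight β z.2 ≤ G z.1 + G z.2 := by
        rcases h1 with h1 | h1
        · exact weight_mul_weight_le hβ hR h1
        · rw [mul_comm, add_comm]
          exact weight_mul_weight_le hβ hR h1
      have h3 := sq_sub_le_min hK hf hlip z.1 z.2
      calc (f z.1 - f z.2) ^ 2 * levy α (z.1 - z.2) * (weight β z.1 * weight β z.2) ≤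
          (4 * K ^ 2 * min 1 (‖z.1 - z.2‖ ^ 2)) * levy α (z.1 - z.2) * (G z.1 + G z.2) := by
            gcongr
        _ = _ := by rw [hk]; ring
    · rw [not_or, mem_ball_zero_iff, mem_ball_zero_iff, not_lt, not_lt] at h1
      rw [h0 _ h1.1, h0 _ h1.2, sub_self, zero_pow two_ne_zero, zero_mul, zero_mul]
      exact mul_nonneg (add_nonneg (hG0 _) (hG0 _)) (hk0 _)
  have hm : AEMeasurable (fun z : Eu d × Eu d =>
      ENNReal.ofReal (G z.1) * ENNReal.ofReal (k (z.1 - z.2))) (volume.prod volume) :=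
    (hGm.comp_quasiMeasurePreserving Measure.quasiMeasurePreserving_fst).mul
      (hkm.ennreal_ofReal.comp (measurable_fst.sub measurable_snd)).aemeasurable
  refine (lintegral_mono hpt).trans_lt ?_
  rw [lintegral_add_left' hm, lintegral_prod_mul_sub' (k := fun z => ENNReal.ofReal (k z)) hGm
    hkm.ennreal_ofReal, lintegral_prod_mul_sub (g := fun z => ENNReal.ofReal (G z))
    (k := fun z => ENNReal.ofReal (k z)) hGm hkm.ennreal_ofReal]
  exact ENNReal.add_lt_top.2 ⟨ENNReal.mul_lt_top hGf hki, ENNReal.mul_lt_top hGf hki⟩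

/-- Energies do not increase under contractions of the support. -/
theorem wE_comp_smul_le {α β : ℝ} (h : α + 2 * β ≤ d) {f : Eu d → ℝ} (hf : Measurable f) {r : ℝ}
    (hr : 1 ≤ r) : wE α β (fun x : Eu d => f (r • x)) ≤ wE α β f := by
  have hr0 : 0 < r := one_pos.trans_le hr
  -- The kernel scales with exponent d + α + 2β and the change of variables on pairs contributes
  -- -2d. The net exponent α + 2β - d is at most 0, and it vanishes in the critical case.
  have hk : ∀ z : Eu d × Eu d, weightedKernel α β (fun x => f (r • x)) z =
      r ^ ((d : ℝ) + α + 2 * β) * weightedKernel α β f (r • z) := by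
    intro z
    rw [weightedKernel_eq, weightedKernel_eq]
    simp only [levy, weight, Prod.smul_fst, Prod.smul_snd]
    rw [← smul_sub, norm_smul, norm_smul, norm_smul, Real.norm_of_nonneg hr0.le,
      Real.mul_rpow hr0.le (norm_nonneg _), Real.mul_rpow hr0.le (norm_nonneg _),
      Real.mul_rpow hr0.le (norm_nonneg _)]
    have e : r ^ ((d : ℝ) + α + 2 * β) * (r ^ (-((d : ℝ) + α)) * r ^ (-β) * r ^ (-β)) = 1 := by
      rw [← Real.rpow_add hr0, ← Real.rpow_add hr0, ← Real.rpow_add hr0]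
      convert Real.rpow_zero r using 2
      ring
    calc _ = (f (r • z.1) - f (r • z.2)) ^ 2 * ‖z.1 - z.2‖ ^ (-((d : ℝ) + α)) * ‖z.1‖ ^ (-β) *
          ‖z.2‖ ^ (-β) * 1 := by ring
      _ = _ := by rw [← e]; ring
  have hkm : Measurable fun z : Eu d × Eu d => ENNReal.ofReal (weightedKernel α β f z) := by
    have : weightedKernel α β f = fun z : Eu d × Eu d =>
        (f z.1 - f z.2) ^ 2 * levy α (z.1 - z.2) * weight β z.1 * weight β z.2 :=
      funext fun z => weightedKernel_eq α β f z
    rw [this]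
    exact ((((((hf.comp measurable_fst).sub (hf.comp measurable_snd)).pow_const 2).mul
      (measurable_levy_sub α)).mul ((measurable_weight β).comp measurable_fst)).mul
      ((measurable_weight β).comp measurable_snd)).ennreal_ofReal
  have hmap := Measure.map_addHaar_smul ((volume : Measure (Eu d)).prod (volume : Measure (Eu d))) hr0.ne'
  have hfr : Module.finrank ℝ (Eu d × Eu d) = d + d := by simp
  unfold wE
  simp only [hk]
  simp only [ENNReal.ofReal_mul (Real.rpow_nonneg hr0.le _)]
  rw [lintegral_const_mul' _ _ ENNReal.ofReal_ne_top,
    ← lintegral_map (μ := (volume : Measure (Eu d)).prod volume)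
      (f := fun z => ENNReal.ofReal (weightedKernel α β f z)) (g := fun z => r • z) hkm
      (measurable_const_smul r), hmap, lintegral_smul_measure, smul_eq_mul, ← mul_assoc, hfr,
    ← ENNReal.ofReal_mul (Real.rpow_nonneg hr0.le _)]
  refine mul_le_of_le_one_left bot_le ?_
  rw [← ENNReal.ofReal_one]
  refine ENNReal.ofReal_le_ofReal ?_
  rw [abs_of_pos (by positivity), ← Real.rpow_natCast, ← Real.rpow_neg hr0.le,
    ← Real.rpow_add hr0]
  refine Real.rpow_le_one_of_one_le_of_nonpos hr ?_
  push_cast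
  linarith

theorem wE_mul_le (α β : ℝ) {f g : Eu d → ℝ} {M N : ℝ} (hf : AEMeasurable f)
    (hM : ∀ x, |f x| ≤ M) (hN : ∀ x, |g x| ≤ N) :
    wE α β (fun x => f x * g x) ≤
      ENNReal.ofReal (2 * N ^ 2) * wE α β f + ENNReal.ofReal (2 * M ^ 2) * wE α β g := by
  unfold wE
  rw [← lintegral_const_mul' _ _ ENNReal.ofReal_ne_top,
    ← lintegral_const_mul' _ _ ENNReal.ofReal_ne_top,
    ← lintegral_add_left' ((aemeasurable_weightedKernel α β hf).ennreal_ofReal.const_mul _)]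
  refine lintegral_mono fun z => ?_
  have h1 := weightedKernel_nonneg α β f z
  have h2 := weightedKernel_nonneg α β g z
  rw [← ENNReal.ofReal_mul (by positivity), ← ENNReal.ofReal_mul (by positivity),
    ← ENNReal.ofReal_add (by positivity) (by positivity)]
  refine ENNReal.ofReal_le_ofReal ?_
  simp only [weightedKernel_eq]
  have h3 := levy_nonneg α (z.1 - z.2)
  have h4 := weight_nonneg β z.1
  have h5 := weight_nonneg β z.2
  have h6 : g z.1 ^ 2 ≤ N ^ 2 := by
    rw [← sq_abs]; exact pow_le_pow_left₀ (abs_nonneg _) (hN _) 2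
  have h7 : f z.2 ^ 2 ≤ M ^ 2 := by
    rw [← sq_abs]; exact pow_le_pow_left₀ (abs_nonneg _) (hM _) 2
  calc (f z.1 * g z.1 - f z.2 * g z.2) ^ 2 * levy α (z.1 - z.2) * weight β z.1 * weight β z.2 ≤
      (2 * (N ^ 2 * (f z.1 - f z.2) ^ 2) + 2 * (M ^ 2 * (g z.1 - g z.2) ^ 2)) *
        levy α (z.1 - z.2) * weight β z.1 * weight β z.2 := by
        gcongr
        refine (sq_mul_sub_mul_le _ _ _ _).trans ?_
        gcongr
    _ = _ := by ring

/-! ### Cutoff near the origin -/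

/-- A cutoff away from the origin, at scale `(n + 1)⁻¹`. -/
def originCut (n : ℕ) (x : Eu d) : ℝ := 1 - radialCut 0 (((n : ℝ) + 1) • x)

theorem continuous_originCut (n : ℕ) : Continuous (originCut n : Eu d → ℝ) := by
  have := (continuous_radialCut (d := d) 0).comp (continuous_const_smul ((n : ℝ) + 1))
  exact continuous_const.sub this

theorem originCut_nonneg (n : ℕ) (x : Eu d) : 0 ≤ originCut n x :=
  sub_nonneg.2 (radialCut_le_one _ _)

theorem originCut_le_one (n : ℕ) (x : Eu d) : originCut n x ≤ 1 := by
  have := radialCut_nonneg 0 (((n : ℝ) + 1) • x)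
  unfold originCut
  linarith

theorem abs_originCut_le (n : ℕ) (x : Eu d) : |originCut n x| ≤ 1 := by
  rw [abs_of_nonneg (originCut_nonneg n x)]
  exact originCut_le_one n x

theorem originCut_eq_zero {n : ℕ} {x : Eu d} (h : ((n : ℝ) + 1) * ‖x‖ ≤ 1) : originCut n x = 0 := by
  rw [originCut, radialCut_eq_one, sub_self]
  rw [norm_smul, Real.norm_of_nonneg (by positivity)]
  simpa using h

theorem tendsto_originCut {x : Eu d} (hx : x ≠ 0) :
    Tendsto (fun n => originCut n x) atTop (𝓝 1) := by
  have hx' : 0 < ‖x‖ := norm_pos_iff.2 hx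
  refine tendsto_const_nhds.congr' ?_
  filter_upwards [eventually_ge_atTop ⌈2 / ‖x‖⌉₊] with n hn
  rw [originCut, radialCut_eq_zero, sub_zero]
  rw [norm_smul, Real.norm_of_nonneg (by positivity)]
  have h1 : 2 / ‖x‖ ≤ n := (Nat.le_ceil _).trans (by exact_mod_cast hn)
  rw [div_le_iff₀ hx'] at h1
  push_cast
  nlinarith

/-- The product rule separates `f` from the cutoff, and scaling compares each cutoff with the first
one. A bound uniform in `n` is enough for lower semicontinuity, so the scale invariant case is
included. -/
theorem exists_wE_mul_originCut_le (hd : 0 < d) {α β : ℝ} (hα : 0 < α) (hα' : α < 2) (hβ : 0 ≤ β)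
    (hβd : α + 2 * β ≤ d) {f : Eu d → ℝ} {K R : ℝ} (hK : 1 ≤ K) (hR : 1 ≤ R)
    (hf : ∀ x, |f x| ≤ K) (hlip : ∀ x y, |f x - f y| ≤ K * ‖x - y‖)
    (h0 : ∀ x, R ≤ ‖x‖ → f x = 0) :
    ∃ C : ℝ≥0∞, C < ∞ ∧ ∀ n, wE α β (fun x => f x * originCut n x) ≤ C := by
  have hfm : AEMeasurable f := by
    have : LipschitzWith (Real.toNNReal K) f := LipschitzWith.of_dist_le_mul fun x y => by
      rw [Real.dist_eq, dist_eq_norm, Real.coe_toNNReal _ (by linarith)]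
      exact hlip x y
    exact this.continuous.measurable.aemeasurable
  have h1 : wE α β f < ∞ :=
    wE_lt_top_of_lipschitz hd hα hα' hβ (by linarith) hK hR hf hlip h0
  have h2 : wE α β (radialCut 0 : Eu d → ℝ) < ∞ :=
    wE_lt_top_of_lipschitz hd hα hα' hβ (by linarith) (K := 1) (R := 2) le_rfl one_le_two
      (fun x => by rw [abs_of_nonneg (radialCut_nonneg 0 x)]; exact radialCut_le_one 0 x)
      (fun x y => by rw [one_mul]; exact abs_radialCut_sub_le 0 x y)
      (fun x hx => radialCut_eq_zero (by simpa using hx))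
  refine ⟨ENNReal.ofReal (2 * 1 ^ 2) * wE α β f +
    ENNReal.ofReal (2 * K ^ 2) * wE α β (radialCut 0 : Eu d → ℝ),
    ENNReal.add_lt_top.2 ⟨ENNReal.mul_lt_top ENNReal.ofReal_lt_top h1,
      ENNReal.mul_lt_top ENNReal.ofReal_lt_top h2⟩, fun n => ?_⟩
  refine (wE_mul_le α β hfm hf (abs_originCut_le n)).trans ?_
  gcongr
  refine le_trans (wE_mono α β (g := fun x => radialCut 0 (((n : ℝ) + 1) • x)) fun x y => ?_)
    (wE_comp_smul_le hβd (continuous_radialCut 0).measurable (by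
      have : (0 : ℝ) ≤ n := Nat.cast_nonneg n
      linarith))
  unfold originCut
  rw [sub_sub_sub_cancel_left, abs_sub_comm]

/-! ### The weighted spaces `L²(Ω, w²)` inside `L²(ℝ^d)` -/

theorem ae_weightedMeasure_iff (hd : 0 < d) (γ : ℝ) {Ω : Set (Eu d)} (hΩ : MeasurableSet Ω)
    {p : Eu d → Prop} :
    (∀ᵐ x ∂(weightedMeasure γ Ω), p x) ↔ ∀ᵐ x, x ∈ Ω → p x := by
  rw [weightedMeasure, ae_withDensity_iff (((measurable_weight γ).pow_const 2).ennreal_ofReal),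
    ae_restrict_iff' hΩ]
  refine eventually_congr ?_
  filter_upwards [ae_ne_zero hd] with x hx
  have h : ENNReal.ofReal (weight γ x ^ 2) ≠ 0 := by
    have := weight_pos γ hx
    rw [Ne, ENNReal.ofReal_eq_zero, not_le]
    positivity
  simp [h]

theorem timesWeight_congr (hd : 0 < d) {γ : ℝ} {Ω : Set (Eu d)} (hΩ : MeasurableSet Ω)
    {f g : Eu d → ℝ} (h : f =ᵐ[weightedMeasure γ Ω] g) :
    timesWeight γ Ω f =ᵐ[volume] timesWeight γ Ω g := by
  filter_upwards [(ae_weightedMeasure_iff hd γ hΩ).1 h] with x hx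
  by_cases hxΩ : x ∈ Ω
  · simp [timesWeight, hxΩ, hx hxΩ]
  · simp [timesWeight, hxΩ]

theorem aemeasurable_timesWeight (hd : 0 < d) {γ : ℝ} {Ω : Set (Eu d)} (hΩ : MeasurableSet Ω)
    {f : Eu d → ℝ} (hf : AEMeasurable f (weightedMeasure γ Ω)) :
    AEMeasurable (timesWeight γ Ω f) :=
  ⟨timesWeight γ Ω (hf.mk f), ((measurable_weight γ).mul hf.measurable_mk).indicator hΩ,
    timesWeight_congr hd hΩ hf.ae_eq_mk⟩

theorem lintegral_timesWeight (γ : ℝ) {Ω : Set (Eu d)} (hΩ : MeasurableSet Ω) (f : Eu d → ℝ) :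
    ∫⁻ x, ENNReal.ofReal (timesWeight γ Ω f x ^ 2) =
      ∫⁻ x, ENNReal.ofReal (f x ^ 2) ∂(weightedMeasure γ Ω) := by
  rw [weightedMeasure, lintegral_withDensity_eq_lintegral_mul_non_measurable _
    (((measurable_weight γ).pow_const 2).ennreal_ofReal)
    (Eventually.of_forall fun _ => ENNReal.ofReal_lt_top), ← lintegral_indicator hΩ]
  refine lintegral_congr fun x => ?_
  by_cases hxΩ : x ∈ Ω
  · rw [Set.indicator_of_mem hxΩ, Pi.mul_apply, ← ENNReal.ofReal_mul (sq_nonneg _), timesWeight,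
      Set.indicator_of_mem hxΩ, mul_pow]
  · simp [timesWeight, hxΩ]

theorem memLp_timesWeight (hd : 0 < d) {γ : ℝ} {Ω : Set (Eu d)} (hΩ : MeasurableSet Ω)
    {f : Eu d → ℝ} (hf : MemLp f 2 (weightedMeasure γ Ω)) : MemLp (timesWeight γ Ω f) 2 := by
  rw [memLp_two_iff_lintegral (aemeasurable_timesWeight hd hΩ hf.1.aemeasurable),
    lintegral_timesWeight γ hΩ]
  exact (memLp_two_iff_lintegral hf.1.aemeasurable).1 hf

/-- The isometry `f ↦ w f` from `L²(Ω, w²)` to `L²(ℝ^d)`. -/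
def weightIso (hd : 0 < d) (γ : ℝ) {Ω : Set (Eu d)} (hΩ : MeasurableSet Ω) :
    Lp ℝ 2 (weightedMeasure γ Ω) →ₗᵢ[ℝ] Lp ℝ 2 (volume : Measure (Eu d)) where
  toFun f := MemLp.toLp (timesWeight γ Ω f) (memLp_timesWeight hd hΩ (Lp.memLp f))
  map_add' f g := by
    refine Lp.ext ((MemLp.coeFn_toLp _).trans (EventuallyEq.trans ?_ (Lp.coeFn_add _ _).symm))
    filter_upwards [timesWeight_congr hd hΩ (Lp.coeFn_add f g),
      MemLp.coeFn_toLp (memLp_timesWeight hd hΩ (Lp.memLp f)),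
      MemLp.coeFn_toLp (memLp_timesWeight hd hΩ (Lp.memLp g))] with x h1 h2 h3
    rw [Pi.add_apply, h1, h2, h3]
    by_cases hxΩ : x ∈ Ω
    · simp [timesWeight, hxΩ, mul_add]
    · simp [timesWeight, hxΩ]
  map_smul' c f := by
    refine Lp.ext ((MemLp.coeFn_toLp _).trans (EventuallyEq.trans ?_ (Lp.coeFn_smul _ _).symm))
    filter_upwards [timesWeight_congr hd hΩ (Lp.coeFn_smul c f),
      MemLp.coeFn_toLp (memLp_timesWeight hd hΩ (Lp.memLp f))] with x h1 h2
    rw [Pi.smul_apply, h1, h2]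
    by_cases hxΩ : x ∈ Ω
    · simp [timesWeight, hxΩ]
      ring
    · simp [timesWeight, hxΩ]
  norm_map' f := by
    refine (sq_eq_sq₀ (norm_nonneg _) (norm_nonneg _)).1 ?_
    refine (norm_sq_toLp (memLp_timesWeight hd hΩ (Lp.memLp f))).trans ?_
    rw [lintegral_timesWeight γ hΩ, Lp.norm_def, lintegral_sq_eq_eLpNorm, ENNReal.toReal_pow]

theorem coeFn_weightIso (hd : 0 < d) {γ : ℝ} {Ω : Set (Eu d)} (hΩ : MeasurableSet Ω)
    (f : Lp ℝ 2 (weightedMeasure γ Ω)) :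
    (weightIso hd γ hΩ f : Eu d → ℝ) =ᵐ[volume] timesWeight γ Ω f :=
  MemLp.coeFn_toLp (memLp_timesWeight hd hΩ (Lp.memLp f))

theorem weightIso_ae_eq_zero (hd : 0 < d) {γ : ℝ} {Ω : Set (Eu d)} (hΩ : MeasurableSet Ω)
    (f : Lp ℝ 2 (weightedMeasure γ Ω)) :
    ∀ᵐ x, x ∉ Ω → (weightIso hd γ hΩ f : Eu d → ℝ) x = 0 := by
  filter_upwards [coeFn_weightIso hd hΩ f] with x hx hxΩ
  rw [hx, timesWeight, Set.indicator_of_notMem hxΩ]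

theorem weight_mul_rpow {γ : ℝ} {x : Eu d} (hx : x ≠ 0) : weight γ x * ‖x‖ ^ γ = 1 := by
  rw [weight, ← Real.rpow_add (norm_pos_iff.2 hx), neg_add_cancel, Real.rpow_zero]

/-- Square integrable functions carried by `Ω` are in the range of the isometry. -/
theorem exists_weightIso_eq (hd : 0 < d) {γ : ℝ} {Ω : Set (Eu d)} (hΩ : MeasurableSet Ω)
    {u : Eu d → ℝ} (hu : MemLp u 2) (h0 : ∀ᵐ x, x ∉ Ω → u x = 0) :
    ∃ f : Lp ℝ 2 (weightedMeasure γ Ω), weightIso hd γ hΩ f = hu.toLp u ∧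
      (f : Eu d → ℝ) =ᵐ[weightedMeasure γ Ω] fun x => u x * ‖x‖ ^ γ := by
  have hm : AEMeasurable (fun x => u x * ‖x‖ ^ γ) (weightedMeasure γ Ω) :=
    (aemeasurable_mul_rpow γ hu.1.aemeasurable).mono_ac
      ((withDensity_absolutelyContinuous _ _).trans Measure.restrict_le_self.absolutelyContinuous)
  have e : timesWeight γ Ω (fun x => u x * ‖x‖ ^ γ) =ᵐ[volume] u := by
    filter_upwards [h0, ae_ne_zero hd] with x hx hx0
    by_cases hxΩ : x ∈ Ω
    · rw [timesWeight, Set.indicator_of_mem hxΩ, mul_left_comm, weight_mul_rpow hx0, mul_one]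
    · rw [timesWeight, Set.indicator_of_notMem hxΩ, hx hxΩ]
  have hL : MemLp (fun x => u x * ‖x‖ ^ γ) 2 (weightedMeasure γ Ω) := by
    rw [memLp_two_iff_lintegral hm, ← lintegral_timesWeight γ hΩ]
    refine lt_of_eq_of_lt (lintegral_congr_ae ?_)
      ((memLp_two_iff_lintegral hu.1.aemeasurable).1 hu)
    filter_upwards [e] with x hx
    rw [hx]
  refine ⟨hL.toLp _, Lp.ext ?_, hL.coeFn_toLp⟩
  refine (coeFn_weightIso hd hΩ _).trans ?_
  exact ((timesWeight_congr hd hΩ hL.coeFn_toLp).trans e).trans (hu.coeFn_toLp).symm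

/-! ### Test functions -/

theorem exists_lipschitz_bounds {f : Eu d → ℝ} (hf : ContDiff ℝ 1 f) (hs : HasCompactSupport f) :
    ∃ K R : ℝ, 1 ≤ K ∧ 1 ≤ R ∧ (∀ x, |f x| ≤ K) ∧ (∀ x y, |f x - f y| ≤ K * ‖x - y‖) ∧
      ∀ x, R ≤ ‖x‖ → f x = 0 := by
  obtain ⟨C, hC⟩ := ContDiff.lipschitzWith_of_hasCompactSupport hs hf one_ne_zero
  obtain ⟨M, hM⟩ := hs.exists_bound_of_continuous hf.continuous
  obtain ⟨R, hR⟩ := hs.isCompact.isBounded.subset_closedBall 0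
  refine ⟨max 1 (max C M), max 1 R + 1, le_max_left _ _, by linarith [le_max_left 1 R],
    fun x => (hM x).trans ((le_max_right _ _).trans (le_max_right _ _)), fun x y => ?_,
    fun x hx => ?_⟩
  · have h1 := hC.dist_le_mul x y
    rw [Real.dist_eq, dist_eq_norm] at h1
    exact h1.trans (mul_le_mul_of_nonneg_right ((le_max_left _ _).trans (le_max_right _ _))
      (norm_nonneg _))
  · by_contra hne
    have := hR (subset_tsupport f hne)
    rw [mem_closedBall_zero_iff] at this
    linarith [le_max_right 1 R]

theorem integrable_sq_of_hasCompactSupport {f : Eu d → ℝ} (hf : Continuous f)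
    (hs : HasCompactSupport f) : Integrable fun x => f x ^ 2 := by
  refine Continuous.integrable_of_hasCompactSupport (hf.pow 2) ?_
  exact hs.comp_left (g := fun s : ℝ => s ^ 2) (by simp)

/-- `C¹` functions with compact support in `Ω` belong to `W_0^{α/2,2}(Ω)`. -/
theorem memW0_of_contDiff (hd : 0 < d) {α : ℝ} (hα : 0 < α) (hα' : α < 2) {Ω : Set (Eu d)}
    {f : Eu d → ℝ} (hf : ContDiff ℝ 1 f) (hs : HasCompactSupport f) (hΩ : tsupport f ⊆ Ω) :
    MemW0 α Ω f := by
  obtain ⟨K, R, hK, hR, h1, h2, h3⟩ := exists_lipschitz_bounds hf hs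
  refine MemW0.of_continuous hd hα hα' ?_ hf.continuous fun x hx => ?_
  · rw [memW_iff' α hf.continuous.measurable.aemeasurable]
    exact ⟨integrable_sq_of_hasCompactSupport hf.continuous hs,
      wE_lt_top_of_lipschitz hd hα hα' le_rfl (by simpa using hd) hK hR h1 h2 h3⟩
  · exact image_eq_zero_of_notMem_tsupport fun h => hx (hΩ h)

/-- The domain of the transported form is dense. -/
theorem dense_comap_w0Sub (hd : 0 < d) {α : ℝ} (hα : 0 < α) (hα' : α < 2) (γ : ℝ)
    {Ω : Set (Eu d)} (hΩ : IsOpen Ω) :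
    Dense (((w0Sub hd hα hα' Ω).comap (weightIso hd γ hΩ.measurableSet).toLinearMap :
      Submodule ℝ (Lp ℝ 2 (weightedMeasure γ Ω))) : Set (Lp ℝ 2 (weightedMeasure γ Ω))) := by
  rw [Submodule.dense_iff_topologicalClosure_eq_top, Submodule.topologicalClosure_eq_top_iff,
    Submodule.eq_bot_iff]
  intro f hf
  set U := weightIso hd γ hΩ.measurableSet
  -- Every smooth function with compact support in `Ω` is the image of an element of the domain, so
  -- a vector orthogonal to the domain has an image that annihilates all test functions.
  have hUf : ∀ᵐ x, x ∈ Ω → (U f : Eu d → ℝ) x = 0 := by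
    refine hΩ.ae_eq_zero_of_integral_contDiff_smul_eq_zero ?_ fun g hg hgs hgΩ => ?_
    · exact ((Lp.memLp (U f)).locallyIntegrable one_le_two).locallyIntegrableOn Ω
    · have hg1 : ContDiff ℝ 1 g := hg.of_le (by exact_mod_cast le_top)
      have hW := memW0_of_contDiff hd hα hα' hg1 hgs hgΩ
      have hgL : MemLp g 2 := hW.1.1
      obtain ⟨k, hk, -⟩ := exists_weightIso_eq hd (γ := γ) hΩ.measurableSet hgL
        (Eventually.of_forall fun x hx => image_eq_zero_of_notMem_tsupport fun h => hx (hgΩ h))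
      have hkmem : k ∈ (w0Sub hd hα hα' Ω).comap U.toLinearMap := by
        change MemW0 α Ω (U k)
        rw [hk]
        exact memW0_congr hgL.coeFn_toLp.symm hW
      have h1 := hf k hkmem
      rw [← U.inner_map_map, hk, L2.inner_def] at h1
      rw [← h1]
      refine integral_congr_ae ?_
      filter_upwards [hgL.coeFn_toLp] with x hx
      rw [hx, smul_eq_mul, real_inner_eq_re_inner, RCLike.inner_apply]
      simp [mul_comm]
  have hU0 : U f = 0 := by
    refine Lp.ext ?_
    filter_upwards [hUf, weightIso_ae_eq_zero hd hΩ.measurableSet f, Lp.coeFn_zero ℝ 2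
      (volume : Measure (Eu d))] with x h1 h2 h3
    rw [h3]
    by_cases hx : x ∈ Ω
    · exact h1 hx
    · exact h2 hx
  exact U.injective (hU0.trans (map_zero U).symm)

/-! ### The Hardy form in `L²(Ω, |x|^{-2γ})` -/

/-- The Hardy form with constant `hardyConst d α β`, transported to `L²(Ω, |x|^{-2γ})`. -/
def hardyForm (hd : 0 < d) {α β : ℝ} (hα : 0 < α) (hα' : α < 2) (hβ : 0 < β) (hβd : α + β < d)
    (γ : ℝ) {Ω : Set (Eu d)} (hΩ : MeasurableSet Ω) : SymmForm (Lp ℝ 2 (weightedMeasure γ Ω)) :=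
  (maxForm d α β (constA_pos hd hα hα')).transport (w0Sub hd hα hα' Ω)
    (w0Sub_le hd hα hα' hβ hβd Ω) (weightIso hd γ hΩ).toLinearMap

section

variable (hd : 0 < d) {α β : ℝ} (hα : 0 < α) (hα' : α < 2) (hβ : 0 < β) (hβd : α + β < d)
  {γ : ℝ} {Ω : Set (Eu d)} (hΩ : MeasurableSet Ω)

theorem mem_hardyForm_iff {f : Lp ℝ 2 (weightedMeasure γ Ω)} :
    f ∈ (hardyForm hd hα hα' hβ hβd γ hΩ).dom ↔ MemW0 α Ω (weightIso hd γ hΩ f) := Iff.rfl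

theorem mem_hardyForm_iff_timesWeight {f : Lp ℝ 2 (weightedMeasure γ Ω)} :
    f ∈ (hardyForm hd hα hα' hβ hβd γ hΩ).dom ↔ MemW0 α Ω (timesWeight γ Ω f) :=
  ⟨memW0_congr (coeFn_weightIso hd hΩ f), memW0_congr (coeFn_weightIso hd hΩ f).symm⟩

theorem hardyForm_eq (f : (hardyForm hd hα hα' hβ hβd γ hΩ).dom) :
    (hardyForm hd hα hα' hβ hβd γ hΩ).form f f = constA d α / 2 *
      (wE α β fun x => (weightIso hd γ hΩ f : Eu d → ℝ) x * ‖x‖ ^ β).toReal :=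
  maxForm_eq α β (constA_pos hd hα hα') _

theorem hardyForm_sub_eq (f g : (hardyForm hd hα hα' hβ hβd γ hΩ).dom) :
    (hardyForm hd hα hα' hβ hβd γ hΩ).form (f - g) (f - g) = constA d α / 2 *
      (wE α β fun x => (weightIso hd γ hΩ
        ((f : Lp ℝ 2 (weightedMeasure γ Ω)) - g) : Eu d → ℝ) x * ‖x‖ ^ β).toReal :=
  hardyForm_eq hd hα hα' hβ hβd hΩ (f - g)

theorem hardyForm_eq_hardyEnergy (f : (hardyForm hd hα hα' hβ hβd γ hΩ).dom) :
    (hardyForm hd hα hα' hβ hβd γ hΩ).form f f =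
      hardyEnergy α (hardyConst d α β) Ω (timesWeight γ Ω f.1) := by
  have hf := (mem_hardyForm_iff_timesWeight hd hα hα' hβ hβd hΩ).1 f.2
  rw [hardyForm_eq, hardyEnergy_eq hd hα hα' hβ hβd hf.1
    (Eventually.of_forall fun x hx => Set.indicator_of_notMem hx _)]
  congr 2
  refine wE_congr α β ?_
  filter_upwards [coeFn_weightIso hd hΩ f.1] with x hx
  rw [hx]

theorem isClosable_hardyForm : (hardyForm hd hα hα' hβ hβd γ hΩ).IsClosable :=
  SymmForm.transport_isClosable (isClosed_maxForm α β (constA_pos hd hα hα')) _ _ _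

theorem isClosed_hardyForm (hc : hardyConst d α β < criticalConst d α) :
    (hardyForm hd hα hα' hβ hβd γ hΩ).IsClosed :=
  SymmForm.transport_isClosed (isClosed_maxForm α β (constA_pos hd hα hα')) _ _ _
    (w0Sub_closed hd hα hα' hβ hβd hc Ω)

theorem exists_isClosureOf_hardyForm : ∃ b : SymmForm (Lp ℝ 2 (weightedMeasure γ Ω)),
    b.IsClosureOf (hardyForm hd hα hα' hβ hβd γ hΩ) :=
  SymmForm.transport_isClosureOf (isClosed_maxForm α β (constA_pos hd hα hα')) _ _ _

theorem isTransformedForm_hardyForm (hαd : α < d) :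
    IsTransformedForm α (hardyConst d α β) β Ω (hardyForm hd hα hα' hβ hβd β hΩ) :=
  ⟨fun _ => mem_hardyForm_iff_timesWeight hd hα hα' hβ hβd hΩ, fun f =>
    ⟨(((mem_hardyForm_iff_timesWeight hd hα hα' hβ hβd hΩ).1 f.2).1.integrable_hardyIntegrand
      hd hα hα' hαd _).integrableOn, hardyForm_eq_hardyEnergy hd hα hα' hβ hβd hΩ f⟩⟩

theorem weightedMeasure_zero (Ω : Set (Eu d)) : weightedMeasure 0 Ω = volume.restrict Ω := by
  simp [weightedMeasure, weight_zero]

theorem timesWeight_zero (Ω : Set (Eu d)) (f : Eu d → ℝ) : timesWeight 0 Ω f = Ω.indicator f := by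
  simp [timesWeight, weight_zero]

theorem exists_isHardyForm (hd : 0 < d) {α β : ℝ} (hα : 0 < α) (hα' : α < 2) (hβ : 0 < β)
    (hβd : α + β < d) (hαd : α < d) {Ω : Set (Eu d)} (hΩ : MeasurableSet Ω) :
    ∃ E : SymmForm (Lp ℝ 2 ((volume : Measure (Eu d)).restrict Ω)),
      IsHardyForm α (hardyConst d α β) Ω E ∧ E.IsClosable ∧
        (hardyConst d α β < criticalConst d α → E.IsClosed) := by
  -- The measures for γ = 0 and for Lebesgue measure on `Ω` are equal but not definitionally, so
  -- their L² types differ. Quantifying over μ lets the equality be eliminated by substitution.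
  have key : ∀ μ : Measure (Eu d), weightedMeasure 0 Ω = μ → ∃ E : SymmForm (Lp ℝ 2 μ),
      ((∀ f, f ∈ E.dom ↔ MemW0 α Ω (Ω.indicator f)) ∧
        ∀ f : E.dom, IntegrableOn (hardyIntegrand α (hardyConst d α β) (Ω.indicator f.1)) Ω ∧
          E.form f f = hardyEnergy α (hardyConst d α β) Ω (Ω.indicator f.1)) ∧ E.IsClosable ∧
        (hardyConst d α β < criticalConst d α → E.IsClosed) := by
    rintro _ rfl
    refine ⟨hardyForm hd hα hα' hβ hβd 0 hΩ, ⟨fun f => ?_, fun f => ?_⟩,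
      isClosable_hardyForm hd hα hα' hβ hβd hΩ, isClosed_hardyForm hd hα hα' hβ hβd hΩ⟩
    · rw [mem_hardyForm_iff_timesWeight, timesWeight_zero]
    · rw [hardyForm_eq_hardyEnergy, timesWeight_zero]
      have hf := (mem_hardyForm_iff_timesWeight hd hα hα' hβ hβd hΩ).1 f.2
      rw [timesWeight_zero] at hf
      exact ⟨(hf.1.integrable_hardyIntegrand hd hα hα' hαd _).integrableOn, rfl⟩
  exact key _ (weightedMeasure_zero Ω)

end

/-! ### The Markov property -/

/-- With t = |x|^β and a = u(x) the left side is w((0 ∨ f) ∧ 1), singular in form at the origin. The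
right side is jointly continuous in (a, t) even at t = 0, which is what quasi-continuity needs. -/
theorem inv_mul_unit_eq {a t : ℝ} (ht : 0 < t) :
    t⁻¹ * min (max 0 (a * t)) 1 = max 0 a / max 1 (max 0 a * t) := by
  have h : max 0 (a * t) = max 0 a * t := by
    rw [max_mul_of_nonneg _ _ ht.le, zero_mul]
  rw [h]
  rcases le_total (max 0 a * t) 1 with h1 | h1
  · rw [min_eq_left h1, max_eq_left h1]
    field_simp
  · rw [min_eq_right h1, max_eq_right h1]
    have : 0 < max 0 a := by
      by_contra hn
      have h0 : max 0 a = 0 := le_antisymm (not_lt.1 hn) (le_max_left _ _)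
      rw [h0] at h1
      linarith
    field_simp

theorem weight_eq_inv (β : ℝ) (x : Eu d) : weight β x = (‖x‖ ^ β)⁻¹ :=
  Real.rpow_neg (norm_nonneg x) β

theorem weight_mul_unit_mul_rpow (hd : 0 < d) (β : ℝ) (u : Eu d → ℝ) :
    (fun x : Eu d => weight β x * min (max 0 (u x * ‖x‖ ^ β)) 1 * ‖x‖ ^ β) =ᵐ[volume]
      fun x => min (max 0 (u x * ‖x‖ ^ β)) 1 := by
  filter_upwards [ae_ne_zero hd] with x hx
  rw [mul_right_comm, weight_mul_rpow hx, one_mul]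

theorem wE_weight_mul_unit_le (hd : 0 < d) (α β : ℝ) (u : Eu d → ℝ) :
    wE α β (fun x => weight β x * min (max 0 (u x * ‖x‖ ^ β)) 1 * ‖x‖ ^ β) ≤
      wE α β fun x => u x * ‖x‖ ^ β := by
  rw [wE_congr α β (weight_mul_unit_mul_rpow hd β u)]
  exact wE_mono α β fun x y => abs_unit_sub_unit_le _ _

theorem MemW0.weight_mul_unit (hd : 0 < d) {α β : ℝ} (hα : 0 < α) (hα' : α < 2) (hβ : 0 < β)
    (hβd : α + β < d) {Ω : Set (Eu d)} {u : Eu d → ℝ} (hu : MemW0 α Ω u) :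
    MemW0 α Ω fun x => weight β x * min (max 0 (u x * ‖x‖ ^ β)) 1 := by
  have hm := aemeasurable_of_memW hu.1
  obtain ⟨h2, hE⟩ := (memW_iff' α hm).1 hu.1
  have hvm : AEMeasurable fun x : Eu d => weight β x * min (max 0 (u x * ‖x‖ ^ β)) 1 :=
    (measurable_weight β).aemeasurable.mul
      ((aemeasurable_const.max (aemeasurable_mul_rpow β hm)).min aemeasurable_const)
  have habs : ∀ x : Eu d, (weight β x * min (max 0 (u x * ‖x‖ ^ β)) 1) ^ 2 ≤ u x ^ 2 := by
    intro x
    rw [sq_le_sq]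
    -- At the origin the weight takes the default value 0^{-β} = 0, so the bound holds at every
    -- point.
    rcases eq_or_ne x 0 with rfl | hx
    · rw [weight, norm_zero, Real.zero_rpow (neg_ne_zero.2 hβ.ne'), zero_mul, abs_zero]
      exact abs_nonneg _
    · rw [abs_mul, abs_of_pos (weight_pos β hx)]
      refine (mul_le_mul_of_nonneg_left (abs_unit_le _) (weight_nonneg β x)).trans (le_of_eq ?_)
      rw [abs_mul, abs_of_nonneg (Real.rpow_nonneg (norm_nonneg x) β), mul_left_comm,
        weight_mul_rpow hx, mul_one]
  have hW : MemW α fun x => weight β x * min (max 0 (u x * ‖x‖ ^ β)) 1 := by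
    -- The L² norm and the Hardy integral are dominated by those of `u`, and the contraction lowers
    -- the weighted energy; the ground state representation then gives back the unweighted energy.
    refine memW_of_wE_lt_top hd hα hα' hβ hβd hvm ?_ ?_ ?_
    · refine h2.mono' (hvm.pow_const 2).aestronglyMeasurable (Eventually.of_forall fun x => ?_)
      rw [Real.norm_of_nonneg (sq_nonneg _)]
      exact habs x
    · refine (hu.1.integrable_hardy hd hα hα' (by linarith)).mono'
        ((hvm.pow_const 2).mul (measurable_norm_rpow _).aemeasurable).aestronglyMeasurable
        (Eventually.of_forall fun x => ?_)
      rw [Real.norm_of_nonneg (by positivity)]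
      exact mul_le_mul_of_nonneg_right (habs x) (by positivity)
    · exact (wE_weight_mul_unit_le hd α β u).trans_lt
        ((hu.1.wE_le hd hα hα' hβ hβd).trans_lt hE)
  obtain ⟨-, u', hu', hq, hcap⟩ := hu
  refine ⟨hW, fun x => max 0 (u' x) / max 1 (max 0 (u' x) * ‖x‖ ^ β), ?_, ?_, ?_⟩
  · filter_upwards [hu', ae_ne_zero hd] with x hx hx0
    rw [hx, weight_eq_inv, inv_mul_unit_eq (Real.rpow_pos_of_pos (norm_pos_iff.2 hx0) β)]
  · refine QuasiContinuous.comp₂ hd hα hα' hq (Continuous.quasiContinuous hd hα hα'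
      (f := fun x : Eu d => ‖x‖ ^ β) (continuous_norm.rpow_const fun _ => Or.inr hβ.le))
      (φ := fun p : ℝ × ℝ => max 0 p.1 / max 1 (max 0 p.1 * p.2)) ?_
    refine Continuous.div (by fun_prop) (by fun_prop) fun p => ?_
    exact (one_pos.trans_le (le_max_left _ _)).ne'
  · refine le_antisymm ((capacity_mono α ?_).trans hcap.le) bot_le
    rintro x ⟨hx, hne⟩
    refine ⟨hx, fun h => hne ?_⟩
    simp [h]

theorem hardyForm_markov (hd : 0 < d) {α β : ℝ} (hα : 0 < α) (hα' : α < 2) (hβ : 0 < β)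
    (hβd : α + β < d) {Ω : Set (Eu d)} (hΩ : MeasurableSet Ω)
    (f : (hardyForm hd hα hα' hβ hβd β hΩ).dom) :
    ∃ g : (hardyForm hd hα hα' hβ hβd β hΩ).dom,
      (g : Lp ℝ 2 (weightedMeasure β Ω)) =
        SymmForm.unitContraction (f : Lp ℝ 2 (weightedMeasure β Ω)) ∧
      (hardyForm hd hα hα' hβ hβd β hΩ).form g g ≤ (hardyForm hd hα hα' hβ hβd β hΩ).form f f := by
  have hf : MemW0 α Ω (weightIso hd β hΩ f) := f.2
  have e : (fun x => weight β x * min (max 0 ((weightIso hd β hΩ f : Eu d → ℝ) x * ‖x‖ ^ β)) 1)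
      =ᵐ[volume] (weightIso hd β hΩ (SymmForm.unitContraction f.1) : Eu d → ℝ) := by
    filter_upwards [coeFn_weightIso hd hΩ f.1,
      coeFn_weightIso hd hΩ (SymmForm.unitContraction f.1),
      (ae_weightedMeasure_iff hd β hΩ).1 (SymmForm.coeFn_unitContraction f.1), ae_ne_zero hd]
      with x h1 h2 h3 hx
    rw [h1, h2]
    by_cases hxΩ : x ∈ Ω
    · rw [timesWeight, timesWeight, Set.indicator_of_mem hxΩ, Set.indicator_of_mem hxΩ, h3 hxΩ,
        mul_right_comm, weight_mul_rpow hx, one_mul]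
    · rw [timesWeight, timesWeight, Set.indicator_of_notMem hxΩ, Set.indicator_of_notMem hxΩ]
      simp
  refine ⟨⟨SymmForm.unitContraction f.1,
    memW0_congr e (hf.weight_mul_unit hd hα hα' hβ hβd)⟩, rfl, ?_⟩
  rw [hardyForm_eq, hardyForm_eq]
  refine mul_le_mul_of_nonneg_left (ENNReal.toReal_mono ?_ ?_)
    (half_pos (constA_pos hd hα hα')).le
  · exact ((hf.1.wE_le hd hα hα' hβ hβd).trans_lt
      ((memW_iff' α (aemeasurable_of_memW hf.1)).1 hf.1).2).ne
  · refine le_trans (le_of_eq (wE_congr α β ?_)) (wE_weight_mul_unit_le hd α β _)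
    filter_upwards [e] with x hx
    rw [hx]

/-! ### Regularity -/

theorem isCc_mul_rpow {Ω : Set (Eu d)} {ψ : Eu d → ℝ} (h : SymmForm.IsCc Ω ψ) {β : ℝ}
    (hβ : 0 < β) : SymmForm.IsCc Ω fun x => ψ x * ‖x‖ ^ β := by
  obtain ⟨hc, hs, hΩ⟩ := h
  exact ⟨hc.mul (continuous_norm.rpow_const fun _ => Or.inr hβ.le), hs.mul_right,
    (tsupport_mul_subset_left).trans hΩ⟩

/-- By the ground state representation the form norm is at most the norm of W, so the approximants
of W_0 suffice. Dividing by w multiplies them by |x|^β, which is continuous as β > 0. -/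
theorem hardyForm_exists_approx (hd : 0 < d) {α β : ℝ} (hα : 0 < α) (hα' : α < 2) (hβ : 0 < β)
    (hβd : α + β < d) {Ω : Set (Eu d)} (hΩ : IsOpen Ω)
    (f : (hardyForm hd hα hα' hβ hβd β hΩ.measurableSet).dom) {ε : ℝ} (hε : 0 < ε) :
    ∃ φ : Eu d → ℝ, SymmForm.IsCc Ω φ ∧
      ∃ g : (hardyForm hd hα hα' hβ hβd β hΩ.measurableSet).dom,
        (((g : Lp ℝ 2 (weightedMeasure β Ω)) : Eu d → ℝ) =ᵐ[weightedMeasure β Ω] φ) ∧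
        (hardyForm hd hα hα' hβ hβd β hΩ.measurableSet).form (f - g) (f - g) +
          ‖(f : Lp ℝ 2 (weightedMeasure β Ω)) - g‖ ^ 2 < ε := by
  have hA := constA_pos hd hα hα'
  set U := weightIso hd β hΩ.measurableSet with hU
  have hf : MemW0 α Ω (U f) := f.2
  have hfm := aemeasurable_of_memW hf.1
  obtain ⟨ψ, hψ, hle⟩ := hf.exists_approx hd hα hα' hΩ (ε := ENNReal.ofReal (ε / 2))
    (ENNReal.ofReal_pos.2 (by positivity))
  have hψm : AEMeasurable ψ := hψ.1.measurable.aemeasurable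
  have hW : MemW α ψ := by
    have h1 : MemW α fun x => (U f : Eu d → ℝ) x - ψ x :=
      (memW_iff hd hα hα' (hfm.fun_sub hψm)).2 (hle.trans_lt ENNReal.ofReal_lt_top)
    refine memW_congr (Eventually.of_forall fun x => ?_)
      (hf.1.add hd hα hα' (h1.const_mul hd hα hα' (-1)))
    ring
  have hψ0 : ∀ x, x ∉ Ω → ψ x = 0 := fun x hx =>
    image_eq_zero_of_notMem_tsupport fun h => hx (hψ.2.2 h)
  have hW0 : MemW0 α Ω ψ := MemW0.of_continuous hd hα hα' hW hψ.1 hψ0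
  obtain ⟨k, hk, hkψ⟩ := exists_weightIso_eq hd (γ := β) hΩ.measurableSet hW.1
    (Eventually.of_forall hψ0)
  have hkD : k ∈ (hardyForm hd hα hα' hβ hβd β hΩ.measurableSet).dom := by
    rw [mem_hardyForm_iff, hk]
    exact memW0_congr hW.1.coeFn_toLp.symm hW0
  refine ⟨_, isCc_mul_rpow hψ hβ, ⟨k, hkD⟩, hkψ, ?_⟩
  have hsub : MemW α (U (f.1 - k)) :=
    ((mem_hardyForm_iff hd hα hα' hβ hβd hΩ.measurableSet).1
      ((hardyForm hd hα hα' hβ hβd β hΩ.measurableSet).dom.sub_mem f.2 hkD)).1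
  have hfin := ((memW_iff' α (aemeasurable_of_memW hsub)).1 hsub).2
  have hone : energyOne α (U (f.1 - k)) ≤ ENNReal.ofReal (ε / 2) := by
    refine le_trans (le_of_eq (energyOne_congr α ?_)) hle
    rw [map_sub]
    refine (Lp.coeFn_sub _ _).trans ?_
    rw [hk]
    filter_upwards [hW.1.coeFn_toLp] with x hx
    rw [Pi.sub_apply, hx]
  have h1 := ENNReal.toReal_mono ENNReal.ofReal_ne_top hone
  rw [ENNReal.toReal_ofReal (by positivity), toReal_energyOne hA hfin, U.norm_map] at h1
  have h2 := ENNReal.toReal_mono hfin.ne (hsub.wE_le hd hα hα' hβ hβd)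
  have h3 := mul_le_mul_of_nonneg_left h2 (half_pos hA).le
  have h4 := hardyForm_sub_eq hd hα hα' hβ hβd hΩ.measurableSet f ⟨k, hkD⟩
  refine lt_of_le_of_lt (add_le_add_left (h4.le.trans h3) _) ?_
  exact h1.trans_lt (by linarith)

theorem continuous_weight_mul_originCut (β : ℝ) {ψ : Eu d → ℝ} (hψ : Continuous ψ) (n : ℕ) :
    Continuous fun x : Eu d => weight β x * (ψ x * originCut n x) := by
  rw [continuous_iff_continuousAt]
  intro x
  rcases eq_or_ne x 0 with rfl | hx
  · have h : (fun x : Eu d => weight β x * (ψ x * originCut n x)) =ᶠ[𝓝 0] fun _ => 0 := by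
      filter_upwards [Metric.ball_mem_nhds (0 : Eu d)
        (show (0 : ℝ) < ((n : ℝ) + 1)⁻¹ by positivity)] with x hx
      rw [mem_ball_zero_iff] at hx
      rw [originCut_eq_zero, mul_zero, mul_zero]
      have hn : (0 : ℝ) < (n : ℝ) + 1 := by positivity
      exact (mul_le_mul_of_nonneg_left hx.le hn.le).trans (mul_inv_cancel₀ hn.ne').le
    exact continuousAt_const.congr h.symm
  · exact (continuous_norm.continuousAt.rpow_const (Or.inl (norm_ne_zero_iff.2 hx))).mul
      (hψ.mul (continuous_originCut n)).continuousAt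

theorem integrable_sq_weight_mul (hd : 0 < d) {β : ℝ} (hβ : 0 ≤ β) (hβd : 2 * β < d)
    {ψ : Eu d → ℝ} (hψ : Continuous ψ) {K R : ℝ} (hK : ∀ x, |ψ x| ≤ K)
    (h0 : ∀ x, R ≤ ‖x‖ → ψ x = 0) : Integrable fun x => (weight β x * ψ x) ^ 2 := by
  refine ((integrable_indicator_weight (R := R) hd hβ hβd).const_mul (K ^ 2)).mono'
    (((measurable_weight β).mul hψ.measurable).pow_const 2).aestronglyMeasurable
    (Eventually.of_forall fun x => ?_)
  rw [Real.norm_of_nonneg (sq_nonneg _)]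
  by_cases hx : x ∈ Metric.ball (0 : Eu d) R
  · rw [Set.indicator_of_mem hx, mul_pow]
    have h1 := pow_le_pow_left₀ (abs_nonneg _) (hK x) 2
    rw [sq_abs] at h1
    have h2 := weight_nonneg β x
    nlinarith [mul_le_mul_of_nonneg_left h1 (sq_nonneg (weight β x)),
      mul_nonneg (sq_nonneg K) h2]
  · rw [h0 x (by simpa using hx)]
    simp only [mul_zero, ne_eq, OfNat.ofNat_ne_zero, not_false_eq_true, zero_pow]
    rw [Set.indicator_of_notMem hx, mul_zero]

/-- Compactly supported `C¹` functions on `Ω` belong to the domain of the closure. -/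
theorem mem_closure_hardyForm_of_contDiff (hd : 0 < d) {α β : ℝ} (hα : 0 < α) (hα' : α < 2)
    (hβ : 0 < β) (hβd : α + β < d) (hβd' : α + 2 * β ≤ d) {Ω : Set (Eu d)} (hΩ : IsOpen Ω)
    {b : SymmForm (Lp ℝ 2 (weightedMeasure β Ω))}
    (hb : b.IsClosureOf (hardyForm hd hα hα' hβ hβd β hΩ.measurableSet))
    {ψ : Eu d → ℝ} (hψ : ContDiff ℝ 1 ψ) (hs : HasCompactSupport ψ) (hψΩ : tsupport ψ ⊆ Ω) :
    ∃ g : b.dom, ((g : Lp ℝ 2 (weightedMeasure β Ω)) : Eu d → ℝ) =ᵐ[weightedMeasure β Ω] ψ := by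
  have hA := constA_pos hd hα hα'
  set U := weightIso hd β hΩ.measurableSet with hU
  obtain ⟨hcl, ⟨hle, hext⟩, -⟩ := hb
  obtain ⟨K, R, hK, hR, hKb, hlip, hR0⟩ := exists_lipschitz_bounds hψ hs
  -- The cut-off functions ψ η_n vanish near the origin, so w ψ η_n is continuous with compact
  -- support. Its Hardy integral is finite and its weighted energy is at most `C`, hence it belongs
  -- to W_0.
  obtain ⟨C, hC, hCle⟩ := exists_wE_mul_originCut_le hd hα hα' hβ.le hβd' hK hR hKb hlip hR0
  have hψ0 : ∀ x, x ∉ Ω → ψ x = 0 := fun x hx =>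
    image_eq_zero_of_notMem_tsupport fun h => hx (hψΩ h)
  have hsq := integrable_sq_weight_mul hd hβ.le (by linarith) hψ.continuous hKb hR0
  have hum : AEMeasurable fun x : Eu d => weight β x * ψ x :=
    ((measurable_weight β).mul hψ.continuous.measurable).aemeasurable
  have hL : MemLp (fun x : Eu d => weight β x * ψ x) 2 :=
    (memLp_two_iff_lintegral hum).2 ((integrable_sq_iff hum).1 hsq)
  obtain ⟨f, hf, hfψ⟩ := exists_weightIso_eq hd (γ := β) hΩ.measurableSet hL
    (Eventually.of_forall fun x hx => by rw [hψ0 x hx, mul_zero])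
  have hmul : ∀ v : Eu d → ℝ, (fun x => weight β x * v x * ‖x‖ ^ β) =ᵐ[volume] v := fun v => by
    filter_upwards [ae_ne_zero hd] with x hx
    rw [mul_right_comm, weight_mul_rpow hx, one_mul]
  have hW : ∀ n, MemW α fun x : Eu d => weight β x * (ψ x * originCut n x) := fun n => by
    have hc := continuous_weight_mul_originCut β hψ.continuous n
    have hcs : HasCompactSupport fun x : Eu d => weight β x * (ψ x * originCut n x) :=
      (hs.mul_right (f' := originCut n)).mul_left (f := weight β)
    obtain ⟨M, hM⟩ := hcs.exists_bound_of_continuous hc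
    have h2 := integrable_sq_of_hasCompactSupport hc hcs
    refine memW_of_wE_lt_top hd hα hα' hβ hβd hc.measurable.aemeasurable h2
      (integrable_sq_mul_rpow_of_bounded hd hα (by linarith) h2 hM) ?_
    rw [wE_congr α β (hmul _)]
    exact (hCle n).trans_lt hC
  have hW0 : ∀ n, MemW0 α Ω fun x : Eu d => weight β x * (ψ x * originCut n x) := fun n =>
    MemW0.of_continuous hd hα hα' (hW n) (continuous_weight_mul_originCut β hψ.continuous n)
      fun x hx => by rw [hψ0 x hx, zero_mul, mul_zero]
  choose k hk _ using fun n => exists_weightIso_eq hd (γ := β) hΩ.measurableSet (hW n).1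
    (Eventually.of_forall fun x hx => by rw [hψ0 x hx, zero_mul, mul_zero])
  have hkD : ∀ n, k n ∈ (hardyForm hd hα hα' hβ hβd β hΩ.measurableSet).dom := fun n => by
    rw [mem_hardyForm_iff, hk]
    exact memW0_congr (hW n).1.coeFn_toLp.symm (hW0 n)
  have hlim : Tendsto k atTop (𝓝 f) := by
    rw [tendsto_iff_norm_sub_tendsto_zero]
    have e : ∀ n, ‖k n - f‖ ^ 2 = (∫⁻ x, ENNReal.ofReal
        ((weight β x * (ψ x * originCut n x) - weight β x * ψ x) ^ 2)).toReal := fun n => by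
      rw [← U.norm_map, map_sub, hk, hf, ← MemLp.toLp_sub, norm_sq_toLp]
      rfl
    have h1 : Tendsto (fun n => ‖k n - f‖ ^ 2) atTop (𝓝 0) := by
      simp only [e]
      have h2 := tendsto_lintegral_sq_of_dominated
        (u := fun n x => weight β x * (ψ x * originCut n x) - weight β x * ψ x)
        (v := fun x => weight β x * ψ x)
        (fun n => (continuous_weight_mul_originCut β hψ.continuous n).measurable.aemeasurable.fun_sub
          hum) ((integrable_sq_iff hum).1 hsq) (fun n x => ?_) ?_
      · exact (ENNReal.tendsto_toReal ENNReal.zero_ne_top).comp h2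
      · rw [← mul_assoc, ← mul_sub_one, abs_mul]
        refine mul_le_of_le_one_right (abs_nonneg _) (abs_le.2 ⟨?_, ?_⟩)
        · linarith [originCut_nonneg n x]
        · linarith [originCut_le_one n x]
      · filter_upwards [ae_ne_zero hd] with x hx
        have h3 := (((tendsto_originCut hx).const_mul (ψ x)).const_mul (weight β x)).sub_const
          (weight β x * ψ x)
        simpa using h3
    have h2 := h1.sqrt
    simpa only [Real.sqrt_zero, Real.sqrt_sq (norm_nonneg _)] using h2
  -- Bounded form values and L² convergence place the limit ψ in the domain of the closed form;
  -- convergence in the form norm is not needed.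
  obtain ⟨g, hg, -⟩ := hcl.exists_of_tendsto_of_le
    (u := fun n => Submodule.inclusion hle ⟨k n, hkD n⟩) hlim
    (M := constA d α / 2 * C.toReal) fun n => by
      rw [hext, hardyForm_eq]
      refine mul_le_mul_of_nonneg_left (ENNReal.toReal_mono hC.ne ?_) (half_pos hA).le
      refine le_trans (le_of_eq (wE_congr α β ?_)) (hCle n)
      refine EventuallyEq.trans ?_ (hmul _)
      have := (hW n).1.coeFn_toLp
      rw [← hk n] at this
      filter_upwards [this] with x hx
      exact congrArg (· * ‖x‖ ^ β) hx
  refine ⟨g, ?_⟩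
  rw [hg]
  refine hfψ.trans ((ae_weightedMeasure_iff hd β hΩ.measurableSet).2 ?_)
  filter_upwards [hmul ψ] with x hx _
  exact hx

theorem exists_contDiff_near {Ω : Set (Eu d)} {φ : Eu d → ℝ} (hφ : SymmForm.IsCc Ω φ) {ε : ℝ}
    (hε : 0 < ε) : ∃ ψ : Eu d → ℝ, ContDiff ℝ 1 ψ ∧ SymmForm.IsCc Ω ψ ∧
      ∀ x, |φ x - ψ x| < ε := by
  obtain ⟨ψ, h1, h2, h3⟩ := Continuous.exists_contDiff_approx 1 hφ.1
    (continuous_const (y := ε)) fun _ => hε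
  refine ⟨ψ, h1, ⟨h1.continuous, hφ.2.1.mono h3, (closure_mono h3).trans hφ.2.2⟩, fun x => ?_⟩
  have := h2 x
  rwa [dist_comm, Real.dist_eq] at this

section

variable (hd : 0 < d) {α β : ℝ} (hα : 0 < α) (hα' : α < 2) (hβ : 0 < β) (hβd : α + β < d)
  {Ω : Set (Eu d)} (hΩ : IsOpen Ω) {b : SymmForm (Lp ℝ 2 (weightedMeasure β Ω))}

theorem isDirichletForm_of_isClosureOf_hardyForm
    (hb : b.IsClosureOf (hardyForm hd hα hα' hβ hβd β hΩ.measurableSet)) : b.IsDirichletForm :=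
  hb.isDirichletForm (dense_comap_w0Sub hd hα hα' β hΩ)
    (hardyForm_markov hd hα hα' hβ hβd hΩ.measurableSet)

theorem isRegular_of_isClosureOf_hardyForm
    (hb : b.IsClosureOf (hardyForm hd hα hα' hβ hβd β hΩ.measurableSet))
    (hβd' : α + 2 * β ≤ d) : b.IsRegular Ω := by
  refine hb.isRegular (fun f ε hε => hardyForm_exists_approx hd hα hα' hβ hβd hΩ f hε)
    fun φ hφ ε hε => ?_
  obtain ⟨ψ, h1, h2, h3⟩ := exists_contDiff_near hφ hε
  exact ⟨ψ, h2, mem_closure_hardyForm_of_contDiff hd hα hα' hβ hβd hβd' hΩ hb h1 h2.2.1 h2.2.2, h3⟩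

end

/-! ### The ground state representation -/

theorem hardyEnergy_timesWeight (hd : 0 < d) {α β : ℝ} (hα : 0 < α) (hα' : α < 2) (hβ : 0 < β)
    (hβd : α + β < d) {Ω : Set (Eu d)} {f : Eu d → ℝ} (hf : MemW0 α Ω (timesWeight β Ω f)) :
    Integrable (weightedKernel α β (Ω.indicator f)) (volume.prod volume) ∧
      hardyEnergy α (hardyConst d α β) Ω (timesWeight β Ω f) = constA d α / 2 *
        ∫ z, weightedKernel α β (Ω.indicator f) z ∂(volume.prod volume) := by
  have hm := aemeasurable_of_memW hf.1
  have e : (fun x => timesWeight β Ω f x * ‖x‖ ^ β) =ᵐ[volume] Ω.indicator f := by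
    filter_upwards [ae_ne_zero hd] with x hx
    by_cases hxΩ : x ∈ Ω
    · rw [timesWeight, Set.indicator_of_mem hxΩ, Set.indicator_of_mem hxΩ, mul_right_comm,
        weight_mul_rpow hx, one_mul]
    · rw [timesWeight, Set.indicator_of_notMem hxΩ, Set.indicator_of_notMem hxΩ, zero_mul]
  have hfm : AEMeasurable (Ω.indicator f) := (aemeasurable_mul_rpow β hm).congr e
  have hlt := (hf.1.wE_le hd hα hα' hβ hβd).trans_lt ((memW_iff' α hm).1 hf.1).2
  rw [wE_congr α β e] at hlt
  refine ⟨(integrable_weightedKernel_iff α β hfm).2 hlt, ?_⟩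
  rw [hardyEnergy_eq hd hα hα' hβ hβd hf.1
    (Eventually.of_forall fun x hx => Set.indicator_of_notMem hx _), wE_congr α β e,
    integral_weightedKernel α β hfm]

end FractionalHardy

end

/-! ### Assembly of the three statements -/

theorem mainTheorem5 (d : ℕ) (α : ℝ) (hα : 0 < α) (hα' : α < min 2 (d : ℝ))
    (Ω : Set (EuclideanSpace ℝ (Fin d))) (hΩ : IsOpen Ω) (h0 : (0 : EuclideanSpace ℝ (Fin d)) ∈ Ω)
    (c : ℝ) (hc : 0 < c) (hc' : c ≤ criticalConst d α)
    (β : ℝ) (hβ : IsHardyExponent d α c β) :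
    (c < criticalConst d α →
      (∃ Q : SymmForm (Lp ℝ 2 (weightedMeasure β Ω)), IsTransformedForm α c β Ω Q ∧
        Q.IsDirichletForm ∧ Q.IsRegular Ω) ∧
      ∃ E : SymmForm (Lp ℝ 2 ((volume : Measure (EuclideanSpace ℝ (Fin d))).restrict Ω)),
        IsHardyForm α c Ω E ∧ E.IsClosed) ∧
    (c = criticalConst d α →
      (∃ Q : SymmForm (Lp ℝ 2 (weightedMeasure β Ω)), IsTransformedForm α c β Ω Q ∧
        Q.IsClosable ∧
        ∃ Qbar : SymmForm (Lp ℝ 2 (weightedMeasure β Ω)), Qbar.IsClosureOf Q ∧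
          Qbar.IsDirichletForm ∧ Qbar.IsRegular Ω) ∧
      ∃ E : SymmForm (Lp ℝ 2 ((volume : Measure (EuclideanSpace ℝ (Fin d))).restrict Ω)),
        IsHardyForm α c Ω E ∧ E.IsClosable) ∧
    (∀ f : Lp ℝ 2 (weightedMeasure β Ω), MemW0 α Ω (timesWeight β Ω f) →
      Integrable (weightedKernel α β (Ω.indicator f)) (volume.prod volume) ∧
      hardyEnergy α c Ω (timesWeight β Ω f) =
        constA d α / 2 *
          ∫ z, weightedKernel α β (Ω.indicator f) z ∂(volume.prod volume)) := by
  have hαd : α < d := hα'.trans_le (min_le_right _ _)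
  have hα2 : α < 2 := hα'.trans_le (min_le_left _ _)
  have hd : 0 < d := by exact_mod_cast hα.trans hαd
  have hβ0 : 0 < β := hβ.1
  have hβ1 : β ≤ (d - α) / 2 := hβ.2.1
  have hβd : α + β < d := by linarith
  -- The scaling condition for the cutoffs at the origin, with equality exactly at β = (d - α)/2.
  have hβd' : α + 2 * β ≤ d := by linarith
  obtain rfl := eq_hardyConst_of_isHardyExponent hd hα hβ
  have hQ := isTransformedForm_hardyForm hd hα hα2 hβ0 hβd hΩ.measurableSet hαd
  obtain ⟨E, hE, hE1, hE2⟩ := exists_isHardyForm hd hα hα2 hβ0 hβd hαd hΩ.measurableSet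
  refine ⟨fun hlt => ⟨⟨_, hQ, ?_⟩, E, hE, hE2 hlt⟩, fun _ => ⟨⟨_, hQ, ?_, ?_⟩, E, hE, hE1⟩,
    fun f hf => hardyEnergy_timesWeight hd hα hα2 hβ0 hβd hf⟩
  -- A closed form is its own closure, so the subcritical case also follows from the results on
  -- closures.
  · have hb := (isClosed_hardyForm hd hα hα2 hβ0 hβd hΩ.measurableSet (γ := β)
      hlt).isClosureOf_self
    exact ⟨isDirichletForm_of_isClosureOf_hardyForm hd hα hα2 hβ0 hβd hΩ hb,
      isRegular_of_isClosureOf_hardyForm hd hα hα2 hβ0 hβd hΩ hb hβd'⟩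
  · exact isClosable_hardyForm hd hα hα2 hβ0 hβd hΩ.measurableSet
  · obtain ⟨b, hb⟩ := exists_isClosureOf_hardyForm hd hα hα2 hβ0 hβd hΩ.measurableSet (γ := β)
    exact ⟨b, hb, isDirichletForm_of_isClosureOf_hardyForm hd hα hα2 hβ0 hβd hΩ hb,
      isRegular_of_isClosureOf_hardyForm hd hα hα2 hβ0 hβd hΩ hb hβd'⟩
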